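/- **Setting.** Let $n\ge 1$, $c>0$, $\Gamma=\Gamma^\top\in\mathbb R^{n\times n}$ positive definite, $\phi(x)=\frac1{2c}x^\top\Gamma x$. Let $g\in C^1(\mathbb R^n;\mathbb R^n)$ satisfy $\|g(v)\|\le\bar g\|v\|$ for all $v$ and some $\bar g>0$, and, for some $\delta\in(0,1)$, $\sup_{s\in\mathbb R}\min_{\delta\le\|v\|\le1}v^\top g(-sv)=\infty$. Put $\mathfrak H=L^2(\mathbb R^n;e^{\phi})$, with inner product $\int e^{\phi}z_1z_2\,dx$, and $\mathfrak V=\{e^{-\phi}f: f\in W^{1,2}(\mathbb R^n;e^{-\phi})\}$, with inner product $\langle z_1,z_2\rangle_{\mathfrak H}+\mathfrak a(z_1,z_2)$, where $\mathfrak a(z_1,z_2)=\int e^{-\phi}\,\nabla(e^{\phi}z_1)\cdot\nabla(e^{\phi}z_2)\,dx$. Let $\mathfrak A:\mathcal D(\mathfrak A)\subset\mathfrak V\to\mathfrak H$ be the operator associated with $\mathfrak a$: $y=\mathfrak Av$ iff $\mathfrak a(v,w)=\langle y,w\rangle_{\mathfrak H}$ for all $w\in\mathfrak V$. Let $(T(t))_{t\ge0}$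 be the $C_0$-semigroup on $\mathfrak H$ generated by $-c\mathfrak A$, let $\mathfrak H_{-1/2}$ and $\mathfrak H_{-1}$ be the duals of $\mathfrak V$ and of $\mathcal D(\mathfrak A)$ (with graph norm) with respect to the pivot space $\mathfrak H$, and let $T_{-1}(t)$ be the continuous extension of $T(t)$ to $\mathfrak H_{-1}$. Let $\mathfrak B_1 f=-\operatorname{div}f$, as an operator $\mathfrak H^n\to\mathfrak H_{-1/2}\subset\mathfrak H_{-1}$, i.e. $\langle\mathfrak B_1f,w\rangle=\int f\cdot\nabla(e^{\phi}w)\,dx$. Given $p_0\in\mathfrak H$, $d\in L^\infty(0,\infty;\mathfrak H)$ and $u\in C(\mathbb R_{\ge0};\mathbb R^n)$, a function $p\in C([0,t_1];\mathfrak H)$ is a *mild solution on $[0,t_1]$* of $$\dot p=-c\mathfrak Ap-\operatorname{div}(p\,g(u))+d,\qquad p(0)=p_0, \tag{1}$$ if in $\mathfrak H_{-1}$, for all $t\in[0,t_1]$, $p(t)=T(t)p_0+\int_0^tT_{-1}(t-s)\big(\mathfrak B_1(p(s)g(u(s)))+d(s)\big)\,ds$. Let $y_{\rm ref}\in W^{1,\infty}(\mathbb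 R_{\ge0};\mathbb R^n)$ (continuous representative). Let $\varphi\in C^1(\mathbb R_{\ge0};\mathbb R)$ with $\varphi(t)>0$ for $t>0$, $\liminf_{t\to\infty}\varphi(t)>0$, and $|\dot\varphi(t)|\le\xi(1+\varphi(t))$ for all $t\ge0$ and some $\xi>0$. Let $\alpha\in C^1([0,1);[1,\infty))$ be a bijection and $N\in C^1(\mathbb R_{\ge0};\mathbb R)$ a surjection. A triple $(p,u,y)$ is a *mild solution of the closed loop on $\mathbb R_{\ge0}$* if for every $t_1>0$: $u,y\in C([0,t_1];\mathbb R^n)$, $p$ is a mild solution of (1) on $[0,t_1]$, and for all $t\in[0,t_1]$ $$y(t)=\int_{\mathbb R^n}x\,p(t,x)\,dx,\qquad w(t)=\varphi(t)\big(y(t)-y_{\rm ref}(t)\big),\qquad u(t)=(N\circ\alpha)\big(\|w(t)\|^2\big)\,w(t),$$ where $\|w(t)\|^2\in[0,1)$, the domain of $\alpha$. **Theorem.** Assume in addition that $\int d(t,x)\,dx=0$ for almost all $t\ge0$, that $P_0:=\int p_0\,dx\ne0$, and that $\varphi(0)\|E_0-y_{\rm ref}(0)\|<1$ with $E_0:=\int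 x\,p_0(x)\,dx$. Then there exists a unique mild solution $(p,u,y)$ of the closed loop on $\mathbb R_{\ge0}$, and: 1. $p\in L^q(0,t_1;\mathfrak V)\cap W^{1,q}(0,t_1;\mathfrak H_{-1/2})$ for all $t_1>0$ and $1\le q<2$; $p\in L^\infty(0,\infty;\mathfrak H)$; $u$ is continuous and bounded on $\mathbb R_{\ge0}$; $y\in W^{1,\infty}(\mathbb R_{\ge0};\mathbb R^n)$. 2. There is $\varepsilon\in(0,1)$ with $\varphi(t)\|y(t)-y_{\rm ref}(t)\|\le\varepsilon$ for all $t\ge0$. 3. For almost all $t>0$, $p(t)\in\mathfrak V$ and for all $v\in\mathfrak V$: $\langle\dot p(t),v\rangle=-c\,\mathfrak a(p(t),v)+\langle\mathfrak B_1(p(t)g(u(t)))+d(t),v\rangle$, where $\dot p$ is the weak derivative in $\mathfrak H_{-1/2}$. If $p_0\in\mathfrak V$, then $p\in L^q(0,t_1;\mathfrak V)\cap W^{1,q}(0,t_1;\mathfrak H_{-1/2})$ for all $t_1>0$ and $1\le q<\infty$. 4. If $d=0$, then * $\int p(t,x)\,dx=\int p_0\,dx$ for all $t\ge0$; * if $p_0\ge0$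 a.e., then for all $t\ge0$, $p(t,x)\ge0$ for a.e. $x$; * if $P_0=1$, put ${\rm Cov}(t)=\int(x-y(t))(x-y(t))^\top p(t,x)\,dx$. For any orthonormal basis $v_1,\dots,v_n$ of $\mathbb R^n$ with $\Gamma v_k=c\lambda_kv_k$, and $V=[v_1,\dots,v_n]$, $\Lambda={\rm diag}(\lambda_k)$, $R={\rm diag}(\sqrt{\lambda_k/2})$, there is $K\in\mathbb R^{n\times n}$ such that for all $t\ge0$ $${\rm Cov}(t)=\tfrac14VR^{-1}\big(e^{-c\Lambda t}Ke^{-c\Lambda t}+2I\big)R^{-1}V^\top,$$ and $\lim_{t\to\infty}{\rm Cov}(t)=c\,\Gamma^{-1}$. -/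

import Mathlib

open MeasureTheory Set Filter Topology
open scoped Matrix ENNReal ContDiff

noncomputable section

/-! ## Spaces of functions of time -/

/-- `f'` is the weak derivative of `f` on the open set `J ⊆ ℝ` (Bochner sense). -/
def HasWeakDerivOn {X : Type*} [NormedAddCommGroup X] [NormedSpace ℝ X]
    (f f' : ℝ → X) (J : Set ℝ) : Prop :=
  LocallyIntegrableOn f J ∧ LocallyIntegrableOn f' J ∧
    ∀ ψ : ℝ → ℝ, ContDiff ℝ ∞ ψ → HasCompactSupport ψ → tsupport ψ ⊆ J →
      ∫ t in J, deriv ψ t • f t = - ∫ t in J, ψ t • f' t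

/-- `f ∈ W^{1,q}(J; X)` for an open interval `J`. -/
def MemW1 {X : Type*} [NormedAddCommGroup X] [NormedSpace ℝ X]
    (q : ℝ≥0∞) (J : Set ℝ) (f : ℝ → X) : Prop :=
  ∃ f' : ℝ → X, MemLp f q (volume.restrict J) ∧ MemLp f' q (volume.restrict J) ∧
    HasWeakDerivOn f f' J

/-! ## Weighted spaces -/

/-- The Euclidean space `ℝⁿ`. -/
abbrev Euc (n : ℕ) : Type := EuclideanSpace ℝ (Fin n)

/-- The potential `φ(x) = xᵀ Γ x / (2 c)`. -/
def pot {n : ℕ} (c : ℝ) (Γ : Matrix (Fin n) (Fin n) ℝ) (x : Euc n) : ℝ :=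
  1 / (2 * c) * (x.ofLp ⬝ᵥ (Γ *ᵥ x.ofLp))

/-- The measure `e^φ dx` on `ℝⁿ`. -/
def wMeasure {n : ℕ} (c : ℝ) (Γ : Matrix (Fin n) (Fin n) ℝ) : Measure (Euc n) :=
  volume.withDensity fun x => ENNReal.ofReal (Real.exp (pot c Γ x))

/-- The state space `𝔥 = L²(ℝⁿ; e^φ)`, with inner product `⟨z₁, z₂⟩ = ∫ e^φ z₁ z₂ dx`. -/
abbrev HSp {n : ℕ} (c : ℝ) (Γ : Matrix (Fin n) (Fin n) ℝ) : Type :=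
  Lp ℝ 2 (wMeasure c Γ)

/-- The Hilbert space `𝔥ⁿ`. -/
abbrev HnSp {n : ℕ} (c : ℝ) (Γ : Matrix (Fin n) (Fin n) ℝ) : Type :=
  PiLp 2 fun _ : Fin n => HSp c Γ

/-- `g` is the weak partial derivative `∂f/∂xᵢ` on `ℝⁿ`. -/
def HasWeakPartial {n : ℕ} (i : Fin n) (f g : Euc n → ℝ) : Prop :=
  LocallyIntegrable f ∧ LocallyIntegrable g ∧
    ∀ ψ : Euc n → ℝ, ContDiff ℝ ∞ ψ → HasCompactSupport ψ →
      ∫ x, f x * fderiv ℝ ψ x (EuclideanSpace.single i 1) = - ∫ x, g x * ψ x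

theorem HasWeakPartial.zero {n : ℕ} (i : Fin n) :
    HasWeakPartial i (fun _ => 0) (fun _ => 0) :=
  ⟨locallyIntegrable_zero, locallyIntegrable_zero, by intros; simp⟩

theorem HasWeakPartial.const_mul {n : ℕ} {i : Fin n} {f g : Euc n → ℝ}
    (h : HasWeakPartial i f g) (a : ℝ) :
    HasWeakPartial i (fun x => a * f x) (fun x => a * g x) := by
  refine ⟨h.1.smul a, h.2.1.smul a, fun ψ h1 h2 => ?_⟩
  simp only [mul_assoc, integral_const_mul, h.2.2 ψ h1 h2, mul_neg]

theorem HasWeakPartial.add {n : ℕ} {i : Fin n} {f g f' g' : Euc n → ℝ}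
    (h : HasWeakPartial i f g) (h' : HasWeakPartial i f' g') :
    HasWeakPartial i (fun x => f x + f' x) (fun x => g x + g' x) := by
  refine ⟨h.1.add h'.1, h.2.1.add h'.2.1, fun ψ h1 h2 => ?_⟩
  have hc : Continuous fun x => fderiv ℝ ψ x (EuclideanSpace.single i 1) :=
    (h1.continuous_fderiv (by simp)).clm_apply continuous_const
  have hs : HasCompactSupport fun x => fderiv ℝ ψ x (EuclideanSpace.single i 1) :=
    (h2.fderiv (𝕜 := ℝ)).comp_left (g := fun L : Euc n →L[ℝ] ℝ =>
      L (EuclideanSpace.single i 1)) rfl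
  have e : ∀ {k : Euc n → ℝ}, LocallyIntegrable k →
      Integrable fun x => k x * fderiv ℝ ψ x (EuclideanSpace.single i 1) := fun hk => by
    simpa using hk.integrable_smul_right_of_hasCompactSupport hc hs
  have e' : ∀ {k : Euc n → ℝ}, LocallyIntegrable k → Integrable fun x => k x * ψ x :=
    fun hk => by
      simpa using hk.integrable_smul_right_of_hasCompactSupport h1.continuous h2
  simp only [add_mul]
  rw [integral_add (e h.1) (e h'.1), integral_add (e' h.2.1) (e' h'.2.1),
    h.2.2 ψ h1 h2, h'.2.2 ψ h1 h2, neg_add]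

theorem HasWeakPartial.congr {n : ℕ} {i : Fin n} {f g f' g' : Euc n → ℝ}
    (h : HasWeakPartial i f g) (hf : f =ᵐ[volume] f') (hg : g =ᵐ[volume] g') :
    HasWeakPartial i f' g' := by
  refine ⟨h.1.congr hf, h.2.1.congr hg, fun ψ h1 h2 => ?_⟩
  have a : ∫ x, f' x * fderiv ℝ ψ x (EuclideanSpace.single i 1)
      = ∫ x, f x * fderiv ℝ ψ x (EuclideanSpace.single i 1) :=
    integral_congr_ae (hf.mono fun x hx => by simp only [hx])
  have b : ∫ x, g' x * ψ x = ∫ x, g x * ψ x :=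
    integral_congr_ae (hg.mono fun x hx => by simp only [hx])
  rw [a, b, h.2.2 ψ h1 h2]

theorem volume_ac_wMeasure {n : ℕ} (c : ℝ) (Γ : Matrix (Fin n) (Fin n) ℝ) :
    (volume : Measure (Euc n)) ≪ wMeasure c Γ := by
  have hm : Continuous (pot c Γ) := by unfold pot; fun_prop
  refine withDensity_absolutelyContinuous' ?_ ?_
  · exact (hm.rexp.measurable.ennreal_ofReal).aemeasurable
  · exact Filter.Eventually.of_forall fun x => by simp [Real.exp_pos]

/-- The space `𝔙 = {e^{-φ} f | f ∈ W^{1,2}(ℝⁿ; e^{-φ})}`. Its element `z` is stored together with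
`G = e^{-φ} ∇(e^φ z) ∈ 𝔥ⁿ` (which `z` determines), so that the inner product inherited from
`𝔥 × 𝔥ⁿ` is `⟨e^φ z₁, e^φ z₂⟩_H + ⟨∇(e^φ z₁), ∇(e^φ z₂)⟩_{Hⁿ}` with `H = L²(ℝⁿ; e^{-φ})`. -/
def VGraph {n : ℕ} (c : ℝ) (Γ : Matrix (Fin n) (Fin n) ℝ) :
    Submodule ℝ (WithLp 2 (HSp c Γ × HnSp c Γ)) where
  carrier := {z | ∀ i : Fin n, HasWeakPartial i
    (fun x => Real.exp (pot c Γ x) * z.fst x) (fun x => Real.exp (pot c Γ x) * z.snd i x)}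
  zero_mem' := fun i => by
    have h0 := (volume_ac_wMeasure c Γ).ae_eq (Lp.coeFn_zero ℝ 2 (wMeasure c Γ))
    refine (HasWeakPartial.zero i).congr (h0.mono fun x hx => ?_) (h0.mono fun x hx => ?_)
    · exact (mul_eq_zero_of_right _ hx).symm
    · exact (mul_eq_zero_of_right _ hx).symm
  add_mem' := fun {z w} hz hw i => by
    refine ((hz i).add (hw i)).congr ?_ ?_
    · filter_upwards [(volume_ac_wMeasure c Γ).ae_eq (Lp.coeFn_add z.fst w.fst)] with x hx
      simp only [WithLp.add_fst, hx, Pi.add_apply, mul_add]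
    · filter_upwards [(volume_ac_wMeasure c Γ).ae_eq (Lp.coeFn_add (z.snd i) (w.snd i))]
        with x hx
      simp only [WithLp.add_snd, PiLp.add_apply, hx, Pi.add_apply, mul_add]
  smul_mem' := fun a z hz i => by
    refine ((hz i).const_mul a).congr ?_ ?_
    · filter_upwards [(volume_ac_wMeasure c Γ).ae_eq (Lp.coeFn_smul a z.fst)] with x hx
      simp only [WithLp.smul_fst, hx, Pi.smul_apply, smul_eq_mul]
      ring
    · filter_upwards [(volume_ac_wMeasure c Γ).ae_eq (Lp.coeFn_smul a (z.snd i))] with x hx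
      simp only [WithLp.smul_snd, PiLp.smul_apply, hx, Pi.smul_apply, smul_eq_mul]
      ring

/-- The Hilbert space `𝔙`; it equals `𝔥_{1/2}` up to an equivalent norm. -/
def VSp {n : ℕ} (c : ℝ) (Γ : Matrix (Fin n) (Fin n) ℝ) : Type := ↥(VGraph c Γ)

instance {n : ℕ} (c : ℝ) (Γ : Matrix (Fin n) (Fin n) ℝ) : NormedAddCommGroup (VSp c Γ) :=
  inferInstanceAs (NormedAddCommGroup ↥(VGraph c Γ))

instance {n : ℕ} (c : ℝ) (Γ : Matrix (Fin n) (Fin n) ℝ) : InnerProductSpace ℝ (VSp c Γ) :=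
  inferInstanceAs (InnerProductSpace ℝ ↥(VGraph c Γ))

/-- The inclusion `𝔙 → 𝔥`. -/
def VSp.val {n : ℕ} (c : ℝ) (Γ : Matrix (Fin n) (Fin n) ℝ) : VSp c Γ →L[ℝ] HSp c Γ :=
  (WithLp.fstL 2 ℝ (HSp c Γ) (HnSp c Γ)).comp (VGraph c Γ).subtypeL

/-- The map `𝔙 → 𝔥ⁿ`, `z ↦ e^{-φ} ∇(e^φ z)`. -/
def VSp.grad {n : ℕ} (c : ℝ) (Γ : Matrix (Fin n) (Fin n) ℝ) : VSp c Γ →L[ℝ] HnSp c Γ :=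
  (WithLp.sndL 2 ℝ (HSp c Γ) (HnSp c Γ)).comp (VGraph c Γ).subtypeL

/-- The form `𝔞(z₁, z₂) = ⟨∇(e^φ z₁), ∇(e^φ z₂)⟩_{Hⁿ}` on `𝔙`. -/
def formA {n : ℕ} (c : ℝ) (Γ : Matrix (Fin n) (Fin n) ℝ) (z₁ z₂ : VSp c Γ) : ℝ :=
  inner ℝ (VSp.grad c Γ z₁) (VSp.grad c Γ z₂)

/-! ## The operator `𝔄`, the semigroup, and the extrapolation spaces -/

/-- The graph of the operator `𝔄 : D(𝔄) ⊆ 𝔙 → 𝔥` associated with the form `𝔞`, i.e.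
`y = 𝔄 v` if and only if `𝔞(v, w) = ⟨y, w⟩` for all `w ∈ 𝔙`. -/
def AGraph {n : ℕ} (c : ℝ) (Γ : Matrix (Fin n) (Fin n) ℝ) :
    Submodule ℝ (WithLp 2 (VSp c Γ × HSp c Γ)) where
  carrier := {z | ∀ w : VSp c Γ, formA c Γ z.fst w = inner ℝ z.snd (VSp.val c Γ w)}
  zero_mem' := fun w => by simp [formA]
  add_mem' := fun {z z'} hz hz' w => by
    have h := hz w
    have h' := hz' w
    simp only [formA] at h h' ⊢
    simp only [WithLp.add_fst, WithLp.add_snd, map_add, inner_add_left, h, h']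
  smul_mem' := fun a z hz w => by
    have h := hz w
    simp only [formA] at h ⊢
    simp only [WithLp.smul_fst, WithLp.smul_snd, map_smul, real_inner_smul_left, h]

/-- The domain `D(𝔄)` with (a norm equivalent to) the graph norm. -/
def DSp {n : ℕ} (c : ℝ) (Γ : Matrix (Fin n) (Fin n) ℝ) : Type := ↥(AGraph c Γ)

instance {n : ℕ} (c : ℝ) (Γ : Matrix (Fin n) (Fin n) ℝ) : NormedAddCommGroup (DSp c Γ) :=
  inferInstanceAs (NormedAddCommGroup ↥(AGraph c Γ))

instance {n : ℕ} (c : ℝ) (Γ : Matrix (Fin n) (Fin n) ℝ) : InnerProductSpace ℝ (DSp c Γ) :=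
  inferInstanceAs (InnerProductSpace ℝ ↥(AGraph c Γ))

/-- The inclusion `D(𝔄) → 𝔙`. -/
def DSp.toV {n : ℕ} (c : ℝ) (Γ : Matrix (Fin n) (Fin n) ℝ) : DSp c Γ →L[ℝ] VSp c Γ :=
  (WithLp.fstL 2 ℝ (VSp c Γ) (HSp c Γ)).comp (AGraph c Γ).subtypeL

/-- `𝔄` as a map `D(𝔄) → 𝔥`. -/
def DSp.opA {n : ℕ} (c : ℝ) (Γ : Matrix (Fin n) (Fin n) ℝ) : DSp c Γ →L[ℝ] HSp c Γ :=
  (WithLp.sndL 2 ℝ (VSp c Γ) (HSp c Γ)).comp (AGraph c Γ).subtypeL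

/-- `T` (restricted to `t ≥ 0`) is a `C₀`-semigroup on `X`. -/
structure IsC0Semigroup {X : Type*} [NormedAddCommGroup X] [NormedSpace ℝ X]
    (T : ℝ → X →L[ℝ] X) : Prop where
  zero : T 0 = ContinuousLinearMap.id ℝ X
  add : ∀ s t : ℝ, 0 ≤ s → 0 ≤ t → T (s + t) = (T s).comp (T t)
  cont : ∀ x : X, ContinuousOn (fun t => T t x) (Ici 0)

/-- `T` is a `C₀`-semigroup on `𝔥` whose generator is `-c𝔄`: the limit of `(T(h) x - x) / h` as
`h ↓ 0` exists and equals `z` if and only if `x ∈ D(𝔄)` and `z = -c 𝔄 x`. -/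
def IsGeneratedByFP {n : ℕ} (c : ℝ) (Γ : Matrix (Fin n) (Fin n) ℝ)
    (T : ℝ → HSp c Γ →L[ℝ] HSp c Γ) : Prop :=
  IsC0Semigroup T ∧ ∀ x z : HSp c Γ,
    Tendsto (fun h : ℝ => h⁻¹ • (T h x - x)) (𝓝[>] 0) (𝓝 z) ↔
      ∃ v : DSp c Γ, VSp.val c Γ (DSp.toV c Γ v) = x ∧ z = -(c • DSp.opA c Γ v)

/-- The semigroup `(T(t))_{t ≥ 0}` generated by the Fokker-Planck operator `-c𝔄` on `𝔥`
(a generator determines its semigroup). -/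
def fpSemigroup {n : ℕ} (c : ℝ) (Γ : Matrix (Fin n) (Fin n) ℝ) :
    ℝ → HSp c Γ →L[ℝ] HSp c Γ :=
  Classical.epsilon (IsGeneratedByFP c Γ)

/-- The space `𝔥_{-1/2}`, the dual of `𝔥_{1/2} = 𝔙` with respect to the pivot space `𝔥`. -/
abbrev HmHalf {n : ℕ} (c : ℝ) (Γ : Matrix (Fin n) (Fin n) ℝ) : Type :=
  StrongDual ℝ (VSp c Γ)

/-- The space `𝔥_{-1}`, the dual of `D(𝔄)` with respect to the pivot space `𝔥`. As `𝔄` is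
self-adjoint, it is the completion of `𝔥` for the norm `‖(β I + c𝔄)⁻¹ x‖`, `β > 0`, up to an
equivalent norm. -/
abbrev HmOne {n : ℕ} (c : ℝ) (Γ : Matrix (Fin n) (Fin n) ℝ) : Type :=
  StrongDual ℝ (DSp c Γ)

/-- The embedding `𝔥 → 𝔥_{-1/2}`. -/
def toHmHalf {n : ℕ} (c : ℝ) (Γ : Matrix (Fin n) (Fin n) ℝ) (x : HSp c Γ) : HmHalf c Γ :=
  (innerSL ℝ x).comp (VSp.val c Γ)

/-- The embedding `𝔥_{-1/2} → 𝔥_{-1}`. -/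
def halfToOne {n : ℕ} (c : ℝ) (Γ : Matrix (Fin n) (Fin n) ℝ) (F : HmHalf c Γ) : HmOne c Γ :=
  F.comp (DSp.toV c Γ)

/-- The embedding `𝔥 → 𝔥_{-1}`. -/
def toHmOne {n : ℕ} (c : ℝ) (Γ : Matrix (Fin n) (Fin n) ℝ) (x : HSp c Γ) : HmOne c Γ :=
  halfToOne c Γ (toHmHalf c Γ x)

/-- `T₋₁(t)`, the (unique) continuous linear extension of `T(t)` from `𝔥` to `𝔥_{-1}`. -/
def fpSemigroupExt {n : ℕ} (c : ℝ) (Γ : Matrix (Fin n) (Fin n) ℝ) (t : ℝ) :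
    HmOne c Γ →L[ℝ] HmOne c Γ :=
  Classical.epsilon fun S : HmOne c Γ →L[ℝ] HmOne c Γ =>
    ∀ x : HSp c Γ, S (toHmOne c Γ x) = toHmOne c Γ (fpSemigroup c Γ t x)

/-- The control operator `𝔅₁ f = -div f`, `𝔥ⁿ → 𝔥_{-1/2}`. The divergence is distributional:
`⟨-div f, w⟩_𝔥 = ∫ -(div f) e^φ w dx = ∫ f · ∇(e^φ w) dx = ⟨f, e^{-φ} ∇(e^φ w)⟩_{𝔥ⁿ}`. -/
def opB1 {n : ℕ} (c : ℝ) (Γ : Matrix (Fin n) (Fin n) ℝ) (f : HnSp c Γ) : HmHalf c Γ :=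
  (innerSL ℝ f).comp (VSp.grad c Γ)

/-- The map `F(v, u) = v · g(u)` with values in `𝔥ⁿ`. -/
def opF {n : ℕ} (c : ℝ) (Γ : Matrix (Fin n) (Fin n) ℝ) (g : Euc n → Euc n)
    (v : HSp c Γ) (u : Euc n) : HnSp c Γ :=
  WithLp.toLp 2 fun i => g u i • v

/-! ## Mild solutions -/

/-- `p` is a mild solution on `[0, t₁]` of
`ṗ = -c𝔄 p + 𝔅₁ F(p, u) + d`, `p(0) = p₀`. The integral is a Bochner integral in `𝔥_{-1}`. -/
structure IsMildSolutionOn {n : ℕ} (c : ℝ) (Γ : Matrix (Fin n) (Fin n) ℝ) (g : Euc n → Euc n)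
    (p₀ : HSp c Γ) (d : ℝ → HSp c Γ) (t₁ : ℝ) (p : ℝ → HSp c Γ) (u : ℝ → Euc n) : Prop where
  cont : ContinuousOn p (Icc 0 t₁)
  integrable : ∀ t ∈ Icc 0 t₁, IntervalIntegrable (fun s => fpSemigroupExt c Γ (t - s)
    (halfToOne c Γ (opB1 c Γ (opF c Γ g (p s) (u s))) + toHmOne c Γ (d s))) volume 0 t
  eq : ∀ t ∈ Icc 0 t₁, toHmOne c Γ (p t) = toHmOne c Γ (fpSemigroup c Γ t p₀) +
    ∫ s in (0 : ℝ)..t, fpSemigroupExt c Γ (t - s)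
      (halfToOne c Γ (opB1 c Γ (opF c Γ g (p s) (u s))) + toHmOne c Γ (d s))

/-- The total mass `∫ f dx`. -/
def mass {n : ℕ} (c : ℝ) (Γ : Matrix (Fin n) (Fin n) ℝ) (f : HSp c Γ) : ℝ := ∫ x, f x

/-- The mean `∫ x f(x) dx ∈ ℝⁿ`. -/
def meanVal {n : ℕ} (c : ℝ) (Γ : Matrix (Fin n) (Fin n) ℝ) (f : HSp c Γ) : Euc n :=
  ∫ x, f x • x

/-- The matrix `∫ (x - m)(x - m)ᵀ f(x) dx` with `m = ∫ x f(x) dx`. -/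
def covMat {n : ℕ} (c : ℝ) (Γ : Matrix (Fin n) (Fin n) ℝ) (f : HSp c Γ) :
    Matrix (Fin n) (Fin n) ℝ :=
  Matrix.of fun i j => ∫ x, (x i - meanVal c Γ f i) * (x j - meanVal c Γ f j) * f x

/-- `g` is linearly bounded and satisfies the high-gain property
`sup_{s ∈ ℝ} min_{δ ≤ ‖v‖ ≤ 1} vᵀ g(-s v) = ∞` for some `δ ∈ (0, 1)`. -/
structure IsHighGain {n : ℕ} (g : Euc n → Euc n) : Prop where
  linBdd : ∃ b > 0, ∀ v : Euc n, ‖g v‖ ≤ b * ‖v‖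
  highGain : ∃ δ ∈ Ioo (0 : ℝ) 1, ∀ M : ℝ, ∃ s : ℝ, ∀ v : Euc n,
    δ ≤ ‖v‖ → ‖v‖ ≤ 1 → M ≤ inner ℝ v (g (-(s • v)))

/-- The class `Φ` of funnel functions. -/
structure IsFunnelFun (φ : ℝ → ℝ) : Prop where
  smooth : ContDiffOn ℝ 1 φ (Ici 0)
  pos : ∀ t > 0, 0 < φ t
  liminf_pos : ∃ m > 0, ∀ᶠ t in atTop, m ≤ φ t
  deriv_le : ∃ ξ > 0, ∀ t ≥ 0, |derivWithin φ (Ici 0) t| ≤ ξ * (1 + φ t)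

/-- Admissible funnel control design parameters `(φ, α, N)`; only the values of `φ` and `N` on
`[0, ∞)` and those of `α` on `[0, 1)` matter. -/
structure IsFunnelDesign (φ α N : ℝ → ℝ) : Prop where
  funnel : IsFunnelFun φ
  smooth_α : ContDiffOn ℝ 1 α (Ico 0 1)
  bij_α : BijOn α (Ico 0 1) (Ici 1)
  smooth_N : ContDiffOn ℝ 1 N (Ici 0)
  surj_N : SurjOn N (Ici 0) univ

/-- `(p, u, y)` is a mild solution on `[0, t₁]` of the closed loop formed by the controlled
Fokker-Planck equation, the output `y = ∫ x p dx` and the funnel controller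
`u = (N ∘ α)(‖w‖²) w`, `w = φ (y - y_ref)`. For the feedback to make sense, `‖w‖²` has to lie in
the domain `[0, 1)` of `α`. -/
structure IsClosedLoopOn {n : ℕ} (c : ℝ) (Γ : Matrix (Fin n) (Fin n) ℝ) (g : Euc n → Euc n)
    (p₀ : HSp c Γ) (d : ℝ → HSp c Γ) (φ α N : ℝ → ℝ) (yref : ℝ → Euc n) (t₁ : ℝ)
    (p : ℝ → HSp c Γ) (u y : ℝ → Euc n) : Prop where
  cont_u : ContinuousOn u (Icc 0 t₁)
  cont_y : ContinuousOn y (Icc 0 t₁)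
  output : ∀ t ∈ Icc 0 t₁, y t = meanVal c Γ (p t)
  dom : ∀ t ∈ Icc 0 t₁, ‖φ t • (y t - yref t)‖ ^ 2 ∈ Ico (0 : ℝ) 1
  feedback : ∀ t ∈ Icc 0 t₁,
    u t = N (α (‖φ t • (y t - yref t)‖ ^ 2)) • (φ t • (y t - yref t))
  mild : IsMildSolutionOn c Γ g p₀ d t₁ p u

/-- `(p, u, y)` is a mild solution of the closed loop on `[0, ∞)`. -/
def IsClosedLoop {n : ℕ} (c : ℝ) (Γ : Matrix (Fin n) (Fin n) ℝ) (g : Euc n → Euc n)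
    (p₀ : HSp c Γ) (d : ℝ → HSp c Γ) (φ α N : ℝ → ℝ) (yref : ℝ → Euc n)
    (p : ℝ → HSp c Γ) (u y : ℝ → Euc n) : Prop :=
  ∀ t₁ > 0, IsClosedLoopOn c Γ g p₀ d φ α N yref t₁ p u y

/-! ## Regularity and the weak formulation -/

/-- `p ∈ L^q(0, t₁; 𝔙) ∩ W^{1,q}(0, t₁; 𝔥_{-1/2})`. -/
def IsRegularOn {n : ℕ} (c : ℝ) (Γ : Matrix (Fin n) (Fin n) ℝ) (q : ℝ≥0∞) (t₁ : ℝ)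
    (p : ℝ → HSp c Γ) : Prop :=
  (∃ P : ℝ → VSp c Γ, (∀ᵐ t ∂volume.restrict (Ioo 0 t₁), VSp.val c Γ (P t) = p t) ∧
    MemLp P q (volume.restrict (Ioo 0 t₁))) ∧
  MemW1 q (Ioo 0 t₁) fun t => toHmHalf c Γ (p t)

/-- For almost all `t > 0`, `p(t) ∈ 𝔙` and
`⟨ṗ(t), v⟩ = -c ⟨p(t), 𝔄 v⟩ + ⟨𝔅₁ F(p(t), u(t)) + d(t), v⟩` for all `v ∈ 𝔙`, where `ṗ` is the weak
derivative in `𝔥_{-1/2}` and `⟨p(t), 𝔄 v⟩ = 𝔞(p(t), v)` is the duality pairing of `𝔥_{1/2} = 𝔙`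
and `𝔥_{-1/2}`. -/
def IsWeakSolution {n : ℕ} (c : ℝ) (Γ : Matrix (Fin n) (Fin n) ℝ) (g : Euc n → Euc n)
    (d : ℝ → HSp c Γ) (p : ℝ → HSp c Γ) (u : ℝ → Euc n) : Prop :=
  ∃ pdot : ℝ → HmHalf c Γ, HasWeakDerivOn (fun t => toHmHalf c Γ (p t)) pdot (Ioi 0) ∧
    ∀ᵐ t ∂volume.restrict (Ioi 0), ∃ P : VSp c Γ, VSp.val c Γ P = p t ∧ ∀ v : VSp c Γ,
      pdot t v = -(c * formA c Γ P v) +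
        (opB1 c Γ (opF c Γ g (p t) (u t)) + toHmHalf c Γ (d t)) v

end

noncomputable section

section

/-! ### Temperate functions and the Gaussian weight -/

/-! Everything is diagonalised by Hermite functions. Let `v` be an orthonormal basis with `Γ v_j = c
l_j v_j`. In the coordinates `√l_j ⟨v_j, x⟩` the weight `e^{-φ}` is a standard Gaussian, and the
functions `e^{-φ} H_k`, with `k` a multi-index, form after normalisation a Hilbert basis `e_k` of
`𝔥` consisting of eigenvectors of `𝔄` with eigenvalues `μ_k = ∑ l_j k_j` (`formA_eigV`,
`eq_zero_of_inner_hermH`). Thus `𝔙` and `D(𝔄)` are weighted `ℓ²` spaces, and both the semigroup and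
its extension multiply the `k`-th coefficient by `e^{-c μ_k t}` (`fpSemigroup_basisH`,
`fpSemigroupExt_eigD`).

The operator `e^{-φ} ∇ e^φ` lowers indices. Hence `p` is a mild solution exactly when it is
continuous and its coefficients `a_k` solve the triangular system `a_k' = -c μ_k a_k + ∑_j b_j √(l_j
k_j) a_{k - e_j} + d_k` with `b_j = ⟨v_j, g(u)⟩`. This system is solved degree by degree. Young's
inequality lets the dissipation absorb the coupling, and the resulting energy estimates give
continuity in `𝔥`, square integrability in `𝔙`, and local boundedness in `𝔙` when the initial value
lies there. For the bound on the whole half-line, each of the finitely many low modes is bounded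
separately, while in high degree the dissipation dominates the coupling
(`IsTriSol.exists_bound_global`).

The nonlinear feedback is handled in finite dimensions. Since `∫ d = 0`, mode zero, that is the
mass, is conserved, so the modes of degree one give a closed equation `y' = -L y + P₀ g(u) + D` for
the mean (`isPrim_meanVal`). With the feedback inserted it is an autonomous loop for `y` alone. Once
`y` is found, `u` is a known continuous function, the linear equation yields `p`, and the mean of
`p` is `y` because both solve the same linear equation. The same route gives uniqueness.

The funnel equation is solved without continuing maximal solutions (`exists_funnel_solution`). The
high-gain property and surjectivity of `N ∘ α` provide a radius `ρ < 1`, as close to one as desired,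
at which the feedback pushes `w` inwards more strongly than all other terms can push outwards. The
feedback is replaced outside `‖w‖² ≤ ρ` by a globally Lipschitz extension, and a barrier argument
shows that the level `ρ` is never crossed, so the extension is never seen.

For `d = 0`, the product rule cancels the input from the second cumulants, which therefore decay
like `e^{-c (l_i + l_j) t}`; this is the covariance formula. For positivity, the Fourier transform
of `p(t)` divided by that of the Gaussian changes only by a phase along the dilated frequency `e^{c
l_j t} ξ_j`. So `p(t)` has the characteristic function of the contracted and translated initial
measure convolved with a Gaussian, and is nonnegative (`ae_nonneg_of_charFun`). -/

theorem Function.HasTemperateGrowth.fderiv_apply {E F : Type*} [NormedAddCommGroup E]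
    [NormedSpace ℝ E] [NormedAddCommGroup F] [NormedSpace ℝ F] {f : E → F}
    (hf : f.HasTemperateGrowth) (a : E) :
    (fun x => fderiv ℝ f x a).HasTemperateGrowth := by
  have h : (fderiv ℝ f).HasTemperateGrowth := by
    refine ⟨hf.1.fderiv_right (m := ∞) (by simp), fun m => ?_⟩
    obtain ⟨k, C, h⟩ := hf.2 (m + 1)
    exact ⟨k, C, fun x => by rw [norm_iteratedFDeriv_fderiv]; exact h x⟩
  exact (ContinuousLinearMap.apply ℝ F a).hasTemperateGrowth.comp h

/-- An orthonormal basis `v` of eigenvectors of `Γ`, with positive eigenvalues `c l`. -/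
structure IsEigBasis {n : ℕ} (c : ℝ) (Γ : Matrix (Fin n) (Fin n) ℝ)
    (v : OrthonormalBasis (Fin n) ℝ (Euc n)) (l : Fin n → ℝ) : Prop where
  cpos : 0 < c
  pos : ∀ k, 0 < l k
  eig : ∀ k, Γ *ᵥ (v k).ofLp = (c * l k) • (v k).ofLp

namespace IsEigBasis

variable {n : ℕ} {c : ℝ} {Γ : Matrix (Fin n) (Fin n) ℝ}
  {v : OrthonormalBasis (Fin n) ℝ (Euc n)} {l : Fin n → ℝ}

theorem mulVec (h : IsEigBasis c Γ v l) (x : Euc n) :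
    Γ *ᵥ x.ofLp = ∑ j, (inner ℝ (v j) x * (c * l j)) • (v j).ofLp := by
  conv_lhs => rw [← v.sum_repr' x]
  rw [WithLp.ofLp_sum, Matrix.mulVec_sum]
  refine Finset.sum_congr rfl fun j _ => ?_
  rw [WithLp.ofLp_smul, Matrix.mulVec_smul, h.eig, smul_smul]

theorem dotProduct_mulVec (h : IsEigBasis c Γ v l) (x y : Euc n) :
    y.ofLp ⬝ᵥ (Γ *ᵥ x.ofLp) = ∑ j, c * l j * inner ℝ (v j) x * inner ℝ (v j) y := by
  rw [h.mulVec, dotProduct_sum]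
  refine Finset.sum_congr rfl fun j _ => ?_
  rw [dotProduct_smul, EuclideanSpace.inner_eq_star_dotProduct (v j) y]
  simp only [star_trivial, smul_eq_mul]
  ring

theorem pot_eq (h : IsEigBasis c Γ v l) (x : Euc n) :
    pot c Γ x = 1 / 2 * ∑ j, l j * inner ℝ (v j) x ^ 2 := by
  have hc := h.cpos.ne'
  rw [pot, h.dotProduct_mulVec, Finset.mul_sum, Finset.mul_sum]
  refine Finset.sum_congr rfl fun j _ => ?_
  field_simp

/-- The constant is half the smallest `l j`; in dimension zero both sides vanish and any positive
constant serves. -/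
theorem exists_le_pot (h : IsEigBasis c Γ v l) :
    ∃ b > 0, ∀ x : Euc n, b * ‖x‖ ^ 2 ≤ pot c Γ x := by
  obtain ⟨m, hm, hml⟩ : ∃ m > 0, ∀ j, m ≤ l j := by
    rcases isEmpty_or_nonempty (Fin n) with hn | hn
    · exact ⟨1, one_pos, fun j => (IsEmpty.false j).elim⟩
    · obtain ⟨j, hj⟩ := Finite.exists_min l
      exact ⟨l j, h.pos j, hj⟩
  refine ⟨m / 2, by positivity, fun x => ?_⟩
  rw [h.pot_eq, ← v.sum_sq_norm_inner_right x]
  have : ∑ j, m * inner ℝ (v j) x ^ 2 ≤ ∑ j, l j * inner ℝ (v j) x ^ 2 :=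
    Finset.sum_le_sum fun j _ => mul_le_mul_of_nonneg_right (hml j) (sq_nonneg _)
  simp only [Real.norm_eq_abs, sq_abs]
  rw [← Finset.mul_sum] at this
  linarith

theorem hasTemperateGrowth_pot (h : IsEigBasis c Γ v l) : (pot c Γ).HasTemperateGrowth := by
  have : pot c Γ = fun x => 1 / 2 * ∑ j, l j * inner ℝ (v j) x ^ 2 := funext h.pot_eq
  rw [this]
  fun_prop

theorem fderiv_pot (h : IsEigBasis c Γ v l) (x : Euc n) (j : Fin n) :
    fderiv ℝ (pot c Γ) x (v j) = l j * inner ℝ (v j) x := by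
  have : pot c Γ = fun x => 1 / 2 * ∑ j, l j * inner ℝ (v j) x ^ 2 := funext h.pot_eq
  have hd : ∀ i, HasFDerivAt (fun x : Euc n => l i * inner ℝ (v i) x ^ 2)
      (l i • ((2 * inner ℝ (v i) x) • innerSL ℝ (v i))) x := fun i => by
    have h1 := ((innerSL ℝ (v i)).hasFDerivAt (x := x)).pow 2
    simpa using! h1.const_mul (l i)
  have := ((HasFDerivAt.fun_sum (u := Finset.univ) fun i _ => hd i).const_mul (1 / 2)).fderiv
  rw [funext h.pot_eq, this]
  simp only [_root_.smul_apply, _root_.sum_apply, smul_eq_mul,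
    innerSL_apply_apply, orthonormal_iff_ite.1 v.orthonormal]
  simp
  ring

end IsEigBasis

theorem integrable_exp_neg_mul_sq_norm {n : ℕ} {b : ℝ} (hb : 0 < b) :
    Integrable fun x : Euc n => Real.exp (-b * ‖x‖ ^ 2) := by
  have h1 := GaussianFourier.integrable_cexp_neg_mul_sq_norm_add (V := Euc n)
    (b := (b : ℂ)) (by simpa using hb) 0 0
  refine h1.norm.congr (Eventually.of_forall fun x => ?_)
  simp only [Complex.norm_exp, zero_mul, add_zero]
  congr 1
  rw [← Complex.ofReal_neg, ← Complex.ofReal_pow, ← Complex.ofReal_mul, Complex.ofReal_re]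

/-- One half of the quadratic decay absorbs the polynomial growth of `f`; the other half is an
integrable Gaussian. -/
theorem IsEigBasis.integrable_mul_exp {n : ℕ} {c : ℝ} {Γ : Matrix (Fin n) (Fin n) ℝ}
    {v : OrthonormalBasis (Fin n) ℝ (Euc n)} {l : Fin n → ℝ} (h : IsEigBasis c Γ v l)
    {f : Euc n → ℝ} (hf : Continuous f) {C : ℝ} {k : ℕ}
    (hC : ∀ x, ‖f x‖ ≤ C * (1 + ‖x‖) ^ k) :
    Integrable fun x => f x * Real.exp (-pot c Γ x) := by
  obtain ⟨b, hb, hpot⟩ := h.exists_le_pot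
  have hC0 : 0 ≤ C := by simpa using (norm_nonneg _).trans (hC 0)
  have hg : Integrable fun x : Euc n => Real.exp (-(b / 2) * ‖x‖ ^ 2) :=
    integrable_exp_neg_mul_sq_norm (by positivity)
  obtain ⟨B, hB⟩ : ∃ B : ℝ, ∀ r : ℝ, 0 ≤ r → (1 + r) ^ k * Real.exp (-(b / 2) * r ^ 2) ≤ B := by
    have h1 : Tendsto (fun r : ℝ => r ^ k * Real.exp (-r)) atTop (𝓝 0) :=
      Real.tendsto_pow_mul_exp_neg_atTop_nhds_zero k
    obtain ⟨B, hB⟩ : ∃ B : ℝ, ∀ r : ℝ, 0 ≤ r → r ^ k * Real.exp (-r) ≤ B := by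
      obtain ⟨R, hR⟩ := eventually_atTop.1 (h1.eventually (gt_mem_nhds (zero_lt_one' ℝ)))
      obtain ⟨B, hB⟩ := (isCompact_Icc (a := (0 : ℝ)) (b := R)).bddAbove_image
        (f := fun r : ℝ => r ^ k * Real.exp (-r)) (by fun_prop)
      refine ⟨max B 1, fun r hr => ?_⟩
      rcases le_total r R with hrR | hrR
      · exact (hB ⟨r, ⟨hr, hrR⟩, rfl⟩).trans (le_max_left _ _)
      · exact (hR r hrR).le.trans (le_max_right _ _)
    refine ⟨B * Real.exp (1 + 1 / (2 * b)), fun r hr => ?_⟩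
    have h2 := hB (1 + r) (by linarith)
    -- Completing the square gives `b r² / 2 ≥ r - 1 / (2b)`, which reduces Gaussian decay to
    -- exponential decay.
    have h3 : Real.exp (-(b / 2) * r ^ 2) ≤ Real.exp (-(1 + r)) * Real.exp (1 + 1 / (2 * b)) := by
      rw [← Real.exp_add]
      refine Real.exp_le_exp.2 ?_
      have : 0 ≤ (b * r - 1) ^ 2 / (2 * b) := by positivity
      have e : (b * r - 1) ^ 2 / (2 * b) = b / 2 * r ^ 2 - r + 1 / (2 * b) := by
        field_simp
        ring
      linarith
    calc (1 + r) ^ k * Real.exp (-(b / 2) * r ^ 2)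
        ≤ (1 + r) ^ k * (Real.exp (-(1 + r)) * Real.exp (1 + 1 / (2 * b))) := by gcongr
      _ = (1 + r) ^ k * Real.exp (-(1 + r)) * Real.exp (1 + 1 / (2 * b)) := by ring
      _ ≤ _ := by gcongr
  have hpc : Continuous (pot c Γ) := h.hasTemperateGrowth_pot.1.continuous
  refine (hg.const_mul (C * B)).mono' (by fun_prop) (Eventually.of_forall fun x => ?_)
  rw [norm_mul, Real.norm_of_nonneg (Real.exp_pos _).le]
  calc ‖f x‖ * Real.exp (-pot c Γ x)
      ≤ C * (1 + ‖x‖) ^ k * Real.exp (-(b * ‖x‖ ^ 2)) := by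
        gcongr
        · exact hC x
        · exact hpot x
    _ = C * ((1 + ‖x‖) ^ k * Real.exp (-(b / 2) * ‖x‖ ^ 2)) * Real.exp (-(b / 2) * ‖x‖ ^ 2) := by
        rw [show -(b * ‖x‖ ^ 2) = -(b / 2) * ‖x‖ ^ 2 + -(b / 2) * ‖x‖ ^ 2 by ring, Real.exp_add]
        ring
    _ ≤ C * B * Real.exp (-(b / 2) * ‖x‖ ^ 2) := by
        gcongr
        exact hB _ (norm_nonneg _)

/-! ### The measure `e^φ dx` and its space of square integrable functions -/

section Weighted

variable {n : ℕ} {c : ℝ} {Γ : Matrix (Fin n) (Fin n) ℝ}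

theorem continuous_pot : Continuous (pot c Γ) := by unfold pot; fun_prop

theorem wMeasure_ac_volume : wMeasure c Γ ≪ (volume : Measure (Euc n)) :=
  withDensity_absolutelyContinuous _ _

theorem ae_wMeasure_iff {p : Euc n → Prop} : (∀ᵐ x ∂wMeasure c Γ, p x) ↔ ∀ᵐ x, p x :=
  ⟨fun h => (volume_ac_wMeasure c Γ).ae_le h, fun h => wMeasure_ac_volume.ae_le h⟩

theorem integral_wMeasure (f : Euc n → ℝ) :
    ∫ x, f x ∂wMeasure c Γ = ∫ x, Real.exp (pot c Γ x) * f x := by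
  have hm : Measurable fun x : Euc n => ENNReal.ofReal (Real.exp (pot c Γ x)) :=
    (continuous_pot.rexp.measurable).ennreal_ofReal
  rw [wMeasure, integral_withDensity_eq_integral_toReal_smul hm (by simp)]
  simp [ENNReal.toReal_ofReal (Real.exp_pos _).le]

theorem integrable_wMeasure_iff {f : Euc n → ℝ} :
    Integrable f (wMeasure c Γ) ↔ Integrable fun x => Real.exp (pot c Γ x) * f x := by
  have hm : Measurable fun x : Euc n => ENNReal.ofReal (Real.exp (pot c Γ x)) :=
    (continuous_pot.rexp.measurable).ennreal_ofReal
  rw [wMeasure, integrable_withDensity_iff_integrable_smul' hm (by simp)]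
  simp [ENNReal.toReal_ofReal (Real.exp_pos _).le]

theorem inner_HSp (z w : HSp c Γ) :
    inner ℝ z w = ∫ x, Real.exp (pot c Γ x) * (z x * w x) := by
  rw [L2.inner_def, ← integral_wMeasure]
  simp [mul_comm]

theorem HSp.integrable_mul (z w : HSp c Γ) :
    Integrable fun x => Real.exp (pot c Γ x) * (z x * w x) := by
  rw [← integrable_wMeasure_iff]
  simpa [mul_comm] using L2.integrable_inner (𝕜 := ℝ) z w

theorem HSp.ext_ae {z w : HSp c Γ} (h : ∀ᵐ x : Euc n, z x = w x) : z = w :=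
  Lp.ext (ae_wMeasure_iff.2 h)

end Weighted

variable {n : ℕ} {c : ℝ} {Γ : Matrix (Fin n) (Fin n) ℝ}
  {v : OrthonormalBasis (Fin n) ℝ (Euc n)} {l : Fin n → ℝ}

/-- Squaring `e^{-φ} f` and integrating against `e^φ dx` leaves `e^{-φ} f²`, which is integrable. -/
theorem IsEigBasis.memLp_exp_mul (h : IsEigBasis c Γ v l) {f : Euc n → ℝ}
    (hf : f.HasTemperateGrowth) :
    MemLp (fun x => Real.exp (-pot c Γ x) * f x) 2 (wMeasure c Γ) := by
  have hfc : Continuous f := hf.1.continuous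
  have hpc : Continuous (pot c Γ) := continuous_pot
  rw [memLp_two_iff_integrable_sq (by fun_prop), integrable_wMeasure_iff]
  obtain ⟨k, C, hC⟩ := (hf.pow 2).2 0
  refine (h.integrable_mul_exp (hf.pow 2).1.continuous (C := C) (k := k)
    (fun x => by simpa using hC x)).congr (Eventually.of_forall fun x => ?_)
  simp only [Pi.pow_apply, mul_pow]
  rw [pow_two (Real.exp _), ← mul_assoc, ← mul_assoc, ← Real.exp_add, ← sub_eq_add_neg,
    sub_self, Real.exp_zero]
  ring

/-- The element `e^{-φ} f` of `𝔥`, for a smooth function `f` of polynomial growth. -/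
def gaussEmb (c : ℝ) (Γ : Matrix (Fin n) (Fin n) ℝ) (f : Euc n → ℝ) : HSp c Γ := by
  classical
  exact if h : MemLp (fun x => Real.exp (-pot c Γ x) * f x) 2 (wMeasure c Γ) then h.toLp else 0

theorem IsEigBasis.coe_gaussEmb (h : IsEigBasis c Γ v l) {f : Euc n → ℝ}
    (hf : f.HasTemperateGrowth) :
    ∀ᵐ x : Euc n, gaussEmb c Γ f x = Real.exp (-pot c Γ x) * f x := by
  rw [gaussEmb, dif_pos (h.memLp_exp_mul hf)]
  exact ae_wMeasure_iff.1 (MemLp.coeFn_toLp _)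

theorem IsEigBasis.gaussEmb_add (h : IsEigBasis c Γ v l) {f g : Euc n → ℝ}
    (hf : f.HasTemperateGrowth) (hg : g.HasTemperateGrowth) :
    gaussEmb c Γ (fun x => f x + g x) = gaussEmb c Γ f + gaussEmb c Γ g := by
  refine HSp.ext_ae ?_
  filter_upwards [h.coe_gaussEmb (hf.add hg), h.coe_gaussEmb hf, h.coe_gaussEmb hg,
    ae_wMeasure_iff.1 (Lp.coeFn_add (gaussEmb c Γ f) (gaussEmb c Γ g))] with x h1 h2 h3 h4
  rw [h4, Pi.add_apply, h2, h3]
  refine h1.trans ?_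
  simp [mul_add]

theorem IsEigBasis.gaussEmb_const_mul (h : IsEigBasis c Γ v l) {f : Euc n → ℝ}
    (hf : f.HasTemperateGrowth) (a : ℝ) :
    gaussEmb c Γ (fun x => a * f x) = a • gaussEmb c Γ f := by
  refine HSp.ext_ae ?_
  have h0 : (fun x => a * f x).HasTemperateGrowth := by fun_prop
  filter_upwards [h.coe_gaussEmb h0, h.coe_gaussEmb hf,
    ae_wMeasure_iff.1 (Lp.coeFn_smul a (gaussEmb c Γ f))] with x h1 h2 h4
  rw [h4, Pi.smul_apply, h2, h1, smul_eq_mul]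
  ring

theorem IsEigBasis.gaussEmb_sum (h : IsEigBasis c Γ v l) {ι : Type*} (s : Finset ι)
    {f : ι → Euc n → ℝ} (hf : ∀ i, (f i).HasTemperateGrowth) :
    gaussEmb c Γ (fun x => ∑ i ∈ s, f i x) = ∑ i ∈ s, gaussEmb c Γ (f i) := by
  classical
  induction s using Finset.induction_on with
  | empty =>
    have := h.gaussEmb_const_mul (Function.HasTemperateGrowth.const (E := Euc n) (0 : ℝ)) 0
    simpa using this
  | insert i s hi ih =>
    simp only [Finset.sum_insert hi]
    rw [h.gaussEmb_add (hf i) (Function.HasTemperateGrowth.sum fun j _ => hf j), ih]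

/-- The two weights cancel. Unweighted moments of `z` are therefore inner products in `𝔥`,
continuous in `z`. -/
theorem IsEigBasis.inner_gaussEmb (h : IsEigBasis c Γ v l) (z : HSp c Γ) {f : Euc n → ℝ}
    (hf : f.HasTemperateGrowth) : inner ℝ z (gaussEmb c Γ f) = ∫ x, z x * f x := by
  rw [inner_HSp]
  refine integral_congr_ae ?_
  filter_upwards [h.coe_gaussEmb hf] with x hx
  rw [hx, ← mul_assoc, ← mul_assoc, mul_comm (Real.exp _) (z x), mul_assoc (z x), ← Real.exp_add]
  simp

theorem IsEigBasis.integrable_mul_temperate (h : IsEigBasis c Γ v l) (z : HSp c Γ)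
    {f : Euc n → ℝ} (hf : f.HasTemperateGrowth) : Integrable fun x => z x * f x := by
  refine (HSp.integrable_mul z (gaussEmb c Γ f)).congr ?_
  filter_upwards [h.coe_gaussEmb hf] with x hx
  rw [hx, ← mul_assoc, ← mul_assoc, mul_comm (Real.exp _) (z x), mul_assoc (z x), ← Real.exp_add]
  simp

end

section

variable {n : ℕ} {c : ℝ} {Γ : Matrix (Fin n) (Fin n) ℝ}
  {v : OrthonormalBasis (Fin n) ℝ (Euc n)} {l : Fin n → ℝ}

/-! ### The space `𝔙` -/

theorem VSp.hasWeakPartial (w : VSp c Γ) (i : Fin n) :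
    HasWeakPartial i (fun x => Real.exp (pot c Γ x) * VSp.val c Γ w x)
      (fun x => Real.exp (pot c Γ x) * VSp.grad c Γ w i x) := w.2 i

theorem VSp.inner_def (w w' : VSp c Γ) :
    inner ℝ w w' = inner ℝ (VSp.val c Γ w) (VSp.val c Γ w') + formA c Γ w w' := rfl

theorem formA_eq_sum (w w' : VSp c Γ) :
    formA c Γ w w' = ∑ i, inner ℝ (VSp.grad c Γ w i) (VSp.grad c Γ w' i) := by
  rw [formA, PiLp.inner_apply]

/-- The directional derivative `e^{-φ} ∂ₐ(e^φ w)` of `w ∈ 𝔙`. -/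
def gradAlong (c : ℝ) (Γ : Matrix (Fin n) (Fin n) ℝ) (a : Euc n) (w : VSp c Γ) : HSp c Γ :=
  ∑ i, a i • VSp.grad c Γ w i

theorem VSp.grad_eq_sum (v : OrthonormalBasis (Fin n) ℝ (Euc n)) (w : VSp c Γ) (i : Fin n) :
    VSp.grad c Γ w i = ∑ j, v j i • gradAlong c Γ (v j) w := by
  have h : ∀ i' : Fin n, ∑ j, v j i * v j i' = if i' = i then 1 else 0 := fun i' => by
    have h1 := v.sum_inner_mul_inner (EuclideanSpace.single i (1 : ℝ))
      (EuclideanSpace.single i' (1 : ℝ))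
    simp only [EuclideanSpace.inner_single_left, EuclideanSpace.inner_single_right, map_one,
      one_mul] at h1
    simpa using h1
  simp only [gradAlong, Finset.smul_sum, smul_smul]
  rw [Finset.sum_comm]
  simp only [← Finset.sum_smul, h]
  simp

/-- The form is defined through the standard coordinates; the eigenbasis of `Γ` is the one in which
it decouples. -/
theorem formA_eq_sum_gradAlong (v : OrthonormalBasis (Fin n) ℝ (Euc n)) (w w' : VSp c Γ) :
    formA c Γ w w' = ∑ j, inner ℝ (gradAlong c Γ (v j) w) (gradAlong c Γ (v j) w') := by
  rw [formA_eq_sum]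
  have : ∀ i, inner ℝ (VSp.grad c Γ w i) (VSp.grad c Γ w' i) =
      ∑ j, inner ℝ (gradAlong c Γ (v j) w) (v j i • VSp.grad c Γ w' i) := fun i => by
    conv_lhs => rw [VSp.grad_eq_sum v w i, sum_inner]
    simp only [real_inner_smul_left, real_inner_smul_right]
  simp only [this]
  rw [Finset.sum_comm]
  refine Finset.sum_congr rfl fun j _ => ?_
  rw [← inner_sum]
  rfl

theorem tendsto_bump_comp_div (b : ContDiffBump (0 : Euc n)) (x : Euc n) :
    Tendsto (fun m : ℕ => b (((m : ℝ) + 1)⁻¹ • x)) atTop (𝓝 1) := by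
  have h1 : Tendsto (fun m : ℕ => ((m : ℝ) + 1)⁻¹ • x) atTop (𝓝 ((0 : ℝ) • x)) := by
    refine Tendsto.smul_const ?_ x
    exact tendsto_inv_atTop_zero.comp (tendsto_atTop_add_const_right _ _
      tendsto_natCast_atTop_atTop)
  rw [zero_smul] at h1
  have h2 := (b.continuous.tendsto 0).comp h1
  rwa [b.one_of_mem_closedBall (Metric.mem_closedBall_self b.rIn_pos.le)] at h2

/-- Integration by parts against functions of polynomial growth. -/
theorem IsEigBasis.integral_grad_mul (h : IsEigBasis c Γ v l) (w : VSp c Γ) (i : Fin n)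
    {f : Euc n → ℝ} (hf : f.HasTemperateGrowth) :
    ∫ x, VSp.grad c Γ w i x * f x = ∫ x, VSp.val c Γ w x *
      (fderiv ℝ (pot c Γ) x (EuclideanSpace.single i 1) * f x -
        fderiv ℝ f x (EuclideanSpace.single i 1)) := by
  set e : Euc n := EuclideanSpace.single i 1
  have hp := h.hasTemperateGrowth_pot
  have hp' := hp.fderiv_apply e
  have hf' := hf.fderiv_apply e
  -- The adjoint of `∂_i` with respect to the Gaussian weight `e^{-φ}`, applied to `f`.
  set q : Euc n → ℝ := fun x => fderiv ℝ (pot c Γ) x e * f x - fderiv ℝ f x e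
  have hq : q.HasTemperateGrowth := by fun_prop
  let b : ContDiffBump (0 : Euc n) := ⟨1, 2, one_pos, one_lt_two⟩
  have hb : ContDiff ℝ ∞ b := b.contDiff
  have hb' : Continuous fun x => fderiv ℝ b x e :=
    (hb.continuous_fderiv (by simp)).clm_apply continuous_const
  have hbs : HasCompactSupport fun x => fderiv ℝ b x e :=
    (b.hasCompactSupport.fderiv (𝕜 := ℝ)).comp_left (g := fun L : Euc n →L[ℝ] ℝ => L e) rfl
  obtain ⟨K, hK⟩ := hb'.bounded_above_of_compact_support hbs
  -- The function `e^{-φ} f` is not compactly supported, so it is multiplied by dilates of a bump.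
  -- Differentiating the cutoff costs a term of order `1 / (m + 1)`, which disappears in the limit
  -- by dominated convergence.
  have key : ∀ m : ℕ, ∫ x, b (((m : ℝ) + 1)⁻¹ • x) * (VSp.grad c Γ w i x * f x) =
      ∫ x, (b (((m : ℝ) + 1)⁻¹ • x) * (VSp.val c Γ w x * q x) -
        ((m : ℝ) + 1)⁻¹ * fderiv ℝ b (((m : ℝ) + 1)⁻¹ • x) e * (VSp.val c Γ w x * f x)) := by
    intro m
    set a : ℝ := ((m : ℝ) + 1)⁻¹
    have ha : a ≠ 0 := by positivity
    have hpc := hp.1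
    have hfc := hf.1
    have hba : ContDiff ℝ ∞ fun x : Euc n => b (a • x) := by fun_prop
    have hcs : HasCompactSupport fun x : Euc n => b (a • x) :=
      b.hasCompactSupport.comp_homeomorph (Homeomorph.smulOfNeZero a ha)
    have h1 := (w.hasWeakPartial i).2.2 (fun x => b (a • x) * (Real.exp (-pot c Γ x) * f x))
      (by fun_prop) hcs.mul_right
    have h2 : ∀ x, fderiv ℝ (fun x => b (a • x) * (Real.exp (-pot c Γ x) * f x)) x
        (EuclideanSpace.single i 1) =
        Real.exp (-pot c Γ x) * (a * fderiv ℝ b (a • x) e * f x - b (a • x) * q x) := by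
      intro x
      have d1 : HasFDerivAt (fun x : Euc n => b (a • x))
          ((fderiv ℝ b (a • x)).comp (a • ContinuousLinearMap.id ℝ (Euc n))) x :=
        ((hb.differentiable (by simp) _).hasFDerivAt).comp x
          ((hasFDerivAt_id x).const_smul a)
      have d2 := ((hpc.differentiable (by simp) x).hasFDerivAt).fun_neg.exp
      have d3 := (hfc.differentiable (by simp) x).hasFDerivAt
      rw [(d1.fun_mul (d2.fun_mul d3)).fderiv]
      simp [q, e]
      ring
    simp only [h2] at h1
    have e1 : ∀ x, Real.exp (pot c Γ x) * Real.exp (-pot c Γ x) = 1 := fun x => by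
      rw [← Real.exp_add]; simp
    have h3 : ∫ x, b (a • x) * (VSp.grad c Γ w i x * f x) =
        ∫ x, Real.exp (pot c Γ x) * VSp.grad c Γ w i x *
          (b (a • x) * (Real.exp (-pot c Γ x) * f x)) := by
      congr 1 with x
      linear_combination (-(b (a • x) * (VSp.grad c Γ w i x * f x))) * e1 x
    rw [h3, ← neg_eq_iff_eq_neg.2 h1, ← integral_neg]
    congr 1 with x
    linear_combination (VSp.val c Γ w x * (b (a • x) * q x - a * fderiv ℝ b (a • x) e * f x)) * e1 x
  have i1 := h.integrable_mul_temperate (VSp.grad c Γ w i) hf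
  have i2 := h.integrable_mul_temperate (VSp.val c Γ w) hq
  have i3 := h.integrable_mul_temperate (VSp.val c Γ w) hf
  have ha1 : ∀ m : ℕ, ((m : ℝ) + 1)⁻¹ ≤ 1 := fun m => inv_le_one_of_one_le₀ (by
    have : (0 : ℝ) ≤ m := m.cast_nonneg
    linarith)
  have l1 : Tendsto (fun m : ℕ => ∫ x, b (((m : ℝ) + 1)⁻¹ • x) * (VSp.grad c Γ w i x * f x)) atTop
      (𝓝 (∫ x, VSp.grad c Γ w i x * f x)) := by
    refine tendsto_integral_of_dominated_convergence (fun x => ‖VSp.grad c Γ w i x * f x‖)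
      (fun m => ?_) i1.norm (fun m => Eventually.of_forall fun x => ?_)
      (Eventually.of_forall fun x => ?_)
    · exact (hb.continuous.comp (continuous_const_smul _)).aestronglyMeasurable.mul i1.1
    · rw [norm_mul, Real.norm_of_nonneg b.nonneg]
      exact mul_le_of_le_one_left (norm_nonneg _) b.le_one
    · simpa using (tendsto_bump_comp_div b x).mul_const (VSp.grad c Γ w i x * f x)
  have l2 : Tendsto (fun m : ℕ => ∫ x, (b (((m : ℝ) + 1)⁻¹ • x) * (VSp.val c Γ w x * q x) -
        ((m : ℝ) + 1)⁻¹ * fderiv ℝ b (((m : ℝ) + 1)⁻¹ • x) e * (VSp.val c Γ w x * f x))) atTop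
      (𝓝 (∫ x, VSp.val c Γ w x * q x)) := by
    refine tendsto_integral_of_dominated_convergence
      (fun x => ‖VSp.val c Γ w x * q x‖ + K * ‖VSp.val c Γ w x * f x‖)
      (fun m => ?_) (i2.norm.add (i3.norm.const_mul K)) (fun m => Eventually.of_forall fun x => ?_)
      (Eventually.of_forall fun x => ?_)
    · exact ((hb.continuous.comp (continuous_const_smul _)).aestronglyMeasurable.mul i2.1).sub
        (((hb'.comp (continuous_const_smul _)).const_smul
          (((m : ℝ) + 1)⁻¹)).aestronglyMeasurable.mul
          i3.1)
    · refine (norm_sub_le _ _).trans (add_le_add ?_ ?_)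
      · rw [norm_mul, Real.norm_of_nonneg b.nonneg]
        exact mul_le_of_le_one_left (norm_nonneg _) b.le_one
      · rw [norm_mul, norm_mul]
        refine mul_le_mul_of_nonneg_right ?_ (norm_nonneg _)
        rw [Real.norm_of_nonneg (by positivity)]
        exact (mul_le_of_le_one_left (norm_nonneg _) (ha1 m)).trans (hK _)
    · have t1 := (tendsto_bump_comp_div b x).mul_const (VSp.val c Γ w x * q x)
      have t2 : Tendsto (fun m : ℕ => ((m : ℝ) + 1)⁻¹ * fderiv ℝ b (((m : ℝ) + 1)⁻¹ • x) e)
          atTop (𝓝 0) := by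
        refine squeeze_zero_norm (a := fun m : ℕ => ((m : ℝ) + 1)⁻¹ * K) (fun m => ?_) ?_
        · rw [norm_mul, Real.norm_of_nonneg (by positivity)]
          exact mul_le_mul_of_nonneg_left (hK _) (by positivity)
        · have : Tendsto (fun m : ℕ => ((m : ℝ) + 1)⁻¹) atTop (𝓝 0) :=
            tendsto_inv_atTop_zero.comp (tendsto_atTop_add_const_right _ _
              tendsto_natCast_atTop_atTop)
          simpa using this.mul_const K
      simpa using t1.sub (t2.mul_const (VSp.val c Γ w x * f x))
  refine tendsto_nhds_unique l1 (l2.congr fun m => (key m).symm)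

theorem IsEigBasis.inner_grad_gaussEmb (h : IsEigBasis c Γ v l) (w : VSp c Γ) (i : Fin n)
    {f : Euc n → ℝ} (hf : f.HasTemperateGrowth) :
    inner ℝ (VSp.grad c Γ w i) (gaussEmb c Γ f) = inner ℝ (VSp.val c Γ w)
      (gaussEmb c Γ fun x => fderiv ℝ (pot c Γ) x (EuclideanSpace.single i 1) * f x -
        fderiv ℝ f x (EuclideanSpace.single i 1)) := by
  have := h.hasTemperateGrowth_pot.fderiv_apply (EuclideanSpace.single i 1)
  have := hf.fderiv_apply (EuclideanSpace.single i 1)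
  rw [h.inner_gaussEmb _ hf, h.inner_gaussEmb _ (by fun_prop), h.integral_grad_mul w i hf]

theorem Euc.map_eq_sum (L : Euc n →L[ℝ] ℝ) (a : Euc n) :
    L a = ∑ i, a i * L (EuclideanSpace.single i 1) := by
  conv_lhs => rw [← (EuclideanSpace.basisFun (Fin n) ℝ).sum_repr a]
  simp

/-- The right-hand side contains the adjoint of the weighted directional derivative; on Hermite
functions it becomes the raising operator. -/
theorem IsEigBasis.inner_gradAlong_gaussEmb (h : IsEigBasis c Γ v l) (w : VSp c Γ) (a : Euc n)
    {f : Euc n → ℝ} (hf : f.HasTemperateGrowth) :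
    inner ℝ (gradAlong c Γ a w) (gaussEmb c Γ f) = inner ℝ (VSp.val c Γ w)
      (gaussEmb c Γ fun x => fderiv ℝ (pot c Γ) x a * f x - fderiv ℝ f x a) := by
  have hp := h.hasTemperateGrowth_pot.fderiv_apply
  have hf' := hf.fderiv_apply
  have e : (fun x => fderiv ℝ (pot c Γ) x a * f x - fderiv ℝ f x a) = fun x =>
      ∑ i, a i * (fderiv ℝ (pot c Γ) x (EuclideanSpace.single i 1) * f x -
        fderiv ℝ f x (EuclideanSpace.single i 1)) := funext fun x => by
    rw [Euc.map_eq_sum (fderiv ℝ (pot c Γ) x) a, Euc.map_eq_sum (fderiv ℝ f x) a, Finset.sum_mul,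
      ← Finset.sum_sub_distrib]
    exact Finset.sum_congr rfl fun i _ => by ring
  rw [e, h.gaussEmb_sum _ (fun i => by fun_prop), inner_sum, gradAlong, sum_inner]
  refine Finset.sum_congr rfl fun i _ => ?_
  rw [h.gaussEmb_const_mul (by fun_prop), real_inner_smul_left, real_inner_smul_right,
    h.inner_grad_gaussEmb w i hf]

/-- A smooth function `f` of polynomial growth gives the element `e^{-φ} f` of `𝔙`. -/
theorem IsEigBasis.exists_gaussV (h : IsEigBasis c Γ v l) {f : Euc n → ℝ}
    (hf : f.HasTemperateGrowth) :
    ∃ w : VSp c Γ, VSp.val c Γ w = gaussEmb c Γ f ∧ ∀ i, VSp.grad c Γ w i =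
      gaussEmb c Γ fun x => fderiv ℝ f x (EuclideanSpace.single i 1) := by
  have e1 : ∀ x, Real.exp (pot c Γ x) * Real.exp (-pot c Γ x) = 1 := fun x => by
    rw [← Real.exp_add]; simp
  refine ⟨⟨WithLp.toLp 2 (gaussEmb c Γ f, WithLp.toLp 2 fun i =>
    gaussEmb c Γ fun x => fderiv ℝ f x (EuclideanSpace.single i 1)), fun i => ?_⟩, rfl,
    fun i => rfl⟩
  set e : Euc n := EuclideanSpace.single i 1
  have hf' := hf.fderiv_apply e
  have hc : Continuous fun x => fderiv ℝ f x e := hf'.1.continuous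
  have : HasWeakPartial i f fun x => fderiv ℝ f x e := by
    refine ⟨hf.1.continuous.locallyIntegrable, hc.locallyIntegrable, fun ψ h1 h2 => ?_⟩
    have hψ : Continuous fun x => fderiv ℝ ψ x e :=
      (h1.continuous_fderiv (by simp)).clm_apply continuous_const
    have hs : HasCompactSupport fun x => fderiv ℝ ψ x e :=
      (h2.fderiv (𝕜 := ℝ)).comp_left (g := fun L : Euc n →L[ℝ] ℝ => L e) rfl
    refine integral_mul_fderiv_eq_neg_fderiv_mul_of_integrable ?_ ?_ ?_
      (fun x _ => hf.1.differentiable (by simp) x) (fun x _ => h1.differentiable (by simp) x)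
    · exact (hc.mul h1.continuous).integrable_of_hasCompactSupport h2.mul_left
    · exact (hf.1.continuous.mul hψ).integrable_of_hasCompactSupport hs.mul_left
    · exact (hf.1.continuous.mul h1.continuous).integrable_of_hasCompactSupport h2.mul_left
  refine this.congr ?_ ?_
  · filter_upwards [h.coe_gaussEmb hf] with x hx
    exact (by rw [hx, ← mul_assoc, e1, one_mul] :
      f x = Real.exp (pot c Γ x) * gaussEmb c Γ f x)
  · filter_upwards [h.coe_gaussEmb hf'] with x hx
    exact (by rw [hx, ← mul_assoc, e1, one_mul] :
      fderiv ℝ f x e = Real.exp (pot c Γ x) * gaussEmb c Γ (fun x => fderiv ℝ f x e) x)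

theorem IsEigBasis.locallyIntegrable_exp_mul (h : IsEigBasis c Γ v l) (z : HSp c Γ) :
    LocallyIntegrable fun x => Real.exp (pot c Γ x) * z x := by
  have h1 : Integrable fun x => z x := by
    simpa using h.integrable_mul_temperate z (f := fun _ => 1) (by fun_prop)
  have h2 : LocallyIntegrable (fun x => z x) := h1.locallyIntegrable
  rw [← locallyIntegrableOn_univ] at h2 ⊢
  exact h2.continuousOn_mul continuous_pot.rexp.continuousOn isOpen_univ.isLocallyClosed

/-- Membership becomes a family of linear equations which are continuous in the pair `(z, G)`, so
the graph is closed and `𝔙` is complete. The factor `e^φ` compensates the `e^{-φ}` built into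
`gaussEmb`; compact support keeps the product temperate. -/
theorem IsEigBasis.mem_VGraph_iff (h : IsEigBasis c Γ v l)
    (z : WithLp 2 (HSp c Γ × HnSp c Γ)) : z ∈ VGraph c Γ ↔
      ∀ (i : Fin n) (ψ : Euc n → ℝ), ContDiff ℝ ∞ ψ → HasCompactSupport ψ →
        inner ℝ z.fst (gaussEmb c Γ fun x => Real.exp (pot c Γ x) *
          fderiv ℝ ψ x (EuclideanSpace.single i 1)) =
        - inner ℝ (z.snd i) (gaussEmb c Γ fun x => Real.exp (pot c Γ x) * ψ x) := by
  have hp := h.hasTemperateGrowth_pot.1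
  have key : ∀ (i : Fin n) (ψ : Euc n → ℝ), ContDiff ℝ ∞ ψ → HasCompactSupport ψ →
      (inner ℝ z.fst (gaussEmb c Γ fun x => Real.exp (pot c Γ x) *
          fderiv ℝ ψ x (EuclideanSpace.single i 1)) =
        ∫ x, Real.exp (pot c Γ x) * z.fst x * fderiv ℝ ψ x (EuclideanSpace.single i 1)) ∧
      (inner ℝ (z.snd i) (gaussEmb c Γ fun x => Real.exp (pot c Γ x) * ψ x) =
        ∫ x, Real.exp (pot c Γ x) * z.snd i x * ψ x) := by
    intro i ψ h1 h2
    have hs : HasCompactSupport fun x => fderiv ℝ ψ x (EuclideanSpace.single i 1) :=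
      (h2.fderiv (𝕜 := ℝ)).comp_left (g := fun L : Euc n →L[ℝ] ℝ =>
        L (EuclideanSpace.single i 1)) rfl
    have hψ : ContDiff ℝ ∞ fun x => fderiv ℝ ψ x (EuclideanSpace.single i 1) :=
      (h1.fderiv_right (m := ∞) (by simp)).clm_apply contDiff_const
    constructor
    · have ht : (fun x => Real.exp (pot c Γ x) *
          fderiv ℝ ψ x (EuclideanSpace.single i 1)).HasTemperateGrowth :=
        HasCompactSupport.hasTemperateGrowth hs.mul_left (by fun_prop)
      rw [h.inner_gaussEmb _ ht]
      congr 1 with x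
      ring
    · have ht : (fun x => Real.exp (pot c Γ x) * ψ x).HasTemperateGrowth :=
        HasCompactSupport.hasTemperateGrowth h2.mul_left (by fun_prop)
      rw [h.inner_gaussEmb _ ht]
      congr 1 with x
      ring
  constructor
  · intro hz i ψ h1 h2
    rw [(key i ψ h1 h2).1, (key i ψ h1 h2).2]
    exact (hz i).2.2 ψ h1 h2
  · intro hz i
    refine ⟨h.locallyIntegrable_exp_mul _, h.locallyIntegrable_exp_mul _, fun ψ h1 h2 => ?_⟩
    rw [← (key i ψ h1 h2).1, ← (key i ψ h1 h2).2]
    exact hz i ψ h1 h2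

theorem IsEigBasis.isClosed_VGraph (h : IsEigBasis c Γ v l) :
    IsClosed (VGraph c Γ : Set (WithLp 2 (HSp c Γ × HnSp c Γ))) := by
  have : (VGraph c Γ : Set (WithLp 2 (HSp c Γ × HnSp c Γ))) =
      ⋂ (i : Fin n) (ψ : Euc n → ℝ) (_ : ContDiff ℝ ∞ ψ) (_ : HasCompactSupport ψ),
        {z | inner ℝ z.fst (gaussEmb c Γ fun x => Real.exp (pot c Γ x) *
          fderiv ℝ ψ x (EuclideanSpace.single i 1)) =
        - inner ℝ (z.snd i) (gaussEmb c Γ fun x => Real.exp (pot c Γ x) * ψ x)} := by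
    ext z
    simp only [SetLike.mem_coe, h.mem_VGraph_iff, mem_iInter, mem_ofPred_eq]
  rw [this]
  refine isClosed_iInter fun i => isClosed_iInter fun ψ => isClosed_iInter fun _ =>
    isClosed_iInter fun _ => isClosed_eq ?_ ?_
  · exact (WithLp.fstL 2 ℝ (HSp c Γ) (HnSp c Γ)).continuous.inner continuous_const
  · refine (Continuous.inner ?_ continuous_const).neg
    exact (PiLp.proj (𝕜 := ℝ) 2 (fun _ : Fin n => HSp c Γ) i).continuous.comp
      (WithLp.sndL 2 ℝ (HSp c Γ) (HnSp c Γ)).continuous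

theorem IsEigBasis.completeSpace_VSp (h : IsEigBasis c Γ v l) : CompleteSpace (VSp c Γ) :=
  h.isClosed_VGraph.completeSpace_coe

theorem isClosed_AGraph : IsClosed (AGraph c Γ : Set (WithLp 2 (VSp c Γ × HSp c Γ))) := by
  have : (AGraph c Γ : Set (WithLp 2 (VSp c Γ × HSp c Γ))) = ⋂ w : VSp c Γ,
      {z | formA c Γ z.fst w = inner ℝ z.snd (VSp.val c Γ w)} := by
    ext z
    simp only [mem_iInter, mem_ofPred_eq]
    rfl
  rw [this]
  refine isClosed_iInter fun w => isClosed_eq ?_ ?_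
  · exact ((VSp.grad c Γ).continuous.comp
      (WithLp.fstL 2 ℝ (VSp c Γ) (HSp c Γ)).continuous).inner continuous_const
  · exact (WithLp.sndL 2 ℝ (VSp c Γ) (HSp c Γ)).continuous.inner continuous_const

theorem IsEigBasis.completeSpace_DSp (h : IsEigBasis c Γ v l) : CompleteSpace (DSp c Γ) := by
  have := h.completeSpace_VSp
  exact isClosed_AGraph.completeSpace_coe

end

section

/-! ### Hermite functions -/

theorem Polynomial.derivative_hermite_succ (m : ℕ) :
    derivative (hermite (m + 1)) = (m + 1 : ℕ) * hermite m := by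
  induction m with
  | zero => simp
  | succ m ih =>
    rw [hermite_succ (m + 1), derivative_sub, derivative_mul, ih, derivative_X, derivative_mul,
      derivative_natCast, hermite_succ m]
    push_cast
    ring

/-- For `m = 0` the truncated index `m - 1` is harmless because its coefficient vanishes. The same
convention governs all lowered indices below. -/
theorem Polynomial.derivative_hermite (m : ℕ) :
    derivative (hermite m) = (m : ℕ) * hermite (m - 1) := by
  cases m with
  | zero => simp
  | succ m => simpa using derivative_hermite_succ m

/-- The value of the `m`-th (probabilists') Hermite polynomial. -/
def hermR (m : ℕ) (s : ℝ) : ℝ := Polynomial.aeval s (Polynomial.hermite m)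

theorem hermR_zero (s : ℝ) : hermR 0 s = 1 := by simp [hermR]

theorem hermR_succ (m : ℕ) (s : ℝ) :
    hermR (m + 1) s = s * hermR m s - m * hermR (m - 1) s := by
  simp only [hermR, Polynomial.hermite_succ m, Polynomial.derivative_hermite]
  simp

theorem hasDerivAt_hermR (m : ℕ) (s : ℝ) : HasDerivAt (hermR m) (m * hermR (m - 1) s) s := by
  have := Polynomial.hasDerivAt_aeval (Polynomial.hermite m) s
  rw [Polynomial.derivative_hermite] at this
  simpa [hermR] using! this

theorem hermR_hasTemperateGrowth (m : ℕ) : (hermR m).HasTemperateGrowth := by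
  induction m using Nat.strong_induction_on with
  | _ m ih =>
    cases m with
    | zero =>
      rw [show hermR 0 = fun _ => 1 from funext hermR_zero]
      fun_prop
    | succ m =>
      have h1 := ih m (by omega)
      have h2 := ih (m - 1) (by omega)
      rw [show hermR (m + 1) = fun s => s * hermR m s - m * hermR (m - 1) s from
        funext (hermR_succ m)]
      fun_prop

variable {n : ℕ} {c : ℝ} {Γ : Matrix (Fin n) (Fin n) ℝ}
  {v : OrthonormalBasis (Fin n) ℝ (Euc n)} {l : Fin n → ℝ}

/-- The Hermite function with multi-index `k`, in the coordinates `√(l j) ⟨v j, x⟩`. -/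
def hermFun (v : OrthonormalBasis (Fin n) ℝ (Euc n)) (l : Fin n → ℝ) (k : Fin n → ℕ)
    (x : Euc n) : ℝ := ∏ j, hermR (k j) (√(l j) * inner ℝ (v j) x)

theorem hermFun_hasTemperateGrowth (k : Fin n → ℕ) : (hermFun v l k).HasTemperateGrowth := by
  unfold hermFun
  suffices h : ∀ s : Finset (Fin n), (fun x : Euc n =>
      ∏ j ∈ s, hermR (k j) (√(l j) * inner ℝ (v j) x)).HasTemperateGrowth from h _
  classical
  intro s
  induction s using Finset.induction_on with
  | empty => simp
  | insert j s hj ih =>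
    simp only [Finset.prod_insert hj]
    have : (fun x : Euc n => hermR (k j) (√(l j) * inner ℝ (v j) x)).HasTemperateGrowth :=
      (hermR_hasTemperateGrowth (k j)).comp (by fun_prop)
    fun_prop

theorem hermFun_split (k : Fin n → ℕ) (j : Fin n) (x : Euc n) :
    hermFun v l k x = hermR (k j) (√(l j) * inner ℝ (v j) x) *
      ∏ i ∈ Finset.univ.erase j, hermR (k i) (√(l i) * inner ℝ (v i) x) := by
  exact (Finset.mul_prod_erase Finset.univ
    (fun i => hermR (k i) (√(l i) * inner ℝ (v i) x)) (Finset.mem_univ j)).symm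

theorem hermFun_congr_split {k k' : Fin n → ℕ} {j : Fin n} (hk : ∀ i ≠ j, k' i = k i) (x : Euc n) :
    hermFun v l k' x = hermR (k' j) (√(l j) * inner ℝ (v j) x) *
      ∏ i ∈ Finset.univ.erase j, hermR (k i) (√(l i) * inner ℝ (v i) x) := by
  rw [hermFun_split k' j]
  congr 1
  exact Finset.prod_congr rfl fun i hi => by rw [hk i (Finset.ne_of_mem_erase hi)]

theorem hermFun_zero (x : Euc n) : hermFun v l 0 x = 1 := by
  simp [hermFun, hermR_zero]

theorem hermFun_add_single (k : Fin n → ℕ) (j : Fin n) (x : Euc n) :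
    hermFun v l (k + Pi.single j 1) x = √(l j) * inner ℝ (v j) x * hermFun v l k x -
      k j * hermFun v l (k - Pi.single j 1) x := by
  rw [hermFun_split k j, hermFun_congr_split (k := k) (k' := k + Pi.single j 1) (j := j)
    (fun i hi => by simp [hi]), hermFun_congr_split (k := k) (k' := k - Pi.single j 1) (j := j)
    (fun i hi => by simp [hi])]
  simp only [Pi.add_apply, Pi.sub_apply, Pi.single_eq_same, hermR_succ]
  ring

/-- Moving along `v j` changes only the `j`-th factor of the product, by orthonormality. This is the
lowering relation. -/
theorem fderiv_hermFun (k : Fin n → ℕ) (j : Fin n) (x : Euc n) :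
    fderiv ℝ (hermFun v l k) x (v j) = √(l j) * k j * hermFun v l (k - Pi.single j 1) x := by
  have hd : DifferentiableAt ℝ (hermFun v l k) x :=
    (hermFun_hasTemperateGrowth k).1.differentiable (by simp) x
  have h1 : HasLineDerivAt ℝ (hermFun v l k)
      (√(l j) * k j * hermFun v l (k - Pi.single j 1) x) x (v j) := by
    rw [hermFun_congr_split (k := k) (k' := k - Pi.single j 1) (j := j)
      (fun i hi => by simp [hi])]
    have e : (fun t : ℝ => hermFun v l k (x + t • v j)) = fun t =>
        hermR (k j) (√(l j) * (inner ℝ (v j) x + t)) *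
        ∏ i ∈ Finset.univ.erase j, hermR (k i) (√(l i) * inner ℝ (v i) x) := funext fun t => by
      rw [hermFun_split k j]
      congr 1
      · rw [inner_add_right, real_inner_smul_right, orthonormal_iff_ite.1 v.orthonormal]
        simp
      · refine Finset.prod_congr rfl fun i hi => ?_
        rw [inner_add_right, real_inner_smul_right, orthonormal_iff_ite.1 v.orthonormal,
          if_neg (Finset.ne_of_mem_erase hi)]
        simp
    unfold HasLineDerivAt
    rw [e]
    have h2 : HasDerivAt (fun t : ℝ => √(l j) * (inner ℝ (v j) x + t)) (√(l j)) 0 := by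
      simpa using ((hasDerivAt_id (0 : ℝ)).const_add (inner ℝ (v j) x)).const_mul (√(l j))
    have h3 := (HasDerivAt.comp (0 : ℝ)
      (hasDerivAt_hermR (k j) (√(l j) * (inner ℝ (v j) x + 0))) h2).mul_const
      (∏ i ∈ Finset.univ.erase j, hermR (k i) (√(l i) * inner ℝ (v i) x))
    convert! h3 using 1
    simp only [Pi.sub_apply, Pi.single_eq_same, add_zero]
    ring
  exact (hd.hasFDerivAt.hasLineDerivAt (v j)).unique h1

/-- The (unnormalised) eigenfunction `e^{-φ} H_k` of `𝔄`. -/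
def hermH (c : ℝ) (Γ : Matrix (Fin n) (Fin n) ℝ) (v : OrthonormalBasis (Fin n) ℝ (Euc n))
    (l : Fin n → ℝ) (k : Fin n → ℕ) : HSp c Γ := gaussEmb c Γ (hermFun v l k)

/-! ### Ladder relations and orthogonality of the Hermite functions -/

namespace IsEigBasis

theorem inner_hermH (h : IsEigBasis c Γ v l) (z : HSp c Γ) (k : Fin n → ℕ) :
    inner ℝ z (hermH c Γ v l k) = ∫ x, z x * hermFun v l k x :=
  h.inner_gaussEmb z (hermFun_hasTemperateGrowth k)

/-- Since `∂_j φ = l_j ⟨v_j, x⟩`, the adjoint derivative of `H_k` is, by the three-term recurrence,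
`√l_j H_{k + e_j}`: the adjoint of the gradient raises indices. -/
theorem inner_gradAlong_hermH (h : IsEigBasis c Γ v l) (w : VSp c Γ) (j : Fin n)
    (k : Fin n → ℕ) : inner ℝ (gradAlong c Γ (v j) w) (hermH c Γ v l k) =
      √(l j) * inner ℝ (VSp.val c Γ w) (hermH c Γ v l (k + Pi.single j 1)) := by
  rw [hermH, h.inner_gradAlong_gaussEmb w (v j) (hermFun_hasTemperateGrowth k),
    ← real_inner_smul_right, hermH, ← h.gaussEmb_const_mul (hermFun_hasTemperateGrowth _)]
  congr 2 with x
  rw [h.fderiv_pot, fderiv_hermFun, hermFun_add_single]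
  linear_combination (-(inner ℝ (v j) x * hermFun v l k x)) * Real.mul_self_sqrt (h.pos j).le

theorem exists_hermV (h : IsEigBasis c Γ v l) (k : Fin n → ℕ) : ∃ w : VSp c Γ,
    VSp.val c Γ w = hermH c Γ v l k ∧ ∀ j, gradAlong c Γ (v j) w =
      (√(l j) * k j) • hermH c Γ v l (k - Pi.single j 1) := by
  obtain ⟨w, hw, hw'⟩ := h.exists_gaussV (hermFun_hasTemperateGrowth (v := v) (l := l) k)
  have hf := (hermFun_hasTemperateGrowth (v := v) (l := l) k).fderiv_apply
  refine ⟨w, hw, fun j => ?_⟩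
  rw [hermH, ← h.gaussEmb_const_mul (hermFun_hasTemperateGrowth _), gradAlong]
  simp only [hw']
  calc _ = ∑ i, gaussEmb c Γ (fun x => v j i * fderiv ℝ (hermFun v l k) x
        (EuclideanSpace.single i 1)) :=
        Finset.sum_congr rfl fun i _ => (h.gaussEmb_const_mul (hf _) _).symm
    _ = _ := by
        rw [← h.gaussEmb_sum _ (fun i => by fun_prop)]
        congr 1 with x
        rw [← Euc.map_eq_sum, fderiv_hermFun]

/-- The pairing of the gradient of `H_m` with `H_k` is computed twice, by lowering `m` and by
raising `k`. -/
theorem inner_hermH_add_single (h : IsEigBasis c Γ v l) (k m : Fin n → ℕ) (j : Fin n) :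
    inner ℝ (hermH c Γ v l (k + Pi.single j 1)) (hermH c Γ v l m) =
      m j * inner ℝ (hermH c Γ v l k) (hermH c Γ v l (m - Pi.single j 1)) := by
  obtain ⟨w, hw, hw'⟩ := h.exists_hermV m
  have := h.inner_gradAlong_hermH w j k
  rw [hw, hw', real_inner_smul_left, mul_assoc] at this
  have h0 : √(l j) ≠ 0 := (Real.sqrt_pos.2 (h.pos j)).ne'
  rw [real_inner_comm, ← mul_left_cancel₀ h0 this, real_inner_comm]

/-- The normalisation constant `∫ e^{-φ}`. -/
def _root_.gaussZ (c : ℝ) (Γ : Matrix (Fin n) (Fin n) ℝ) : ℝ := ∫ x : Euc n, Real.exp (-pot c Γ x)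

theorem gaussZ_pos (h : IsEigBasis c Γ v l) : 0 < gaussZ c Γ := by
  refine integral_exp_pos ?_
  simpa using h.integrable_mul_exp (f := fun _ => 1) continuous_const (C := 1) (k := 0)
    (fun x => by simp)

theorem inner_hermH_zero (h : IsEigBasis c Γ v l) :
    inner ℝ (hermH c Γ v l 0) (hermH c Γ v l 0) = gaussZ c Γ := by
  rw [h.inner_hermH, gaussZ]
  refine integral_congr_ae ?_
  filter_upwards [h.coe_gaussEmb (hermFun_hasTemperateGrowth (v := v) (l := l) 0)] with x hx
  rw [hermH, hx]
  simp [hermFun_zero]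

theorem _root_.multiIndex_induction {P : (Fin n → ℕ) → Prop} (h0 : P 0)
    (hs : ∀ k j, P k → P (k + Pi.single j 1)) (k : Fin n → ℕ) : P k := by
  induction hm : ∑ j, k j generalizing k with
  | zero =>
    have : k = 0 := funext fun j => by simpa using (Finset.sum_eq_zero_iff.1 hm) j
    rwa [this]
  | succ m ih =>
    obtain ⟨j, hj⟩ : ∃ j, k j ≠ 0 := by
      by_contra! hcon
      simp [hcon] at hm
    have e : k = (k - Pi.single j 1) + Pi.single j 1 := funext fun i => by
      by_cases hi : i = j
      · subst hi; simp; omega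
      · simp [hi]
    rw [e]
    refine hs _ _ (ih _ ?_)
    rw [e] at hm
    simp only [Pi.add_apply, Finset.sum_add_distrib, Finset.sum_pi_single', Finset.mem_univ,
      if_true] at hm
    omega

/-- Raisings of `k` are transferred to lowerings of `m`, each contributing a factor `m_j`. For `k =
0` and `m ≠ 0` the transfer in the other direction lowers the zero index and gives zero. -/
theorem inner_hermH_hermH (h : IsEigBasis c Γ v l) (k m : Fin n → ℕ) :
    inner ℝ (hermH c Γ v l k) (hermH c Γ v l m) =
      if k = m then gaussZ c Γ * ∏ j, ((k j).factorial : ℝ) else 0 := by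
  induction k using multiIndex_induction generalizing m with
  | h0 =>
    by_cases hm : m = 0
    · subst hm
      rw [if_pos rfl, h.inner_hermH_zero]
      simp
    · rw [if_neg (Ne.symm hm)]
      obtain ⟨j, hj⟩ : ∃ j, m j ≠ 0 := by
        by_contra! hcon
        exact hm (funext hcon)
      have e : m = (m - Pi.single j 1) + Pi.single j 1 := funext fun i => by
        by_cases hi : i = j
        · subst hi; simp; omega
        · simp [hi]
      rw [e, real_inner_comm, h.inner_hermH_add_single]
      simp
  | hs k j ih =>
    rw [h.inner_hermH_add_single, ih]
    by_cases hj : m j = 0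
    · rw [hj, Nat.cast_zero, zero_mul, if_neg]
      rintro rfl
      simp at hj
    · have e : k = m - Pi.single j 1 ↔ k + Pi.single j 1 = m := by
        constructor
        · rintro rfl
          funext i
          by_cases hi : i = j
          · subst hi; simp; omega
          · simp [hi]
        · rintro rfl
          funext i
          simp
      simp only [e]
      split_ifs with hkm
      · subst hkm
        have e1 : ∏ i, ((k + Pi.single j 1 : Fin n → ℕ) i).factorial =
            (k j + 1) * ∏ i, (k i).factorial := by
          rw [← Finset.mul_prod_erase _ _ (Finset.mem_univ j),
            ← Finset.mul_prod_erase Finset.univ (fun i => (k i).factorial) (Finset.mem_univ j)]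
          rw [Finset.prod_congr rfl (g := fun i => (k i).factorial) fun i hi => by
            simp [Finset.ne_of_mem_erase hi]]
          simp [Nat.factorial_succ, mul_assoc]
        rw [← Nat.cast_prod, ← Nat.cast_prod, e1]
        simp
        ring
      · simp

end IsEigBasis

/-! ### Injectivity of the Fourier transform, and totality of the Hermite functions -/

/-- Injectivity of characteristic functions yields `z⁺ dx = z⁻ dx + μ`. The left side has no mass on
`{z < 0}`, hence neither has `z⁻ dx`, and this set is null. The case `μ = 0`, applied to `z` and
`-z`, is injectivity of the Fourier transform. -/
theorem ae_nonneg_of_charFun {z : Euc n → ℝ} (hz : StronglyMeasurable z) (hi : Integrable z)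
    (μ : Measure (Euc n)) [IsFiniteMeasure μ]
    (h : ∀ ξ : Euc n, ∫ x, (z x : ℂ) * Complex.exp (inner ℝ x ξ * Complex.I) = charFun μ ξ) :
    ∀ᵐ x, 0 ≤ z x := by
  have hm : Measurable z := hz.measurable
  set μp : Measure (Euc n) := volume.withDensity fun x => ENNReal.ofReal (z x)
  set μm : Measure (Euc n) := volume.withDensity fun x => ENNReal.ofReal (-z x)
  have fp : IsFiniteMeasure μp := isFiniteMeasure_withDensity_ofReal hi.2
  have fm : IsFiniteMeasure μm := isFiniteMeasure_withDensity_ofReal hi.neg.2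
  have hE : ∀ ξ : Euc n, Continuous fun x : Euc n => Complex.exp (inner ℝ x ξ * Complex.I) :=
    fun ξ => by fun_prop
  have hb : ∀ ξ x : Euc n, ‖Complex.exp (inner ℝ x ξ * Complex.I)‖ ≤ 1 := fun ξ x => by
    rw [Complex.norm_exp_ofReal_mul_I]
  have key : ∀ y : Euc n → ℝ, Measurable y → ∀ ξ,
      charFun (volume.withDensity fun x => ENNReal.ofReal (y x)) ξ =
      ∫ x, ((max (y x) 0 : ℝ) : ℂ) * Complex.exp (inner ℝ x ξ * Complex.I) := by
    intro y hy ξ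
    rw [charFun_apply, integral_withDensity_eq_integral_toReal_smul hy.ennreal_ofReal (by simp)]
    simp only [ENNReal.toReal_ofReal', Complex.real_smul]
  have heq : μp = μm + μ := by
    refine Measure.ext_of_charFun (funext fun ξ => ?_)
    have : charFun (μm + μ) ξ = charFun μm ξ + charFun μ ξ := by
      simp only [charFun_apply]
      refine integral_add_measure ?_ ?_
      · exact Integrable.of_bound (hE ξ).aestronglyMeasurable 1 (Eventually.of_forall (hb ξ))
      · exact Integrable.of_bound (hE ξ).aestronglyMeasurable 1 (Eventually.of_forall (hb ξ))
    rw [this, key z hm, key (fun x => -z x) hm.neg, ← h, ← integral_add]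
    · congr 1 with x
      rw [← add_mul, ← Complex.ofReal_add]
      congr 2
      rcases le_total (z x) 0 with hx | hx
      · rw [max_eq_right hx, max_eq_left (by linarith)]; ring
      · rw [max_eq_left hx, max_eq_right (by linarith)]; ring
    · refine Integrable.mul_bdd (c := 1) hi.neg.pos_part.ofReal
        (hE ξ).aestronglyMeasurable (Eventually.of_forall (hb ξ))
    · exact Integrable.mul_bdd (c := 1) hi.ofReal (hE ξ).aestronglyMeasurable
        (Eventually.of_forall (hb ξ))
  have hS : MeasurableSet {x | z x < 0} := measurableSet_lt hm measurable_const
  have h0 : μp {x | z x < 0} = 0 := by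
    rw [withDensity_apply _ hS, setLIntegral_congr_fun hS (g := fun _ => 0) (fun x hx =>
      ENNReal.ofReal_of_nonpos (le_of_lt hx))]
    simp
  have h1 : μm {x | z x < 0} = 0 := by
    rw [heq, Measure.add_apply] at h0
    exact (add_eq_zero.1 h0).1
  rw [withDensity_apply _ hS, setLIntegral_eq_zero_iff hS
    (f := fun x => ENNReal.ofReal (-z x)) hm.neg.ennreal_ofReal] at h1
  filter_upwards [h1] with x hx
  by_contra hcon
  have := hx (not_le.1 hcon)
  rw [ENNReal.ofReal_eq_zero] at this
  exact hcon (by linarith)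

theorem IsEigBasis.integrable_mul_exp_abs (h : IsEigBasis c Γ v l) (z : HSp c Γ) (ξ : Euc n) :
    Integrable fun x => z x * Real.exp |inner ℝ x ξ| := by
  have hpc : Continuous (pot c Γ) := continuous_pot
  obtain ⟨b, hb, hpot⟩ := h.exists_le_pot
  have hm : MemLp (fun x => Real.exp (-pot c Γ x) * Real.exp |inner ℝ x ξ|) 2 (wMeasure c Γ) := by
    rw [memLp_two_iff_integrable_sq (by fun_prop), integrable_wMeasure_iff]
    refine ((integrable_exp_neg_mul_sq_norm (n := n) (b := b / 2) (by positivity)).const_mul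
      (Real.exp (2 * ‖ξ‖ ^ 2 / b))).mono' (by fun_prop) (Eventually.of_forall fun x => ?_)
    rw [Real.norm_of_nonneg (by positivity), mul_pow, ← Real.exp_nat_mul, ← Real.exp_nat_mul,
      ← Real.exp_add, ← Real.exp_add, ← Real.exp_add]
    refine Real.exp_le_exp.2 ?_
    have h1 := hpot x
    have h2 : |inner ℝ x ξ| ≤ ‖x‖ * ‖ξ‖ := abs_real_inner_le_norm x ξ
    -- Completing the square trades half of `b ‖x‖²` for the linear exponent `2 ‖x‖ ‖ξ‖`, at the
    -- cost of the constant `2 ‖ξ‖² / b`.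
    have h3 : 0 ≤ (b * ‖x‖ - 2 * ‖ξ‖) ^ 2 / (2 * b) := by positivity
    have h4 : (b * ‖x‖ - 2 * ‖ξ‖) ^ 2 / (2 * b) =
        b / 2 * ‖x‖ ^ 2 - 2 * (‖x‖ * ‖ξ‖) + 2 * ‖ξ‖ ^ 2 / b := by
      field_simp
      ring
    push_cast
    linarith
  have h1 := integrable_wMeasure_iff.1 ((Lp.memLp z).integrable_mul hm)
  refine h1.congr (Eventually.of_forall fun x => ?_)
  have e1 : Real.exp (pot c Γ x) * Real.exp (-pot c Γ x) = 1 := by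
    rw [← Real.exp_add]; simp
  simp only [Pi.mul_apply]
  linear_combination (z x * Real.exp |inner ℝ x ξ|) * e1

/-- The span of the Hermite functions is stable under multiplication by coordinates, so it contains
all powers `⟨x, ξ⟩^m`. Exponential moments of `z` permit termwise integration of the series of
`e^{i⟨x, ξ⟩}`; hence the Fourier transform of `z` vanishes. -/
theorem IsEigBasis.eq_zero_of_inner_hermH (h : IsEigBasis c Γ v l) {z : HSp c Γ}
    (hz : ∀ k, inner ℝ z (hermH c Γ v l k) = 0) : z = 0 := by
  let W : Submodule ℝ (Euc n → ℝ) := Submodule.span ℝ (range (hermFun v l))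
  have hW : ∀ f ∈ W, f.HasTemperateGrowth ∧ ∫ x, z x * f x = 0 := by
    intro f hf
    induction hf using Submodule.span_induction with
    | mem f hf =>
      obtain ⟨k, rfl⟩ := hf
      exact ⟨hermFun_hasTemperateGrowth k, by rw [← h.inner_hermH, hz]⟩
    | zero => exact ⟨.zero, by simp⟩
    | add f g _ _ h1 h2 =>
      refine ⟨h1.1.add h2.1, ?_⟩
      simp only [Pi.add_apply, mul_add]
      rw [integral_add (h.integrable_mul_temperate z h1.1) (h.integrable_mul_temperate z h2.1),
        h1.2, h2.2, add_zero]
    | smul a f _ h1 =>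
      refine ⟨(Function.HasTemperateGrowth.const a).mul h1.1, ?_⟩
      simp only [Pi.smul_apply, smul_eq_mul, mul_left_comm _ a]
      rw [integral_const_mul, h1.2, mul_zero]
  have hmul : ∀ (j : Fin n), ∀ f ∈ W, (fun x => inner ℝ (v j) x * f x) ∈ W := by
    intro j f hf
    induction hf using Submodule.span_induction with
    | mem f hf =>
      obtain ⟨k, rfl⟩ := hf
      have h0 : √(l j) ≠ 0 := (Real.sqrt_pos.2 (h.pos j)).ne'
      have e : (fun x => inner ℝ (v j) x * hermFun v l k x) =
          (√(l j))⁻¹ • (hermFun v l (k + Pi.single j 1) +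
            (k j : ℝ) • hermFun v l (k - Pi.single j 1)) := funext fun x => by
        simp only [Pi.smul_apply, Pi.add_apply, smul_eq_mul, hermFun_add_single]
        field_simp
        ring
      rw [e]
      exact W.smul_mem _ (W.add_mem (Submodule.subset_span ⟨_, rfl⟩)
        (W.smul_mem _ (Submodule.subset_span ⟨_, rfl⟩)))
    | zero =>
      have : (fun x => inner ℝ (v j) x * (0 : Euc n → ℝ) x) = 0 := funext fun x => by simp
      rw [this]
      exact W.zero_mem
    | add f g _ _ h1 h2 =>
      convert! W.add_mem h1 h2 using 1
      ext x
      simp [mul_add]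
    | smul a f _ h1 =>
      convert! W.smul_mem a h1 using 1
      ext x
      simp only [Pi.smul_apply, smul_eq_mul]
      ring
  have hpow : ∀ (ξ : Euc n) (m : ℕ), (fun x : Euc n => inner ℝ x ξ ^ m) ∈ W := by
    intro ξ m
    induction m with
    | zero =>
      simp only [pow_zero]
      exact Submodule.subset_span ⟨0, funext hermFun_zero⟩
    | succ m ih =>
      have e : (fun x : Euc n => inner ℝ x ξ ^ (m + 1)) =
          ∑ j, inner ℝ (v j) ξ • fun x => inner ℝ (v j) x * inner ℝ x ξ ^ m := funext fun x => by
        rw [pow_succ', Finset.sum_apply]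
        nth_rw 1 [← v.sum_inner_mul_inner]
        rw [Finset.sum_mul]
        refine Finset.sum_congr rfl fun j _ => ?_
        simp only [Pi.smul_apply, smul_eq_mul]
        rw [real_inner_comm]
        ring
      rw [e]
      exact W.sum_mem fun j _ => W.smul_mem _ (hmul j _ ih)
  have hint : Integrable fun x => z x := by
    simpa using h.integrable_mul_temperate z (f := fun _ => 1) (by fun_prop)
  have hcf : ∀ ξ : Euc n, ∫ x, (z x : ℂ) * Complex.exp (inner ℝ x ξ * Complex.I) = 0 := by
    intro ξ
    have hs : HasSum (fun m : ℕ => ∫ x, (z x : ℂ) *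
        ((inner ℝ x ξ * Complex.I) ^ m / (m.factorial : ℂ)))
        (∫ x, (z x : ℂ) * Complex.exp (inner ℝ x ξ * Complex.I)) := by
      refine hasSum_integral_of_dominated_convergence
        (bound := fun m x => ‖z x‖ * (|inner ℝ x ξ| ^ m / (m.factorial : ℝ))) (fun m => ?_)
        (fun m => Eventually.of_forall fun x => ?_) (Eventually.of_forall fun x => ?_) ?_
        (Eventually.of_forall fun x => ?_)
      · have : Continuous fun x : Euc n =>
          ((inner ℝ x ξ : ℂ) * Complex.I) ^ m / (m.factorial : ℂ) := by fun_prop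
        exact hint.ofReal.1.mul this.aestronglyMeasurable
      · rw [norm_mul, norm_div, norm_pow, norm_mul, Complex.norm_I, mul_one, Complex.norm_real,
          Complex.norm_real, Complex.norm_natCast, Real.norm_eq_abs (inner ℝ x ξ)]
      · exact (Real.summable_pow_div_factorial _).mul_left _
      · simp only [tsum_mul_left]
        refine (h.integrable_mul_exp_abs z ξ).norm.congr (Eventually.of_forall fun x => ?_)
        simp only [norm_mul]
        congr 1
        rw [Real.norm_of_nonneg (Real.exp_pos _).le, Real.exp_eq_exp_ℝ,
          NormedSpace.exp_eq_tsum_div]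
      · refine HasSum.mul_left _ ?_
        rw [Complex.exp_eq_exp_ℂ]
        exact NormedSpace.expSeries_div_hasSum_exp _
    have h0 : ∀ m : ℕ, ∫ x, (z x : ℂ) *
        ((inner ℝ x ξ * Complex.I) ^ m / (m.factorial : ℂ)) = 0 := by
      intro m
      have h1 := (hW _ (hpow ξ m)).2
      calc ∫ x, (z x : ℂ) * ((inner ℝ x ξ * Complex.I) ^ m / (m.factorial : ℂ))
          = ∫ x, ((z x * inner ℝ x ξ ^ m : ℝ) : ℂ) * (Complex.I ^ m / (m.factorial : ℂ)) := by
            congr 1 with x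
            push_cast
            ring
        _ = 0 := by
            rw [integral_mul_const, integral_complex_ofReal, h1]
            simp
    simp only [h0] at hs
    exact hs.unique hasSum_zero
  have hsm : StronglyMeasurable z := Lp.stronglyMeasurable z
  have p1 := ae_nonneg_of_charFun hsm hint 0 (fun ξ => by rw [hcf]; simp)
  have p2 := ae_nonneg_of_charFun (z := fun x => -z x) hsm.neg hint.neg 0 (fun ξ => by
    have := hcf ξ
    simp only [Complex.ofReal_neg, neg_mul, integral_neg, this]; simp)
  refine HSp.ext_ae ?_
  filter_upwards [p1, p2, ae_wMeasure_iff.1 (Lp.coeFn_zero ℝ 2 (wMeasure c Γ))] with x h1 h2 h3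
  rw [h3, Pi.zero_apply]
  linarith

end

section

/-! ### Hilbert bases and diagonal operators -/

section HilbertBasis

variable {ι E : Type*} [NormedAddCommGroup E] [InnerProductSpace ℝ E]

theorem HilbertBasis.hasSum_inner_sq (b : HilbertBasis ι ℝ E) (x : E) :
    HasSum (fun i => inner ℝ (b i) x ^ 2) (‖x‖ ^ 2) := by
  have := b.hasSum_inner_mul_inner x x
  rw [real_inner_self_eq_norm_sq] at this
  refine this.congr_fun fun i => ?_
  rw [real_inner_comm x, sq]

theorem HilbertBasis.ext_inner (b : HilbertBasis ι ℝ E) {x y : E}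
    (h : ∀ i, inner ℝ (b i) x = inner ℝ (b i) y) : x = y := by
  refine b.repr.injective (lp.ext (funext fun i => ?_))
  rw [b.repr_apply_apply, b.repr_apply_apply, h]

theorem HilbertBasis.exists_of_summable (b : HilbertBasis ι ℝ E) {a : ι → ℝ}
    (ha : Summable fun i => a i ^ 2) : ∃ x : E, ∀ i, inner ℝ (b i) x = a i := by
  have hm : Memℓp a 2 := by
    rw [memℓp_gen_iff (by norm_num)]
    simpa using ha
  refine ⟨b.repr.symm ⟨a, hm⟩, fun i => ?_⟩
  rw [← b.repr_apply_apply, LinearIsometryEquiv.apply_symm_apply]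

theorem HilbertBasis.ext_clm {F : Type*} [NormedAddCommGroup F] [NormedSpace ℝ F]
    (b : HilbertBasis ι ℝ E) {L L' : E →L[ℝ] F} (h : ∀ i, L (b i) = L' (b i)) : L = L' := by
  refine ContinuousLinearMap.ext_on (s := range b) ?_ ?_
  · have := b.dense_span
    rw [← Submodule.dense_iff_topologicalClosure_eq_top] at this
    exact this
  · rintro _ ⟨i, rfl⟩
    exact h i

/-- Used in `𝔥` for the semigroup and in `D(𝔄)` for the operator whose transpose is its extension.
-/
theorem HilbertBasis.exists_diagonal (b : HilbertBasis ι ℝ E) (m : ι → ℝ) (hm : ∀ i, |m i| ≤ 1) :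
    ∃ L : E →L[ℝ] E, (∀ i x, inner ℝ (b i) (L x) = m i * inner ℝ (b i) x) ∧
      ∀ x, ‖L x‖ ≤ ‖x‖ := by
  have hle : ∀ x i, (m i * inner ℝ (b i) x) ^ 2 ≤ inner ℝ (b i) x ^ 2 := fun x i => by
    rw [mul_pow]
    refine mul_le_of_le_one_left (sq_nonneg _) ?_
    rw [← sq_abs]
    exact pow_le_one₀ (abs_nonneg _) (hm i)
  have hex : ∀ x : E, ∃ y : E, ∀ i, inner ℝ (b i) y = m i * inner ℝ (b i) x := fun x =>
    b.exists_of_summable (Summable.of_nonneg_of_le (fun i => sq_nonneg _) (hle x)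
      (b.hasSum_inner_sq x).summable)
  choose f hf using hex
  have hn : ∀ x, ‖f x‖ ≤ ‖x‖ := fun x => by
    refine le_of_sq_le_sq ?_ (norm_nonneg _)
    refine hasSum_le (fun i => ?_) (b.hasSum_inner_sq (f x)) (b.hasSum_inner_sq x)
    rw [hf]
    exact hle x i
  refine ⟨LinearMap.mkContinuous ⟨⟨f, fun x y => b.ext_inner fun i => ?_⟩,
    fun a x => b.ext_inner fun i => ?_⟩ 1 fun x => by simpa using! hn x, fun i x => hf x i, hn⟩
  · rw [inner_add_right, hf, hf, hf, inner_add_right, mul_add]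
  · simp only [RingHom.id_apply, real_inner_smul_right, hf]
    ring

end HilbertBasis

variable {n : ℕ} {c : ℝ} {Γ : Matrix (Fin n) (Fin n) ℝ}
  {v : OrthonormalBasis (Fin n) ℝ (Euc n)} {l : Fin n → ℝ}

/-- The eigenvalues of `𝔄`. -/
def eigVal (l : Fin n → ℝ) (k : Fin n → ℕ) : ℝ := ∑ j, l j * k j

/-- The norm of the Hermite function with multi-index `k`. -/
def hermNorm (c : ℝ) (Γ : Matrix (Fin n) (Fin n) ℝ) (k : Fin n → ℕ) : ℝ :=
  √(gaussZ c Γ * ∏ j, ((k j).factorial : ℝ))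

theorem sub_add_single {k : Fin n → ℕ} {j : Fin n} (hj : k j ≠ 0) :
    k - Pi.single j 1 + Pi.single j 1 = k := funext fun i => by
  by_cases hi : i = j
  · subst hi; simp; omega
  · simp [hi]

/-! ### Eigenvector bases of `𝔥`, `𝔙` and `D(𝔄)` -/

namespace IsEigBasis

theorem eigVal_nonneg (h : IsEigBasis c Γ v l) (k : Fin n → ℕ) : 0 ≤ eigVal l k :=
  Finset.sum_nonneg fun j _ => mul_nonneg (h.pos j).le (Nat.cast_nonneg _)

theorem hermNorm_pos (h : IsEigBasis c Γ v l) (k : Fin n → ℕ) : 0 < hermNorm c Γ k :=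
  Real.sqrt_pos.2 (mul_pos h.gaussZ_pos
    (Finset.prod_pos fun _ _ => Nat.cast_pos.2 (Nat.factorial_pos _)))

theorem hermNorm_add_single (h : IsEigBasis c Γ v l) (k : Fin n → ℕ) (j : Fin n) :
    hermNorm c Γ (k + Pi.single j 1) = √(k j + 1) * hermNorm c Γ k := by
  have e1 := h.inner_hermH_hermH (k + Pi.single j 1) (k + Pi.single j 1)
  rw [h.inner_hermH_add_single, show k + Pi.single j 1 - Pi.single j 1 = k from
    funext fun i => by simp, h.inner_hermH_hermH, if_pos rfl, if_pos rfl] at e1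
  rw [hermNorm, hermNorm, ← e1, ← Real.sqrt_mul (by positivity)]
  simp

theorem orthonormal_hermH (h : IsEigBasis c Γ v l) :
    Orthonormal ℝ fun k => (hermNorm c Γ k)⁻¹ • hermH c Γ v l k := by
  rw [orthonormal_iff_ite]
  intro k m
  rw [real_inner_smul_left, real_inner_smul_right, h.inner_hermH_hermH]
  split_ifs with hkm
  · subst hkm
    have h0 := (h.hermNorm_pos k).ne'
    have h1 : gaussZ c Γ * ∏ j, ((k j).factorial : ℝ) = hermNorm c Γ k ^ 2 :=
      (Real.sq_sqrt (mul_nonneg h.gaussZ_pos.le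
        (Finset.prod_nonneg fun j _ => Nat.cast_nonneg _))).symm
    rw [h1]
    field_simp
  · simp

/-- The Hilbert basis of `𝔥` consisting of eigenvectors of `𝔄`. -/
def basisH (h : IsEigBasis c Γ v l) : HilbertBasis (Fin n → ℕ) ℝ (HSp c Γ) :=
  HilbertBasis.mkOfOrthogonalEqBot h.orthonormal_hermH <| by
    rw [Submodule.eq_bot_iff]
    intro z hz
    refine h.eq_zero_of_inner_hermH fun k => ?_
    have := (Submodule.mem_orthogonal' _ _).1 hz _ (Submodule.subset_span ⟨k, rfl⟩)
    rw [real_inner_smul_right] at this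
    exact (mul_eq_zero.1 this).resolve_left (inv_ne_zero (h.hermNorm_pos k).ne')

theorem basisH_apply (h : IsEigBasis c Γ v l) (k : Fin n → ℕ) :
    h.basisH k = (hermNorm c Γ k)⁻¹ • hermH c Γ v l k :=
  congrFun (HilbertBasis.coe_mkOfOrthogonalEqBot _ _) k

theorem hermH_eq (h : IsEigBasis c Γ v l) (k : Fin n → ℕ) :
    hermH c Γ v l k = hermNorm c Γ k • h.basisH k := by
  rw [basisH_apply, smul_inv_smul₀ (h.hermNorm_pos k).ne']

theorem inner_gradAlong_basisH (h : IsEigBasis c Γ v l) (w : VSp c Γ) (j : Fin n)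
    (k : Fin n → ℕ) : inner ℝ (gradAlong c Γ (v j) w) (h.basisH k) =
      √(l j * (k j + 1)) * inner ℝ (VSp.val c Γ w) (h.basisH (k + Pi.single j 1)) := by
  have := h.inner_gradAlong_hermH w j k
  rw [h.hermH_eq, h.hermH_eq, real_inner_smul_right, real_inner_smul_right,
    h.hermNorm_add_single] at this
  refine mul_left_cancel₀ (h.hermNorm_pos k).ne' (this.trans ?_)
  rw [Real.sqrt_mul (h.pos j).le]
  ring

theorem exists_eigenvector (h : IsEigBasis c Γ v l) (k : Fin n → ℕ) : ∃ w : VSp c Γ,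
    VSp.val c Γ w = h.basisH k ∧ ∀ j, gradAlong c Γ (v j) w =
      √(l j * k j) • h.basisH (k - Pi.single j 1) := by
  obtain ⟨w, hw, hw'⟩ := h.exists_hermV k
  refine ⟨(hermNorm c Γ k)⁻¹ • w, by rw [map_smul, hw, basisH_apply], fun j => ?_⟩
  have e : gradAlong c Γ (v j) ((hermNorm c Γ k)⁻¹ • w) =
      (hermNorm c Γ k)⁻¹ • gradAlong c Γ (v j) w := by
    simp only [gradAlong, map_smul, PiLp.smul_apply, Finset.smul_sum]
    exact Finset.sum_congr rfl fun i _ => smul_comm _ _ _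
  rw [e, hw']
  by_cases hj : k j = 0
  · simp [hj]
  · have h1 := h.hermNorm_add_single (k - Pi.single j 1) j
    rw [sub_add_single hj] at h1
    have h2 : (((k - Pi.single j 1 : Fin n → ℕ) j : ℕ) : ℝ) + 1 = k j := by
      simp only [Pi.sub_apply, Pi.single_eq_same]
      rw [Nat.cast_sub (Nat.one_le_iff_ne_zero.2 hj)]
      simp
    rw [h2] at h1
    have h3 := (h.hermNorm_pos (k - Pi.single j 1)).ne'
    have h4 : (0 : ℝ) < √(k j) := Real.sqrt_pos.2 (Nat.cast_pos.2 (Nat.pos_of_ne_zero hj))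
    rw [h.hermH_eq (k - Pi.single j 1), h1, smul_smul, smul_smul, Real.sqrt_mul (h.pos j).le]
    congr 1
    have h5 : (k j : ℝ) = √(k j) * √(k j) := (Real.mul_self_sqrt (Nat.cast_nonneg _)).symm
    field_simp
    rw [sq]
    linear_combination √(l j) * h5

/-- The eigenvector of `𝔄` with index `k`, as an element of `𝔙`. -/
def eigV (h : IsEigBasis c Γ v l) (k : Fin n → ℕ) : VSp c Γ := (h.exists_eigenvector k).choose

theorem val_eigV (h : IsEigBasis c Γ v l) (k : Fin n → ℕ) :
    VSp.val c Γ (h.eigV k) = h.basisH k := (h.exists_eigenvector k).choose_spec.1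

theorem gradAlong_eigV (h : IsEigBasis c Γ v l) (k : Fin n → ℕ) (j : Fin n) :
    gradAlong c Γ (v j) (h.eigV k) = √(l j * k j) • h.basisH (k - Pi.single j 1) :=
  (h.exists_eigenvector k).choose_spec.2 j

/-- In each direction `v_j` the gradient lowers and its adjoint raises, returning to `k` with the
factor `l_j k_j`; the sum over `j` is the eigenvalue. -/
theorem formA_eigV (h : IsEigBasis c Γ v l) (k : Fin n → ℕ) (w : VSp c Γ) :
    formA c Γ (h.eigV k) w = eigVal l k * inner ℝ (h.basisH k) (VSp.val c Γ w) := by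
  rw [formA_eq_sum_gradAlong v, eigVal, Finset.sum_mul]
  refine Finset.sum_congr rfl fun j _ => ?_
  rw [h.gradAlong_eigV, real_inner_smul_left, real_inner_comm, h.inner_gradAlong_basisH]
  by_cases hj : k j = 0
  · simp [hj]
  · have h2 : (((k - Pi.single j 1 : Fin n → ℕ) j : ℕ) : ℝ) + 1 = k j := by
      simp only [Pi.sub_apply, Pi.single_eq_same]
      rw [Nat.cast_sub (Nat.one_le_iff_ne_zero.2 hj)]
      simp
    rw [h2, sub_add_single hj, ← mul_assoc,
      Real.mul_self_sqrt (mul_nonneg (h.pos j).le (Nat.cast_nonneg _)), real_inner_comm]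

theorem _root_.formA_comm (w w' : VSp c Γ) : formA c Γ w w' = formA c Γ w' w :=
  real_inner_comm _ _

theorem inner_eigV (h : IsEigBasis c Γ v l) (k : Fin n → ℕ) (w : VSp c Γ) :
    inner ℝ (h.eigV k) w = (1 + eigVal l k) * inner ℝ (h.basisH k) (VSp.val c Γ w) := by
  rw [VSp.inner_def, h.val_eigV, h.formA_eigV]
  ring

/-- The coefficients of the stored gradient are multiples of coefficients of the value at raised
indices, so the value determines the gradient. -/
theorem val_injective (h : IsEigBasis c Γ v l) : Function.Injective (VSp.val c Γ) := by
  rw [injective_iff_map_eq_zero]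
  intro w hw
  have h1 : ∀ j, gradAlong c Γ (v j) w = 0 := fun j => h.basisH.ext_inner fun k => by
    rw [real_inner_comm, h.inner_gradAlong_basisH, hw]
    simp
  rw [← inner_self_eq_zero (𝕜 := ℝ), VSp.inner_def, hw, formA_eq_sum_gradAlong v]
  simp [h1]

theorem one_add_eigVal_pos (h : IsEigBasis c Γ v l) (k : Fin n → ℕ) : 0 < 1 + eigVal l k := by
  linarith [h.eigVal_nonneg k]

theorem orthonormal_eigV (h : IsEigBasis c Γ v l) :
    Orthonormal ℝ fun k => (√(1 + eigVal l k))⁻¹ • h.eigV k := by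
  rw [orthonormal_iff_ite]
  intro k m
  rw [real_inner_smul_left, real_inner_smul_right, h.inner_eigV, h.val_eigV,
    orthonormal_iff_ite.1 h.basisH.orthonormal]
  split_ifs with hkm
  · subst hkm
    have h0 := (Real.sqrt_pos.2 (h.one_add_eigVal_pos k)).ne'
    nth_rw 3 [← Real.mul_self_sqrt (h.one_add_eigVal_pos k).le]
    field_simp
  · simp

/-- The Hilbert basis of `𝔙` consisting of eigenvectors of `𝔄`. -/
def basisV (h : IsEigBasis c Γ v l) : HilbertBasis (Fin n → ℕ) ℝ (VSp c Γ) :=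
  haveI := h.completeSpace_VSp
  HilbertBasis.mkOfOrthogonalEqBot h.orthonormal_eigV <| by
    rw [Submodule.eq_bot_iff]
    intro w hw
    refine h.val_injective ?_
    rw [map_zero]
    refine h.basisH.ext_inner fun k => ?_
    have := (Submodule.mem_orthogonal _ _).1 hw _ (Submodule.subset_span ⟨k, rfl⟩)
    rw [real_inner_smul_left, h.inner_eigV] at this
    rw [inner_zero_right]
    exact ((mul_eq_zero.1 this).resolve_left
      (inv_ne_zero (Real.sqrt_pos.2 (h.one_add_eigVal_pos k)).ne') |> mul_eq_zero.1).resolve_left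
      (h.one_add_eigVal_pos k).ne'

theorem basisV_apply (h : IsEigBasis c Γ v l) (k : Fin n → ℕ) :
    h.basisV k = (√(1 + eigVal l k))⁻¹ • h.eigV k :=
  haveI := h.completeSpace_VSp
  congrFun (HilbertBasis.coe_mkOfOrthogonalEqBot _ _) k

theorem inner_basisV (h : IsEigBasis c Γ v l) (k : Fin n → ℕ) (w : VSp c Γ) :
    inner ℝ (h.basisV k) w = √(1 + eigVal l k) * inner ℝ (h.basisH k) (VSp.val c Γ w) := by
  rw [h.basisV_apply, real_inner_smul_left, h.inner_eigV, ← mul_assoc]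
  congr 1
  have h0 := (Real.sqrt_pos.2 (h.one_add_eigVal_pos k)).ne'
  nth_rw 2 [← Real.mul_self_sqrt (h.one_add_eigVal_pos k).le]
  field_simp

/-- Together with `exists_VSp` this identifies `𝔙` with `ℓ²` weighted by `1 + μ_k`; `D(𝔄)` is
treated in the same way with weight `1 + μ_k + μ_k²`. -/
theorem hasSum_norm_sq_VSp (h : IsEigBasis c Γ v l) (w : VSp c Γ) :
    HasSum (fun k => (1 + eigVal l k) * inner ℝ (h.basisH k) (VSp.val c Γ w) ^ 2) (‖w‖ ^ 2) := by
  refine (h.basisV.hasSum_inner_sq w).congr_fun fun k => ?_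
  rw [h.inner_basisV, mul_pow, Real.sq_sqrt (h.one_add_eigVal_pos k).le]

theorem exists_VSp (h : IsEigBasis c Γ v l) {a : (Fin n → ℕ) → ℝ}
    (ha : Summable fun k => (1 + eigVal l k) * a k ^ 2) :
    ∃ w : VSp c Γ, ∀ k, inner ℝ (h.basisH k) (VSp.val c Γ w) = a k := by
  obtain ⟨w, hw⟩ := h.basisV.exists_of_summable (a := fun k => √(1 + eigVal l k) * a k)
    (by simpa only [mul_pow, Real.sq_sqrt (h.one_add_eigVal_pos _).le] using ha)
  refine ⟨w, fun k => mul_left_cancel₀ (Real.sqrt_pos.2 (h.one_add_eigVal_pos k)).ne' ?_⟩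
  rw [← h.inner_basisV, hw]

theorem HmHalf_ext (h : IsEigBasis c Γ v l) {F G : HmHalf c Γ}
    (hFG : ∀ k, F (h.eigV k) = G (h.eigV k)) : F = G := by
  refine h.basisV.ext_clm fun k => ?_
  rw [h.basisV_apply, map_smul, map_smul, hFG]

/-- The eigenvector of `𝔄` with index `k`, as an element of `D(𝔄)`. -/
def eigD (h : IsEigBasis c Γ v l) (k : Fin n → ℕ) : DSp c Γ :=
  ⟨WithLp.toLp 2 (h.eigV k, eigVal l k • h.basisH k), fun w => by
    rw [WithLp.toLp_snd, WithLp.toLp_fst, h.formA_eigV, real_inner_smul_left]⟩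

theorem toV_eigD (h : IsEigBasis c Γ v l) (k : Fin n → ℕ) :
    DSp.toV c Γ (h.eigD k) = h.eigV k := rfl

theorem opA_eigD (h : IsEigBasis c Γ v l) (k : Fin n → ℕ) :
    DSp.opA c Γ (h.eigD k) = eigVal l k • h.basisH k := rfl

theorem _root_.DSp.formA_toV (w : DSp c Γ) (w' : VSp c Γ) :
    formA c Γ (DSp.toV c Γ w) w' = inner ℝ (DSp.opA c Γ w) (VSp.val c Γ w') := w.2 w'

theorem _root_.DSp.inner_def (w w' : DSp c Γ) :
    inner ℝ w w' = inner ℝ (DSp.toV c Γ w) (DSp.toV c Γ w') +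
      inner ℝ (DSp.opA c Γ w) (DSp.opA c Γ w') := rfl

theorem inner_basisH_opA (h : IsEigBasis c Γ v l) (k : Fin n → ℕ) (w : DSp c Γ) :
    inner ℝ (h.basisH k) (DSp.opA c Γ w) =
      eigVal l k * inner ℝ (h.basisH k) (VSp.val c Γ (DSp.toV c Γ w)) := by
  rw [← h.formA_eigV, formA_comm, DSp.formA_toV, h.val_eigV, real_inner_comm]

/-- The square of the norm of `eigD k`. -/
def _root_.eigValD (l : Fin n → ℝ) (k : Fin n → ℕ) : ℝ := 1 + eigVal l k + eigVal l k ^ 2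

theorem eigValD_pos (h : IsEigBasis c Γ v l) (k : Fin n → ℕ) : 0 < eigValD l k := by
  have := h.eigVal_nonneg k
  unfold eigValD
  positivity

theorem inner_eigD (h : IsEigBasis c Γ v l) (k : Fin n → ℕ) (w : DSp c Γ) :
    inner ℝ (h.eigD k) w =
      eigValD l k * inner ℝ (h.basisH k) (VSp.val c Γ (DSp.toV c Γ w)) := by
  rw [DSp.inner_def, h.toV_eigD, h.opA_eigD, h.inner_eigV, real_inner_smul_left,
    h.inner_basisH_opA, eigValD]
  ring

theorem toV_injective (h : IsEigBasis c Γ v l) :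
    Function.Injective fun w : DSp c Γ => VSp.val c Γ (DSp.toV c Γ w) := by
  refine (injective_iff_map_eq_zero ((VSp.val c Γ).comp (DSp.toV c Γ))).2 fun w hw => ?_
  have hw : VSp.val c Γ (DSp.toV c Γ w) = 0 := hw
  have h1 : DSp.toV c Γ w = 0 := h.val_injective (by rw [hw, map_zero])
  have h2 : DSp.opA c Γ w = 0 := h.basisH.ext_inner fun k => by
    rw [h.inner_basisH_opA, hw]
    simp
  rw [← inner_self_eq_zero (𝕜 := ℝ), DSp.inner_def, h1, h2]
  simp

theorem orthonormal_eigD (h : IsEigBasis c Γ v l) :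
    Orthonormal ℝ fun k => (√(eigValD l k))⁻¹ • h.eigD k := by
  rw [orthonormal_iff_ite]
  intro k m
  rw [real_inner_smul_left, real_inner_smul_right, h.inner_eigD, h.toV_eigD, h.val_eigV,
    orthonormal_iff_ite.1 h.basisH.orthonormal]
  split_ifs with hkm
  · subst hkm
    have h0 := (Real.sqrt_pos.2 (h.eigValD_pos k)).ne'
    nth_rw 3 [← Real.mul_self_sqrt (h.eigValD_pos k).le]
    field_simp
  · simp

/-- The Hilbert basis of `D(𝔄)` consisting of eigenvectors of `𝔄`. -/
def basisD (h : IsEigBasis c Γ v l) : HilbertBasis (Fin n → ℕ) ℝ (DSp c Γ) :=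
  haveI := h.completeSpace_DSp
  HilbertBasis.mkOfOrthogonalEqBot h.orthonormal_eigD <| by
    rw [Submodule.eq_bot_iff]
    intro w hw
    refine h.toV_injective ?_
    simp only [map_zero]
    refine h.basisH.ext_inner fun k => ?_
    have := (Submodule.mem_orthogonal _ _).1 hw _ (Submodule.subset_span ⟨k, rfl⟩)
    rw [real_inner_smul_left, h.inner_eigD] at this
    rw [inner_zero_right]
    exact ((mul_eq_zero.1 this).resolve_left
      (inv_ne_zero (Real.sqrt_pos.2 (h.eigValD_pos k)).ne') |> mul_eq_zero.1).resolve_left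
      (h.eigValD_pos k).ne'

theorem basisD_apply (h : IsEigBasis c Γ v l) (k : Fin n → ℕ) :
    h.basisD k = (√(eigValD l k))⁻¹ • h.eigD k :=
  haveI := h.completeSpace_DSp
  congrFun (HilbertBasis.coe_mkOfOrthogonalEqBot _ _) k

theorem inner_basisD (h : IsEigBasis c Γ v l) (k : Fin n → ℕ) (w : DSp c Γ) :
    inner ℝ (h.basisD k) w =
      √(eigValD l k) * inner ℝ (h.basisH k) (VSp.val c Γ (DSp.toV c Γ w)) := by
  rw [h.basisD_apply, real_inner_smul_left, h.inner_eigD, ← mul_assoc]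
  congr 1
  have h0 := (Real.sqrt_pos.2 (h.eigValD_pos k)).ne'
  nth_rw 2 [← Real.mul_self_sqrt (h.eigValD_pos k).le]
  field_simp

theorem exists_DSp (h : IsEigBasis c Γ v l) {a : (Fin n → ℕ) → ℝ}
    (ha : Summable fun k => eigValD l k * a k ^ 2) :
    ∃ w : DSp c Γ, ∀ k, inner ℝ (h.basisH k) (VSp.val c Γ (DSp.toV c Γ w)) = a k := by
  obtain ⟨w, hw⟩ := h.basisD.exists_of_summable (a := fun k => √(eigValD l k) * a k)
    (by simpa only [mul_pow, Real.sq_sqrt (h.eigValD_pos _).le] using ha)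
  refine ⟨w, fun k => mul_left_cancel₀ (Real.sqrt_pos.2 (h.eigValD_pos k)).ne' ?_⟩
  rw [← h.inner_basisD, hw]

/-- Identities in `𝔥_{-1}` reduce in this way to one scalar identity for each multi-index. -/
theorem HmOne_ext (h : IsEigBasis c Γ v l) {F G : HmOne c Γ}
    (hFG : ∀ k, F (h.eigD k) = G (h.eigD k)) : F = G := by
  refine h.basisD.ext_clm fun k => ?_
  rw [h.basisD_apply, map_smul, map_smul, hFG]

theorem toHmOne_eigD (h : IsEigBasis c Γ v l) (x : HSp c Γ) (k : Fin n → ℕ) :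
    toHmOne c Γ x (h.eigD k) = inner ℝ (h.basisH k) x := by
  rw [real_inner_comm, ← h.val_eigV, ← h.toV_eigD]
  rfl

theorem toHmHalf_eigV (h : IsEigBasis c Γ v l) (x : HSp c Γ) (k : Fin n → ℕ) :
    toHmHalf c Γ x (h.eigV k) = inner ℝ (h.basisH k) x := by
  rw [real_inner_comm, ← h.val_eigV]
  rfl

theorem _root_.gradAlong_eq_sum (v : OrthonormalBasis (Fin n) ℝ (Euc n)) (a : Euc n)
    (w : VSp c Γ) : gradAlong c Γ a w = ∑ j, inner ℝ (v j) a • gradAlong c Γ (v j) w := by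
  conv_lhs => rw [gradAlong, ← v.sum_repr' a]
  simp only [gradAlong, Finset.smul_sum, smul_smul, WithLp.ofLp_sum, WithLp.ofLp_smul,
    Finset.sum_apply, Pi.smul_apply, smul_eq_mul, Finset.sum_smul]
  exact Finset.sum_comm

theorem _root_.opB1_opF (g : Euc n → Euc n) (p : HSp c Γ) (u : Euc n) (w : VSp c Γ) :
    opB1 c Γ (opF c Γ g p u) w = inner ℝ p (gradAlong c Γ (g u) w) := by
  rw [opB1, ContinuousLinearMap.comp_apply, innerSL_apply_apply, PiLp.inner_apply, gradAlong,
    inner_sum]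
  refine Finset.sum_congr rfl fun i _ => ?_
  rw [opF, real_inner_smul_left, real_inner_smul_right]

/-- By duality the divergence meets the gradient of the eigenvector, which is lowered. Mode `k` is
thus driven only by the modes `k - e_j`: this is the triangular structure of the whole problem. -/
theorem opB1_opF_eigV (h : IsEigBasis c Γ v l) (g : Euc n → Euc n) (p : HSp c Γ) (u : Euc n)
    (k : Fin n → ℕ) : opB1 c Γ (opF c Γ g p u) (h.eigV k) = ∑ j, inner ℝ (v j) (g u) *
      (√(l j * k j) * inner ℝ (h.basisH (k - Pi.single j 1)) p) := by
  rw [opB1_opF, gradAlong_eq_sum v, inner_sum]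
  refine Finset.sum_congr rfl fun j _ => ?_
  rw [real_inner_smul_right, h.gradAlong_eigV, real_inner_smul_right,
    real_inner_comm (h.basisH _) p]

end IsEigBasis

end

section

/-! ### The semigroup and its extension -/

variable {n : ℕ} {c : ℝ} {Γ : Matrix (Fin n) (Fin n) ℝ}
  {v : OrthonormalBasis (Fin n) ℝ (Euc n)} {l : Fin n → ℝ}

/-- Dominated convergence in coordinates with respect to a Hilbert basis. -/
theorem HilbertBasis.tendsto_of_dominated {ι E β : Type*} [NormedAddCommGroup E]
    [InnerProductSpace ℝ E] (b : HilbertBasis ι ℝ E) {F : Filter β} {f : β → E} {x : E}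
    {bound : ι → ℝ} (hb : Summable fun i => bound i ^ 2)
    (hf : ∀ᶠ t in F, ∀ i, |inner ℝ (b i) (f t) - inner ℝ (b i) x| ≤ bound i)
    (hlim : ∀ i, Tendsto (fun t => inner ℝ (b i) (f t)) F (𝓝 (inner ℝ (b i) x))) :
    Tendsto f F (𝓝 x) := by
  have h1 : Tendsto (fun t => ∑' i, (inner ℝ (b i) (f t) - inner ℝ (b i) x) ^ 2) F
      (𝓝 (∑' _ : ι, (0 : ℝ))) := by
    refine tendsto_tsum_of_dominated_convergence hb (fun i => ?_) ?_
    · have := ((hlim i).sub_const (inner ℝ (b i) x)).pow 2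
      simpa using this
    · filter_upwards [hf] with t ht i
      rw [Real.norm_of_nonneg (sq_nonneg _), ← sq_abs]
      exact pow_le_pow_left₀ (abs_nonneg _) (ht i) 2
  rw [tsum_zero] at h1
  have h2 : (fun t => ∑' i, (inner ℝ (b i) (f t) - inner ℝ (b i) x) ^ 2) =
      fun t => ‖f t - x‖ ^ 2 := funext fun t => by
    rw [← (b.hasSum_inner_sq (f t - x)).tsum_eq]
    simp only [inner_sub_right]
  rw [h2] at h1
  rw [tendsto_iff_norm_sub_tendsto_zero]
  have h3 := (Real.continuous_sqrt.tendsto 0).comp h1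
  rw [Real.sqrt_zero] at h3
  exact h3.congr fun t => Real.sqrt_sq (norm_nonneg _)

theorem abs_exp_sub_one_le {x : ℝ} (hx : x ≤ 0) : |Real.exp x - 1| ≤ |x| := by
  rw [abs_of_nonpos (by linarith [Real.exp_le_one_iff.2 hx]), abs_of_nonpos hx]
  linarith [Real.add_one_le_exp x]

namespace IsEigBasis

theorem exp_eigVal_le_one (h : IsEigBasis c Γ v l) (k : Fin n → ℕ) {t : ℝ} (ht : 0 ≤ t) :
    Real.exp (-(c * eigVal l k * t)) ≤ 1 :=
  Real.exp_le_one_iff.2 (neg_nonpos.2 (mul_nonneg (mul_nonneg h.cpos.le (h.eigVal_nonneg k)) ht))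

theorem abs_exp_eigVal_le_one (h : IsEigBasis c Γ v l) (k : Fin n → ℕ) {t : ℝ} (ht : 0 ≤ t) :
    |Real.exp (-(c * eigVal l k * t))| ≤ 1 := by
  rw [abs_of_pos (Real.exp_pos _)]
  exact h.exp_eigVal_le_one k ht

/-- The semigroup is the multiplier `e^{-c μ_k t}`, with time cut off at zero so that all `t` are
admitted. If the difference quotient at `x` converges to `z`, then `z_k = -c μ_k x_k`, and
summability of `z_k²` puts `x` in the domain. Conversely the quotients converge by dominated
convergence in `ℓ²`. -/
theorem exists_isGeneratedByFP (h : IsEigBasis c Γ v l) :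
    ∃ T, IsGeneratedByFP c Γ T := by
  have hc := h.cpos
  have hex : ∀ t : ℝ, ∃ L : HSp c Γ →L[ℝ] HSp c Γ, ∀ k x,
      inner ℝ (h.basisH k) (L x) =
        Real.exp (-(c * eigVal l k * max t 0)) * inner ℝ (h.basisH k) x := fun t => by
    obtain ⟨L, hL, -⟩ := h.basisH.exists_diagonal
      (fun k => Real.exp (-(c * eigVal l k * max t 0)))
      (fun k => h.abs_exp_eigVal_le_one k (le_max_right _ _))
    exact ⟨L, hL⟩
  choose T hT using hex
  have hT' : ∀ t, 0 ≤ t → ∀ k x, inner ℝ (h.basisH k) (T t x) =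
        Real.exp (-(c * eigVal l k * t)) * inner ℝ (h.basisH k) x := fun t ht k x => by
    rw [hT, max_eq_left ht]
  refine ⟨T, ⟨?_, ?_, ?_⟩, fun x z => ⟨fun hz => ?_, ?_⟩⟩
  · ext1 x
    refine h.basisH.ext_inner fun k => ?_
    rw [hT' 0 le_rfl]
    simp
  · intro s t hs ht
    ext1 x
    refine h.basisH.ext_inner fun k => ?_
    rw [hT' _ (add_nonneg hs ht), ContinuousLinearMap.comp_apply, hT' _ hs, hT' _ ht, ← mul_assoc,
      ← Real.exp_add]
    congr 2
    ring
  · intro x t ht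
    refine h.basisH.tendsto_of_dominated (bound := fun k => 2 * |inner ℝ (h.basisH k) x|) ?_ ?_ ?_
    · simp only [mul_pow, sq_abs]
      exact (h.basisH.hasSum_inner_sq x).summable.mul_left _
    · filter_upwards [self_mem_nhdsWithin] with s hs k
      rw [hT' s hs, hT' t ht, ← sub_mul, abs_mul]
      refine mul_le_mul_of_nonneg_right ?_ (abs_nonneg _)
      refine (abs_sub _ _).trans ?_
      linarith [h.abs_exp_eigVal_le_one k hs, h.abs_exp_eigVal_le_one k ht]
    · intro k
      simp only [hT]
      have : Continuous fun s : ℝ => Real.exp (-(c * eigVal l k * max s 0)) *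
          inner ℝ (h.basisH k) x := by fun_prop
      exact (this.tendsto t).mono_left nhdsWithin_le_nhds
  · have hcoef : ∀ k, inner ℝ (h.basisH k) z = -(c * eigVal l k) * inner ℝ (h.basisH k) x := by
      intro k
      have h1 := ((innerSL ℝ (h.basisH k)).continuous.tendsto z).comp hz
      have h2 : Tendsto (fun s : ℝ => s⁻¹ * (Real.exp (-(c * eigVal l k * s)) - 1)) (𝓝[>] 0)
          (𝓝 (-(c * eigVal l k))) := by
        have hd : HasDerivAt (fun s : ℝ => Real.exp (-(c * eigVal l k * s)))
            (-(c * eigVal l k)) 0 := by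
          simpa using ((hasDerivAt_id (0 : ℝ)).const_mul (c * eigVal l k)).fun_neg.exp
        have := hd.tendsto_slope_zero_right
        simpa using this
      refine tendsto_nhds_unique h1 ((h2.mul_const (inner ℝ (h.basisH k) x)).congr' ?_)
      filter_upwards [self_mem_nhdsWithin] with s hs
      simp only [Function.comp_apply, innerSL_apply_apply, real_inner_smul_right, inner_sub_right]
      rw [hT' s (le_of_lt hs)]
      ring
    -- The weight satisfies `1 + μ + μ² ≤ 2 + 2 μ²`, which is controlled by `x_k²` and `z_k² = c²
    -- μ_k² x_k²`.
    have hs : Summable fun k => eigValD l k * inner ℝ (h.basisH k) x ^ 2 := by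
      have s1 := (h.basisH.hasSum_inner_sq x).summable
      have s2 := (h.basisH.hasSum_inner_sq z).summable
      refine Summable.of_nonneg_of_le
        (fun k => mul_nonneg (h.eigValD_pos k).le (sq_nonneg _)) (fun k => ?_)
        ((s1.mul_left 2).add (s2.mul_left (2 * (c⁻¹) ^ 2)))
      rw [hcoef k, eigValD]
      have : eigVal l k ≤ 1 + eigVal l k ^ 2 := by nlinarith [sq_nonneg (eigVal l k - 1)]
      have e : 2 * c⁻¹ ^ 2 * (-(c * eigVal l k) * inner ℝ (h.basisH k) x) ^ 2 =
          2 * eigVal l k ^ 2 * inner ℝ (h.basisH k) x ^ 2 := by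
        field_simp
      rw [e]
      nlinarith [sq_nonneg (inner ℝ (h.basisH k) x)]
    obtain ⟨w, hw⟩ := h.exists_DSp hs
    refine ⟨w, h.basisH.ext_inner hw, h.basisH.ext_inner fun k => ?_⟩
    rw [hcoef, inner_neg_right, real_inner_smul_right, h.inner_basisH_opA, hw]
    ring
  · rintro ⟨w, rfl, rfl⟩
    refine h.basisH.tendsto_of_dominated
      (bound := fun k => 2 * c * |inner ℝ (h.basisH k) (DSp.opA c Γ w)|) ?_ ?_ ?_
    · simp only [mul_pow, sq_abs]
      exact (h.basisH.hasSum_inner_sq _).summable.mul_left _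
    · filter_upwards [self_mem_nhdsWithin] with s hs k
      have hs : 0 < s := hs
      rw [real_inner_smul_right, inner_sub_right, hT' s hs.le, inner_neg_right,
        real_inner_smul_right, h.inner_basisH_opA]
      set y := inner ℝ (h.basisH k) (VSp.val c Γ (DSp.toV c Γ w))
      have h0 := h.eigVal_nonneg k
      have h1 : |Real.exp (-(c * eigVal l k * s)) - 1| ≤ c * eigVal l k * s := by
        refine (abs_exp_sub_one_le (by simp; positivity)).trans ?_
        rw [abs_neg, abs_of_nonneg (by positivity)]
      have e : s⁻¹ * (Real.exp (-(c * eigVal l k * s)) * y - y) - -(c * (eigVal l k * y)) =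
          (s⁻¹ * (Real.exp (-(c * eigVal l k * s)) - 1) + c * eigVal l k) * y := by ring
      have h2 : |s⁻¹ * (Real.exp (-(c * eigVal l k * s)) - 1)| ≤ c * eigVal l k := by
        rw [abs_mul, abs_of_pos (inv_pos.2 hs)]
        calc _ ≤ s⁻¹ * (c * eigVal l k * s) := by gcongr
          _ = _ := by field_simp
      rw [e, abs_mul, abs_mul, ← mul_assoc]
      refine mul_le_mul_of_nonneg_right ((abs_add_le _ _).trans ?_) (abs_nonneg _)
      rw [abs_of_nonneg (a := c * eigVal l k) (by positivity), abs_of_nonneg h0]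
      linarith
    · intro k
      have h2 : Tendsto (fun s : ℝ => s⁻¹ * (Real.exp (-(c * eigVal l k * s)) - 1)) (𝓝[>] 0)
          (𝓝 (-(c * eigVal l k))) := by
        have hd : HasDerivAt (fun s : ℝ => Real.exp (-(c * eigVal l k * s)))
            (-(c * eigVal l k)) 0 := by
          simpa using ((hasDerivAt_id (0 : ℝ)).const_mul (c * eigVal l k)).fun_neg.exp
        have := hd.tendsto_slope_zero_right
        simpa using this
      have h3 := h2.mul_const (inner ℝ (h.basisH k) (VSp.val c Γ (DSp.toV c Γ w)))
      have e : inner ℝ (h.basisH k) (-(c • DSp.opA c Γ w)) =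
          -(c * eigVal l k) * inner ℝ (h.basisH k) (VSp.val c Γ (DSp.toV c Γ w)) := by
        rw [inner_neg_right, real_inner_smul_right, h.inner_basisH_opA]
        ring
      rw [e]
      refine h3.congr' ?_
      filter_upwards [self_mem_nhdsWithin] with s hs
      rw [real_inner_smul_right, inner_sub_right, hT' s (le_of_lt hs)]
      ring

theorem fpSemigroup_spec (h : IsEigBasis c Γ v l) : IsGeneratedByFP c Γ (fpSemigroup c Γ) :=
  Classical.epsilon_spec h.exists_isGeneratedByFP

/-- `fpSemigroup` is a choice of which only the generator is known. The path `e^{c μ_k s} T(s) e_k`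
has vanishing right derivative, hence is constant; so the generator determines the semigroup. -/
theorem fpSemigroup_basisH (h : IsEigBasis c Γ v l) (k : Fin n → ℕ) {t : ℝ} (ht : 0 ≤ t) :
    fpSemigroup c Γ t (h.basisH k) = Real.exp (-(c * eigVal l k * t)) • h.basisH k := by
  obtain ⟨⟨h0, hadd, hcont⟩, hgen⟩ := h.fpSemigroup_spec
  set T := fpSemigroup c Γ
  set κ := c * eigVal l k
  have hlim : Tendsto (fun s : ℝ => s⁻¹ • (T s (h.basisH k) - h.basisH k)) (𝓝[>] 0)
      (𝓝 (-(κ • h.basisH k))) := by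
    refine (hgen _ _).2 ⟨h.eigD k, by rw [h.toV_eigD, h.val_eigV], ?_⟩
    rw [h.opA_eigD, smul_smul]
  have hd : ∀ s ∈ Ici (0 : ℝ), HasDerivWithinAt (fun s => T s (h.basisH k))
      (-(κ • T s (h.basisH k))) (Ici s) s := by
    intro s hs
    rw [hasDerivWithinAt_iff_tendsto_slope]
    have e1 : Ici s \ {s} = Ioi s := by ext r; simp [lt_iff_le_and_ne]
    rw [e1]
    have h1 := ((T s).continuous.tendsto _).comp hlim
    rw [map_neg, map_smul] at h1
    have h2 : Tendsto (fun r : ℝ => r - s) (𝓝[>] s) (𝓝[>] 0) := by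
      refine tendsto_nhdsWithin_iff.2 ⟨?_, ?_⟩
      · have : Tendsto (fun r : ℝ => r - s) (𝓝 s) (𝓝 (s - s)) := by
          exact (continuous_id.sub continuous_const).tendsto s
        rw [sub_self] at this
        exact this.mono_left nhdsWithin_le_nhds
      · filter_upwards [self_mem_nhdsWithin] with r hr
        exact sub_pos.2 (show s < r from hr)
    refine (h1.comp h2).congr' ?_
    filter_upwards [self_mem_nhdsWithin] with r hr
    have hr : s < r := hr
    have h3 := hadd s (r - s) hs (sub_pos.2 hr).le
    rw [add_sub_cancel] at h3
    simp only [Function.comp_apply, slope_def_module, map_smul, map_sub, h3,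
      ContinuousLinearMap.comp_apply]
  have hd2 : ∀ s ∈ Ico (0 : ℝ) t, HasDerivWithinAt
      (fun s => Real.exp (κ * s) • T s (h.basisH k)) 0 (Ici s) s := by
    intro s hs
    have h1 : HasDerivWithinAt (fun s : ℝ => Real.exp (κ * s))
        (Real.exp (κ * s) * κ) (Ici s) s := by
      simpa using (((hasDerivAt_id s).const_mul κ).exp).hasDerivWithinAt (s := Ici s)
    have h2 := h1.fun_smul (hd s hs.1)
    rwa [smul_neg, smul_smul, neg_add_cancel] at h2
  have hc : ContinuousOn (fun s => Real.exp (κ * s) • T s (h.basisH k)) (Icc 0 t) := by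
    have h1 : Continuous fun s : ℝ => Real.exp (κ * s) := by fun_prop
    exact h1.continuousOn.smul ((hcont (h.basisH k)).mono fun s hs => hs.1)
  have := constant_of_has_deriv_right_zero hc hd2 t ⟨ht, le_rfl⟩
  simp only [mul_zero, Real.exp_zero, one_smul, h0, ContinuousLinearMap.id_apply] at this
  conv_rhs => rw [← this]
  rw [smul_smul, ← Real.exp_add]
  simp

theorem inner_fpSemigroup (h : IsEigBasis c Γ v l) (k : Fin n → ℕ) {t : ℝ} (ht : 0 ≤ t)
    (x : HSp c Γ) : inner ℝ (h.basisH k) (fpSemigroup c Γ t x) =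
      Real.exp (-(c * eigVal l k * t)) * inner ℝ (h.basisH k) x := by
  have : (innerSL ℝ (h.basisH k)).comp (fpSemigroup c Γ t) =
      Real.exp (-(c * eigVal l k * t)) • innerSL ℝ (h.basisH k) := by
    refine h.basisH.ext_clm fun m => ?_
    rw [ContinuousLinearMap.comp_apply, h.fpSemigroup_basisH m ht, map_smul,
      _root_.smul_apply, innerSL_apply_apply, orthonormal_iff_ite.1 h.basisH.orthonormal]
    split_ifs with hkm
    · rw [hkm]
    · simp
  exact DFunLike.congr_fun this x

theorem exists_diagD (h : IsEigBasis c Γ v l) {t : ℝ} (ht : 0 ≤ t) :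
    ∃ R : DSp c Γ →L[ℝ] DSp c Γ, (∀ w, ‖R w‖ ≤ ‖w‖) ∧
      ∀ k, R (h.eigD k) = Real.exp (-(c * eigVal l k * t)) • h.eigD k := by
  obtain ⟨R, hR, hn⟩ := h.basisD.exists_diagonal (fun k => Real.exp (-(c * eigVal l k * t)))
      (fun k => h.abs_exp_eigVal_le_one k ht)
  refine ⟨R, hn, fun k => h.basisD.ext_inner fun m => ?_⟩
  rw [hR, real_inner_smul_right, h.inner_basisD, h.toV_eigD, h.val_eigV,
    orthonormal_iff_ite.1 h.basisH.orthonormal]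
  split_ifs with hkm
  · rw [hkm]
  · simp

/-- An extension exists: precomposition of functionals with the diagonal contraction of `D(𝔄)`. -/
theorem fpSemigroupExt_spec (h : IsEigBasis c Γ v l) {t : ℝ} (ht : 0 ≤ t) (x : HSp c Γ) :
    fpSemigroupExt c Γ t (toHmOne c Γ x) = toHmOne c Γ (fpSemigroup c Γ t x) := by
  refine Classical.epsilon_spec (p := fun S : HmOne c Γ →L[ℝ] HmOne c Γ =>
    ∀ x : HSp c Γ, S (toHmOne c Γ x) = toHmOne c Γ (fpSemigroup c Γ t x)) ?_ x
  obtain ⟨R, -, hR⟩ := h.exists_diagD ht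
  refine ⟨(ContinuousLinearMap.compL ℝ (DSp c Γ) (DSp c Γ) ℝ).flip R, fun x =>
    h.HmOne_ext fun k => ?_⟩
  simp only [ContinuousLinearMap.flip_apply, ContinuousLinearMap.compL_apply,
    ContinuousLinearMap.comp_apply]
  rw [hR, map_smul, h.toHmOne_eigD, h.toHmOne_eigD, h.inner_fpSemigroup k ht, smul_eq_mul]

/-- The identity holds on `𝔥` and passes to `𝔥_{-1}` by density. The difference of both sides is a
functional `Λ` on `𝔥_{-1}` vanishing on `𝔥`; by the Riesz representation it is evaluation at some
`y₀ ∈ D(𝔄)`, and testing it on `y₀` itself gives `‖y₀‖² = 0` in `𝔥`. -/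
theorem fpSemigroupExt_eigD (h : IsEigBasis c Γ v l) {t : ℝ} (ht : 0 ≤ t) (F : HmOne c Γ)
    (k : Fin n → ℕ) : fpSemigroupExt c Γ t F (h.eigD k) =
      Real.exp (-(c * eigVal l k * t)) * F (h.eigD k) := by
  have := h.completeSpace_DSp
  set e := Real.exp (-(c * eigVal l k * t))
  let ev : HmOne c Γ →L[ℝ] ℝ := ContinuousLinearMap.apply ℝ ℝ (h.eigD k)
  let Λ : HmOne c Γ →L[ℝ] ℝ := ev.comp (fpSemigroupExt c Γ t) - e • ev
  have h0 : ∀ x, Λ (toHmOne c Γ x) = 0 := fun x => by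
    have h1 : Λ (toHmOne c Γ x) = fpSemigroupExt c Γ t (toHmOne c Γ x) (h.eigD k) -
      e * toHmOne c Γ x (h.eigD k) := rfl
    rw [h1, h.fpSemigroupExt_spec ht, h.toHmOne_eigD, h.toHmOne_eigD, h.inner_fpSemigroup k ht,
      sub_self]
  let J := InnerProductSpace.toDual ℝ (DSp c Γ)
  let M : StrongDual ℝ (DSp c Γ) := LinearMap.mkContinuous
    ⟨⟨fun y => Λ (J y), fun y y' => by rw [map_add, map_add]⟩, fun a y => by
      change Λ (J (a • y)) = a • Λ (J y)
      rw [map_smulₛₗ, conj_trivial, map_smul]⟩ ‖Λ‖ fun y => by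
      rw [← J.norm_map y]; exact Λ.le_opNorm _
  obtain ⟨y₀, hy₀⟩ := J.surjective M
  have hΛ : ∀ G : HmOne c Γ, Λ G = G y₀ := fun G => by
    obtain ⟨y, rfl⟩ := J.surjective G
    have h1 : Λ (J y) = M y := rfl
    rw [h1, ← hy₀]
    simp only [J, InnerProductSpace.toDual_apply_apply]
    exact real_inner_comm _ _
  have hy₀0 : y₀ = 0 := by
    refine h.toV_injective ?_
    simp only [map_zero]
    have h1 := h0 (VSp.val c Γ (DSp.toV c Γ y₀))
    rw [hΛ] at h1
    exact inner_self_eq_zero.1 h1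
  have h2 := hΛ F
  rw [hy₀0, map_zero] at h2
  exact sub_eq_zero.1 h2

theorem norm_fpSemigroupExt_le (h : IsEigBasis c Γ v l) {t : ℝ} (ht : 0 ≤ t) (F : HmOne c Γ) :
    ‖fpSemigroupExt c Γ t F‖ ≤ ‖F‖ := by
  obtain ⟨R, hn, hR⟩ := h.exists_diagD ht
  have : fpSemigroupExt c Γ t F = F.comp R := h.HmOne_ext fun k => by
    rw [h.fpSemigroupExt_eigD ht, ContinuousLinearMap.comp_apply, hR, map_smul, smul_eq_mul]
  rw [this]
  refine ContinuousLinearMap.opNorm_le_bound _ (norm_nonneg _) fun w => ?_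
  exact (F.le_opNorm _).trans (mul_le_mul_of_nonneg_left (hn w) (norm_nonneg _))

end IsEigBasis

/-! ### Eigenbases of a positive definite matrix -/

theorem exists_isEigBasis (hc : 0 < c) (hΓ : Γ.PosDef) :
    ∃ (v : OrthonormalBasis (Fin n) ℝ (Euc n)) (l : Fin n → ℝ), IsEigBasis c Γ v l := by
  refine ⟨hΓ.1.eigenvectorBasis, fun k => c⁻¹ * hΓ.1.eigenvalues k, hc,
    fun k => mul_pos (inv_pos.2 hc) (hΓ.eigenvalues_pos k), fun k => ?_⟩
  rw [mul_inv_cancel_left₀ hc.ne']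
  exact hΓ.1.mulVec_eigenvectorBasis k

/-- The covariance formula is claimed for every orthonormal eigenbasis, not merely for the one fixed
in the rest of the argument. -/
theorem isEigBasis_of_posDef (hc : 0 < c) (hΓ : Γ.PosDef)
    (hv : ∀ k, Γ *ᵥ (v k).ofLp = (c * l k) • (v k).ofLp) : IsEigBasis c Γ v l := by
  refine ⟨hc, fun k => ?_, hv⟩
  have h0 : (v k).ofLp ≠ 0 := fun h => by
    have := v.orthonormal.1 k
    rw [show v k = 0 from WithLp.ofLp_injective 2 h] at this
    simp at this
  have h1 := hΓ.dotProduct_mulVec_pos h0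
  rw [hv, dotProduct_smul, star_trivial] at h1
  have h2 : (v k).ofLp ⬝ᵥ (v k).ofLp = 1 := by
    have := v.orthonormal.1 k
    have h3 := real_inner_self_eq_norm_sq (v k)
    rw [this, EuclideanSpace.inner_eq_star_dotProduct, star_trivial] at h3
    simpa using h3
  rw [h2, smul_eq_mul, mul_one] at h1
  exact (mul_pos_iff_of_pos_left hc).1 h1

end

section

/-! ### Primitives on the half-line -/

/-- `F` is a primitive of the locally integrable function `f` on `[0, ∞)`. -/
structure IsPrim {E : Type*} [NormedAddCommGroup E] [NormedSpace ℝ E] (F f : ℝ → E) : Prop where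
  intervalIntegrable : ∀ T ≥ 0, IntervalIntegrable f volume 0 T
  eq_integral : ∀ t ≥ 0, F t = F 0 + ∫ s in (0 : ℝ)..t, f s

namespace IsPrim

variable {E : Type*} [NormedAddCommGroup E] [NormedSpace ℝ E] {F f : ℝ → E}

theorem intervalIntegrable' (h : IsPrim F f) {s t : ℝ} (hs : 0 ≤ s) (ht : 0 ≤ t) :
    IntervalIntegrable f volume s t :=
  (h.intervalIntegrable s hs).symm.trans (h.intervalIntegrable t ht)

theorem sub_eq (h : IsPrim F f) {s t : ℝ} (hs : 0 ≤ s) (ht : 0 ≤ t) :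
    F t - F s = ∫ r in s..t, f r := by
  rw [h.eq_integral t ht, h.eq_integral s hs, add_sub_add_left_eq_sub,
    intervalIntegral.integral_interval_sub_left (h.intervalIntegrable t ht)
      (h.intervalIntegrable s hs)]

theorem continuousOn (h : IsPrim F f) : ContinuousOn F (Ici 0) := by
  intro t ht
  have ht : 0 ≤ t := ht
  have h1 : ContinuousOn (fun t => ∫ s in (0 : ℝ)..t, f s) (uIcc 0 (t + 1)) :=
    intervalIntegral.continuousOn_primitive_interval
      ((intervalIntegrable_iff' (by simp)).1 (h.intervalIntegrable (t + 1) (by linarith)))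
  rw [uIcc_of_le (by linarith)] at h1
  have h2 : ContinuousWithinAt (fun t => F 0 + ∫ s in (0 : ℝ)..t, f s) (Icc 0 (t + 1)) t :=
    continuousWithinAt_const.add (h1 t ⟨ht, by linarith⟩)
  have h3 : ContinuousWithinAt F (Icc 0 (t + 1)) t :=
    h2.congr (fun s hs => h.eq_integral s hs.1) (h.eq_integral t ht)
  refine h3.mono_of_mem_nhdsWithin ?_
  rw [← Ici_inter_Iic]
  exact inter_mem self_mem_nhdsWithin (mem_nhdsWithin_of_mem_nhds (Iic_mem_nhds (by linarith)))

theorem congr {F' f' : ℝ → E} (h : IsPrim F f) (hF : EqOn F' F (Ici 0))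
    (hf : ∀ᵐ t ∂volume.restrict (Ioi 0), f' t = f t) : IsPrim F' f' := by
  have hae : ∀ T ≥ 0, ∀ᵐ t ∂volume.restrict (uIoc 0 T), f t = f' t := fun T hT => by
    rw [uIoc_of_le hT]
    exact (ae_restrict_of_ae_restrict_of_subset Ioc_subset_Ioi_self hf).mono fun t ht => ht.symm
  refine ⟨fun T hT => (h.intervalIntegrable T hT).congr_ae (hae T hT), fun t ht => ?_⟩
  rw [hF ht, hF (mem_Ici.2 le_rfl), h.eq_integral t ht]
  congr 1
  exact intervalIntegral.integral_congr_ae_restrict (hae t ht)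

theorem const (a : E) : IsPrim (fun _ => a) (fun _ => (0 : E)) :=
  ⟨fun _ _ => intervalIntegrable_const, fun t _ => by simp⟩

theorem add {G g : ℝ → E} (h : IsPrim F f) (h' : IsPrim G g) :
    IsPrim (fun t => F t + G t) (fun t => f t + g t) := by
  refine ⟨fun T hT => (h.1 T hT).add (h'.1 T hT), fun t ht => ?_⟩
  rw [intervalIntegral.integral_add (h.1 t ht) (h'.1 t ht), h.2 t ht, h'.2 t ht]
  abel

theorem sum {ι : Type*} (s : Finset ι) {F f : ι → ℝ → E} (h : ∀ i ∈ s, IsPrim (F i) (f i)) :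
    IsPrim (fun t => ∑ i ∈ s, F i t) (fun t => ∑ i ∈ s, f i t) := by
  classical
  induction s using Finset.induction_on with
  | empty => simpa using IsPrim.const (0 : E)
  | insert i s hi ih =>
    simp only [Finset.sum_insert hi]
    exact (h i (Finset.mem_insert_self _ _)).add (ih fun j hj => h j (Finset.mem_insert_of_mem hj))

theorem clm_comp {E' : Type*} [NormedAddCommGroup E'] [NormedSpace ℝ E'] [CompleteSpace E]
    [CompleteSpace E'] (h : IsPrim F f) (L : E →L[ℝ] E') :
    IsPrim (fun t => L (F t)) (fun t => L (f t)) := by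
  refine ⟨fun T hT => ⟨L.integrable_comp (h.1 T hT).1, L.integrable_comp (h.1 T hT).2⟩,
    fun t ht => ?_⟩
  rw [h.2 t ht, map_add, L.intervalIntegral_comp_comm (h.1 t ht)]

theorem const_mul {F f : ℝ → ℝ} (h : IsPrim F f) (a : ℝ) :
    IsPrim (fun t => a * F t) (fun t => a * f t) := by
  refine ⟨fun T hT => (h.1 T hT).const_mul a, fun t ht => ?_⟩
  rw [intervalIntegral.integral_const_mul, h.2 t ht, mul_add]

theorem absolutelyContinuousOnInterval {F f : ℝ → ℝ} (h : IsPrim F f) {T : ℝ} (hT : 0 ≤ T) :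
    AbsolutelyContinuousOnInterval F 0 T := by
  have h1 := (h.intervalIntegrable T hT).absolutelyContinuousOnInterval_intervalIntegral
    (c := 0) (by simp)
  have h2 : AbsolutelyContinuousOnInterval (fun _ : ℝ => F 0) 0 T :=
    (LipschitzWith.const (F 0)).lipschitzOnWith.absolutelyContinuousOnInterval
  have h3 := h2.add h1
  rw [absolutelyContinuousOnInterval_iff] at h3 ⊢
  intro ε hε
  obtain ⟨δ, hδ, h4⟩ := h3 ε hε
  refine ⟨δ, hδ, fun I hI hI' => ?_⟩
  convert! h4 I hI hI' using 2 with i hi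
  have e : ∀ t ∈ uIcc 0 T, F t = F 0 + ∫ s in (0 : ℝ)..t, f s := fun t ht => by
    rw [uIcc_of_le hT] at ht
    exact h.eq_integral t ht.1
  have hm := hI.1 i hi
  rw [e _ hm.1, e _ hm.2]
  rfl

theorem ae_hasDerivAt {F f : ℝ → ℝ} (h : IsPrim F f) {T : ℝ} (hT : 0 ≤ T) :
    ∀ᵐ t, t ∈ Ioo 0 T → HasDerivAt F (f t) t := by
  filter_upwards [(h.intervalIntegrable T hT).ae_hasDerivAt_integral] with t ht htT
  have h1 := ht (by rw [uIcc_of_le hT]; exact ⟨htT.1.le, htT.2.le⟩) 0 (by simp)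
  refine (h1.const_add (F 0)).congr_of_eventuallyEq ?_
  filter_upwards [Ioi_mem_nhds htT.1] with s hs
  exact h.eq_integral s (le_of_lt hs)

/-- Primitives are absolutely continuous with almost everywhere derivatives `f` and `g`, so
integration by parts applies. -/
theorem mul {F f G g : ℝ → ℝ} (h : IsPrim F f) (h' : IsPrim G g) :
    IsPrim (fun t => F t * G t) (fun t => f t * G t + F t * g t) := by
  have hsub : ∀ T ≥ 0, uIcc 0 T ⊆ Ici (0 : ℝ) := fun T hT => by
    rw [uIcc_of_le hT]; exact fun s hs => hs.1
  refine ⟨fun T hT => ((h.1 T hT).mul_continuousOn (h'.continuousOn.mono (hsub T hT))).add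
    ((h'.1 T hT).continuousOn_mul (h.continuousOn.mono (hsub T hT))), fun t ht => ?_⟩
  have key := (h.absolutelyContinuousOnInterval ht).integral_deriv_mul_eq_sub
    (h'.absolutelyContinuousOnInterval ht)
  rw [← sub_eq_iff_eq_add', ← key]
  refine intervalIntegral.integral_congr_ae ?_
  have hne : ∀ᵐ s : ℝ, s ≠ t := by
    simp [ae_iff, measure_singleton]
  filter_upwards [h.ae_hasDerivAt ht, h'.ae_hasDerivAt ht, hne] with s h1 h2 h3 hs
  rw [uIoc_of_le ht] at hs
  have hs' : s ∈ Ioo 0 t := ⟨hs.1, lt_of_le_of_ne hs.2 h3⟩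
  rw [(h1 hs').deriv, (h2 hs').deriv]

theorem of_hasDerivWithinAt [CompleteSpace E] (hc : ContinuousOn f (Ici 0))
    (hd : ∀ t ≥ 0, HasDerivWithinAt F (f t) (Ici 0) t) : IsPrim F f := by
  have hsub : ∀ T ≥ 0, uIcc 0 T ⊆ Ici (0 : ℝ) := fun T hT => by
    rw [uIcc_of_le hT]; exact fun s hs => hs.1
  have hi : ∀ T ≥ 0, IntervalIntegrable f volume 0 T := fun T hT =>
    (hc.mono (hsub T hT)).intervalIntegrable
  refine ⟨hi, fun t ht => ?_⟩
  rw [intervalIntegral.integral_eq_sub_of_hasDeriv_right (f := F) ?_ ?_ (hi t ht)]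
  · abel
  · exact fun s hs => ((hd s (hsub t ht hs)).continuousWithinAt).mono (hsub t ht)
  · intro s hs
    rw [min_eq_left ht, max_eq_right ht] at hs
    exact (hd s hs.1.le).mono fun r hr => hs.1.le.trans (le_of_lt hr)

theorem exp (κ : ℝ) : IsPrim (fun t => Real.exp (κ * t)) (fun t => κ * Real.exp (κ * t)) := by
  refine of_hasDerivWithinAt (by fun_prop) fun t _ => ?_
  have := ((hasDerivAt_id t).const_mul κ).exp
  simp only [id, mul_one] at this
  rw [mul_comm]
  exact this.hasDerivWithinAt

/-- Variation of constants. -/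
theorem eq_exp_mul {a f : ℝ → ℝ} {κ : ℝ}
    (h : IsPrim a fun t => -(κ * a t) + f t) {t : ℝ} (ht : 0 ≤ t) :
    a t = Real.exp (-(κ * t)) * a 0 + ∫ s in (0 : ℝ)..t, Real.exp (-(κ * (t - s))) * f s := by
  have h1 := ((IsPrim.exp κ).mul h).eq_integral t ht
  have e : ∀ s, κ * Real.exp (κ * s) * a s + Real.exp (κ * s) * (-(κ * a s) + f s) =
      Real.exp (κ * s) * f s := fun s => by ring
  simp only [e, mul_zero, Real.exp_zero, one_mul] at h1
  have e2 : ∀ s, Real.exp (-(κ * (t - s))) * f s =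
      Real.exp (-(κ * t)) * (Real.exp (κ * s) * f s) := fun s => by
    rw [← mul_assoc, ← Real.exp_add]
    ring_nf
  simp only [e2, intervalIntegral.integral_const_mul]
  rw [← mul_add, ← h1, ← mul_assoc, ← Real.exp_add]
  simp

theorem of_eq_exp_mul {a f : ℝ → ℝ} {κ a₀ : ℝ} (hf : ∀ T ≥ 0, IntervalIntegrable f volume 0 T)
    (h : ∀ t ≥ 0, a t = Real.exp (-(κ * t)) * a₀ +
      ∫ s in (0 : ℝ)..t, Real.exp (-(κ * (t - s))) * f s) :
    IsPrim a fun t => -(κ * a t) + f t := by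
  have h0 : IsPrim (fun t => a₀ + ∫ s in (0 : ℝ)..t, Real.exp (κ * s) * f s)
      (fun s => Real.exp (κ * s) * f s) :=
    ⟨fun T hT => (hf T hT).continuousOn_mul (by fun_prop), fun t ht => by simp⟩
  have h1 := (IsPrim.exp (-κ)).mul h0
  have e : ∀ t ≥ 0, a t = Real.exp (-κ * t) *
      (a₀ + ∫ s in (0 : ℝ)..t, Real.exp (κ * s) * f s) := fun t ht => by
    have e2 : ∀ s, Real.exp (-(κ * (t - s))) * f s =
        Real.exp (-(κ * t)) * (Real.exp (κ * s) * f s) := fun s => by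
      rw [← mul_assoc, ← Real.exp_add]
      ring_nf
    rw [h t ht]
    simp only [e2, intervalIntegral.integral_const_mul]
    rw [← mul_add, neg_mul]
  refine h1.congr e ?_
  filter_upwards [ae_restrict_mem measurableSet_Ioi] with t ht
  have e3 : Real.exp (-κ * t) * Real.exp (κ * t) = 1 := by rw [← Real.exp_add]; simp
  rw [e t (le_of_lt ht), ← mul_assoc (Real.exp (-κ * t)) (Real.exp (κ * t)), e3]
  ring

end IsPrim

/-! ### Gronwall estimates -/

/-- Difference quotients of `F` are averages of `f`, hence eventually below any number exceeding `K
F(x) + H`, by continuity of `F`. This is what Gronwall's inequality for lower right derivatives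
requires. The rate `K` may be negative, which is how uniform bounds in time arise. -/
theorem IsPrim.le_gronwallBound {F f : ℝ → ℝ} (h : IsPrim F f) {K H T : ℝ}
    (hle : ∀ᵐ t ∂volume.restrict (Ioi 0), t ≤ T → f t ≤ K * F t + H) :
    ∀ t ∈ Icc 0 T, F t ≤ gronwallBound (F 0) K H t := by
  intro t ht
  have hT : 0 ≤ T := ht.1.trans ht.2
  have hc : ContinuousOn F (Icc 0 T) := h.continuousOn.mono fun s hs => hs.1
  have := le_gronwallBound_of_liminf_deriv_right_le (f := F) (f' := fun t => K * F t + H)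
    (δ := F 0) (K := K) (ε := H) (a := 0) (b := T) hc ?_ le_rfl (fun _ _ => le_rfl) t ht
  · simpa using this
  · intro x hx r hr
    refine Eventually.frequently ?_
    have hx1 : ContinuousWithinAt (fun t => K * F t + H) (Icc 0 T) x :=
      (continuousWithinAt_const.mul (hc x ⟨hx.1, hx.2.le⟩)).add continuousWithinAt_const
    obtain ⟨r', hr1, hr2⟩ := exists_between hr
    have hev : ∀ᶠ z in 𝓝[>] x, ∀ y ∈ Icc x z, y ≤ T ∧ K * F y + H < r' := by
      have h1 : {y | K * F y + H < r'} ∈ 𝓝[Icc 0 T] x := hx1.eventually (gt_mem_nhds hr1)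
      have h2 : {y | K * F y + H < r'} ∩ Icc 0 T ∈ 𝓝[≥] x := by
        have : Icc 0 T ∈ 𝓝[≥] x := by
          rw [mem_nhdsGE_iff_exists_Icc_subset]
          exact ⟨T, hx.2, Icc_subset_Icc_left hx.1⟩
        refine inter_mem ?_ this
        exact nhdsWithin_le_of_mem this h1
      obtain ⟨u, hu, hsub⟩ := mem_nhdsGE_iff_exists_Icc_subset.1 h2
      filter_upwards [Ioc_mem_nhdsGT hu] with z hz y hy
      have := hsub ⟨hy.1, hy.2.trans hz.2⟩
      exact ⟨this.2.2, this.1⟩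
    filter_upwards [hev, self_mem_nhdsWithin] with z hz hxz
    have hxz : x < z := hxz
    have h0z : 0 ≤ z := hx.1.trans hxz.le
    rw [h.sub_eq hx.1 h0z]
    have h3 : ∫ s in x..z, f s ≤ ∫ _ in x..z, r' := by
      refine intervalIntegral.integral_mono_ae_restrict hxz.le (h.intervalIntegrable' hx.1 h0z)
        intervalIntegrable_const ?_
      have h4 : ∀ᵐ t ∂volume.restrict (Ioc x z), t ≤ T → f t ≤ K * F t + H :=
        ae_restrict_of_ae_restrict_of_subset (fun s hs => lt_of_le_of_lt hx.1 hs.1) hle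
      rw [← restrict_Ioc_eq_restrict_Icc]
      filter_upwards [h4, ae_restrict_mem measurableSet_Ioc] with s hs hs'
      have := hz s ⟨hs'.1.le, hs'.2⟩
      exact (hs this.1).trans this.2.le
    rw [intervalIntegral.integral_const, smul_eq_mul] at h3
    rw [inv_mul_lt_iff₀ (sub_pos.2 hxz)]
    exact h3.trans_lt (mul_lt_mul_of_pos_left hr2 (sub_pos.2 hxz))

theorem gronwallBound_mono_left {δ δ' K ε t : ℝ} (h : δ ≤ δ') :
    gronwallBound δ K ε t ≤ gronwallBound δ' K ε t := by
  unfold gronwallBound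
  split_ifs <;> gcongr

theorem gronwallBound_neg_le {δ K H t : ℝ} (hδ : 0 ≤ δ) (hK : 0 < K) (hH : 0 ≤ H) (ht : 0 ≤ t) :
    gronwallBound δ (-K) H t ≤ δ + H / K := by
  rw [gronwallBound_of_K_ne_0 (by linarith)]
  have h1 : Real.exp (-K * t) ≤ 1 := Real.exp_le_one_iff.2 (by nlinarith)
  have h2 : H / -K * (Real.exp (-K * t) - 1) = H / K * (1 - Real.exp (-K * t)) := by
    rw [div_neg]; ring
  simp only [h2]
  have h3 : 0 ≤ H / K := by positivity
  nlinarith [Real.exp_pos (-K * t)]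

/-! ### Weak derivatives in time -/

theorem integral_deriv_mul_eq_neg {F f : ℝ → ℝ} (h : IsPrim F f) {ψ : ℝ → ℝ}
    (h1 : ContDiff ℝ ∞ ψ) (h2 : HasCompactSupport ψ) {J : Set ℝ}
    (h3 : tsupport ψ ⊆ J) (hJ0 : J ⊆ Ioi 0) :
    ∫ t in J, deriv ψ t * F t = - ∫ t in J, ψ t * f t := by
  obtain ⟨T, hT0, hT⟩ : ∃ T > 0, tsupport ψ ⊆ Icc 0 T := by
    obtain ⟨T, hT⟩ := h2.isCompact.bddAbove
    exact ⟨max T 1, by positivity, fun t ht =>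
      ⟨(hJ0 (h3 ht)).le, (hT ht).trans (le_max_left _ _)⟩⟩
  have hd : Continuous (deriv ψ) := h1.continuous_deriv (by simp)
  have hψ : IsPrim ψ (deriv ψ) := IsPrim.of_hasDerivWithinAt hd.continuousOn fun t _ =>
    ((h1.differentiable (by simp) t).hasDerivAt).hasDerivWithinAt
  have h0 : ψ 0 = 0 := image_eq_zero_of_notMem_tsupport fun hm =>
    lt_irrefl (0 : ℝ) (mem_Ioi.1 (hJ0 (h3 hm)))
  have hT1 : ψ (T + 1) = 0 := image_eq_zero_of_notMem_tsupport fun hm => by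
    linarith [(hT hm).2]
  have hT' : 0 ≤ T + 1 := by linarith
  have hsub : uIcc 0 (T + 1) ⊆ Ici (0 : ℝ) := by
    rw [uIcc_of_le hT']; exact fun s hs => hs.1
  have key := (hψ.mul h).eq_integral (T + 1) hT'
  rw [h0, hT1, zero_mul, zero_mul, zero_add, intervalIntegral.integral_add
    ((h.continuousOn.mono hsub).intervalIntegrable.continuousOn_mul hd.continuousOn)
    ((h.1 _ hT').continuousOn_mul h1.continuous.continuousOn)] at key
  have conv : ∀ q : ℝ → ℝ, (∀ t ∉ tsupport ψ, q t = 0) →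
      ∫ t in J, q t = ∫ t in (0 : ℝ)..(T + 1), q t := fun q hq => by
    rw [intervalIntegral.integral_of_le hT', setIntegral_eq_integral_of_forall_compl_eq_zero
      (fun t ht => hq t fun hm => ht (h3 hm)), setIntegral_eq_integral_of_forall_compl_eq_zero
      (s := Ioc 0 (T + 1)) (f := q)
      (fun t ht => hq t fun hm => ht ⟨hJ0 (h3 hm), by linarith [(hT hm).2]⟩)]
  rw [conv _ fun t ht => ?_, conv _ fun t ht => ?_]
  · linarith
  · rw [image_eq_zero_of_notMem_tsupport ht, zero_mul]
  · rw [image_eq_zero_of_notMem_tsupport fun hm => ht (tsupport_deriv_subset hm), zero_mul]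

/-- Weak differentiability of a vector valued path is tested through a separating family of
functionals. In the dual spaces these are the evaluations at eigenvectors, where scalar equations
are available. -/
theorem hasWeakDerivOn_of_isPrim {E ι : Type*} [NormedAddCommGroup E] [NormedSpace ℝ E]
    [CompleteSpace E] {F f : ℝ → E} {J : Set ℝ} (hJ0 : J ⊆ Ioi 0)
    (hF : LocallyIntegrableOn F J) (hf : LocallyIntegrableOn f J) (L : ι → E →L[ℝ] ℝ)
    (hL : ∀ x y, (∀ i, L i x = L i y) → x = y)
    (h : ∀ i, IsPrim (fun t => L i (F t)) (fun t => L i (f t))) : HasWeakDerivOn F f J := by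
  refine ⟨hF, hf, fun ψ h1 h2 h3 => hL _ _ fun i => ?_⟩
  have key : ∀ (q : ℝ → ℝ) (G : ℝ → E), LocallyIntegrableOn G J → Continuous q →
      tsupport q ⊆ tsupport ψ → IntegrableOn (fun t => q t • G t) J := by
    intro q G hG hq hs
    have hcs : IsCompact (tsupport q) := h2.isCompact.of_isClosed_subset (isClosed_tsupport _) hs
    have h4 : IntegrableOn (fun t => q t • G t) (tsupport q) :=
      (hG.integrableOn_compact_subset (hs.trans h3) hcs).continuousOn_smul hq.continuousOn hcs
    refine (integrableOn_iff_integrable_of_support_subset ?_).1 h4 |>.integrableOn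
    intro t ht
    by_contra hcon
    exact ht (by simp [image_eq_zero_of_notMem_tsupport hcon])
  have hd : Continuous (deriv ψ) := h1.continuous_deriv (by simp)
  rw [map_neg, ← ContinuousLinearMap.integral_comp_comm _
      (key _ _ hF hd (closure_minimal (support_deriv_subset) (isClosed_tsupport _))),
    ← ContinuousLinearMap.integral_comp_comm _ (key _ _ hf h1.continuous subset_rfl)]
  simp only [map_smul, smul_eq_mul]
  exact integral_deriv_mul_eq_neg (h i) h1 h2 h3 hJ0

/-- A continuous function on `[0, ∞)` is a primitive of its weak derivative. -/
theorem isPrim_of_hasWeakDerivOn {E : Type*} [NormedAddCommGroup E] [NormedSpace ℝ E]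
    [CompleteSpace E] [FiniteDimensional ℝ E] {F f : ℝ → E} (hF : ContinuousOn F (Ici 0))
    (hf : ∀ T ≥ 0, IntervalIntegrable f volume 0 T) (h : HasWeakDerivOn F f (Ioi 0)) :
    IsPrim F f := by
  set P : ℝ → E := fun t => ∫ s in (0 : ℝ)..t, f s
  have hP : IsPrim P f := ⟨hf, fun t _ => by simp [P]⟩
  set G : ℝ → E := fun t => F t - P t
  have hGc : ContinuousOn G (Ici 0) := hF.sub hP.continuousOn
  have hGc' : ContinuousOn G (Ioi 0) := hGc.mono Ioi_subset_Ici_self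
  have hGl : LocallyIntegrableOn G (Ioi 0) := hGc'.locallyIntegrableOn measurableSet_Ioi
  have hPl : LocallyIntegrableOn P (Ioi 0) :=
    (hP.continuousOn.mono Ioi_subset_Ici_self).locallyIntegrableOn measurableSet_Ioi
  have hint : ∀ (q : ℝ → ℝ) (R : ℝ → E), LocallyIntegrableOn R (Ioi 0) → Continuous q →
      HasCompactSupport q → tsupport q ⊆ Ioi 0 → IntegrableOn (fun t => q t • R t) (Ioi 0) := by
    intro q R hR hq hcs hs
    have h4 : IntegrableOn (fun t => q t • R t) (tsupport q) :=
      (hR.integrableOn_compact_subset hs hcs.isCompact).continuousOn_smul hq.continuousOn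
        hcs.isCompact
    refine (integrableOn_iff_integrable_of_support_subset ?_).1 h4 |>.integrableOn
    intro t ht
    by_contra hcon
    exact ht (by simp [image_eq_zero_of_notMem_tsupport hcon])
  have hPw : HasWeakDerivOn P f (Ioi 0) :=
    hasWeakDerivOn_of_isPrim subset_rfl hPl h.2.1 (fun L : StrongDual ℝ E => L)
      (fun x y hxy => by
        by_contra hne
        obtain ⟨L, hL⟩ := SeparatingDual.exists_ne_zero (R := ℝ) (sub_ne_zero.2 hne)
        exact hL (by rw [map_sub, hxy L, sub_self]))
      (fun L => hP.clm_comp L)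
  have hG0 : ∀ ψ : ℝ → ℝ, ContDiff ℝ ∞ ψ → HasCompactSupport ψ → tsupport ψ ⊆ Ioi 0 →
      ∫ t in Ioi 0, deriv ψ t • G t = 0 := by
    intro ψ h1 h2 h3
    have hd : Continuous (deriv ψ) := h1.continuous_deriv (by simp)
    have hs : tsupport (deriv ψ) ⊆ Ioi 0 := (tsupport_deriv_subset).trans h3
    simp only [G, smul_sub]
    rw [integral_sub (hint _ _ h.1 hd h2.deriv hs) (hint _ _ hPl hd h2.deriv hs),
      h.2.2 ψ h1 h2 h3, hPw.2.2 ψ h1 h2 h3, sub_self]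
  -- The lemma of du Bois-Reymond. The constant is the average of `G` against a fixed bump supported
  -- in `[1, 3]`.
  obtain ⟨m, hm⟩ : ∃ m : E, ∀ t ∈ Ioi (0 : ℝ), G t = m := by
    let b : ContDiffBump (2 : ℝ) := ⟨1 / 2, 1, by norm_num, by norm_num⟩
    let η : ℝ → ℝ := b.normed volume
    have hη : ContDiff ℝ ∞ η := b.contDiff_normed
    have hηc : HasCompactSupport η := b.hasCompactSupport_normed
    have hηs : tsupport η ⊆ Ioi 0 := by
      rw [b.tsupport_normed_eq]
      intro t ht
      rw [Metric.mem_closedBall, Real.dist_eq] at ht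
      have := (abs_le.1 ht).1
      simp only [b] at this
      exact show (0 : ℝ) < t by linarith
    have hη1 : ∫ t, η t = 1 := b.integral_normed
    set m : E := ∫ t in Ioi 0, η t • G t
    refine ⟨m, ?_⟩
    have hae : ∀ᵐ t, t ∈ Ioi (0 : ℝ) → G t - m = 0 := by
      refine isOpen_Ioi.ae_eq_zero_of_integral_contDiff_smul_eq_zero
        (hGl.sub (locallyIntegrableOn_const m)) fun χ hχ hχc hχs => ?_
      set a : ℝ := ∫ t, χ t
      -- Having mean zero, `θ` is the derivative of a compactly supported function, so it
      -- annihilates `G`.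
      set θ : ℝ → ℝ := fun t => χ t - a * η t
      have hθ : ContDiff ℝ ∞ θ := by fun_prop
      have hθc : HasCompactSupport θ := hχc.sub hηc.mul_left
      have hθs : tsupport θ ⊆ Ioi 0 := by
        refine (tsupport_sub _ _).trans (union_subset hχs ?_)
        exact (tsupport_mul_subset_right).trans hηs
      have hχi : Integrable χ := hχ.continuous.integrable_of_hasCompactSupport hχc
      have hηi : Integrable η := hη.continuous.integrable_of_hasCompactSupport hηc
      have hθi : Integrable θ := hθ.continuous.integrable_of_hasCompactSupport hθc
      have hθ0 : ∫ t, θ t = 0 := by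
        rw [integral_sub hχi (hηi.const_mul a), integral_const_mul, hη1, mul_one, sub_self]
      obtain ⟨A, B, hA, hAB⟩ : ∃ A B : ℝ, 0 < A ∧ tsupport θ ⊆ Icc A B := by
        rcases (tsupport θ).eq_empty_or_nonempty with he | hne
        · exact ⟨1, 1, one_pos, by simp [he]⟩
        · obtain ⟨B, hB⟩ := hθc.isCompact.bddAbove
          obtain ⟨A, hA⟩ := hθc.isCompact.exists_isLeast hne
          exact ⟨A, B, hθs hA.1, fun t ht => ⟨hA.2 ht, hB ht⟩⟩
      set ψ : ℝ → ℝ := fun t => ∫ s in (0 : ℝ)..t, θ s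
      have hψd : ∀ t, HasDerivAt ψ (θ t) t := fun t =>
        intervalIntegral.integral_hasDerivAt_right (hθ.continuous.intervalIntegrable _ _)
          (hθ.continuous.stronglyMeasurableAtFilter _ _) hθ.continuous.continuousAt
      have hψ' : deriv ψ = θ := funext fun t => (hψd t).deriv
      have hψ : ContDiff ℝ ∞ ψ := by
        rw [contDiff_infty_iff_deriv, hψ']
        exact ⟨fun t => (hψd t).differentiableAt, hθ⟩
      have hz : ∀ t ∉ Icc A B, θ t = 0 := fun t ht =>
        image_eq_zero_of_notMem_tsupport fun hm => ht (hAB hm)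
      have hψs : Function.support ψ ⊆ Icc A B := by
        intro t ht
        by_contra hcon
        refine ht ?_
        rw [mem_Icc, not_and_or, not_le, not_le] at hcon
        rcases hcon with hcon | hcon
        · refine (intervalIntegral.integral_congr (g := fun _ => (0 : ℝ)) fun s hs => hz s ?_).trans
            (by simp)
          rintro ⟨h1, -⟩
          rcases (mem_uIcc.1 hs) with hs | hs <;> linarith
        · have h0 : ∫ s in (0 : ℝ)..t, θ s = ∫ s, θ s := by
            rcases le_total 0 t with ht0 | ht0
            · rw [intervalIntegral.integral_of_le ht0,
                setIntegral_eq_integral_of_forall_compl_eq_zero]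
              intro s hs
              refine hz s fun hs' => hs ⟨hA.trans_le hs'.1, hs'.2.trans hcon.le⟩
            · have : ∀ s, θ s = 0 := fun s => hz s fun hs' => by linarith [hs'.1, hs'.2]
              simp [this]
          exact h0.trans hθ0
      have hψt : tsupport ψ ⊆ Icc A B := closure_minimal hψs isClosed_Icc
      have hψc : HasCompactSupport ψ := isCompact_Icc.of_isClosed_subset (isClosed_tsupport _) hψt
      have h5 := hG0 ψ hψ hψc fun t ht => hA.trans_le (hψt ht).1
      rw [hψ'] at h5
      have i1 := hint χ G hGl hχ.continuous hχc hχs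
      have i2 := hint η G hGl hη.continuous hηc hηs
      have e1 : ∫ t in Ioi 0, θ t • G t = (∫ t in Ioi 0, χ t • G t) - a • m := by
        simp only [θ, sub_smul, mul_smul]
        have i3 : IntegrableOn (fun t => a • η t • G t) (Ioi 0) volume := Integrable.smul a i2
        rw [integral_sub i1 i3, integral_smul]
      have e2 : ∫ t, χ t • (G t - m) = ∫ t in Ioi 0, χ t • (G t - m) := by
        rw [setIntegral_eq_integral_of_forall_compl_eq_zero]
        intro t ht
        rw [image_eq_zero_of_notMem_tsupport fun hm => ht (hχs hm), zero_smul]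
      have e3 : ∫ t in Ioi 0, χ t • m = a • m := by
        rw [setIntegral_eq_integral_of_forall_compl_eq_zero, integral_smul_const]
        intro t ht
        rw [image_eq_zero_of_notMem_tsupport fun hm => ht (hχs hm), zero_smul]
      rw [e2]
      simp only [smul_sub]
      rw [integral_sub i1 (hχi.integrableOn.smul_const m), e3, ← e1, h5]
    intro t ht
    by_contra hne
    have h6 : ∀ᵐ t ∂volume.restrict (Ioi (0 : ℝ)), G t = m := by
      rw [ae_restrict_iff' measurableSet_Ioi]
      filter_upwards [hae] with t ht h
      exact sub_eq_zero.1 (ht h)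
    exact hne (Measure.eqOn_open_of_ae_eq h6 isOpen_Ioi hGc' continuousOn_const ht)
  refine ⟨hf, fun t ht => ?_⟩
  have hm0 : ∀ t ∈ Ici (0 : ℝ), G t = m := by
    intro t ht
    have h7 : EqOn G (fun _ => m) (closure (Ioi 0) ∩ Ici 0) := by
      intro s hs
      rw [closure_Ioi, inter_self] at hs
      rcases eq_or_lt_of_le (show (0 : ℝ) ≤ s from hs) with h0 | h0
      · subst h0
        have l1 : Tendsto G (𝓝[>] 0) (𝓝 (G 0)) :=
          (hGc 0 (mem_Ici.2 le_rfl)).mono_left (nhdsWithin_mono _ Ioi_subset_Ici_self)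
        have l2 : Tendsto G (𝓝[>] 0) (𝓝 m) := by
          refine tendsto_const_nhds.congr' ?_
          filter_upwards [self_mem_nhdsWithin] with r hr
          exact (hm r hr).symm
        exact tendsto_nhds_unique l1 l2
      · exact hm s h0
    refine h7 ?_
    rw [closure_Ioi, inter_self]
    exact ht
  have h8 := hm0 t ht
  have h9 := hm0 0 (mem_Ici.2 le_rfl)
  simp only [G, P, intervalIntegral.integral_same, sub_zero] at h8 h9
  rw [h9, ← h8]
  abel

end

section

/-! ### Triangular systems indexed by multi-indices -/

variable {n : ℕ}

/-- The multi-indices of degree at most `N`. -/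
def degBox (n N : ℕ) : Finset (Fin n → ℕ) :=
  (Fintype.piFinset fun _ : Fin n => Finset.range (N + 1)).filter fun k => ∑ j, k j ≤ N

theorem mem_degBox {N : ℕ} {k : Fin n → ℕ} : k ∈ degBox n N ↔ ∑ j, k j ≤ N := by
  rw [degBox, Finset.mem_filter, Fintype.mem_piFinset]
  refine ⟨fun h => h.2, fun h => ⟨fun j => ?_, h⟩⟩
  rw [Finset.mem_range]
  have := Finset.single_le_sum (f := k) (fun i _ => Nat.zero_le _) (Finset.mem_univ j)
  omega

theorem exists_subset_degBox (s : Finset (Fin n → ℕ)) : ∃ N, s ⊆ degBox n N :=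
  ⟨∑ k ∈ s, ∑ j, k j, fun _ hk => mem_degBox.2
    (Finset.single_le_sum (f := fun k : Fin n → ℕ => ∑ j, k j) (fun _ _ => Nat.zero_le _) hk)⟩

theorem sum_add_single (k : Fin n → ℕ) (j : Fin n) :
    ∑ i, (k + Pi.single j 1 : Fin n → ℕ) i = (∑ i, k i) + 1 := by
  simp [Finset.sum_add_distrib]

/-- Lowering an index stays inside the box. This moves the coupling terms `a_{k - e_j}²` back to the
index `k`, with a shifted weight. -/
theorem sum_shift_le (N : ℕ) (j : Fin n) {f : (Fin n → ℕ) → ℝ} (hf : ∀ k, 0 ≤ f k) :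
    ∑ k ∈ degBox n N, (if k j = 0 then 0 else f k) ≤
      ∑ k ∈ degBox n N, f (k + Pi.single j 1) := by
  classical
  have hinj : Function.Injective fun k : Fin n → ℕ => k + Pi.single j 1 :=
    fun k m hkm => add_right_cancel hkm
  rw [← Finset.sum_image (f := f) (g := fun k => k + Pi.single j 1) hinj.injOn]
  have e : ∑ k ∈ degBox n N, (if k j = 0 then 0 else f k) =
      ∑ k ∈ (degBox n N).filter (fun k => k j ≠ 0), f k := by
    rw [Finset.sum_filter]
    exact Finset.sum_congr rfl fun k _ => by by_cases h : k j = 0 <;> simp [h]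
  rw [e]
  refine Finset.sum_le_sum_of_subset_of_nonneg (fun k hk => ?_) fun k _ _ => hf k
  rw [Finset.mem_filter, mem_degBox] at hk
  rw [Finset.mem_image]
  refine ⟨k - Pi.single j 1, mem_degBox.2 ?_, sub_add_single hk.2⟩
  have := sum_add_single (k - Pi.single j 1) j
  rw [sub_add_single hk.2] at this
  omega

theorem eigVal_add_single (l : Fin n → ℝ) (k : Fin n → ℕ) (j : Fin n) :
    eigVal l (k + Pi.single j 1) = eigVal l k + l j := by
  simp only [eigVal, Pi.add_apply, Nat.cast_add, mul_add, Finset.sum_add_distrib]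
  congr 1
  rw [Finset.sum_eq_single j (fun i _ hi => by simp [hi]) (by simp)]
  simp

/-- The coupling and source terms of the triangular system. -/
def triForce (l : Fin n → ℝ) (b : Fin n → ℝ → ℝ) (d : (Fin n → ℕ) → ℝ → ℝ)
    (a : (Fin n → ℕ) → ℝ → ℝ) (k : Fin n → ℕ) (t : ℝ) : ℝ :=
  ∑ j, b j t * (√(l j * k j) * a (k - Pi.single j 1) t) + d k t

/-- `a` solves `a_k' = -c μ_k a_k + ∑ⱼ bⱼ √(lⱼ kⱼ) a_{k - eⱼ} + d_k`. -/
def IsTriSol (c : ℝ) (l : Fin n → ℝ) (b : Fin n → ℝ → ℝ) (d : (Fin n → ℕ) → ℝ → ℝ)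
    (a : (Fin n → ℕ) → ℝ → ℝ) : Prop :=
  ∀ k, IsPrim (a k) fun t => -(c * eigVal l k * a k t) + triForce l b d a k t

section Tri

variable {c : ℝ} {l : Fin n → ℝ} {b : Fin n → ℝ → ℝ} {d a : (Fin n → ℕ) → ℝ → ℝ}

theorem intervalIntegrable_triForce (hb : ∀ j, ContinuousOn (b j) (Ici 0))
    (hd : ∀ k, ∀ T ≥ 0, IntervalIntegrable (d k) volume 0 T)
    (ha : ∀ k, ContinuousOn (a k) (Ici 0)) (k : Fin n → ℕ) :
    ∀ T ≥ 0, IntervalIntegrable (triForce l b d a k) volume 0 T := by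
  intro T hT
  refine IntervalIntegrable.add (ContinuousOn.intervalIntegrable ?_) (hd k T hT)
  have hsub : uIcc 0 T ⊆ Ici (0 : ℝ) := by rw [uIcc_of_le hT]; exact fun s hs => hs.1
  exact continuousOn_finsetSum _ fun j _ => ((hb j).mono hsub).mul
    (continuousOn_const.mul ((ha _).mono hsub))

theorem triForce_congr {a' : (Fin n → ℕ) → ℝ → ℝ} {k : Fin n → ℕ} {t : ℝ}
    (h : ∀ j, k j ≠ 0 → a (k - Pi.single j 1) t = a' (k - Pi.single j 1) t) :
    triForce l b d a k t = triForce l b d a' k t := by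
  unfold triForce
  congr 1
  refine Finset.sum_congr rfl fun j _ => ?_
  by_cases hj : k j = 0
  · simp [hj]
  · rw [h j hj]

theorem sum_sub_single_add_one {k : Fin n → ℕ} {j : Fin n} (hj : k j ≠ 0) :
    ∑ i, (k - Pi.single j 1 : Fin n → ℕ) i + 1 = ∑ i, k i := by
  rw [← sum_add_single, sub_add_single hj]

/-- By variation of constants a mode is determined by its initial value, its source and modes of
smaller degree. -/
theorem IsTriSol.unique {a' : (Fin n → ℕ) → ℝ → ℝ} {T : ℝ}
    {b' : Fin n → ℝ → ℝ} (hbb : ∀ j, EqOn (b j) (b' j) (Icc 0 T))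
    (h : IsTriSol c l b d a) (h' : IsTriSol c l b' d a')
    (h0 : ∀ k, a k 0 = a' k 0) (k : Fin n → ℕ) : EqOn (a k) (a' k) (Icc 0 T) := by
  induction hm : ∑ j, k j using Nat.strong_induction_on generalizing k with
  | _ m ih =>
    intro t ht
    rw [(h k).eq_exp_mul ht.1, (h' k).eq_exp_mul ht.1, h0]
    congr 1
    refine intervalIntegral.integral_congr fun s hs => ?_
    rw [uIcc_of_le ht.1] at hs
    have hs' : s ∈ Icc 0 T := ⟨hs.1, hs.2.trans ht.2⟩
    congr 1
    have e : triForce l b d a k s = triForce l b' d a k s := by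
      simp only [triForce, hbb _ hs']
    rw [e]
    refine triForce_congr fun j hj => ?_
    have h1 := sum_sub_single_add_one hj
    exact ih (∑ i, (k - Pi.single j 1 : Fin n → ℕ) i) (by omega) _ rfl hs'

/-- Iterated solution of the triangular system, degree by degree. -/
def triIter (c : ℝ) (l : Fin n → ℝ) (b : Fin n → ℝ → ℝ) (d : (Fin n → ℕ) → ℝ → ℝ)
    (a₀ : (Fin n → ℕ) → ℝ) : ℕ → (Fin n → ℕ) → ℝ → ℝ
  | 0 => fun _ _ => 0
  | N + 1 => fun k t => Real.exp (-(c * eigVal l k * t)) * a₀ k + ∫ s in (0 : ℝ)..t,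
      Real.exp (-(c * eigVal l k * (t - s))) * triForce l b d (triIter c l b d a₀ N) k s

theorem exists_isTriSol (hb : ∀ j, ContinuousOn (b j) (Ici 0))
    (hd : ∀ k, ∀ T ≥ 0, IntervalIntegrable (d k) volume 0 T) (a₀ : (Fin n → ℕ) → ℝ) :
    ∃ a, IsTriSol c l b d a ∧ ∀ k, a k 0 = a₀ k := by
  set A := triIter c l b d a₀
  have hAc : ∀ N k, ContinuousOn (A N k) (Ici 0) := by
    intro N
    induction N with
    | zero => exact fun k => continuousOn_const
    | succ N ih =>
      exact fun k => (IsPrim.of_eq_exp_mul (κ := c * eigVal l k) (a₀ := a₀ k)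
        (intervalIntegrable_triForce hb hd ih k) fun t _ => rfl).continuousOn
  -- A mode of degree `m` is final after `m + 1` iterations, as only smaller degrees feed it.
  set a : (Fin n → ℕ) → ℝ → ℝ := fun k => A (∑ j, k j + 1) k
  have hforce : ∀ k s, triForce l b d (A (∑ j, k j)) k s = triForce l b d a k s := fun k s => by
    refine triForce_congr fun j hj => ?_
    simp only [a]
    rw [sum_sub_single_add_one hj]
  refine ⟨a, fun k => ?_, fun k => ?_⟩
  · refine IsPrim.of_eq_exp_mul (a₀ := a₀ k)
      (intervalIntegrable_triForce hb hd (fun k => hAc _ k) k) fun t _ => ?_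
    simp only [← hforce]
    rfl
  · have : a k 0 = Real.exp (-(c * eigVal l k * 0)) * a₀ k + ∫ s in (0 : ℝ)..0,
      Real.exp (-(c * eigVal l k * (0 - s))) * triForce l b d (A (∑ j, k j)) k s := rfl
    rw [this]
    simp

/-! ### Energy estimates -/

/-- The rate of change of the weighted energy. -/
def energyRate (c : ℝ) (l : Fin n → ℝ) (b : Fin n → ℝ → ℝ) (d a : (Fin n → ℕ) → ℝ → ℝ)
    (w : (Fin n → ℕ) → ℝ) (N : ℕ) (t : ℝ) : ℝ :=
  ∑ k ∈ degBox n N, w k * (2 * a k t * (-(c * eigVal l k * a k t) + triForce l b d a k t))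

theorem IsTriSol.isPrim_energy (h : IsTriSol c l b d a) (w : (Fin n → ℕ) → ℝ) (N : ℕ) :
    IsPrim (fun t => ∑ k ∈ degBox n N, w k * a k t ^ 2) (energyRate c l b d a w N) := by
  refine IsPrim.sum _ fun k _ => IsPrim.const_mul ?_ (w k)
  have := (h k).mul (h k)
  refine this.congr (fun t _ => sq _) (Eventually.of_forall fun t => ?_)
  ring

/-- Young's inequality bounds each coupling term by `c l_j k_j a_k² + c⁻¹ b_j² a_{k - e_j}²`. Summed
over `j`, the first part uses up half of the dissipation `2 c μ_k a_k²`. The second is reindexed and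
becomes diagonal, with no growth in `k` beyond that of the weight. -/
theorem energyRate_le (hc : 0 < c) (hl : ∀ j, 0 < l j) {w : (Fin n → ℕ) → ℝ} (hw : ∀ k, 0 ≤ w k)
    (N : ℕ) (t : ℝ) : energyRate c l b d a w N t ≤
      -(c * ∑ k ∈ degBox n N, w k * eigVal l k * a k t ^ 2) +
      c⁻¹ * ∑ k ∈ degBox n N, (∑ j, w (k + Pi.single j 1) * b j t ^ 2) * a k t ^ 2 +
      2 * ∑ k ∈ degBox n N, w k * a k t * d k t := by
  have hterm : ∀ k : Fin n → ℕ, ∀ j, 2 * a k t * (b j t *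
      (√(l j * k j) * a (k - Pi.single j 1) t)) ≤
      c * (l j * k j) * a k t ^ 2 +
        c⁻¹ * (if k j = 0 then 0 else b j t ^ 2 * a (k - Pi.single j 1) t ^ 2) := by
    intro k j
    by_cases hj : k j = 0
    · simp [hj]
    · rw [if_neg hj]
      have h1 : √(l j * k j) ^ 2 = l j * k j :=
        Real.sq_sqrt (mul_nonneg (hl j).le (Nat.cast_nonneg _))
      set r := √(l j * k j)
      rw [← h1]
      set y := b j t * a (k - Pi.single j 1) t
      have h2 : 0 ≤ c⁻¹ * (c * (r * a k t) - y) ^ 2 := by positivity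
      have h3 : c⁻¹ * (c * (r * a k t) - y) ^ 2 =
          c * r ^ 2 * a k t ^ 2 - 2 * (r * a k t * y) + c⁻¹ * y ^ 2 := by
        field_simp
        ring
      have h4 : y ^ 2 = b j t ^ 2 * a (k - Pi.single j 1) t ^ 2 := mul_pow _ _ _
      rw [← h4]
      have h5 : 2 * a k t * (b j t * (r * a (k - Pi.single j 1) t)) = 2 * (r * a k t * y) := by
        simp only [y]; ring
      linarith
  have hk : ∀ k : Fin n → ℕ,
      w k * (2 * a k t * (-(c * eigVal l k * a k t) + triForce l b d a k t)) ≤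
      -(c * (w k * eigVal l k * a k t ^ 2)) + c⁻¹ * (∑ j, if k j = 0 then 0 else
        w k * (b j t ^ 2 * a (k - Pi.single j 1) t ^ 2)) + 2 * (w k * a k t * d k t) := by
    intro k
    have h1 := Finset.sum_le_sum fun j (_ : j ∈ Finset.univ) => hterm k j
    rw [Finset.sum_add_distrib, ← Finset.mul_sum, ← Finset.mul_sum, ← Finset.sum_mul,
      ← Finset.mul_sum] at h1
    have h2 : (∑ j, if k j = 0 then (0 : ℝ) else
        w k * (b j t ^ 2 * a (k - Pi.single j 1) t ^ 2)) =
        w k * ∑ j, if k j = 0 then (0 : ℝ) else b j t ^ 2 * a (k - Pi.single j 1) t ^ 2 := by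
      rw [Finset.mul_sum]
      exact Finset.sum_congr rfl fun j _ => by split_ifs <;> simp
    rw [h2, triForce]
    have h3 := mul_le_mul_of_nonneg_left h1 (hw k)
    have h4 : ∑ j, l j * (k j : ℝ) = eigVal l k := rfl
    rw [h4] at h3
    linarith
  refine (Finset.sum_le_sum fun k _ => hk k).trans ?_
  rw [Finset.sum_add_distrib, Finset.sum_add_distrib, Finset.sum_neg_distrib, ← Finset.mul_sum,
    ← Finset.mul_sum, ← Finset.mul_sum]
  have hS : ∑ k ∈ degBox n N, (∑ j, if k j = 0 then 0 else
      w k * (b j t ^ 2 * a (k - Pi.single j 1) t ^ 2)) ≤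
      ∑ k ∈ degBox n N, (∑ j, w (k + Pi.single j 1) * b j t ^ 2) * a k t ^ 2 := by
    simp only [Finset.sum_mul]
    rw [Finset.sum_comm, Finset.sum_comm (s := degBox n N)]
    refine Finset.sum_le_sum fun j _ => ?_
    have := sum_shift_le N j (f := fun k => w k * (b j t ^ 2 * a (k - Pi.single j 1) t ^ 2))
      fun k => mul_nonneg (hw k) (by positivity)
    refine this.trans (le_of_eq (Finset.sum_congr rfl fun k _ => ?_))
    rw [show k + Pi.single j 1 - Pi.single j 1 = k from funext fun i => by simp]
    ring
  have := mul_le_mul_of_nonneg_left hS (inv_pos.2 hc).le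
  linarith

theorem two_sum_mul_le {ι : Type*} (s : Finset ι) {w : ι → ℝ} (hw : ∀ k, 0 ≤ w k) (x y : ι → ℝ) :
    2 * ∑ k ∈ s, w k * x k * y k ≤ ∑ k ∈ s, w k * x k ^ 2 + ∑ k ∈ s, w k * y k ^ 2 := by
  rw [Finset.mul_sum, ← Finset.sum_add_distrib]
  refine Finset.sum_le_sum fun k _ => ?_
  nlinarith [mul_nonneg (hw k) (sq_nonneg (x k - y k))]

theorem eigVal_nonneg' (hl : ∀ j, 0 < l j) (k : Fin n → ℕ) : 0 ≤ eigVal l k :=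
  Finset.sum_nonneg fun j _ => mul_nonneg (hl j).le (Nat.cast_nonneg _)

theorem energyRate_one_le (hc : 0 < c) (hl : ∀ j, 0 < l j) {B M t : ℝ} (hB : ∑ j, b j t ^ 2 ≤ B)
    (hM : ∀ s : Finset (Fin n → ℕ), ∑ k ∈ s, d k t ^ 2 ≤ M) (N : ℕ) :
    energyRate c l b d a (fun _ => 1) N t ≤
      (c⁻¹ * B + 1) * ∑ k ∈ degBox n N, 1 * a k t ^ 2 + M -
        c * ∑ k ∈ degBox n N, eigVal l k * a k t ^ 2 := by
  refine (energyRate_le hc hl (fun _ => zero_le_one) N t).trans ?_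
  have h1 : ∑ k ∈ degBox n N, (∑ j, (1 : ℝ) * b j t ^ 2) * a k t ^ 2 ≤
      B * ∑ k ∈ degBox n N, a k t ^ 2 := by
    simp only [one_mul, ← Finset.mul_sum]
    exact mul_le_mul_of_nonneg_right hB (Finset.sum_nonneg fun _ _ => sq_nonneg _)
  have h2 := two_sum_mul_le (degBox n N) (w := fun _ => (1 : ℝ)) (fun _ => zero_le_one)
    (fun k => a k t) (fun k => d k t)
  have h3 := hM (degBox n N)
  have h4 := mul_le_mul_of_nonneg_left h1 (inv_pos.2 hc).le
  simp only [one_mul] at *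
  linarith

theorem nonneg_of_ae_sum_sq_le {ι : Type*} {d : ι → ℝ → ℝ} {M : ℝ}
    (hM : ∀ᵐ t ∂volume.restrict (Ioi 0), ∀ s : Finset ι, ∑ k ∈ s, d k t ^ 2 ≤ M) : 0 ≤ M := by
  have : (ae (volume.restrict (Ioi (0 : ℝ)))).NeBot := ae_neBot.2 (by simp)
  obtain ⟨t, ht⟩ := hM.exists
  simpa using ht ∅

/-- Gronwall's inequality is applied to the energy truncated to a degree box; the constants do not
depend on the truncation. The unused half of the dissipation is then integrated in time. -/
theorem IsTriSol.exists_bound (h : IsTriSol c l b d a) (hc : 0 < c) (hl : ∀ j, 0 < l j)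
    (hb : ∀ j, ContinuousOn (b j) (Ici 0)) {M E₀ : ℝ}
    (hM : ∀ᵐ t ∂volume.restrict (Ioi 0), ∀ s : Finset (Fin n → ℕ), ∑ k ∈ s, d k t ^ 2 ≤ M)
    (h0 : ∀ s : Finset (Fin n → ℕ), ∑ k ∈ s, a k 0 ^ 2 ≤ E₀) (T : ℝ) (hT : 0 ≤ T) :
    ∃ C, (∀ t ∈ Icc 0 T, ∀ s : Finset (Fin n → ℕ), ∑ k ∈ s, a k t ^ 2 ≤ C) ∧
      ∀ N, ∫ t in (0 : ℝ)..T, ∑ k ∈ degBox n N, eigVal l k * a k t ^ 2 ≤ C := by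
  have hM0 : 0 ≤ M := nonneg_of_ae_sum_sq_le hM
  have hE0 : 0 ≤ E₀ := by simpa using h0 ∅
  obtain ⟨B, hB⟩ : ∃ B, ∀ t ∈ Icc 0 T, ∑ j, b j t ^ 2 ≤ B := by
    have hcB : ContinuousOn (fun t => ∑ j, b j t ^ 2) (Icc 0 T) :=
      continuousOn_finsetSum _ fun j _ => ((hb j).mono fun s hs => hs.1).pow 2
    obtain ⟨B, hB⟩ := isCompact_Icc.bddAbove_image hcB
    exact ⟨B, fun t ht => hB ⟨t, ht, rfl⟩⟩
  have hB0 : 0 ≤ B := (Finset.sum_nonneg fun j _ => sq_nonneg (b j 0)).trans (hB 0 ⟨le_rfl, hT⟩)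
  have hK : 0 ≤ c⁻¹ * B + 1 := by positivity
  set K := c⁻¹ * B + 1
  set C₁ := gronwallBound E₀ K M T
  have hbox : ∀ t ∈ Icc 0 T, ∀ N, ∑ k ∈ degBox n N, 1 * a k t ^ 2 ≤ C₁ := by
    intro t ht N
    have h1 := (h.isPrim_energy (fun _ => 1) N).le_gronwallBound (K := K) (H := M) (T := T) ?_ t ht
    · refine h1.trans ?_
      have h2 : ∑ k ∈ degBox n N, 1 * a k 0 ^ 2 ≤ E₀ := by simpa using h0 (degBox n N)
      have h2' : 0 ≤ ∑ k ∈ degBox n N, 1 * a k 0 ^ 2 := Finset.sum_nonneg fun _ _ => by positivity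
      refine (gronwallBound_mono h2' hM0 hK ht.2).trans ?_
      exact gronwallBound_mono_left h2
    · filter_upwards [hM, ae_restrict_mem measurableSet_Ioi] with s hs hs0 hsT
      have h3 := energyRate_one_le (a := a) hc hl (hB s ⟨le_of_lt hs0, hsT⟩) hs N
      have h4 : 0 ≤ c * ∑ k ∈ degBox n N, eigVal l k * a k s ^ 2 :=
        mul_nonneg hc.le (Finset.sum_nonneg fun k _ => mul_nonneg
          (eigVal_nonneg' hl k) (sq_nonneg _))
      linarith
  have hC₁ : 0 ≤ C₁ := (Finset.sum_nonneg fun _ _ => by positivity).trans (hbox 0 ⟨le_rfl, hT⟩ 0)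
  set C₂ := c⁻¹ * (E₀ + (K * C₁ + M) * T)
  have hC₂ : 0 ≤ C₂ := by positivity
  refine ⟨C₁ + C₂, fun t ht s => ?_, fun N => ?_⟩
  · obtain ⟨N, hN⟩ := exists_subset_degBox s
    have h1 := hbox t ht N
    simp only [one_mul] at h1
    have h2 : ∑ k ∈ s, a k t ^ 2 ≤ ∑ k ∈ degBox n N, a k t ^ 2 :=
      Finset.sum_le_sum_of_subset_of_nonneg hN fun _ _ _ => sq_nonneg _
    linarith
  · have hsub : uIcc 0 T ⊆ Ici (0 : ℝ) := by rw [uIcc_of_le hT]; exact fun s hs => hs.1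
    have hQ : IntervalIntegrable (fun t => ∑ k ∈ degBox n N, eigVal l k * a k t ^ 2) volume 0 T :=
      (continuousOn_finsetSum _ fun k _ => continuousOn_const.mul
        (((h k).continuousOn.mono hsub).pow 2)).intervalIntegrable
    have hP := h.isPrim_energy (fun _ => 1) N
    have h1 := hP.eq_integral T hT
    have h2 : ∫ t in (0 : ℝ)..T, energyRate c l b d a (fun _ => 1) N t ≤
        ∫ t in (0 : ℝ)..T, ((K * C₁ + M) - c * ∑ k ∈ degBox n N, eigVal l k * a k t ^ 2) := by
      refine intervalIntegral.integral_mono_ae_restrict hT (hP.1 T hT)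
        (intervalIntegrable_const.sub (hQ.const_mul c)) ?_
      rw [← restrict_Ioc_eq_restrict_Icc]
      have := ae_restrict_of_ae_restrict_of_subset (Ioc_subset_Ioi_self : Ioc (0 : ℝ) T ⊆ Ioi 0) hM
      filter_upwards [this, ae_restrict_mem measurableSet_Ioc] with s hs hs'
      have hsI : s ∈ Icc 0 T := ⟨hs'.1.le, hs'.2⟩
      have h3 := energyRate_one_le (a := a) hc hl (hB s hsI) hs N
      have h4 := mul_le_mul_of_nonneg_left (hbox s hsI N) hK
      linarith
    rw [intervalIntegral.integral_sub intervalIntegrable_const (hQ.const_mul c),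
      intervalIntegral.integral_const, intervalIntegral.integral_const_mul, smul_eq_mul] at h2
    have h5 : 0 ≤ ∑ k ∈ degBox n N, 1 * a k T ^ 2 := Finset.sum_nonneg fun _ _ => by positivity
    have h6 : ∑ k ∈ degBox n N, 1 * a k 0 ^ 2 ≤ E₀ := by simpa using h0 (degBox n N)
    have h7 : c * ∫ t in (0 : ℝ)..T, ∑ k ∈ degBox n N, eigVal l k * a k t ^ 2 ≤
        E₀ + (K * C₁ + M) * T := by linarith
    have h8 := mul_le_mul_of_nonneg_left h7 (inv_pos.2 hc).le
    rw [inv_mul_cancel_left₀ hc.ne'] at h8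
    linarith

/-- The energy estimate with weight `μ_k`. The shifted weight is `μ_k + l_j`, so the coupling costs
only a multiple of the energies already under control, and the remaining dissipation `c μ_k² a_k²`
absorbs the source. -/
theorem IsTriSol.exists_bound_eigVal (h : IsTriSol c l b d a) (hc : 0 < c) (hl : ∀ j, 0 < l j)
    (hb : ∀ j, ContinuousOn (b j) (Ici 0)) {M E₀ E₁ : ℝ}
    (hM : ∀ᵐ t ∂volume.restrict (Ioi 0), ∀ s : Finset (Fin n → ℕ), ∑ k ∈ s, d k t ^ 2 ≤ M)
    (h0 : ∀ s : Finset (Fin n → ℕ), ∑ k ∈ s, a k 0 ^ 2 ≤ E₀)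
    (h1 : ∀ s : Finset (Fin n → ℕ), ∑ k ∈ s, eigVal l k * a k 0 ^ 2 ≤ E₁) (T : ℝ) (hT : 0 ≤ T) :
    ∃ C, ∀ t ∈ Icc 0 T, ∀ s : Finset (Fin n → ℕ), ∑ k ∈ s, eigVal l k * a k t ^ 2 ≤ C := by
  have hM0 : 0 ≤ M := nonneg_of_ae_sum_sq_le hM
  obtain ⟨C₁, hC₁, -⟩ := h.exists_bound hc hl hb hM h0 T hT
  have hC₁0 : 0 ≤ C₁ := by simpa using hC₁ 0 ⟨le_rfl, hT⟩ ∅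
  obtain ⟨B, hB⟩ : ∃ B, ∀ t ∈ Icc 0 T, ∑ j, b j t ^ 2 ≤ B := by
    have hcB : ContinuousOn (fun t => ∑ j, b j t ^ 2) (Icc 0 T) :=
      continuousOn_finsetSum _ fun j _ => ((hb j).mono fun s hs => hs.1).pow 2
    obtain ⟨B, hB⟩ := isCompact_Icc.bddAbove_image hcB
    exact ⟨B, fun t ht => hB ⟨t, ht, rfl⟩⟩
  have hB0 : 0 ≤ B := (Finset.sum_nonneg fun j _ => sq_nonneg (b j 0)).trans (hB 0 ⟨le_rfl, hT⟩)
  set L := ∑ j, l j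
  have hL : 0 ≤ L := Finset.sum_nonneg fun j _ => (hl j).le
  set K := c⁻¹ * B + 1
  have hK : 0 < K := by positivity
  set H := c⁻¹ * (B * L * C₁) + c⁻¹ * M
  have hH : 0 ≤ H := by positivity
  have hrate : ∀ t ∈ Icc 0 T, (∀ s : Finset (Fin n → ℕ), ∑ k ∈ s, d k t ^ 2 ≤ M) → ∀ N,
      energyRate c l b d a (eigVal l) N t ≤
        K * ∑ k ∈ degBox n N, eigVal l k * a k t ^ 2 + H := by
    intro t ht htM N
    refine (energyRate_le hc hl (eigVal_nonneg' hl) N t).trans ?_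
    have e1 : ∑ k ∈ degBox n N, (∑ j, eigVal l (k + Pi.single j 1) * b j t ^ 2) * a k t ^ 2 ≤
        B * ∑ k ∈ degBox n N, eigVal l k * a k t ^ 2 + B * L * C₁ := by
      have e2 : ∀ k : Fin n → ℕ, (∑ j, eigVal l (k + Pi.single j 1) * b j t ^ 2) * a k t ^ 2 ≤
          B * (eigVal l k * a k t ^ 2) + B * L * a k t ^ 2 := by
        intro k
        have e3 : ∑ j, eigVal l (k + Pi.single j 1) * b j t ^ 2 ≤ (eigVal l k + L) * B := by
          calc _ ≤ ∑ j, (eigVal l k + L) * b j t ^ 2 := by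
                refine Finset.sum_le_sum fun j _ => ?_
                rw [eigVal_add_single]
                gcongr
                exact Finset.single_le_sum (fun i _ => (hl i).le) (Finset.mem_univ j)
            _ ≤ _ := by
                rw [← Finset.mul_sum]
                exact mul_le_mul_of_nonneg_left (hB t ht) (add_nonneg (eigVal_nonneg' hl k) hL)
        have := mul_le_mul_of_nonneg_right e3 (sq_nonneg (a k t))
        linarith
      refine (Finset.sum_le_sum fun k _ => e2 k).trans ?_
      rw [Finset.sum_add_distrib, ← Finset.mul_sum, ← Finset.mul_sum]
      gcongr
      exact hC₁ t ht _
    have e4 : 2 * ∑ k ∈ degBox n N, eigVal l k * a k t * d k t ≤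
        c * ∑ k ∈ degBox n N, eigVal l k * eigVal l k * a k t ^ 2 + c⁻¹ * M := by
      calc _ ≤ ∑ k ∈ degBox n N, (c * (eigVal l k * eigVal l k * a k t ^ 2) +
            c⁻¹ * d k t ^ 2) := by
            rw [Finset.mul_sum]
            refine Finset.sum_le_sum fun k _ => ?_
            have h2 : 0 ≤ c⁻¹ * (c * (eigVal l k * a k t) - d k t) ^ 2 := by positivity
            have h3 : c⁻¹ * (c * (eigVal l k * a k t) - d k t) ^ 2 =
                c * (eigVal l k * eigVal l k * a k t ^ 2) - 2 * (eigVal l k * a k t * d k t) +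
                  c⁻¹ * d k t ^ 2 := by
              field_simp
              ring
            linarith
        _ ≤ _ := by
            rw [Finset.sum_add_distrib, ← Finset.mul_sum, ← Finset.mul_sum]
            gcongr
            exact htM _
    have e5 := mul_le_mul_of_nonneg_left e1 (inv_pos.2 hc).le
    have e6 : 0 ≤ ∑ k ∈ degBox n N, eigVal l k * a k t ^ 2 :=
      Finset.sum_nonneg fun k _ => mul_nonneg (eigVal_nonneg' hl k) (sq_nonneg _)
    simp only [K, H]
    linarith
  refine ⟨gronwallBound E₁ K H T, fun t ht s => ?_⟩
  obtain ⟨N, hN⟩ := exists_subset_degBox s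
  refine (Finset.sum_le_sum_of_subset_of_nonneg hN fun k _ _ =>
    mul_nonneg (eigVal_nonneg' hl k) (sq_nonneg _)).trans ?_
  have h2 := (h.isPrim_energy (eigVal l) N).le_gronwallBound (K := K) (H := H) (T := T) ?_ t ht
  · refine h2.trans ?_
    have h2' : 0 ≤ ∑ k ∈ degBox n N, eigVal l k * a k 0 ^ 2 :=
      Finset.sum_nonneg fun k _ => mul_nonneg (eigVal_nonneg' hl k) (sq_nonneg _)
    refine (gronwallBound_mono h2' hH hK.le ht.2).trans ?_
    exact gronwallBound_mono_left (h1 (degBox n N))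
  · filter_upwards [hM, ae_restrict_mem measurableSet_Ioi] with s hs hs0 hsT
    exact hrate s ⟨le_of_lt hs0, hsT⟩ hs N

end Tri

end

/-! ### Bounds on the half-line and continuity of the energy -/

section

section Tri

variable {n : ℕ} {c : ℝ} {l : Fin n → ℝ} {b : Fin n → ℝ → ℝ} {d a : (Fin n → ℕ) → ℝ → ℝ}

theorem exists_pos_le_of_pos (hl : ∀ j, 0 < l j) : ∃ m > 0, ∀ j, m ≤ l j := by
  rcases isEmpty_or_nonempty (Fin n) with hE | hE
  · exact ⟨1, one_pos, fun j => (hE.false j).elim⟩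
  · obtain ⟨j, hj⟩ := Finite.exists_min l
    exact ⟨l j, hl j, hj⟩

theorem eigVal_pos (hl : ∀ j, 0 < l j) {k : Fin n → ℕ} (hk : k ≠ 0) : 0 < eigVal l k := by
  obtain ⟨j, hj⟩ := Function.ne_iff.1 hk
  have h1 : l j * k j ≤ eigVal l k :=
    Finset.single_le_sum (f := fun j => l j * (k j : ℝ))
      (fun i _ => mul_nonneg (hl i).le (Nat.cast_nonneg _)) (Finset.mem_univ j)
  have h2 : 0 < l j * (k j : ℝ) := mul_pos (hl j) (Nat.cast_pos.2 (Nat.pos_of_ne_zero hj))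
  linarith

theorem mul_degree_le_eigVal {m : ℝ} (hm : ∀ j, m ≤ l j) (k : Fin n → ℕ) :
    m * (∑ j, k j : ℕ) ≤ eigVal l k := by
  rw [eigVal, Nat.cast_sum, Finset.mul_sum]
  exact Finset.sum_le_sum fun j _ => mul_le_mul_of_nonneg_right (hm j) (Nat.cast_nonneg _)

theorem IsTriSol.eq_const_zero (h : IsTriSol c l b d a)
    (hd0 : ∀ᵐ t ∂volume.restrict (Ioi 0), d 0 t = 0) {t : ℝ} (ht : 0 ≤ t) : a 0 t = a 0 0 := by
  have h1 : IsPrim (a 0) (fun _ => 0) := by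
    refine (h 0).congr (fun _ _ => rfl) ?_
    filter_upwards [hd0] with s hs
    simp [triForce, eigVal, hs]
  simpa using h1.eq_integral t ht

/-- Induction on the degree. Mode zero has no damping, but it is constant because its source
vanishes. Every other mode has positive damping `c μ_k` and a forcing that is bounded by the
induction hypothesis. -/
theorem IsTriSol.exists_bound_mode (h : IsTriSol c l b d a) (hc : 0 < c) (hl : ∀ j, 0 < l j)
    {β M : ℝ} (hb : ∀ j, ∀ t ≥ 0, |b j t| ≤ β)
    (hM : ∀ᵐ t ∂volume.restrict (Ioi 0), ∀ s : Finset (Fin n → ℕ), ∑ k ∈ s, d k t ^ 2 ≤ M)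
    (hd0 : ∀ᵐ t ∂volume.restrict (Ioi 0), d 0 t = 0) (k : Fin n → ℕ) :
    ∃ C, ∀ t ≥ 0, |a k t| ≤ C := by
  induction hm : ∑ j, k j using Nat.strong_induction_on generalizing k with
  | _ m ih =>
    rcases eq_or_ne k 0 with rfl | hk
    · exact ⟨|a 0 0|, fun t ht => by rw [h.eq_const_zero hd0 ht]⟩
    have hprev : ∀ j, ∃ C, ∀ t ≥ 0, |√(l j * k j) * a (k - Pi.single j 1) t| ≤ C := by
      intro j
      by_cases hj : k j = 0
      · exact ⟨0, by simp [hj]⟩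
      · have h1 := sum_sub_single_add_one hj
        obtain ⟨C, hC⟩ := ih (∑ i, (k - Pi.single j 1 : Fin n → ℕ) i) (by omega) _ rfl
        refine ⟨√(l j * k j) * C, fun t ht => ?_⟩
        rw [abs_mul, abs_of_nonneg (Real.sqrt_nonneg _)]
        exact mul_le_mul_of_nonneg_left (hC t ht) (Real.sqrt_nonneg _)
    choose C hC using hprev
    -- The summand `M + 1` bounds the source, since `|d_k| ≤ d_k² + 1`.
    set F := ∑ j, |β| * |C j| + (M + 1)
    have hM0 := nonneg_of_ae_sum_sq_le hM
    have hF : ∀ᵐ t ∂volume.restrict (Ioi 0), |triForce l b d a k t| ≤ F := by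
      filter_upwards [hM, ae_restrict_mem measurableSet_Ioi] with t ht ht0
      have ht0' : t ≥ 0 := le_of_lt ht0
      refine (abs_add_le _ _).trans (add_le_add ((Finset.abs_sum_le_sum_abs _ _).trans
        (Finset.sum_le_sum fun j _ => ?_)) ?_)
      · rw [abs_mul]
        exact mul_le_mul ((hb j t ht0').trans (le_abs_self _))
          ((hC j t ht0').trans (le_abs_self _)) (abs_nonneg _) (abs_nonneg _)
      · have h1 := ht {k}
        rw [Finset.sum_singleton] at h1
        rw [abs_le]
        constructor <;> nlinarith [sq_nonneg (d k t - 1), sq_nonneg (d k t + 1)]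
    set κ := c * eigVal l k
    have hκ : 0 < κ := mul_pos hc (eigVal_pos hl hk)
    have h3 : ∀ t ≥ 0, a k t * a k t ≤ a k 0 * a k 0 + F ^ 2 / κ / κ := by
      intro t ht
      refine (((h k).mul (h k)).le_gronwallBound (K := -κ) (H := F ^ 2 / κ) (T := t) ?_ t
        ⟨ht, le_rfl⟩).trans
        (gronwallBound_neg_le (mul_self_nonneg _) hκ (by positivity) ht)
      filter_upwards [hF] with s hs _
      have h4 : triForce l b d a k s ^ 2 ≤ F ^ 2 := sq_le_sq' (abs_le.1 hs).1 (abs_le.1 hs).2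
      have h5 : 0 ≤ κ⁻¹ * (κ * a k s - triForce l b d a k s) ^ 2 := by positivity
      have h6 : κ⁻¹ * (κ * a k s - triForce l b d a k s) ^ 2 = κ * (a k s * a k s) -
          2 * (a k s * triForce l b d a k s) + triForce l b d a k s ^ 2 / κ := by
        field_simp
        ring
      have h7 : triForce l b d a k s ^ 2 / κ ≤ F ^ 2 / κ := by gcongr
      simp only [κ] at *
      linarith
    refine ⟨a k 0 * a k 0 + F ^ 2 / κ / κ + 1, fun t ht => ?_⟩
    have h8 := h3 t ht
    rw [abs_le]
    constructor <;> nlinarith [sq_nonneg (a k t - 1), sq_nonneg (a k t + 1)]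

/-- The solution of the triangular system is bounded in `ℓ²` on the half-line. -/
theorem IsTriSol.exists_bound_global (h : IsTriSol c l b d a) (hc : 0 < c) (hl : ∀ j, 0 < l j)
    {β M E₀ : ℝ} (hb : ∀ j, ∀ t ≥ 0, |b j t| ≤ β)
    (hM : ∀ᵐ t ∂volume.restrict (Ioi 0), ∀ s : Finset (Fin n → ℕ), ∑ k ∈ s, d k t ^ 2 ≤ M)
    (hd0 : ∀ᵐ t ∂volume.restrict (Ioi 0), d 0 t = 0)
    (h0 : ∀ s : Finset (Fin n → ℕ), ∑ k ∈ s, a k 0 ^ 2 ≤ E₀) :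
    ∃ C, ∀ t ≥ 0, ∀ s : Finset (Fin n → ℕ), ∑ k ∈ s, a k t ^ 2 ≤ C := by
  obtain ⟨m, hm0, hm⟩ := exists_pos_le_of_pos hl
  have hM0 := nonneg_of_ae_sum_sq_le hM
  set B : ℝ := n * β ^ 2
  have hB0 : 0 ≤ B := by positivity
  have hB : ∀ t ≥ 0, ∑ j, b j t ^ 2 ≤ B := fun t ht => by
    calc ∑ j, b j t ^ 2 ≤ ∑ _ : Fin n, β ^ 2 :=
          Finset.sum_le_sum fun j _ => sq_le_sq' (abs_le.1 (hb j t ht)).1 (abs_le.1 (hb j t ht)).2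
      _ = B := by simp [B]
  -- Above degree `D` the dissipation `c μ_k` is at least `c⁻¹ B + 2`: it pays for the coupling
  -- (`c⁻¹ B`) and for the source (one unit), leaving decay at rate one.
  obtain ⟨D, hD⟩ := exists_nat_ge ((c⁻¹ * B + 2) / (c * m))
  have hD' : c⁻¹ * B + 2 ≤ c * (m * (D + 1)) := by
    rw [div_le_iff₀ (by positivity)] at hD
    nlinarith [mul_pos hc hm0]
  obtain ⟨L, hL0, hL⟩ : ∃ L ≥ 0, ∀ t ≥ 0, ∑ k ∈ degBox n D, a k t ^ 2 ≤ L := by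
    choose C hC using h.exists_bound_mode hc hl hb hM hd0
    refine ⟨∑ k ∈ degBox n D, C k ^ 2, Finset.sum_nonneg fun _ _ => sq_nonneg _, fun t ht => ?_⟩
    exact Finset.sum_le_sum fun k _ =>
      sq_le_sq' (abs_le.1 (hC k t ht)).1 (abs_le.1 (hC k t ht)).2
  -- Only the high modes enter the energy; the finitely many low ones are already bounded by `L` and
  -- act as forcing.
  set w : (Fin n → ℕ) → ℝ := fun k => if ∑ j, k j ≤ D then 0 else 1
  have hw : ∀ k, 0 ≤ w k := fun k => by simp only [w]; split_ifs <;> norm_num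
  have hw1 : ∀ k, w k ≤ 1 := fun k => by simp only [w]; split_ifs <;> norm_num
  have hsplit : ∀ t ≥ 0, ∀ N, ∑ k ∈ degBox n N, a k t ^ 2 ≤
      L + ∑ k ∈ degBox n N, w k * a k t ^ 2 := by
    intro t ht N
    have h1 : ∑ k ∈ degBox n N, (if ∑ j, k j ≤ D then a k t ^ 2 else 0) ≤ L := by
      rw [← Finset.sum_filter]
      refine (Finset.sum_le_sum_of_subset_of_nonneg (fun k hk => ?_) fun _ _ _ =>
        sq_nonneg _).trans (hL t ht)
      exact mem_degBox.2 (Finset.mem_filter.1 hk).2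
    have h2 : ∑ k ∈ degBox n N, a k t ^ 2 =
        ∑ k ∈ degBox n N, (if ∑ j, k j ≤ D then a k t ^ 2 else 0) +
          ∑ k ∈ degBox n N, w k * a k t ^ 2 := by
      rw [← Finset.sum_add_distrib]
      exact Finset.sum_congr rfl fun k _ => by simp only [w]; split_ifs <;> simp
    linarith
  set H := c⁻¹ * (B * L) + M
  have hH : 0 ≤ H := by positivity
  have hrate : ∀ᵐ t ∂volume.restrict (Ioi 0), ∀ N, energyRate c l b d a w N t ≤
      -1 * ∑ k ∈ degBox n N, w k * a k t ^ 2 + H := by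
    filter_upwards [hM, ae_restrict_mem measurableSet_Ioi] with t htM ht0 N
    have ht0' : t ≥ 0 := le_of_lt ht0
    refine (energyRate_le hc hl hw N t).trans ?_
    have e1 : ∑ k ∈ degBox n N, (∑ j, w (k + Pi.single j 1) * b j t ^ 2) * a k t ^ 2 ≤
        B * (L + ∑ k ∈ degBox n N, w k * a k t ^ 2) := by
      refine le_trans ?_ (mul_le_mul_of_nonneg_left (hsplit t ht0' N) hB0)
      rw [Finset.mul_sum]
      refine Finset.sum_le_sum fun k _ => mul_le_mul_of_nonneg_right (le_trans
        (Finset.sum_le_sum fun j _ => ?_) (hB t ht0')) (sq_nonneg _)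
      exact mul_le_of_le_one_left (sq_nonneg _) (hw1 _)
    have e2 : 2 * ∑ k ∈ degBox n N, w k * a k t * d k t ≤
        ∑ k ∈ degBox n N, w k * a k t ^ 2 + M := by
      refine (two_sum_mul_le (degBox n N) hw (fun k => a k t) (fun k => d k t)).trans ?_
      gcongr
      refine (Finset.sum_le_sum fun k _ => mul_le_of_le_one_left (sq_nonneg _) (hw1 k)).trans
        (htM _)
    have e3 : (c⁻¹ * B + 2) * ∑ k ∈ degBox n N, w k * a k t ^ 2 ≤
        c * ∑ k ∈ degBox n N, w k * eigVal l k * a k t ^ 2 := by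
      rw [Finset.mul_sum, Finset.mul_sum]
      refine Finset.sum_le_sum fun k _ => ?_
      by_cases hk : ∑ j, k j ≤ D
      · simp [w, hk]
      · have h1 := mul_degree_le_eigVal hm k
        have h2 : (D : ℝ) + 1 ≤ (∑ j, k j : ℕ) := by exact_mod_cast not_le.1 hk
        have h3 : c⁻¹ * B + 2 ≤ c * eigVal l k :=
          hD'.trans (mul_le_mul_of_nonneg_left
            ((mul_le_mul_of_nonneg_left h2 hm0.le).trans h1) hc.le)
        simp only [w, if_neg hk, one_mul]
        calc _ ≤ c * eigVal l k * a k t ^ 2 := mul_le_mul_of_nonneg_right h3 (sq_nonneg _)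
          _ = _ := by ring
    have e4 := mul_le_mul_of_nonneg_left e1 (inv_pos.2 hc).le
    simp only [H]
    linarith
  refine ⟨L + (E₀ + H / 1), fun t ht s => ?_⟩
  obtain ⟨N, hN⟩ := exists_subset_degBox s
  refine (Finset.sum_le_sum_of_subset_of_nonneg hN fun _ _ _ => sq_nonneg _).trans
    ((hsplit t ht N).trans ?_)
  gcongr
  have h1 := (h.isPrim_energy w N).le_gronwallBound (K := -1) (H := H) (T := t)
    (hrate.mono fun s hs _ => hs N) t ⟨ht, le_rfl⟩
  refine h1.trans ((gronwallBound_mono_left (δ' := E₀) ?_).trans ?_)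
  · exact (Finset.sum_le_sum fun k _ => mul_le_of_le_one_left (sq_nonneg _) (hw1 k)).trans (h0 _)
  · refine gronwallBound_neg_le ?_ one_pos hH ht
    simpa using h0 ∅

/-- Changing the signs of `b` and `d` reverses every term of the rate except the dissipation, so the
upper bound for the reversed system is a lower bound for the original one. -/
theorem abs_energyRate_one_le (hc : 0 < c) (hl : ∀ j, 0 < l j) {B M t : ℝ}
    (hB : ∑ j, b j t ^ 2 ≤ B) (hM : ∀ s : Finset (Fin n → ℕ), ∑ k ∈ s, d k t ^ 2 ≤ M) (N : ℕ) :
    |energyRate c l b d a (fun _ => 1) N t| ≤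
      (c⁻¹ * B + 1) * ∑ k ∈ degBox n N, 1 * a k t ^ 2 + M +
        3 * c * ∑ k ∈ degBox n N, eigVal l k * a k t ^ 2 := by
  have h1 := energyRate_one_le (a := a) hc hl hB hM N
  have h2 := energyRate_one_le (a := a) (b := fun j t => -b j t) (d := fun k t => -d k t) hc hl
    (B := B) (M := M) (t := t) (by simpa using hB) (by simpa using hM) N
  have h3 : energyRate c l (fun j t => -b j t) (fun k t => -d k t) a (fun _ => 1) N t =
      -energyRate c l b d a (fun _ => 1) N t -
        4 * c * ∑ k ∈ degBox n N, eigVal l k * a k t ^ 2 := by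
    simp only [energyRate, triForce, Finset.mul_sum, ← Finset.sum_neg_distrib,
      ← Finset.sum_sub_distrib]
    refine Finset.sum_congr rfl fun k _ => ?_
    have : ∑ j, -b j t * (√(l j * k j) * a (k - Pi.single j 1) t) =
        -∑ j, b j t * (√(l j * k j) * a (k - Pi.single j 1) t) := by
      rw [← Finset.sum_neg_distrib]
      exact Finset.sum_congr rfl fun j _ => by ring
    rw [this]
    ring
  have h4 : 0 ≤ c * ∑ k ∈ degBox n N, eigVal l k * a k t ^ 2 :=
    mul_nonneg hc.le (Finset.sum_nonneg fun k _ => mul_nonneg (eigVal_nonneg' hl k) (sq_nonneg _))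
  rw [abs_le]
  constructor <;> linarith

/-- `∑ μ_k a_k²` is integrable in time, and the partial energies have a common modulus of
continuity. -/
theorem IsTriSol.integrable_tsum_eigVal (h : IsTriSol c l b d a) (hc : 0 < c)
    (hl : ∀ j, 0 < l j) (hb : ∀ j, ContinuousOn (b j) (Ici 0)) {M E₀ : ℝ}
    (hM : ∀ᵐ t ∂volume.restrict (Ioi 0), ∀ s : Finset (Fin n → ℕ), ∑ k ∈ s, d k t ^ 2 ≤ M)
    (h0 : ∀ s : Finset (Fin n → ℕ), ∑ k ∈ s, a k 0 ^ 2 ≤ E₀) (T : ℝ) (hT : 0 ≤ T) :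
    (∀ᵐ t ∂volume.restrict (Ioc 0 T), Summable fun k => eigVal l k * a k t ^ 2) ∧
    IntegrableOn (fun t => ∑' k, eigVal l k * a k t ^ 2) (Ioc 0 T) := by
  obtain ⟨C, -, hC⟩ := h.exists_bound hc hl hb hM h0 T hT
  have hsub : uIcc 0 T ⊆ Ici (0 : ℝ) := by rw [uIcc_of_le hT]; exact fun s hs => hs.1
  have hi : ∀ k, IntegrableOn (fun t => eigVal l k * a k t ^ 2) (Ioc 0 T) := fun k =>
    (intervalIntegrable_iff_integrableOn_Ioc_of_le hT).1 (continuousOn_const.mul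
        (((h k).continuousOn.mono hsub).pow 2)).intervalIntegrable
  have hnn : ∀ k t, 0 ≤ eigVal l k * a k t ^ 2 := fun k t =>
    mul_nonneg (eigVal_nonneg' hl k) (sq_nonneg _)
  have hs : Summable fun k => ∫ t in Ioc 0 T, ‖eigVal l k * a k t ^ 2‖ := by
    refine summable_of_sum_le (c := C) (fun k => integral_nonneg fun t => norm_nonneg _)
      fun s => ?_
    obtain ⟨N, hN⟩ := exists_subset_degBox s
    refine (Finset.sum_le_sum_of_subset_of_nonneg hN fun k _ _ =>
      integral_nonneg fun t => norm_nonneg _).trans ?_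
    have := hC N
    rw [intervalIntegral.integral_of_le hT, integral_finsetSum _ fun k _ => hi k] at this
    refine le_trans (le_of_eq (Finset.sum_congr rfl fun k _ => ?_)) this
    exact integral_congr_ae (Eventually.of_forall fun t => Real.norm_of_nonneg (hnn k t))
  have hl' : ∑' k, ∫⁻ t in Ioc 0 T, ‖eigVal l k * a k t ^ 2‖ₑ ≠ (⊤ : ℝ≥0∞) := by
    have e : ∀ k, ∫⁻ t in Ioc 0 T, ‖eigVal l k * a k t ^ 2‖ₑ =
        ENNReal.ofReal (∫ t in Ioc 0 T, ‖eigVal l k * a k t ^ 2‖) := fun k =>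
      (ofReal_integral_norm_eq_lintegral_enorm (hi k)).symm
    simp only [e]
    exact hs.tsum_ofReal_ne_top
  have hm : ∀ k, AEMeasurable (fun t => ‖eigVal l k * a k t ^ 2‖ₑ) (volume.restrict (Ioc 0 T)) :=
    fun k => (hi k).1.enorm
  rw [← lintegral_tsum hm] at hl'
  have hae : ∀ᵐ t ∂volume.restrict (Ioc 0 T), ∑' k, ‖eigVal l k * a k t ^ 2‖ₑ < (⊤ : ℝ≥0∞) :=
    ae_lt_top' (AEMeasurable.tsum hm) hl'
  have hsm : ∀ᵐ t ∂volume.restrict (Ioc 0 T), Summable fun k => eigVal l k * a k t ^ 2 := by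
    filter_upwards [hae] with t ht
    exact summable_of_sum_le (hnn · t) (c := (∑' k, ‖eigVal l k * a k t ^ 2‖ₑ).toReal) fun s => by
      rw [← ENNReal.ofReal_le_iff_le_toReal ht.ne, ENNReal.ofReal_sum_of_nonneg fun k _ => hnn k t]
      refine le_trans (le_of_eq (Finset.sum_congr rfl fun k _ => ?_)) (ENNReal.sum_le_tsum s)
      rw [Real.enorm_eq_ofReal (hnn k t)]
  refine ⟨hsm, (integrable_toReal_of_lintegral_ne_top (AEMeasurable.tsum hm) hl').congr ?_⟩
  filter_upwards [hsm] with t ht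
  have e : ∀ k, ‖eigVal l k * a k t ^ 2‖ₑ = ENNReal.ofReal (eigVal l k * a k t ^ 2) := fun k =>
    Real.enorm_eq_ofReal (hnn k t)
  simp only [e]
  rw [← ENNReal.ofReal_tsum_of_nonneg (hnn · t) ht, ENNReal.toReal_ofReal
    (tsum_nonneg (hnn · t))]

/-- The rates of all truncated energies are dominated by one integrable function `q`. The increments
of the limit are therefore bounded by integrals of `q`. -/
theorem IsTriSol.continuousOn_tsum (h : IsTriSol c l b d a) (hc : 0 < c) (hl : ∀ j, 0 < l j)
    (hb : ∀ j, ContinuousOn (b j) (Ici 0)) {M E₀ : ℝ}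
    (hM : ∀ᵐ t ∂volume.restrict (Ioi 0), ∀ s : Finset (Fin n → ℕ), ∑ k ∈ s, d k t ^ 2 ≤ M)
    (h0 : ∀ s : Finset (Fin n → ℕ), ∑ k ∈ s, a k 0 ^ 2 ≤ E₀) (T : ℝ) (hT : 0 ≤ T) :
    ContinuousOn (fun t => ∑' k, a k t ^ 2) (Icc 0 T) := by
  obtain ⟨C, hC, -⟩ := h.exists_bound hc hl hb hM h0 T hT
  obtain ⟨hsm, hint⟩ := h.integrable_tsum_eigVal hc hl hb hM h0 T hT
  obtain ⟨B, hB⟩ : ∃ B, ∀ t ∈ Icc 0 T, ∑ j, b j t ^ 2 ≤ B := by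
    have hcB : ContinuousOn (fun t => ∑ j, b j t ^ 2) (Icc 0 T) :=
      continuousOn_finsetSum _ fun j _ => ((hb j).mono fun s hs => hs.1).pow 2
    obtain ⟨B, hB⟩ := isCompact_Icc.bddAbove_image hcB
    exact ⟨B, fun t ht => hB ⟨t, ht, rfl⟩⟩
  have hB0 : 0 ≤ B := (Finset.sum_nonneg fun j _ => sq_nonneg (b j 0)).trans (hB 0 ⟨le_rfl, hT⟩)
  have hK : 0 ≤ c⁻¹ * B + 1 := by positivity
  set q : ℝ → ℝ := fun t => (c⁻¹ * B + 1) * C + M + 3 * c * ∑' k, eigVal l k * a k t ^ 2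
  have hq : IntegrableOn q (Ioc 0 T) := (integrable_const _).add (hint.const_mul _)
  have hsum : ∀ t ∈ Icc 0 T, Summable fun k => a k t ^ 2 := fun t ht =>
    summable_of_sum_le (fun _ => sq_nonneg _) (hC t ht)
  have hbox : Tendsto (degBox n) atTop atTop := by
    refine tendsto_atTop_finset_of_monotone ?_ fun k => ⟨∑ j, k j, mem_degBox.2 le_rfl⟩
    exact fun N N' hN k hk => mem_degBox.2 ((mem_degBox.1 hk).trans hN)
  have hrate : ∀ᵐ t ∂volume.restrict (Ioc 0 T), ∀ N,
      ‖energyRate c l b d a (fun _ => 1) N t‖ ≤ q t := by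
    filter_upwards [ae_restrict_of_ae_restrict_of_subset
      (Ioc_subset_Ioi_self : Ioc (0 : ℝ) T ⊆ Ioi 0) hM, hsm, ae_restrict_mem measurableSet_Ioc]
      with t h1 h2 h3 N
    have h3' : t ∈ Icc 0 T := ⟨h3.1.le, h3.2⟩
    refine (abs_energyRate_one_le hc hl (hB t h3') h1 N).trans ?_
    have h4 : ∑ k ∈ degBox n N, eigVal l k * a k t ^ 2 ≤ ∑' k, eigVal l k * a k t ^ 2 :=
      h2.sum_le_tsum _ fun k _ => mul_nonneg (eigVal_nonneg' hl k) (sq_nonneg _)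
    have h5 : ∑ k ∈ degBox n N, 1 * a k t ^ 2 ≤ C := by simpa using hC t h3' (degBox n N)
    simp only [q]
    gcongr
  have key : ∀ s ∈ Icc 0 T, ∀ t ∈ Icc 0 T,
      |(∑' k, a k t ^ 2) - ∑' k, a k s ^ 2| ≤ |∫ r in s..t, q r| := by
    intro s hs t ht
    have h1 : Tendsto (fun N => |∑ k ∈ degBox n N, 1 * a k t ^ 2 -
        ∑ k ∈ degBox n N, 1 * a k s ^ 2|) atTop
        (𝓝 |(∑' k, a k t ^ 2) - ∑' k, a k s ^ 2|) := by
      simp only [one_mul]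
      exact (((hsum t ht).hasSum.comp hbox).sub ((hsum s hs).hasSum.comp hbox)).abs
    refine le_of_tendsto h1 (Eventually.of_forall fun N => ?_)
    rw [(h.isPrim_energy (fun _ => 1) N).sub_eq hs.1 ht.1, ← Real.norm_eq_abs]
    have hsub : uIoc s t ⊆ Ioc 0 T := by
      rcases le_total s t with hst | hst
      · rw [uIoc_of_le hst]; exact Ioc_subset_Ioc hs.1 ht.2
      · rw [uIoc_of_ge hst]; exact Ioc_subset_Ioc ht.1 hs.2
    refine intervalIntegral.norm_integral_le_abs_of_norm_le ?_ ?_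
    · filter_upwards [ae_restrict_of_ae_restrict_of_subset hsub hrate] with r hr
      exact hr N
    · rw [intervalIntegrable_iff]
      exact hq.mono_set hsub
  have hcq : ContinuousOn (fun t => ∫ r in (0 : ℝ)..t, q r) (Icc 0 T) := by
    have := intervalIntegral.continuousOn_primitive_interval (μ := volume) (f := q) (a := 0)
      (b := T) ((intervalIntegrable_iff' (by simp)).1
        ((intervalIntegrable_iff_integrableOn_Ioc_of_le hT).2 hq))
    rwa [uIcc_of_le hT] at this
  intro s hs
  have h2 : Tendsto (fun t => |∫ r in s..t, q r|) (𝓝[Icc 0 T] s) (𝓝 0) := by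
    have h3 := ((hcq s hs).sub (continuousWithinAt_const (b := ∫ r in (0 : ℝ)..s, q r))).abs
    have h4 : ContinuousWithinAt (fun t => |∫ r in s..t, q r|) (Icc 0 T) s := by
      refine h3.congr (fun t ht => ?_) ?_
      · rw [Pi.sub_apply, intervalIntegral.integral_interval_sub_left]
        · exact (intervalIntegrable_iff_integrableOn_Ioc_of_le ht.1).2
            (hq.mono_set (Ioc_subset_Ioc_right ht.2))
        · exact (intervalIntegrable_iff_integrableOn_Ioc_of_le hs.1).2
            (hq.mono_set (Ioc_subset_Ioc_right hs.2))
      · simp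
    simpa [ContinuousWithinAt] using h4
  rw [ContinuousWithinAt, tendsto_iff_norm_sub_tendsto_zero]
  refine squeeze_zero' (Eventually.of_forall fun _ => norm_nonneg _) ?_ h2
  filter_upwards [self_mem_nhdsWithin] with t ht
  exact key s hs t ht

end Tri

end

section

/-! ### Measurability through Hilbert bases -/

section HilbertBasis

variable {ι E : Type*} [NormedAddCommGroup E] [InnerProductSpace ℝ E]

/-- Convergence of coefficients and norms implies strong convergence: the tail of `f t` is its
squared norm minus finitely many coefficients, hence eventually as small as the tail of `x`. It
turns continuity of the energy into continuity of the path. -/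
theorem HilbertBasis.tendsto_of_norm_sq (b : HilbertBasis ι ℝ E) {β : Type*} {F : Filter β}
    {f : β → E} {x : E} (hn : Tendsto (fun t => ‖f t‖ ^ 2) F (𝓝 (‖x‖ ^ 2)))
    (hi : ∀ i, Tendsto (fun t => inner ℝ (b i) (f t)) F (𝓝 (inner ℝ (b i) x))) :
    Tendsto f F (𝓝 x) := by
  have hle : ∀ (s : Finset ι) (y : E), ‖y - x‖ ^ 2 ≤
      ∑ i ∈ s, (inner ℝ (b i) y - inner ℝ (b i) x) ^ 2 +
        2 * (‖y‖ ^ 2 - ∑ i ∈ s, inner ℝ (b i) y ^ 2) +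
        2 * (‖x‖ ^ 2 - ∑ i ∈ s, inner ℝ (b i) x ^ 2) := by
    intro s y
    have h1 := b.hasSum_inner_sq (y - x)
    have h2 := (((b.hasSum_inner_sq y).mul_left 2).add ((b.hasSum_inner_sq x).mul_left 2)).sub h1
    have h3 := sum_le_hasSum s (fun i _ => ?_) h2
    · simp only [inner_sub_right, Finset.sum_sub_distrib, Finset.sum_add_distrib,
        ← Finset.mul_sum] at h3
      linarith
    · rw [inner_sub_right]
      nlinarith [sq_nonneg (inner ℝ (b i) y + inner ℝ (b i) x)]
  have hsq : Tendsto (fun t => ‖f t - x‖ ^ 2) F (𝓝 0) := by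
    refine tendsto_order.2 ⟨fun a ha => Eventually.of_forall fun t =>
      ha.trans_le (sq_nonneg _), fun ε hε => ?_⟩
    obtain ⟨s, hs⟩ := ((tendsto_order.1 (b.hasSum_inner_sq x)).1 (‖x‖ ^ 2 - ε / 4)
      (by linarith)).exists
    have h4 : Tendsto (fun t => ∑ i ∈ s, (inner ℝ (b i) (f t) - inner ℝ (b i) x) ^ 2 +
        2 * (‖f t‖ ^ 2 - ∑ i ∈ s, inner ℝ (b i) (f t) ^ 2) +
        2 * (‖x‖ ^ 2 - ∑ i ∈ s, inner ℝ (b i) x ^ 2)) F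
        (𝓝 (∑ i ∈ s, (inner ℝ (b i) x - inner ℝ (b i) x) ^ 2 +
        2 * (‖x‖ ^ 2 - ∑ i ∈ s, inner ℝ (b i) x ^ 2) +
        2 * (‖x‖ ^ 2 - ∑ i ∈ s, inner ℝ (b i) x ^ 2))) :=
      ((tendsto_finsetSum _ fun i _ => ((hi i).sub_const _).pow 2).add
        ((hn.sub (tendsto_finsetSum _ fun i _ => (hi i).pow 2)).const_mul 2)).add
          tendsto_const_nhds
    refine ((tendsto_order.1 h4).2 ε ?_).mono fun t ht => (hle s (f t)).trans_lt ht
    simp only [sub_self, ne_eq, OfNat.ofNat_ne_zero, not_false_eq_true, zero_pow,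
      Finset.sum_const_zero, zero_add]
    linarith
  rw [tendsto_iff_norm_sub_tendsto_zero]
  have := hsq.sqrt
  simpa [Real.sqrt_sq] using this

variable [Countable ι] {α : Type*} [MeasurableSpace α] {μ : Measure α}

theorem HilbertBasis.aestronglyMeasurable (b : HilbertBasis ι ℝ E) {f : α → E}
    (hf : ∀ i, AEStronglyMeasurable (fun t => inner ℝ (b i) (f t)) μ) :
    AEStronglyMeasurable f μ := by
  refine aestronglyMeasurable_of_tendsto_ae (atTop : Filter (Finset ι))
    (f := fun s t => ∑ i ∈ s, inner ℝ (b i) (f t) • b i) (fun s => ?_)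
    (Eventually.of_forall fun t => ?_)
  · exact Finset.aestronglyMeasurable_fun_sum _ fun i _ =>
      (hf i).smul aestronglyMeasurable_const
  · have := b.hasSum_repr (f t)
    simp only [b.repr_apply_apply] at this
    exact this

theorem HilbertBasis.aestronglyMeasurable_dual (b : HilbertBasis ι ℝ E) [CompleteSpace E]
    {f : α → StrongDual ℝ E} (hf : ∀ i, AEStronglyMeasurable (fun t => f t (b i)) μ) :
    AEStronglyMeasurable f μ := by
  have h1 : AEStronglyMeasurable (fun t => (InnerProductSpace.toDual ℝ E).symm (f t)) μ := by
    refine b.aestronglyMeasurable fun i => ?_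
    refine (hf i).congr (Eventually.of_forall fun t => ?_)
    simp only
    rw [real_inner_comm, InnerProductSpace.toDual_symm_apply]
  simpa using! (InnerProductSpace.toDual ℝ E).continuous.comp_aestronglyMeasurable h1

end HilbertBasis

theorem ae_restrict_Ioi_of_forall_Ioc {p : ℝ → Prop}
    (h : ∀ T : ℝ, 0 ≤ T → ∀ᵐ t ∂volume.restrict (Ioc 0 T), p t) :
    ∀ᵐ t ∂volume.restrict (Ioi 0), p t := by
  have e : Ioi (0 : ℝ) = ⋃ N : ℕ, Ioc 0 (N : ℝ) := by
    ext t
    simp only [mem_Ioi, mem_iUnion, mem_Ioc]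
    exact ⟨fun ht => (exists_nat_ge t).imp fun N hN => ⟨ht, hN⟩, fun ⟨N, hN⟩ => hN.1⟩
  rw [e, ae_restrict_iUnion_iff]
  exact fun N => h N (Nat.cast_nonneg N)

theorem ae_norm_le_of_memLp_top {E : Type*} [NormedAddCommGroup E] {d : ℝ → E} {μ : Measure ℝ}
    (hd : MemLp d (⊤ : ℝ≥0∞) μ) : ∃ M ≥ 0, ∀ᵐ t ∂μ, ‖d t‖ ≤ M := by
  refine ⟨(eLpNorm d ⊤ μ).toReal, ENNReal.toReal_nonneg, ?_⟩
  filter_upwards [ae_le_eLpNormEssSup (f := d) (μ := μ)] with t ht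
  rw [← eLpNorm_exponent_top] at ht
  rw [← toReal_enorm]
  exact ENNReal.toReal_mono hd.2.ne ht

theorem integrable_of_norm_le_norm_add {E : Type*} [NormedAddCommGroup E] {μ : Measure ℝ}
    {f f₁ f₂ : ℝ → E} (hf : AEStronglyMeasurable f μ) (h1 : Integrable f₁ μ)
    (h2 : Integrable f₂ μ) (hle : ∀ᵐ t ∂μ, ‖f t‖ ≤ ‖f₁ t + f₂ t‖) : Integrable f μ :=
  (h1.add h2).mono hf hle

/-! ### Mild solutions and their coefficients -/

section Coef

variable {n : ℕ} {c : ℝ} {Γ : Matrix (Fin n) (Fin n) ℝ}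
  {v : OrthonormalBasis (Fin n) ℝ (Euc n)} {l : Fin n → ℝ} {g : Euc n → Euc n}
  {d p : ℝ → HSp c Γ} {u : ℝ → Euc n}

theorem continuous_opB1 : Continuous (opB1 c Γ) :=
  (innerSL ℝ).continuous.clm_comp continuous_const

theorem continuous_halfToOne : Continuous (halfToOne c Γ) :=
  continuous_id.clm_comp continuous_const

theorem continuous_toHmHalf : Continuous (toHmHalf c Γ) :=
  (innerSL ℝ).continuous.clm_comp continuous_const

theorem continuousOn_opF {s : Set ℝ} (hg : Continuous g) (hp : ContinuousOn p s)
    (hu : ContinuousOn u s) : ContinuousOn (fun t => opF c Γ g (p t) (u t)) s := by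
  refine (PiLp.continuous_toLp 2 _).comp_continuousOn (continuousOn_pi.2 fun i => ?_)
  have h1 : ContinuousOn (fun t => (g (u t)).ofLp i) s :=
    (PiLp.continuous_apply 2 _ i).comp_continuousOn (hg.comp_continuousOn hu)
  exact h1.smul hp

namespace IsEigBasis

/-- The coefficients of a path in `𝔥`. -/
def coef (h : IsEigBasis c Γ v l) (p : ℝ → HSp c Γ) (k : Fin n → ℕ) (t : ℝ) : ℝ :=
  inner ℝ (h.basisH k) (p t)

/-- The components of the drift `g(u)`. -/
def _root_.drift (v : OrthonormalBasis (Fin n) ℝ (Euc n)) (g : Euc n → Euc n) (u : ℝ → Euc n)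
    (j : Fin n) (t : ℝ) : ℝ := inner ℝ (v j) (g (u t))

theorem _root_.continuousOn_drift {s : Set ℝ} (v : OrthonormalBasis (Fin n) ℝ (Euc n))
    (hg : Continuous g) (hu : ContinuousOn u s) (j : Fin n) : ContinuousOn (drift v g u j) s :=
  continuousOn_const.inner (hg.comp_continuousOn hu)

theorem continuousOn_coef (h : IsEigBasis c Γ v l) {s : Set ℝ} (hp : ContinuousOn p s)
    (k : Fin n → ℕ) : ContinuousOn (h.coef p k) s := continuousOn_const.inner hp

theorem sum_coef_sq_le (h : IsEigBasis c Γ v l) (p : ℝ → HSp c Γ) (t : ℝ)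
    (s : Finset (Fin n → ℕ)) : ∑ k ∈ s, h.coef p k t ^ 2 ≤ ‖p t‖ ^ 2 :=
  sum_le_hasSum s (fun _ _ => sq_nonneg _) (h.basisH.hasSum_inner_sq (p t))

theorem exists_sum_coef_sq_le (h : IsEigBasis c Γ v l)
    (hd : MemLp d (⊤ : ℝ≥0∞) (volume.restrict (Ioi 0))) : ∃ M,
    ∀ᵐ t ∂volume.restrict (Ioi 0), ∀ s : Finset (Fin n → ℕ), ∑ k ∈ s, h.coef d k t ^ 2 ≤ M := by
  obtain ⟨M, -, hM⟩ := ae_norm_le_of_memLp_top hd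
  refine ⟨M ^ 2, hM.mono fun t ht s => (h.sum_coef_sq_le d t s).trans ?_⟩
  gcongr

theorem intervalIntegrable_coef (h : IsEigBasis c Γ v l)
    (hd : MemLp d (⊤ : ℝ≥0∞) (volume.restrict (Ioi 0))) (k : Fin n → ℕ) (T : ℝ) (hT : 0 ≤ T) :
    IntervalIntegrable (h.coef d k) volume 0 T := by
  rw [intervalIntegrable_iff_integrableOn_Ioc_of_le hT]
  have h1 : MemLp d (⊤ : ℝ≥0∞) (volume.restrict (Ioc 0 T)) :=
    hd.mono_measure (Measure.restrict_mono Ioc_subset_Ioi_self le_rfl)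
  exact (innerSL ℝ (h.basisH k)).integrable_comp (h1.integrable le_top)

theorem apply_eigD (h : IsEigBasis c Γ v l) (g : Euc n → Euc n) (d p : ℝ → HSp c Γ)
    (u : ℝ → Euc n) (k : Fin n → ℕ) (s : ℝ) :
    (halfToOne c Γ (opB1 c Γ (opF c Γ g (p s) (u s))) + toHmOne c Γ (d s)) (h.eigD k) =
      triForce l (drift v g u) (h.coef d) (h.coef p) k s := by
  rw [_root_.add_apply, h.toHmOne_eigD]
  have : halfToOne c Γ (opB1 c Γ (opF c Γ g (p s) (u s))) (h.eigD k) =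
      opB1 c Γ (opF c Γ g (p s) (u s)) (h.eigV k) := rfl
  rw [this, h.opB1_opF_eigV]
  rfl

/-- The coefficients of a mild solution solve the triangular system. -/
theorem isTriSol_of_isMildSolutionOn (h : IsEigBasis c Γ v l) {p₀ : HSp c Γ} (hg : Continuous g)
    (hd : MemLp d (⊤ : ℝ≥0∞) (volume.restrict (Ioi 0))) (hu : ContinuousOn u (Ici 0))
    (hp : ∀ t₁ > 0, IsMildSolutionOn c Γ g p₀ d t₁ p u) :
    ContinuousOn p (Ici 0) ∧ IsTriSol c l (drift v g u) (h.coef d) (h.coef p) ∧ p 0 = p₀ := by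
  have hpc : ContinuousOn p (Ici 0) := by
    intro t ht
    have ht : 0 ≤ t := ht
    refine ((hp (t + 1) (by linarith)).cont t ⟨ht, by linarith⟩).mono_of_mem_nhdsWithin ?_
    rw [← Ici_inter_Iic]
    exact inter_mem self_mem_nhdsWithin (mem_nhdsWithin_of_mem_nhds (Iic_mem_nhds (by linarith)))
  have heq : ∀ k, ∀ t ≥ 0, h.coef p k t = Real.exp (-(c * eigVal l k * t)) *
      inner ℝ (h.basisH k) p₀ + ∫ s in (0 : ℝ)..t, Real.exp (-(c * eigVal l k * (t - s))) *
        triForce l (drift v g u) (h.coef d) (h.coef p) k s := by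
    intro k t ht
    obtain ⟨-, hi, he⟩ := hp (t + 1) (by linarith)
    have htm : t ∈ Icc 0 (t + 1) := ⟨ht, by linarith⟩
    have h1 := congrArg (fun F : HmOne c Γ => F (h.eigD k)) (he t htm)
    simp only [_root_.add_apply, h.toHmOne_eigD, h.inner_fpSemigroup k ht] at h1
    refine h1.trans (congrArg _ ?_)
    have h2 := (ContinuousLinearMap.apply ℝ ℝ (h.eigD k)).intervalIntegral_comp_comm (hi t htm)
    refine h2.symm.trans (intervalIntegral.integral_congr fun s hs => ?_)
    rw [uIcc_of_le ht] at hs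
    simp only [ContinuousLinearMap.apply_apply]
    rw [h.fpSemigroupExt_eigD (sub_nonneg.2 hs.2), h.apply_eigD]
  refine ⟨hpc, fun k => ?_, h.basisH.ext_inner fun k => ?_⟩
  · exact IsPrim.of_eq_exp_mul (intervalIntegrable_triForce (continuousOn_drift v hg hu)
      (h.intervalIntegrable_coef hd) (h.continuousOn_coef hpc) k) (heq k)
  · simpa [coef] using heq k 0 le_rfl

/-- Coefficientwise the mild formula is variation of constants. What remains is Bochner
integrability in `𝔥_{-1}`: measurability is checked on the eigenvectors, and domination follows
since the extended semigroup is contractive. -/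
theorem isMildSolutionOn_of_isTriSol (h : IsEigBasis c Γ v l) (hg : Continuous g)
    (hd : MemLp d (⊤ : ℝ≥0∞) (volume.restrict (Ioi 0))) (hu : ContinuousOn u (Ici 0))
    (hp : ContinuousOn p (Ici 0)) (hs : IsTriSol c l (drift v g u) (h.coef d) (h.coef p))
    (t₁ : ℝ) : IsMildSolutionOn c Γ g (p 0) d t₁ p u := by
  have := h.completeSpace_DSp
  have hint : ∀ t ∈ Icc 0 t₁, IntervalIntegrable (fun s => fpSemigroupExt c Γ (t - s)
      (halfToOne c Γ (opB1 c Γ (opF c Γ g (p s) (u s))) + toHmOne c Γ (d s))) volume 0 t := by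
    intro t ht
    rw [intervalIntegrable_iff_integrableOn_Ioc_of_le ht.1]
    have hsub : Icc 0 t ⊆ Ici (0 : ℝ) := fun s hs => hs.1
    have hcont : ContinuousOn (fun s => halfToOne c Γ (opB1 c Γ (opF c Γ g (p s) (u s))))
        (Icc 0 t) := continuous_halfToOne.comp_continuousOn (continuous_opB1.comp_continuousOn
          (continuousOn_opF hg (hp.mono hsub) (hu.mono hsub)))
    have hi1 : Integrable (fun s => halfToOne c Γ (opB1 c Γ (opF c Γ g (p s) (u s))))
        (volume.restrict (Ioc 0 t)) := hcont.integrableOn_Icc.mono_set Ioc_subset_Icc_self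
    have hi2 : Integrable (fun s => toHmOne c Γ (d s)) (volume.restrict (Ioc 0 t)) := by
      have h1 : MemLp d (⊤ : ℝ≥0∞) (volume.restrict (Ioc 0 t)) :=
        hd.mono_measure (Measure.restrict_mono Ioc_subset_Ioi_self le_rfl)
      have h2 : IntegrableOn d (Ioc 0 t) := h1.integrable le_top
      exact (((ContinuousLinearMap.compL ℝ (DSp c Γ) (VSp c Γ) ℝ).flip (DSp.toV c Γ)).comp
        (((ContinuousLinearMap.compL ℝ (VSp c Γ) (HSp c Γ) ℝ).flip (VSp.val c Γ)).comp
          (innerSL ℝ))).integrable_comp h2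
    refine integrable_of_norm_le_norm_add ?_ hi1 hi2 ?_
    · refine h.basisD.aestronglyMeasurable_dual fun k => ?_
      simp only [h.basisD_apply, map_smul, smul_eq_mul]
      refine AEStronglyMeasurable.const_mul ?_ _
      have h3 := (intervalIntegrable_iff_integrableOn_Ioc_of_le ht.1).1
        (intervalIntegrable_triForce (l := l) (continuousOn_drift v hg hu)
          (h.intervalIntegrable_coef hd) (h.continuousOn_coef hp) k t ht.1)
      have h4 : Continuous fun s => Real.exp (-(c * eigVal l k * (t - s))) := by fun_prop
      refine (h4.aestronglyMeasurable.mul h3.1).congr ?_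
      filter_upwards [ae_restrict_mem measurableSet_Ioc] with s hs
      rw [h.fpSemigroupExt_eigD (sub_nonneg.2 hs.2), h.apply_eigD]
      rfl
    · filter_upwards [ae_restrict_mem measurableSet_Ioc] with s hs
      exact h.norm_fpSemigroupExt_le (sub_nonneg.2 hs.2) _
  refine ⟨hp.mono fun s hs => hs.1, hint, fun t ht => h.HmOne_ext fun k => ?_⟩
  have h2 := (ContinuousLinearMap.apply ℝ ℝ (h.eigD k)).intervalIntegral_comp_comm (hint t ht)
  rw [_root_.add_apply, h.toHmOne_eigD, h.toHmOne_eigD, h.inner_fpSemigroup k ht.1]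
  refine ((hs k).eq_exp_mul ht.1).trans (congrArg _ (Eq.trans ?_ h2))
  refine intervalIntegral.integral_congr fun s hs => ?_
  rw [uIcc_of_le ht.1] at hs
  simp only [ContinuousLinearMap.apply_apply]
  rw [h.fpSemigroupExt_eigD (sub_nonneg.2 hs.2), h.apply_eigD]

/-- The scalar solutions are square summable at each time and so define a path in `𝔥`. It is
continuous because its coefficients and its norm are. -/
theorem exists_isTriSol_coef (h : IsEigBasis c Γ v l) (hg : Continuous g)
    (hd : MemLp d (⊤ : ℝ≥0∞) (volume.restrict (Ioi 0))) (hu : ContinuousOn u (Ici 0))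
    (p₀ : HSp c Γ) : ∃ p, ContinuousOn p (Ici 0) ∧
      IsTriSol c l (drift v g u) (h.coef d) (h.coef p) ∧ p 0 = p₀ := by
  obtain ⟨M, hM⟩ := h.exists_sum_coef_sq_le hd
  have hb := continuousOn_drift v hg hu
  obtain ⟨a, ha, ha0⟩ := exists_isTriSol (c := c) (l := l) hb (h.intervalIntegrable_coef hd)
    fun k => inner ℝ (h.basisH k) p₀
  have h0 : ∀ s : Finset (Fin n → ℕ), ∑ k ∈ s, a k 0 ^ 2 ≤ ‖p₀‖ ^ 2 := fun s => by
    simp only [ha0]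
    exact h.sum_coef_sq_le (fun _ => p₀) 0 s
  have hex : ∀ t, ∃ x : HSp c Γ, 0 ≤ t → ∀ k, inner ℝ (h.basisH k) x = a k t := fun t => by
    by_cases ht : 0 ≤ t
    · obtain ⟨C, hC, -⟩ := ha.exists_bound h.cpos h.pos hb hM h0 t ht
      obtain ⟨x, hx⟩ := h.basisH.exists_of_summable
        (summable_of_sum_le (fun _ => sq_nonneg _) (hC t ⟨ht, le_rfl⟩))
      exact ⟨x, fun _ => hx⟩
    · exact ⟨0, fun h => absurd h ht⟩
  choose p hp using hex
  refine ⟨p, fun t ht => ?_, fun k => ?_, h.basisH.ext_inner fun k => ?_⟩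
  · have ht : 0 ≤ t := ht
    have hT : (0 : ℝ) ≤ t + 1 := by linarith
    have hsq : ∀ s ≥ 0, ∑' k, a k s ^ 2 = ‖p s‖ ^ 2 := fun s hs => by
      rw [← (h.basisH.hasSum_inner_sq (p s)).tsum_eq]
      simp only [hp s hs]
    have h1 := ha.continuousOn_tsum h.cpos h.pos hb hM h0 (t + 1) hT t ⟨ht, by linarith⟩
    have h2 : ContinuousWithinAt p (Icc 0 (t + 1)) t := by
      refine h.basisH.tendsto_of_norm_sq ?_ fun k => ?_
      · rw [← hsq t ht]
        exact h1.congr' (by filter_upwards [self_mem_nhdsWithin] with s hs using hsq s hs.1)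
      · rw [hp t ht]
        exact (((ha k).continuousOn t ht).mono fun s hs => hs.1).congr'
          (by filter_upwards [self_mem_nhdsWithin] with s hs using (hp s hs.1 k).symm)
    refine h2.mono_of_mem_nhdsWithin ?_
    rw [← Ici_inter_Iic]
    exact inter_mem self_mem_nhdsWithin (mem_nhdsWithin_of_mem_nhds (Iic_mem_nhds (by linarith)))
  · refine (ha k).congr (fun t ht => hp t ht k) ?_
    filter_upwards [ae_restrict_mem measurableSet_Ioi] with t ht
    have ht0 : 0 ≤ t := le_of_lt ht
    have e : ∀ k, h.coef p k t = a k t := fun k => hp t ht0 k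
    simp only [triForce, e]
  · rw [hp 0 le_rfl, ha0]

theorem eqOn_of_isTriSol_coef (h : IsEigBasis c Γ v l) {p' : ℝ → HSp c Γ} {u' : ℝ → Euc n} {T : ℝ}
    (hu : EqOn u' u (Icc 0 T)) (hs : IsTriSol c l (drift v g u) (h.coef d) (h.coef p))
    (hs' : IsTriSol c l (drift v g u') (h.coef d) (h.coef p')) (h0 : p' 0 = p 0) :
    EqOn p' p (Icc 0 T) := fun t ht => h.basisH.ext_inner fun k =>
  IsTriSol.unique (fun j s hs => by simp only [drift, hu hs]) hs' hs
    (fun k => by simp only [coef, h0]) k ht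

end IsEigBasis

end Coef

end

section

/-! ### Regularity of mild solutions -/

section Regularity

variable {n : ℕ} {c : ℝ} {Γ : Matrix (Fin n) (Fin n) ℝ}
  {v : OrthonormalBasis (Fin n) ℝ (Euc n)} {l : Fin n → ℝ} {g : Euc n → Euc n}
  {d p : ℝ → HSp c Γ} {u : ℝ → Euc n}

/-- The form `𝔞` as an operator `𝔙 → 𝔥_{-1/2}`. -/
def formACLM (c : ℝ) (Γ : Matrix (Fin n) (Fin n) ℝ) : VSp c Γ →L[ℝ] HmHalf c Γ :=
  ((ContinuousLinearMap.compL ℝ (VSp c Γ) (HnSp c Γ) ℝ).flip (VSp.grad c Γ)).comp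
    ((innerSL ℝ).comp (VSp.grad c Γ))

theorem formACLM_apply (w w' : VSp c Γ) : formACLM c Γ w w' = formA c Γ w w' := rfl

/-- The embedding `𝔥 → 𝔥_{-1/2}` as a continuous linear map. -/
def toHmHalfCLM (c : ℝ) (Γ : Matrix (Fin n) (Fin n) ℝ) : HSp c Γ →L[ℝ] HmHalf c Γ :=
  ((ContinuousLinearMap.compL ℝ (VSp c Γ) (HSp c Γ) ℝ).flip (VSp.val c Γ)).comp (innerSL ℝ)

theorem toHmHalfCLM_apply (x : HSp c Γ) : toHmHalfCLM c Γ x = toHmHalf c Γ x := rfl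

/-- The right-hand side of the evolution equation in `𝔥_{-1/2}`. -/
def weakRhs (c : ℝ) (Γ : Matrix (Fin n) (Fin n) ℝ) (g : Euc n → Euc n) (d p : ℝ → HSp c Γ)
    (u : ℝ → Euc n) (P : ℝ → VSp c Γ) (t : ℝ) : HmHalf c Γ :=
  (-c) • formACLM c Γ (P t) + (opB1 c Γ (opF c Γ g (p t) (u t)) + toHmHalfCLM c Γ (d t))

theorem locallyIntegrableOn_Ioi {E : Type*} [NormedAddCommGroup E] {f : ℝ → E}
    (hf : ∀ T > 0, IntegrableOn f (Ioo 0 T)) : LocallyIntegrableOn f (Ioi 0) := by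
  intro t ht
  have ht : 0 < t := ht
  exact ⟨Ioo 0 (t + 1), mem_nhdsWithin_of_mem_nhds (Ioo_mem_nhds ht (by linarith)),
    hf _ (by linarith)⟩

theorem memLp_of_continuousOn_Icc {E : Type*} [NormedAddCommGroup E] {f : ℝ → E} {T : ℝ}
    (hf : ContinuousOn f (Icc 0 T)) (q : ℝ≥0∞) : MemLp f q (volume.restrict (Ioo 0 T)) := by
  obtain ⟨C, hC⟩ := isCompact_Icc.exists_bound_of_continuousOn hf
  have h1 : AEStronglyMeasurable f (volume.restrict (Ioo 0 T)) :=
    (hf.mono Ioo_subset_Icc_self).aestronglyMeasurable measurableSet_Ioo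
  refine MemLp.of_bound h1 C ?_
  filter_upwards [ae_restrict_mem measurableSet_Ioo] with t ht
  exact hC t (Ioo_subset_Icc_self ht)

theorem memLp_smul_clm_add {E F : Type*} [NormedAddCommGroup E] [NormedSpace ℝ E]
    [NormedAddCommGroup F] [NormedSpace ℝ F] {μ : Measure ℝ} {q : ℝ≥0∞} (a : ℝ) (L : E →L[ℝ] F)
    {f : ℝ → E} {f₁ f₂ : ℝ → F} (hf : MemLp f q μ) (h1 : MemLp f₁ q μ) (h2 : MemLp f₂ q μ) :
    MemLp (fun t => a • L (f t) + (f₁ t + f₂ t)) q μ :=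
  ((L.comp_memLp' hf).const_smul a).add (h1.add h2)

namespace IsEigBasis

theorem memLp_weakRhs (hg : Continuous g) (hp : ContinuousOn p (Ici 0))
    (hu : ContinuousOn u (Ici 0)) (hd : MemLp d (⊤ : ℝ≥0∞) (volume.restrict (Ioi 0)))
    {P : ℝ → VSp c Γ} {q : ℝ≥0∞} {T : ℝ} (hP : MemLp P q (volume.restrict (Ioo 0 T))) :
    MemLp (weakRhs c Γ g d p u P) q (volume.restrict (Ioo 0 T)) := by
  have hsub : Icc 0 T ⊆ Ici (0 : ℝ) := fun s hs => hs.1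
  have h2 : MemLp (fun t => opB1 c Γ (opF c Γ g (p t) (u t))) q (volume.restrict (Ioo 0 T)) :=
    memLp_of_continuousOn_Icc (continuous_opB1.comp_continuousOn
      (continuousOn_opF hg (hp.mono hsub) (hu.mono hsub))) q
  have h3 : MemLp (fun t => d t) q (volume.restrict (Ioo 0 T)) :=
    (hd.mono_measure (Measure.restrict_mono Ioo_subset_Ioi_self le_rfl)).mono_exponent le_top
  have h4 : MemLp (fun t => toHmHalfCLM c Γ (d t)) q (volume.restrict (Ioo 0 T)) :=
    (toHmHalfCLM c Γ).comp_memLp' h3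
  exact memLp_smul_clm_add (-c) (formACLM c Γ) hP h2 h4

/-- Paired with an eigenvector, the right-hand side in `𝔥_{-1/2}` is that of the scalar equation for
mode `k`. -/
theorem isPrim_weakRhs (h : IsEigBasis c Γ v l)
    (hs : IsTriSol c l (drift v g u) (h.coef d) (h.coef p)) {P : ℝ → VSp c Γ}
    (hP : ∀ᵐ t ∂volume.restrict (Ioi 0), VSp.val c Γ (P t) = p t) (k : Fin n → ℕ) :
    IsPrim (fun t => toHmHalf c Γ (p t) (h.eigV k)) fun t =>
        weakRhs c Γ g d p u P t (h.eigV k) := by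
  refine (hs k).congr (fun t _ => h.toHmHalf_eigV _ _) ?_
  filter_upwards [hP] with t ht
  rw [weakRhs, _root_.add_apply, _root_.add_apply, _root_.smul_apply, formACLM_apply, formA_comm,
    h.formA_eigV, ht, h.opB1_opF_eigV, toHmHalfCLM_apply, h.toHmHalf_eigV, smul_eq_mul]
  simp only [triForce, coef, drift]
  ring

theorem hasWeakDerivOn_weakRhs (h : IsEigBasis c Γ v l) (hg : Continuous g)
    (hp : ContinuousOn p (Ici 0)) (hu : ContinuousOn u (Ici 0))
    (hd : MemLp d (⊤ : ℝ≥0∞) (volume.restrict (Ioi 0)))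
    (hs : IsTriSol c l (drift v g u) (h.coef d) (h.coef p)) {P : ℝ → VSp c Γ}
    (hP : ∀ᵐ t ∂volume.restrict (Ioi 0), VSp.val c Γ (P t) = p t)
    (hP1 : ∀ T > 0, MemLp P 1 (volume.restrict (Ioo 0 T))) {J : Set ℝ} (hJ : J ⊆ Ioi 0) :
    HasWeakDerivOn (fun t => toHmHalf c Γ (p t)) (weakRhs c Γ g d p u P) J := by
  have h1 : LocallyIntegrableOn (fun t => toHmHalf c Γ (p t)) (Ioi 0) :=
    (continuous_toHmHalf.comp_continuousOn (hp.mono Ioi_subset_Ici_self)).locallyIntegrableOn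
      measurableSet_Ioi
  have h2 : LocallyIntegrableOn (weakRhs c Γ g d p u P) (Ioi 0) :=
    locallyIntegrableOn_Ioi fun T hT => memLp_one_iff_integrable.1
      (memLp_weakRhs hg hp hu hd (hP1 T hT))
  refine hasWeakDerivOn_of_isPrim hJ (h1.mono_set hJ) (h2.mono_set hJ)
    (fun k => ContinuousLinearMap.apply ℝ ℝ (h.eigV k)) (fun F G hFG => h.HmHalf_ext hFG) ?_
  exact h.isPrim_weakRhs hs hP

/-- The integrated dissipation is finite, so `∑ μ_k a_k²` converges for almost every time and is
integrable; this is square integrability in `𝔙`. -/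
theorem exists_path_VSp (h : IsEigBasis c Γ v l) (hg : Continuous g)
    (hu : ContinuousOn u (Ici 0)) (hd : MemLp d (⊤ : ℝ≥0∞) (volume.restrict (Ioi 0)))
    (hs : IsTriSol c l (drift v g u) (h.coef d) (h.coef p)) : ∃ P : ℝ → VSp c Γ,
    (∀ᵐ t ∂volume.restrict (Ioi 0), VSp.val c Γ (P t) = p t) ∧
    ∀ T > 0, MemLp P 2 (volume.restrict (Ioo 0 T)) := by
  obtain ⟨M, hM⟩ := h.exists_sum_coef_sq_le hd
  have hb := continuousOn_drift v hg hu
  have hE := h.sum_coef_sq_le p 0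
  have hsq : ∀ t, HasSum (fun k => h.coef p k t ^ 2) (‖p t‖ ^ 2) := fun t =>
    h.basisH.hasSum_inner_sq (p t)
  have hV : ∀ t, (Summable fun k => eigVal l k * h.coef p k t ^ 2) →
      ∃ w : VSp c Γ, VSp.val c Γ w = p t := fun t ht => by
    obtain ⟨w, hw⟩ := h.exists_VSp (a := fun k => h.coef p k t)
      (by simpa only [add_mul, one_mul] using (hsq t).summable.add ht)
    exact ⟨w, h.basisH.ext_inner hw⟩
  have hex : ∀ t, ∃ w : VSp c Γ, (Summable fun k => eigVal l k * h.coef p k t ^ 2) →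
      VSp.val c Γ w = p t := fun t => by
    by_cases ht : Summable fun k => eigVal l k * h.coef p k t ^ 2
    · obtain ⟨w, hw⟩ := hV t ht
      exact ⟨w, fun _ => hw⟩
    · exact ⟨0, fun h => absurd h ht⟩
  choose P hP using hex
  have hae : ∀ T, 0 ≤ T → ∀ᵐ t ∂volume.restrict (Ioc 0 T), VSp.val c Γ (P t) = p t := fun T hT =>
    (hs.integrable_tsum_eigVal h.cpos h.pos hb hM hE T hT).1.mono fun t ht => hP t ht
  refine ⟨P, ae_restrict_Ioi_of_forall_Ioc hae, fun T hT => ?_⟩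
  have hae' : ∀ᵐ t ∂volume.restrict (Ioo 0 T), VSp.val c Γ (P t) = p t :=
    ae_restrict_of_ae_restrict_of_subset Ioo_subset_Ioc_self (hae T hT.le)
  have hsub : Ioo 0 T ⊆ Ici (0 : ℝ) := fun s hs => hs.1.le
  have hcoef : ∀ k, AEStronglyMeasurable (h.coef p k) (volume.restrict (Ioo 0 T)) := fun k =>
    ((hs k).continuousOn.mono hsub).aestronglyMeasurable measurableSet_Ioo
  have hmeas : AEStronglyMeasurable P (volume.restrict (Ioo 0 T)) := by
    refine h.basisV.aestronglyMeasurable fun k => ?_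
    refine ((hcoef k).const_mul √(1 + eigVal l k)).congr ?_
    filter_upwards [hae'] with t ht
    rw [h.inner_basisV, ht, coef]
  obtain ⟨hsm, hint⟩ := hs.integrable_tsum_eigVal h.cpos h.pos hb hM hE T hT.le
  obtain ⟨C, hC, -⟩ := hs.exists_bound h.cpos h.pos hb hM hE T hT.le
  rw [memLp_two_iff_integrable_sq_norm hmeas]
  have hint' : IntegrableOn (fun t => C + ∑' k, eigVal l k * h.coef p k t ^ 2) (Ioo 0 T) :=
    Integrable.add (integrable_const C) (hint.mono_set Ioo_subset_Ioc_self)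
  refine hint'.mono' (hmeas.norm.pow 2) ?_
  filter_upwards [hae', ae_restrict_of_ae_restrict_of_subset Ioo_subset_Ioc_self hsm,
    ae_restrict_mem measurableSet_Ioo] with t ht ht2 ht3
  have e : ‖P t‖ ^ 2 = ‖p t‖ ^ 2 + ∑' k, eigVal l k * h.coef p k t ^ 2 := by
    have h1 := h.hasSum_norm_sq_VSp (P t)
    rw [ht] at h1
    have h2 := (hsq t).add ht2.hasSum
    refine h1.unique (h2.congr_fun fun k => ?_)
    simp only [coef]
    ring
  rw [Real.norm_of_nonneg (sq_nonneg _), e, ← (hsq t).tsum_eq]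
  gcongr
  exact (hsq t).summable.tsum_le_of_sum_le (hC t ⟨ht3.1.le, ht3.2.le⟩)

/-- If `p(0) ∈ 𝔙`, then `p` is locally bounded in `𝔙`. -/
theorem memLp_top_path_VSp (h : IsEigBasis c Γ v l) (hg : Continuous g)
    (hu : ContinuousOn u (Ici 0)) (hd : MemLp d (⊤ : ℝ≥0∞) (volume.restrict (Ioi 0)))
    (hs : IsTriSol c l (drift v g u) (h.coef d) (h.coef p)) {w₀ : VSp c Γ}
    (hw : VSp.val c Γ w₀ = p 0) {P : ℝ → VSp c Γ}
    (hP : ∀ᵐ t ∂volume.restrict (Ioi 0), VSp.val c Γ (P t) = p t) {T : ℝ} (hT : 0 < T)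
    (hPm : AEStronglyMeasurable P (volume.restrict (Ioo 0 T))) :
    MemLp P (⊤ : ℝ≥0∞) (volume.restrict (Ioo 0 T)) := by
  obtain ⟨M, hM⟩ := h.exists_sum_coef_sq_le hd
  have hb := continuousOn_drift v hg hu
  have hE := h.sum_coef_sq_le p 0
  have hE1 : ∀ s : Finset (Fin n → ℕ), ∑ k ∈ s, eigVal l k * h.coef p k 0 ^ 2 ≤ ‖w₀‖ ^ 2 :=
    fun s => by
      have h1 := sum_le_hasSum s (fun k _ => mul_nonneg (h.one_add_eigVal_pos k).le (sq_nonneg _))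
        (h.hasSum_norm_sq_VSp w₀)
      rw [hw] at h1
      refine (Finset.sum_le_sum fun k _ => ?_).trans h1
      exact mul_le_mul_of_nonneg_right (by linarith) (sq_nonneg _)
  obtain ⟨C, hC, -⟩ := hs.exists_bound h.cpos h.pos hb hM hE T hT.le
  obtain ⟨C', hC'⟩ := hs.exists_bound_eigVal h.cpos h.pos hb hM hE hE1 T hT.le
  refine memLp_top_of_bound hPm √(C + C') ?_
  filter_upwards [ae_restrict_of_ae_restrict_of_subset Ioo_subset_Ioi_self hP,
    ae_restrict_mem measurableSet_Ioo] with t ht ht3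
  have ht' : t ∈ Icc 0 T := ⟨ht3.1.le, ht3.2.le⟩
  refine Real.le_sqrt_of_sq_le ?_
  have h1 := h.hasSum_norm_sq_VSp (P t)
  rw [ht] at h1
  refine le_of_tendsto' h1 fun s => ?_
  have e : ∑ k ∈ s, (1 + eigVal l k) * inner ℝ (h.basisH k) (p t) ^ 2 =
      ∑ k ∈ s, h.coef p k t ^ 2 + ∑ k ∈ s, eigVal l k * h.coef p k t ^ 2 := by
    rw [← Finset.sum_add_distrib]
    exact Finset.sum_congr rfl fun k _ => by simp only [coef]; ring
  rw [e]
  exact add_le_add (hC t ht' s) (hC' t ht' s)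

theorem isRegularOn_of_memLp (h : IsEigBasis c Γ v l) (hg : Continuous g)
    (hp : ContinuousOn p (Ici 0)) (hu : ContinuousOn u (Ici 0))
    (hd : MemLp d (⊤ : ℝ≥0∞) (volume.restrict (Ioi 0)))
    (hs : IsTriSol c l (drift v g u) (h.coef d) (h.coef p)) {P : ℝ → VSp c Γ}
    (hP : ∀ᵐ t ∂volume.restrict (Ioi 0), VSp.val c Γ (P t) = p t)
    (hP1 : ∀ T > 0, MemLp P 1 (volume.restrict (Ioo 0 T))) {q : ℝ≥0∞} {T : ℝ}
    (hPq : MemLp P q (volume.restrict (Ioo 0 T))) : IsRegularOn c Γ q T p := by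
  refine ⟨⟨P, ae_restrict_of_ae_restrict_of_subset Ioo_subset_Ioi_self hP, hPq⟩,
    weakRhs c Γ g d p u P, ?_, memLp_weakRhs hg hp hu hd hPq,
    h.hasWeakDerivOn_weakRhs hg hp hu hd hs hP hP1 Ioo_subset_Ioi_self⟩
  exact memLp_of_continuousOn_Icc (continuous_toHmHalf.comp_continuousOn
    (hp.mono fun s hs => hs.1)) q

theorem isRegularOn (h : IsEigBasis c Γ v l) (hg : Continuous g)
    (hp : ContinuousOn p (Ici 0)) (hu : ContinuousOn u (Ici 0))
    (hd : MemLp d (⊤ : ℝ≥0∞) (volume.restrict (Ioi 0)))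
    (hs : IsTriSol c l (drift v g u) (h.coef d) (h.coef p)) {q : ℝ≥0∞} (hq : q ≤ 2) {T : ℝ}
    (hT : 0 < T) : IsRegularOn c Γ q T p := by
  obtain ⟨P, hP, hP2⟩ := h.exists_path_VSp hg hu hd hs
  exact h.isRegularOn_of_memLp hg hp hu hd hs hP
    (fun T hT => (hP2 T hT).mono_exponent (by norm_num)) ((hP2 T hT).mono_exponent hq)

theorem isRegularOn_of_mem_VSp (h : IsEigBasis c Γ v l) (hg : Continuous g)
    (hp : ContinuousOn p (Ici 0)) (hu : ContinuousOn u (Ici 0))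
    (hd : MemLp d (⊤ : ℝ≥0∞) (volume.restrict (Ioi 0)))
    (hs : IsTriSol c l (drift v g u) (h.coef d) (h.coef p)) {w₀ : VSp c Γ}
    (hw : VSp.val c Γ w₀ = p 0) (q : ℝ≥0∞) {T : ℝ} (hT : 0 < T) : IsRegularOn c Γ q T p := by
  obtain ⟨P, hP, hP2⟩ := h.exists_path_VSp hg hu hd hs
  exact h.isRegularOn_of_memLp hg hp hu hd hs hP
    (fun T hT => (hP2 T hT).mono_exponent (by norm_num))
    ((h.memLp_top_path_VSp hg hu hd hs hw hP hT (hP2 T hT).1).mono_exponent le_top)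

theorem isWeakSolution (h : IsEigBasis c Γ v l) (hg : Continuous g)
    (hp : ContinuousOn p (Ici 0)) (hu : ContinuousOn u (Ici 0))
    (hd : MemLp d (⊤ : ℝ≥0∞) (volume.restrict (Ioi 0)))
    (hs : IsTriSol c l (drift v g u) (h.coef d) (h.coef p)) : IsWeakSolution c Γ g d p u := by
  obtain ⟨P, hP, hP2⟩ := h.exists_path_VSp hg hu hd hs
  refine ⟨weakRhs c Γ g d p u P, h.hasWeakDerivOn_weakRhs hg hp hu hd hs hP
    (fun T hT => (hP2 T hT).mono_exponent (by norm_num)) subset_rfl, hP.mono fun t ht =>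
      ⟨P t, ht, fun w => ?_⟩⟩
  rw [weakRhs, _root_.add_apply, _root_.smul_apply, formACLM_apply, toHmHalfCLM_apply, smul_eq_mul,
    neg_mul]

theorem memLp_top_path (h : IsEigBasis c Γ v l) (hp : ContinuousOn p (Ici 0))
    (hd : MemLp d (⊤ : ℝ≥0∞) (volume.restrict (Ioi 0)))
    (hd0 : ∀ᵐ t ∂volume.restrict (Ioi 0), h.coef d 0 t = 0)
    (hs : IsTriSol c l (drift v g u) (h.coef d) (h.coef p)) {β : ℝ}
    (hb : ∀ j, ∀ t ≥ 0, |drift v g u j t| ≤ β) :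
    MemLp p (⊤ : ℝ≥0∞) (volume.restrict (Ioi 0)) := by
  obtain ⟨M, hM⟩ := h.exists_sum_coef_sq_le hd
  obtain ⟨C, hC⟩ := hs.exists_bound_global h.cpos h.pos hb hM hd0 (h.sum_coef_sq_le p 0)
  refine memLp_top_of_bound ((hp.mono Ioi_subset_Ici_self).aestronglyMeasurable
    measurableSet_Ioi) √C ?_
  filter_upwards [ae_restrict_mem measurableSet_Ioi] with t ht
  refine Real.le_sqrt_of_sq_le ?_
  exact le_of_tendsto' (h.basisH.hasSum_inner_sq (p t)) (hC t (le_of_lt ht))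

end IsEigBasis

end Regularity

end

section

/-! ### Ordinary differential equations with integrable right-hand sides -/

section Volterra

variable {E : Type*} [NormedAddCommGroup E] [NormedSpace ℝ E]

/-- Global existence for an ordinary differential equation with a Lipschitz right-hand side whose
Lipschitz constant may grow in time. -/
theorem exists_eq_add_integral [CompleteSpace E] {H : ℝ → E → E}
    (hH : Continuous (Function.uncurry H)) {K : ℝ → ℝ} (hK : Continuous K) (hK0 : ∀ s, 0 ≤ K s)
    (hlip : ∀ s x y, ‖H s x - H s y‖ ≤ K s * ‖x - y‖) (h0 : ∀ s, ‖H s 0‖ ≤ K s) (y₀ : E) :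
    ∃ z : ℝ → E, Continuous z ∧ ∀ t ≥ 0, z t = y₀ + ∫ s in (0 : ℝ)..t, H s (z s) := by
  -- The unknown is written as `z = e^{2κ} x`. In this exponentially weighted norm the integral
  -- operator is a contraction with constant `1/2`, because `∫ K e^{2κ} ≤ e^{2κ} / 2`, however fast
  -- `K` grows.
  set κ : ℝ → ℝ := fun t => ∫ s in (0 : ℝ)..t, K s
  have hκd : ∀ t, HasDerivAt κ (K t) t := fun t =>
    intervalIntegral.integral_hasDerivAt_right (hK.intervalIntegrable _ _)
      (hK.stronglyMeasurableAtFilter _ _) hK.continuousAt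
  have hκc : Continuous κ := continuous_iff_continuousAt.2 fun t => (hκd t).continuousAt
  have hκ0 : ∀ t, 0 ≤ t → 0 ≤ κ t := fun t ht =>
    intervalIntegral.integral_nonneg ht fun s _ => hK0 s
  have hexp : ∀ t, ∫ s in (0 : ℝ)..t, K s * Real.exp (2 * κ s) =
      (Real.exp (2 * κ t) - 1) / 2 := fun t => by
    have hd : ∀ s ∈ uIcc 0 t, HasDerivAt (fun s => Real.exp (2 * κ s) / 2)
        (K s * Real.exp (2 * κ s)) s := fun s _ => by
      refine ((((hκd s).const_mul 2).exp).div_const 2).congr_deriv ?_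
      ring
    rw [intervalIntegral.integral_eq_sub_of_hasDerivAt hd
      (Continuous.intervalIntegrable (by fun_prop) _ _)]
    simp [κ]
    ring
  have hJc : ∀ x : BoundedContinuousFunction ℝ E,
      Continuous fun s => H s (Real.exp (2 * κ s) • x s) := fun x =>
    hH.comp (continuous_id.prodMk ((by fun_prop : Continuous fun s => Real.exp (2 * κ s)).smul
      x.continuous))
  have hPc : ∀ x : BoundedContinuousFunction ℝ E,
      Continuous fun t => ∫ s in (0 : ℝ)..t, H s (Real.exp (2 * κ s) • x s) := fun x =>
    intervalIntegral.continuous_primitive (fun a b => (hJc x).intervalIntegrable a b) 0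
  -- Time is frozen at zero for `t < 0`, so that the fixed point can be sought among bounded
  -- continuous functions on the whole line.
  set Ψ : BoundedContinuousFunction ℝ E → ℝ → E := fun x t =>
    Real.exp (-(2 * κ (max t 0))) • (y₀ + ∫ s in (0 : ℝ)..max t 0, H s (Real.exp (2 * κ s) • x s))
  have hest : ∀ (q : ℝ → E) (C : ℝ), 0 ≤ C → Continuous q →
      (∀ s, 0 ≤ s → ‖q s‖ ≤ C * (K s * Real.exp (2 * κ s))) → ∀ t,
      Real.exp (-(2 * κ (max t 0))) * ‖∫ s in (0 : ℝ)..max t 0, q s‖ ≤ C / 2 := by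
    intro q C hC hq hle t
    have hm : 0 ≤ max t 0 := le_max_right _ _
    have h1 : ‖∫ s in (0 : ℝ)..max t 0, q s‖ ≤
        ∫ s in (0 : ℝ)..max t 0, C * (K s * Real.exp (2 * κ s)) :=
      (intervalIntegral.norm_integral_le_integral_norm hm).trans
        (intervalIntegral.integral_mono_on hm (hq.norm.intervalIntegrable _ _)
          (Continuous.intervalIntegrable (by fun_prop) _ _) fun s hs => hle s hs.1)
    rw [intervalIntegral.integral_const_mul, hexp] at h1
    have h2 : Real.exp (-(2 * κ (max t 0))) * Real.exp (2 * κ (max t 0)) = 1 := by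
      rw [← Real.exp_add]; simp
    have h3 := Real.exp_pos (-(2 * κ (max t 0)))
    calc _ ≤ Real.exp (-(2 * κ (max t 0))) * (C * ((Real.exp (2 * κ (max t 0)) - 1) / 2)) :=
          mul_le_mul_of_nonneg_left h1 h3.le
      _ = C / 2 * (1 - Real.exp (-(2 * κ (max t 0)))) := by linear_combination C / 2 * h2
      _ ≤ C / 2 := mul_le_of_le_one_right (by positivity) (by linarith)
  have hbd : ∀ (x : BoundedContinuousFunction ℝ E) (s : ℝ), 0 ≤ s →
      ‖H s (Real.exp (2 * κ s) • x s)‖ ≤ (1 + ‖x‖) * (K s * Real.exp (2 * κ s)) := by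
    intro x s hs
    have h1 := hlip s (Real.exp (2 * κ s) • x s) 0
    rw [sub_zero, norm_smul, Real.norm_of_nonneg (Real.exp_pos _).le] at h1
    have h2 : ‖H s (Real.exp (2 * κ s) • x s)‖ ≤ ‖H s (Real.exp (2 * κ s) • x s) - H s 0‖ +
        ‖H s 0‖ := norm_le_norm_sub_add _ _
    have h3 : 1 ≤ Real.exp (2 * κ s) := Real.one_le_exp (by linarith [hκ0 s hs])
    have h4 := x.norm_coe_le_norm s
    have h5 : K s * (Real.exp (2 * κ s) * ‖x s‖) ≤ K s * (Real.exp (2 * κ s) * ‖x‖) := by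
      gcongr
      exact hK0 s
    have h6 : K s * 1 ≤ K s * Real.exp (2 * κ s) := mul_le_mul_of_nonneg_left h3 (hK0 s)
    linarith [h0 s]
  have hΨc : ∀ x, Continuous (Ψ x) := fun x =>
    (by fun_prop : Continuous fun t => Real.exp (-(2 * κ (max t 0)))).smul
      (continuous_const.add ((hPc x).comp (continuous_id.max continuous_const)))
  have hexp1 : ∀ t, Real.exp (-(2 * κ (max t 0))) ≤ 1 := fun t =>
    Real.exp_le_one_iff.2 (by linarith [hκ0 _ (le_max_right t 0)])
  have hΨb : ∀ x t, ‖Ψ x t‖ ≤ ‖y₀‖ + (1 + ‖x‖) / 2 := by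
    intro x t
    have h1 := hest _ (1 + ‖x‖) (by positivity) (hJc x) (hbd x) t
    have h2 := Real.exp_pos (-(2 * κ (max t 0)))
    simp only [Ψ]
    rw [norm_smul, Real.norm_of_nonneg h2.le]
    calc _ ≤ Real.exp (-(2 * κ (max t 0))) * (‖y₀‖ +
          ‖∫ s in (0 : ℝ)..max t 0, H s (Real.exp (2 * κ s) • x s)‖) :=
          mul_le_mul_of_nonneg_left (norm_add_le _ _) h2.le
      _ ≤ _ := by nlinarith [norm_nonneg y₀, hexp1 t]
  have hΨl : ∀ (x x' : BoundedContinuousFunction ℝ E) (t : ℝ),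
      ‖Ψ x t - Ψ x' t‖ ≤ ‖x - x'‖ / 2 := by
    intro x x' t
    have h1 := hest _ ‖x - x'‖ (norm_nonneg _) ((hJc x).sub (hJc x')) (fun s hs => ?_) t
    · simp only [Ψ]
      rw [← smul_sub, add_sub_add_left_eq_sub, ← intervalIntegral.integral_sub
        ((hJc x).intervalIntegrable _ _) ((hJc x').intervalIntegrable _ _), norm_smul,
        Real.norm_of_nonneg (Real.exp_pos _).le]
      exact h1
    · refine (hlip _ _ _).trans ?_
      rw [← smul_sub, norm_smul, Real.norm_of_nonneg (Real.exp_pos _).le]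
      have h2 : ‖x s - x' s‖ ≤ ‖x - x'‖ := (x - x').norm_coe_le_norm s
      have h3 : K s * (Real.exp (2 * κ s) * ‖x s - x' s‖) ≤
          K s * (Real.exp (2 * κ s) * ‖x - x'‖) := by
        gcongr
        exact hK0 s
      linarith
  set Φ : BoundedContinuousFunction ℝ E → BoundedContinuousFunction ℝ E := fun x =>
    BoundedContinuousFunction.ofNormedAddCommGroup (Ψ x) (hΨc x) _ (hΨb x)
  have hΦ : ContractingWith (1 / 2) Φ := by
    refine ⟨by norm_num, LipschitzWith.of_dist_le_mul fun x x' => ?_⟩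
    rw [BoundedContinuousFunction.dist_le (by positivity)]
    intro t
    rw [dist_eq_norm, dist_eq_norm]
    refine (hΨl x x' t).trans (le_of_eq ?_)
    push_cast
    ring
  set x := hΦ.fixedPoint
  have hx : ∀ t, Ψ x t = x t := fun t => congrArg (fun q => q t) hΦ.fixedPoint_isFixedPt
  refine ⟨fun t => Real.exp (2 * κ t) • x t, (by fun_prop : Continuous fun t =>
    Real.exp (2 * κ t)).smul x.continuous, fun t ht => ?_⟩
  have h1 := hx t
  simp only [Ψ, max_eq_left ht] at h1
  simp only
  rw [← h1, smul_smul, ← Real.exp_add]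
  simp

end Volterra

/-! ### Uniqueness and a barrier principle -/

section Uniqueness

variable {E : Type*} [NormedAddCommGroup E] [NormedSpace ℝ E]

/-- Gronwall's inequality is applied to `∫ ‖f - f'‖`, which dominates `‖y - y'‖` and is a primitive,
unlike the norm itself. -/
theorem IsPrim.eqOn_of_norm_sub_le {y y' f f' : ℝ → E} {T K : ℝ} (hK : 0 ≤ K) (hy : IsPrim y f)
    (hy' : IsPrim y' f') (h0 : y 0 = y' 0)
    (hle : ∀ t ∈ Icc 0 T, ‖f t - f' t‖ ≤ K * ‖y t - y' t‖) : EqOn y y' (Icc 0 T) := by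
  have hi : ∀ T ≥ 0, IntervalIntegrable (fun t => f t - f' t) volume 0 T := fun T hT =>
    (hy.1 T hT).sub (hy'.1 T hT)
  have hq : IsPrim (fun t => ∫ s in (0 : ℝ)..t, ‖f s - f' s‖) (fun t => ‖f t - f' t‖) :=
    ⟨fun T hT => (hi T hT).norm, fun t _ => by simp⟩
  have hsub : ∀ t ≥ 0, ‖y t - y' t‖ ≤ ∫ s in (0 : ℝ)..t, ‖f s - f' s‖ := fun t ht => by
    rw [hy.2 t ht, hy'.2 t ht, h0, add_sub_add_left_eq_sub,
      ← intervalIntegral.integral_sub (hy.1 t ht) (hy'.1 t ht)]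
    exact intervalIntegral.norm_integral_le_integral_norm ht
  intro t ht
  have h1 := hq.le_gronwallBound (K := K) (H := 0) (T := T) ?_ t ht
  · simp only [intervalIntegral.integral_same, gronwallBound_ε0_δ0] at h1
    exact sub_eq_zero.1 (norm_le_zero_iff.1 ((hsub t ht.1).trans h1))
  · filter_upwards [ae_restrict_mem measurableSet_Ioi] with s hs hsT
    have hs0 : 0 ≤ s := le_of_lt hs
    rw [add_zero]
    exact (hle s ⟨hs0, hsT⟩).trans (mul_le_mul_of_nonneg_left (hsub s hs0) hK)

/-- If `W` exceeds `ρ` at some time, let `t₀` be the last earlier time with `W ≤ ρ`. Then `W t₀ =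
ρ`, and the sign of `W'` just afterwards keeps `W ≤ ρ`, contradicting the choice of `t₀`. -/
theorem IsPrim.le_of_crossing {W W' : ℝ → ℝ} (h : IsPrim W W') {τ ρ : ℝ} (hτ : 0 ≤ τ)
    (h0 : W τ ≤ ρ) (hcross : ∀ t ≥ τ, W t = ρ → ∃ η > 0, ∀ᵐ s ∂volume.restrict (Ioi 0),
      s ∈ Ioc t (t + η) → W' s ≤ 0) : ∀ t ≥ τ, W t ≤ ρ := by
  intro t₁ ht₁
  by_contra! hlt
  have hc : ContinuousOn W (Icc τ t₁) := h.continuousOn.mono fun s hs => hτ.trans hs.1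
  obtain ⟨t₀, ⟨ht₀, hW₀⟩, hmax⟩ : ∃ t₀, IsGreatest (Icc τ t₁ ∩ W ⁻¹' Iic ρ) t₀ :=
    (isCompact_Icc.of_isClosed_subset (hc.preimage_isClosed_of_isClosed isClosed_Icc isClosed_Iic)
      inter_subset_left).exists_isGreatest ⟨τ, ⟨le_rfl, ht₁⟩, h0⟩
  have hW₀ : W t₀ ≤ ρ := hW₀
  have hne : t₀ < t₁ := lt_of_le_of_ne ht₀.2 fun he => by rw [he] at hW₀; linarith
  have heq : W t₀ = ρ := by
    obtain ⟨s, hs, hsρ⟩ := intermediate_value_Icc hne.le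
      (hc.mono (Icc_subset_Icc_left ht₀.1)) (show ρ ∈ Icc (W t₀) (W t₁) from ⟨hW₀, hlt.le⟩)
    have := hmax ⟨⟨ht₀.1.trans hs.1, hs.2⟩, hsρ.le⟩
    rw [show s = t₀ from le_antisymm this hs.1] at hsρ
    exact hsρ
  obtain ⟨η, hη, hle⟩ := hcross t₀ ht₀.1 heq
  set s := min (t₀ + η) t₁
  have hs0 : t₀ < s := lt_min (by linarith) hne
  have ht0 : 0 ≤ t₀ := hτ.trans ht₀.1
  have h1 := h.sub_eq ht0 (ht0.trans hs0.le)
  have h2 : ∫ r in t₀..s, W' r ≤ ∫ _ in t₀..s, (0 : ℝ) := by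
    refine intervalIntegral.integral_mono_ae_restrict hs0.le
      (h.intervalIntegrable' ht0 (ht0.trans hs0.le)) intervalIntegrable_const ?_
    rw [← restrict_Ioc_eq_restrict_Icc]
    filter_upwards [ae_restrict_of_ae_restrict_of_subset (fun r hr => lt_of_le_of_lt ht0 hr.1) hle,
      ae_restrict_mem measurableSet_Ioc] with r hr hr'
    exact hr ⟨hr'.1, hr'.2.trans (min_le_left _ _)⟩
  have h3 : s ∈ Icc τ t₁ ∩ W ⁻¹' Iic ρ :=
    ⟨⟨ht₀.1.trans hs0.le, min_le_right _ _⟩, by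
      simp only [intervalIntegral.integral_zero] at h2
      show W s ≤ ρ
      linarith⟩
  exact absurd (hmax h3) (not_le.2 hs0)

end Uniqueness

theorem IsPrim.norm_sq {n : ℕ} {F f : ℝ → Euc n} (h : IsPrim F f) :
    IsPrim (fun t => ‖F t‖ ^ 2) (fun t => 2 * inner ℝ (F t) (f t)) := by
  have hi : ∀ i : Fin n, IsPrim (fun t => F t i) (fun t => f t i) := fun i =>
    h.clm_comp (EuclideanSpace.proj i)
  have h1 := IsPrim.sum Finset.univ fun i _ => (hi i).mul (hi i)
  refine h1.congr (fun t _ => ?_) (Eventually.of_forall fun t => ?_)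
  · simp only
    rw [EuclideanSpace.real_norm_sq_eq]
    exact Finset.sum_congr rfl fun i _ => sq _
  · simp only
    rw [PiLp.inner_apply, Finset.mul_sum]
    refine Finset.sum_congr rfl fun i _ => ?_
    simp only [RCLike.inner_apply, conj_trivial]
    ring

theorem IsPrim.sub {E : Type*} [NormedAddCommGroup E] [NormedSpace ℝ E] {F f G g : ℝ → E}
    (h : IsPrim F f) (h' : IsPrim G g) : IsPrim (fun t => F t - G t) (fun t => f t - g t) := by
  refine ⟨fun T hT => (h.1 T hT).sub (h'.1 T hT), fun t ht => ?_⟩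
  rw [intervalIntegral.integral_sub (h.1 t ht) (h'.1 t ht), h.2 t ht, h'.2 t ht]
  abel

theorem IsPrim.of_contDiffOn {φ : ℝ → ℝ} (h : ContDiffOn ℝ 1 φ (Ici 0)) :
    IsPrim φ (derivWithin φ (Ici 0)) :=
  IsPrim.of_hasDerivWithinAt (h.continuousOn_derivWithin (uniqueDiffOn_Ici 0) le_rfl)
    fun t ht => (h.differentiableOn one_ne_zero t ht).hasDerivWithinAt

end

section

/-! ### Funnel control of a linear system with input nonlinearity -/

section Funnel

variable {n : ℕ} {g : Euc n → Euc n} {φ α N : ℝ → ℝ}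

/-- The composition of the input nonlinearity and the feedback law. -/
def gainMap (g : Euc n → Euc n) (κ : ℝ → ℝ) (w : Euc n) : Euc n := g (κ (‖w‖ ^ 2) • w)

theorem IsFunnelDesign.contDiffOn (h : IsFunnelDesign φ α N) :
    ContDiffOn ℝ 1 (N ∘ α) (Ico 0 1) :=
  h.smooth_N.comp h.smooth_α fun _ hx => zero_le_one.trans (mem_Ici.1 (h.bij_α.mapsTo hx))

/-- The gain is singular only at the unit sphere; on a smaller compact ball local Lipschitz
continuity is global. -/
theorem exists_lipschitzOnWith_gainMap (hg : ContDiff ℝ 1 g) {κ : ℝ → ℝ}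
    (hκ : ContDiffOn ℝ 1 κ (Ico 0 1)) {ρ : ℝ} (hρ : ρ < 1) :
    ∃ K, LipschitzOnWith K (gainMap g κ) (Metric.closedBall 0 √ρ) := by
  have hρ1 : √ρ < 1 := by
    rw [Real.sqrt_lt' one_pos]
    simpa using hρ
  have hsub : Metric.closedBall (0 : Euc n) √ρ ⊆ Metric.ball 0 1 :=
    Metric.closedBall_subset_ball hρ1
  have h1 : ContDiffOn ℝ 1 (fun w : Euc n => κ (‖w‖ ^ 2)) (Metric.ball 0 1) := by
    refine hκ.comp (f := fun w : Euc n => ‖w‖ ^ 2) (contDiff_norm_sq ℝ).contDiffOn fun w hw => ?_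
    rw [mem_ball_zero_iff] at hw
    exact ⟨sq_nonneg _, by nlinarith [norm_nonneg w]⟩
  have h2 : ContDiffOn ℝ 1 (gainMap g κ) (Metric.ball 0 1) :=
    hg.comp_contDiffOn (h1.smul contDiffOn_id)
  refine LocallyLipschitzOn.exists_lipschitzOnWith_of_compact (isCompact_closedBall _ _)
    fun x hx => ?_
  obtain ⟨K, t, ht, hK⟩ := (h2.contDiffAt
    (Metric.isOpen_ball.mem_nhds (hsub hx))).exists_lipschitzOnWith
  exact ⟨K, t, mem_nhdsWithin_of_mem_nhds ht, hK⟩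

/-- The error in the funnel, scaled by the funnel function. -/
def scaledErr (φ : ℝ → ℝ) (yref y : ℝ → Euc n) (t : ℝ) : Euc n := φ t • (y t - yref t)

theorem continuousOn_scaledErr {yref y : ℝ → Euc n} {s : Set ℝ} (hφ : ContinuousOn φ s)
    (hr : ContinuousOn yref s) (hy : ContinuousOn y s) : ContinuousOn (scaledErr φ yref y) s :=
  hφ.smul (hy.sub hr)

/-- The right-hand side of the closed-loop equation for the mean. -/
def meanRhs (L : Euc n →L[ℝ] Euc n) (P₀ : ℝ) (G : Euc n → Euc n) (D : ℝ → Euc n) (φ : ℝ → ℝ)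
    (yref y : ℝ → Euc n) (t : ℝ) : Euc n :=
  -L (y t) + P₀ • G (scaledErr φ yref y t) + D t

variable {L : Euc n →L[ℝ] Euc n} {P₀ : ℝ} {D yref : ℝ → Euc n}

/-- The disturbance `D` is only integrable. Subtracting its primitive from the unknown leaves an
equation with continuous right-hand side. -/
theorem exists_isPrim_meanRhs {G : Euc n → Euc n} {K : NNReal} (hG : LipschitzWith K G)
    (hD : ∀ T ≥ 0, IntervalIntegrable D volume 0 T) (hφ : ContinuousOn φ (Ici 0))
    (hr : ContinuousOn yref (Ici 0)) (y₀ : Euc n) :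
    ∃ y, y 0 = y₀ ∧ IsPrim y (meanRhs L P₀ G D φ yref y) := by
  have hP : IsPrim (fun t => ∫ s in (0 : ℝ)..t, D s) D := ⟨hD, fun t _ => by simp⟩
  have hext : ∀ {F : Type} [TopologicalSpace F] {f : ℝ → F}, ContinuousOn f (Ici 0) →
      Continuous fun t => f (max t 0) := fun {F} _ f hf =>
    hf.comp_continuous (by fun_prop) fun t => mem_Ici.2 (le_max_right _ _)
  set Q : ℝ → Euc n := fun t => ∫ s in (0 : ℝ)..max t 0, D s
  have hQ : Continuous Q := hext hP.continuousOn
  have hφ' := hext hφ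
  have hr' := hext hr
  set H : ℝ → Euc n → Euc n := fun t x =>
    -L (x + Q t) + P₀ • G (φ (max t 0) • (x + Q t - yref (max t 0)))
  have hHc : Continuous (Function.uncurry H) := by
    have h1 : Continuous fun q : ℝ × Euc n => q.2 + Q q.1 :=
      continuous_snd.add (hQ.comp continuous_fst)
    have h2 : Continuous fun q : ℝ × Euc n => φ (max q.1 0) • (q.2 + Q q.1 - yref (max q.1 0)) :=
      (hφ'.comp continuous_fst).smul (h1.sub (hr'.comp continuous_fst))
    exact (L.continuous.comp h1).neg.add ((hG.continuous.comp h2).const_smul P₀)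
  have hHl : ∀ t x x', ‖H t x - H t x'‖ ≤ (‖L‖ + |P₀| * (K * |φ (max t 0)|)) * ‖x - x'‖ := by
    intro t x x'
    have e : H t x - H t x' = -L (x - x') + P₀ • (G (φ (max t 0) • (x + Q t - yref (max t 0))) -
        G (φ (max t 0) • (x' + Q t - yref (max t 0)))) := by
      simp only [H, smul_sub, map_sub, map_add]
      abel
    have h1 := hG.norm_sub_le (φ (max t 0) • (x + Q t - yref (max t 0)))
      (φ (max t 0) • (x' + Q t - yref (max t 0)))
    rw [← smul_sub, sub_sub_sub_cancel_right, add_sub_add_right_eq_sub, norm_smul,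
      Real.norm_eq_abs] at h1
    rw [e]
    refine (norm_add_le _ _).trans ?_
    rw [norm_neg, norm_smul, Real.norm_eq_abs, add_mul]
    have h2 := mul_le_mul_of_nonneg_left h1 (abs_nonneg P₀)
    have h3 := L.le_opNorm (x - x')
    linarith
  obtain ⟨z, hz, hz'⟩ := exists_eq_add_integral (H := H)
    (K := fun t => ‖L‖ + |P₀| * (K * |φ (max t 0)|) + ‖H t 0‖) hHc
    ((continuous_const.add (continuous_const.mul (continuous_const.mul hφ'.abs))).add
      (hHc.comp (continuous_id.prodMk continuous_const)).norm) (fun t => by positivity)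
    (fun t x x' => (hHl t x x').trans (by
      have : 0 ≤ ‖H t 0‖ * ‖x - x'‖ := by positivity
      rw [add_mul]
      linarith)) (fun t => by
      have : 0 ≤ ‖L‖ + |P₀| * (K * |φ (max t 0)|) := by positivity
      linarith) y₀
  have hc : Continuous fun t => H t (z t) := hHc.comp (continuous_id.prodMk hz)
  have hzp : IsPrim z fun t => H t (z t) :=
    ⟨fun T _ => hc.intervalIntegrable _ _, fun t ht => by rw [hz' t ht, hz' 0 le_rfl]; simp⟩
  refine ⟨fun t => z t + ∫ s in (0 : ℝ)..t, D s, by simp [hz' 0 le_rfl], ?_⟩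
  refine (hzp.add hP).congr (fun t _ => rfl) ?_
  filter_upwards [ae_restrict_mem measurableSet_Ioi] with t ht
  simp only [meanRhs, scaledErr, H, Q, max_eq_left (le_of_lt (mem_Ioi.1 ht))]

/-- Allowing two feedback maps that agree along one of the solutions makes it possible to compare
different truncations of the gain. -/
theorem eqOn_of_isPrim_meanRhs {G G' : Euc n → Euc n} {S : Set (Euc n)} {K : NNReal}
    (hG : LipschitzOnWith K G S) (hφ : ContinuousOn φ (Ici 0)) {y y' : ℝ → Euc n} {T : ℝ}
    (hGG : ∀ t ∈ Icc 0 T, G' (scaledErr φ yref y' t) = G (scaledErr φ yref y' t))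
    (hy : IsPrim y (meanRhs L P₀ G D φ yref y)) (hy' : IsPrim y' (meanRhs L P₀ G' D φ yref y'))
    (h0 : y 0 = y' 0) (hS : ∀ t ∈ Icc 0 T, scaledErr φ yref y t ∈ S)
    (hS' : ∀ t ∈ Icc 0 T, scaledErr φ yref y' t ∈ S) : EqOn y y' (Icc 0 T) := by
  obtain ⟨B, hB⟩ := isCompact_Icc.exists_bound_of_continuousOn
    (hφ.mono (fun s hs => hs.1 : Icc 0 T ⊆ Ici 0))
  refine hy.eqOn_of_norm_sub_le (K := ‖L‖ + |P₀| * (K * |B|)) (by positivity) hy' h0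
    fun t ht => ?_
  have e : meanRhs L P₀ G D φ yref y t - meanRhs L P₀ G' D φ yref y' t = -L (y t - y' t) +
      P₀ • (G (scaledErr φ yref y t) - G (scaledErr φ yref y' t)) := by
    simp only [meanRhs, hGG t ht, smul_sub, map_sub]
    abel
  have h1 := hG.norm_sub_le (hS t ht) (hS' t ht)
  have e2 : scaledErr φ yref y t - scaledErr φ yref y' t = φ t • (y t - y' t) := by
    rw [scaledErr, scaledErr, ← smul_sub, sub_sub_sub_cancel_right]
  rw [e2, norm_smul] at h1
  have hB' : ‖φ t‖ ≤ |B| := (hB t ht).trans (le_abs_self _)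
  have h4 : (K : ℝ) * (‖φ t‖ * ‖y t - y' t‖) ≤ K * (|B| * ‖y t - y' t‖) := by gcongr
  rw [e]
  refine (norm_add_le _ _).trans ?_
  rw [norm_neg, norm_smul, Real.norm_eq_abs, add_mul]
  have h2 := mul_le_mul_of_nonneg_left (h1.trans h4) (abs_nonneg P₀)
  have h3 := L.le_opNorm (y t - y' t)
  linarith

theorem IsFunnelFun.nonneg (h : IsFunnelFun φ) {t : ℝ} (ht : 0 ≤ t) : 0 ≤ φ t := by
  rcases ht.eq_or_lt with rfl | ht
  · have h1 : Tendsto φ (𝓝[>] 0) (𝓝 (φ 0)) :=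
      (h.smooth.continuousOn 0 (mem_Ici.2 le_rfl)).mono_left (nhdsWithin_mono _ Ioi_subset_Ici_self)
    refine ge_of_tendsto h1 ?_
    filter_upwards [self_mem_nhdsWithin] with t ht using (h.pos t ht).le
  · exact (h.pos t ht).le

/-- A positive starting time is needed because `φ` may vanish at zero. -/
theorem IsFunnelFun.exists_le (h : IsFunnelFun φ) {τ : ℝ} (hτ : 0 < τ) :
    ∃ m > 0, ∀ t ≥ τ, m ≤ φ t := by
  obtain ⟨m, hm, hev⟩ := h.liminf_pos
  obtain ⟨T, hT⟩ := eventually_atTop.1 hev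
  obtain ⟨t₀, ht₀, hmin⟩ := isCompact_Icc.exists_isMinOn (nonempty_Icc.2 (le_max_left τ T))
    (h.smooth.continuousOn.mono fun s hs => hτ.le.trans hs.1)
  refine ⟨min m (φ t₀), lt_min hm (h.pos _ (hτ.trans_le ht₀.1)), fun t ht => ?_⟩
  rcases le_total t (max τ T) with h1 | h1
  · exact (min_le_right _ _).trans (hmin ⟨ht, h1⟩)
  · exact (min_le_left _ _).trans (hT t ((le_max_right _ _).trans h1))

/-- The gain attains values of arbitrarily good effect arbitrarily close to the funnel boundary. -/
theorem exists_gain (hn : 0 < n) (hg : IsHighGain g) (hdes : IsFunnelDesign φ α N) (hP₀ : P₀ ≠ 0) :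
    ∃ δ ∈ Ioo (0 : ℝ) 1, ∀ r₁ ∈ Ico (0 : ℝ) 1, ∀ M : ℝ, ∃ ρ ∈ Ioo r₁ 1, ∀ w : Euc n,
      ‖w‖ ^ 2 = ρ → δ ≤ ‖w‖ → P₀ * inner ℝ w (gainMap g (N ∘ α) w) ≤ -M := by
  obtain ⟨b, hb, hlb⟩ := hg.linBdd
  obtain ⟨δ, hδ, hgain⟩ := hg.highGain
  refine ⟨δ, hδ, fun r₁ hr₁ M => ?_⟩
  -- On `[0, r₁]` the values of `α` are at most `A`, and those of `N` on `[0, A]` are at most `B` in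
  -- modulus. A gain of modulus larger than `B` can thus occur only beyond `r₁`.
  obtain ⟨A, hA⟩ := (isCompact_Icc (a := (0 : ℝ)) (b := r₁)).exists_bound_of_continuousOn
    (hdes.smooth_α.continuousOn.mono fun s hs => ⟨hs.1, hs.2.trans_lt hr₁.2⟩)
  obtain ⟨B, hB⟩ := (isCompact_Icc (a := (0 : ℝ)) (b := A)).exists_bound_of_continuousOn
    (hdes.smooth_N.continuousOn.mono fun s hs => hs.1)
  have hA1 : 1 ≤ A := by
    have h1 := hdes.bij_α.mapsTo (show (0 : ℝ) ∈ Ico 0 1 from ⟨le_rfl, one_pos⟩)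
    exact (mem_Ici.1 h1).trans ((le_abs_self _).trans (hA 0 ⟨le_rfl, hr₁.1⟩))
  have hB0 : 0 ≤ B := (norm_nonneg _).trans (hB 0 ⟨le_rfl, zero_le_one.trans hA1⟩)
  -- The first threshold gives the required strength. The second forces `|s| > B`: on a unit vector
  -- the linear bound on `g` limits the effect of `s` to `b |s|`.
  obtain ⟨s, hs⟩ := hgain (max (|P₀|⁻¹ * M) (b * (B + 1)))
  have hsB : B < |s| := by
    have h1 := (le_max_right _ _).trans (hs (EuclideanSpace.single ⟨0, hn⟩ 1)
      (by simpa using hδ.2.le) (by simp))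
    have h2 := (real_inner_le_norm _ _).trans (mul_le_mul_of_nonneg_left
      (hlb (-(s • EuclideanSpace.single (⟨0, hn⟩ : Fin n) (1 : ℝ)))) (norm_nonneg
        (EuclideanSpace.single (⟨0, hn⟩ : Fin n) (1 : ℝ))))
    rw [norm_neg, norm_smul] at h2
    simp only [PiLp.norm_single, norm_one, one_mul, mul_one, Real.norm_eq_abs] at h2
    have h3 := le_of_mul_le_mul_left (h1.trans h2) hb
    linarith
  have hfind : ∀ σ : ℝ, B < |σ| → ∃ ρ ∈ Ioo r₁ 1, N (α ρ) = σ := by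
    intro σ hσ
    obtain ⟨x, hx, hxσ⟩ := hdes.surj_N (mem_univ σ)
    have hxA : A < x := by
      by_contra! hle
      have := hB x ⟨hx, hle⟩
      rw [hxσ, Real.norm_eq_abs] at this
      linarith
    obtain ⟨ρ, hρ, hρx⟩ := hdes.bij_α.surjOn (show x ∈ Ici 1 from hA1.trans hxA.le)
    refine ⟨ρ, ⟨?_, hρ.2⟩, by rw [hρx, hxσ]⟩
    by_contra! hle
    have := hA ρ ⟨hρ.1, hle⟩
    rw [hρx, Real.norm_eq_abs] at this
    linarith [le_abs_self x]
  have hP : 0 < |P₀| := abs_pos.2 hP₀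
  have hle1 : ∀ {w : Euc n} {ρ : ℝ}, ρ < 1 → ‖w‖ ^ 2 = ρ → ‖w‖ ≤ 1 := fun {w ρ} h1 h2 => by
    nlinarith [norm_nonneg w]
  have hM : ∀ q : ℝ, max (|P₀|⁻¹ * M) (b * (B + 1)) ≤ q → M ≤ |P₀| * q := fun q hq => by
    have := mul_le_mul_of_nonneg_left ((le_max_left _ _).trans hq) hP.le
    rwa [mul_inv_cancel_left₀ hP.ne'] at this
  -- The sign of `P₀` decides which gain is used: `-s` if `P₀ < 0`, and `s` if `P₀ > 0`, where the
  -- high-gain inequality is read at `-w`.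
  rcases lt_or_gt_of_ne hP₀ with h | h
  · obtain ⟨ρ, hρ, hρs⟩ := hfind (-s) (by rwa [abs_neg])
    refine ⟨ρ, hρ, fun w hw hδw => ?_⟩
    have h1 := hM _ (hs w hδw (hle1 hρ.2 hw))
    rw [abs_of_neg h] at h1
    simp only [gainMap, Function.comp_apply, hw, hρs, neg_smul]
    linarith
  · obtain ⟨ρ, hρ, hρs⟩ := hfind s hsB
    refine ⟨ρ, hρ, fun w hw hδw => ?_⟩
    have h1 := hM _ (hs (-w) (by rwa [norm_neg]) (by rw [norm_neg]; exact hle1 hρ.2 hw))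
    rw [abs_of_pos h, smul_neg, neg_neg, inner_neg_left] at h1
    simp only [gainMap, Function.comp_apply, hw, hρs]
    linarith

/-- Since `φ(0)` may vanish, the error is not controlled by `w` near time zero. A first truncation
yields a time `τ` up to which `‖w‖² < r₁`. On `[τ, ∞)` the funnel function is at least some `m > 0`,
which bounds error and output and fixes the gain needed, hence `ρ > r₁`. The solution truncated at
`ρ` agrees with the first one on `[0, τ]`, and later `ρ` acts as a barrier. -/
theorem exists_funnel_solution (hn : 0 < n) (hg : ContDiff ℝ 1 g) (hg' : IsHighGain g)
    (hdes : IsFunnelDesign φ α N) (hP₀ : P₀ ≠ 0) (hD : ∀ T ≥ 0, IntervalIntegrable D volume 0 T)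
    {MD : ℝ} (hMD : ∀ᵐ t ∂volume.restrict (Ioi 0), ‖D t‖ ≤ MD) {r : ℝ → Euc n}
    (hr : IsPrim yref r) {Mr : ℝ} (hMr : ∀ᵐ t ∂volume.restrict (Ioi 0), ‖r t‖ ≤ Mr) {My : ℝ}
    (hMy : ∀ᵐ t ∂volume.restrict (Ioi 0), ‖yref t‖ ≤ My) {y₀ : Euc n}
    (h0 : ‖φ 0 • (y₀ - yref 0)‖ < 1) :
    ∃ y, y 0 = y₀ ∧ IsPrim y (meanRhs L P₀ (gainMap g (N ∘ α)) D φ yref y) ∧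
      ∃ ρ ∈ Ioo (0 : ℝ) 1, ∀ t ≥ 0, ‖scaledErr φ yref y t‖ ^ 2 ≤ ρ := by
  have hφ := hdes.funnel
  have hφc := hφ.smooth.continuousOn
  obtain ⟨δ, hδ, hgain⟩ := exists_gain hn hg' hdes hP₀
  set κ := N ∘ α
  have hG : ∀ ρ < 1, ∃ (K : NNReal) (G : Euc n → Euc n), LipschitzWith K G ∧
      EqOn (gainMap g κ) G (Metric.closedBall 0 √ρ) := fun ρ hρ => by
    obtain ⟨K, hK⟩ := exists_lipschitzOnWith_gainMap hg hdes.contDiffOn hρ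
    obtain ⟨G, hG⟩ := hK.extend_finite_dimension
    exact ⟨_, G, hG⟩
  have hball : ∀ {w : Euc n} {ρ : ℝ}, ‖w‖ ^ 2 ≤ ρ → w ∈ Metric.closedBall 0 √ρ := fun h => by
    rw [mem_closedBall_zero_iff]
    exact Real.le_sqrt_of_sq_le h
  have hW₀ : ‖φ 0 • (y₀ - yref 0)‖ ^ 2 < 1 := by nlinarith [norm_nonneg (φ 0 • (y₀ - yref 0))]
  have hδ2 : δ ^ 2 < 1 := by nlinarith [hδ.1, hδ.2]
  -- Taking `r₁ > δ²` guarantees `‖w‖ ≥ δ` at the barrier, where the high-gain inequality is needed.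
  obtain ⟨r₁, hr₁, hr₁'⟩ := exists_between (max_lt hW₀ hδ2)
  have hr₁0 : 0 ≤ r₁ := (sq_nonneg _).trans ((le_max_right _ _).trans hr₁.le)
  obtain ⟨K₁, G₁, hG₁, hGeq₁⟩ := hG r₁ hr₁'
  obtain ⟨y₁, hy₁0, hy₁⟩ := exists_isPrim_meanRhs (L := L) (P₀ := P₀) hG₁ hD hφc hr.continuousOn y₀
  have hcW : ∀ {y f : ℝ → Euc n}, IsPrim y f →
      ContinuousOn (fun t => ‖scaledErr φ yref y t‖ ^ 2) (Ici 0) := fun hy =>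
    (continuousOn_scaledErr hφc hr.continuousOn hy.continuousOn).norm.pow 2
  obtain ⟨τ, hτ, hτW⟩ : ∃ τ > 0, ∀ t ∈ Icc 0 τ, ‖scaledErr φ yref y₁ t‖ ^ 2 < r₁ := by
    have h1 := (hcW hy₁ 0 (mem_Ici.2 le_rfl)).eventually (gt_mem_nhds (a := r₁) (by
      change ‖scaledErr φ yref y₁ 0‖ ^ 2 < r₁
      rw [scaledErr, hy₁0]
      exact (le_max_left _ _).trans_lt hr₁))
    obtain ⟨τ, hτ, hsub⟩ := mem_nhdsGE_iff_exists_Icc_subset.1 h1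
    exact ⟨τ, hτ, fun t ht => hsub ht⟩
  obtain ⟨m, hm, hmφ⟩ := hφ.exists_le hτ
  obtain ⟨ξ, hξ, hφd⟩ := hφ.deriv_le
  have hMD0 : 0 ≤ MD ∧ 0 ≤ Mr ∧ 0 ≤ My := by
    have : (ae (volume.restrict (Ioi (0 : ℝ)))).NeBot := ae_neBot.2 (by simp)
    obtain ⟨t, h1, h2, h3⟩ := (hMD.and (hMr.and hMy)).exists
    exact ⟨(norm_nonneg _).trans h1, (norm_nonneg _).trans h2, (norm_nonneg _).trans h3⟩
  -- `A` bounds `⟨w, -L y + D - r⟩` inside the funnel. `C` bounds `φ' ‖e‖²`, from `|φ'| ≤ ξ (1 +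
  -- φ)`, `‖e‖ ≤ 1 / m` and `φ ‖e‖ ≤ 1`.
  set A := ‖L‖ * (My + 1 / m) + MD + Mr
  set C := ξ * (1 / m ^ 2 + 1 / m)
  -- The extra `1` makes the inequality strict at a crossing time, so that it persists for a short
  -- while by continuity.
  obtain ⟨ρ, hρ, hρgain⟩ := hgain r₁ ⟨hr₁0, hr₁'⟩ (C + A + 1)
  obtain ⟨K, G, hGl, hGeq⟩ := hG ρ hρ.2
  obtain ⟨y, hy0, hy⟩ := exists_isPrim_meanRhs (L := L) (P₀ := P₀) hGl hD hφc hr.continuousOn y₀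
  have hyy : EqOn y y₁ (Icc 0 τ) := by
    refine eqOn_of_isPrim_meanRhs (S := univ) hGl.lipschitzOnWith hφc (fun t ht => ?_) hy hy₁
      (by rw [hy0, hy₁0]) (fun _ _ => mem_univ _) (fun _ _ => mem_univ _)
    rw [← hGeq₁ (hball (hτW t ht).le), ← hGeq (hball ((hτW t ht).le.trans hρ.1.le))]
  have hwy : ∀ t ∈ Icc 0 τ, ‖scaledErr φ yref y t‖ ^ 2 ≤ ρ := fun t ht => by
    rw [scaledErr, hyy ht]
    exact (hτW t ht).le.trans hρ.1.le
  have hφp := IsPrim.of_contDiffOn hφ.smooth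
  have hW := (hφp.mul hφp).mul (hy.sub hr).norm_sq
  have hWe : ∀ t, φ t * φ t * ‖y t - yref t‖ ^ 2 = ‖scaledErr φ yref y t‖ ^ 2 := fun t => by
    rw [scaledErr, norm_smul, mul_pow, Real.norm_eq_abs, sq_abs]
    ring
  have hbound : ∀ t ≥ τ, ‖scaledErr φ yref y t‖ ^ 2 ≤ ρ := by
    intro t ht
    rw [← hWe]
    refine hW.le_of_crossing hτ.le (by rw [hWe]; exact hwy τ ⟨hτ.le, le_rfl⟩) (fun t ht hWt => ?_)
      t ht
    have ht0 : t ∈ Ici 0 := hτ.le.trans ht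
    rw [hWe] at hWt
    have hwc := continuousOn_scaledErr hφc hr.continuousOn hy.continuousOn
    have hq : P₀ * inner ℝ (scaledErr φ yref y t) (G (scaledErr φ yref y t)) < -(C + A) := by
      rw [← hGeq (hball hWt.le)]
      have h1 := hρgain (scaledErr φ yref y t) hWt (by
        have h2 : δ ^ 2 < ‖scaledErr φ yref y t‖ ^ 2 := by
          rw [hWt]
          exact (le_max_right _ _).trans_lt (hr₁.trans hρ.1)
        exact (lt_of_pow_lt_pow_left₀ 2 (norm_nonneg _) h2).le)
      linarith
    have hev : ∀ᶠ s in 𝓝[≥] t, P₀ * inner ℝ (scaledErr φ yref y s) (G (scaledErr φ yref y s)) <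
        -(C + A) ∧ ‖scaledErr φ yref y s‖ ^ 2 < 1 := by
      have hw := (hwc t ht0).mono (Ici_subset_Ici.2 ht0 : Ici t ⊆ Ici 0)
      have h1 : ContinuousWithinAt (fun s => P₀ * inner ℝ (scaledErr φ yref y s)
          (G (scaledErr φ yref y s))) (Ici t) t :=
        continuousWithinAt_const.mul (hw.inner
          (hGl.continuous.continuousAt.comp_continuousWithinAt hw))
      exact (h1.eventually (gt_mem_nhds hq)).and
        ((hw.norm.pow 2).eventually (gt_mem_nhds (by
          simp only [Pi.pow_apply]
          rw [hWt]; exact hρ.2)))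
    obtain ⟨u, hu, hsub⟩ := mem_nhdsGE_iff_exists_Icc_subset.1 hev
    have hu : t < u := hu
    refine ⟨u - t, by linarith, ?_⟩
    filter_upwards [hMD, hMr, hMy] with s h1 h2 h3 hs
    obtain ⟨hs1, hs2⟩ := hsub ⟨hs.1.le, by linarith [hs.2]⟩
    have hs0 : 0 ≤ s := ht0.trans hs.1.le
    have hsφ : m ≤ φ s := hmφ s (ht.le.trans hs.1.le)
    have hφ0 : 0 < φ s := hm.trans_le hsφ
    set w := scaledErr φ yref y s
    set e := y s - yref s
    have hwe : w = φ s • e := rfl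
    have hw1 : ‖w‖ ≤ 1 := by nlinarith [norm_nonneg w]
    have hwn : φ s * ‖e‖ ≤ 1 := by
      rwa [hwe, norm_smul, Real.norm_of_nonneg hφ0.le] at hw1
    have he1 : ‖e‖ ≤ 1 / m := by
      rw [le_div_iff₀ hm]
      nlinarith [norm_nonneg e]
    have he2 : (1 + φ s) * ‖e‖ ^ 2 ≤ 1 / m ^ 2 + 1 / m := by
      have e1 : ‖e‖ ^ 2 ≤ 1 / m ^ 2 := by
        rw [← one_div_pow]
        gcongr
      have e2 : φ s * ‖e‖ * ‖e‖ ≤ 1 * (1 / m) := by gcongr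
      linarith
    have hφ' : derivWithin φ (Ici 0) s * ‖e‖ ^ 2 ≤ C := by
      calc _ ≤ ξ * (1 + φ s) * ‖e‖ ^ 2 := by
            gcongr
            exact (le_abs_self _).trans (hφd s hs0)
        _ = ξ * ((1 + φ s) * ‖e‖ ^ 2) := by ring
        _ ≤ C := mul_le_mul_of_nonneg_left he2 hξ.le
    have hy1 : ‖y s‖ ≤ My + 1 / m := by
      have : y s = yref s + e := by simp [e]
      rw [this]
      exact (norm_add_le _ _).trans (add_le_add h3 he1)
    have hin : ∀ x : Euc n, inner ℝ w x ≤ ‖x‖ := fun x =>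
      (real_inner_le_norm _ _).trans (mul_le_of_le_one_left (norm_nonneg _) hw1)
    have hA : inner ℝ w (-L (y s)) + inner ℝ w (D s) + inner ℝ w (-r s) ≤ A := by
      have a1 := (hin (-L (y s))).trans (le_of_eq (norm_neg _)) |>.trans (L.le_opNorm (y s))
      have a2 := mul_le_mul_of_nonneg_left hy1 (norm_nonneg L)
      have a3 := (hin (D s)).trans h1
      have a4 := ((hin (-r s)).trans (le_of_eq (norm_neg _))).trans h2
      simp only [A]
      linarith
    -- The derivative of `‖w‖² = φ² ‖e‖²`, factored so that the bounds `C`, `A` and the gain can be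
    -- compared directly.
    have hexp : (derivWithin φ (Ici 0) s * φ s + φ s * derivWithin φ (Ici 0) s) * ‖e‖ ^ 2 +
        φ s * φ s * (2 * inner ℝ e (meanRhs L P₀ G D φ yref y s - r s)) =
        2 * φ s * (derivWithin φ (Ici 0) s * ‖e‖ ^ 2 + (inner ℝ w (-L (y s)) +
          inner ℝ w (D s) + inner ℝ w (-r s)) + P₀ * inner ℝ w (G w)) := by
      have : inner ℝ w (meanRhs L P₀ G D φ yref y s - r s) = (inner ℝ w (-L (y s)) +
          inner ℝ w (D s) + inner ℝ w (-r s)) + P₀ * inner ℝ w (G w) := by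
        rw [meanRhs, sub_eq_add_neg, inner_add_right, inner_add_right, inner_add_right,
          real_inner_smul_right]
        ring
      have h4 : φ s * inner ℝ e (meanRhs L P₀ G D φ yref y s - r s) =
          inner ℝ w (meanRhs L P₀ G D φ yref y s - r s) := by
        rw [hwe, real_inner_smul_left]
      rw [this] at h4
      linear_combination 2 * φ s * h4
    rw [hexp]
    refine mul_nonpos_of_nonneg_of_nonpos (by positivity) ?_
    linarith
  have hall : ∀ t ≥ 0, ‖scaledErr φ yref y t‖ ^ 2 ≤ ρ := fun t ht => by
    rcases le_total t τ with h1 | h1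
    · exact hwy t ⟨ht, h1⟩
    · exact hbound t h1
  refine ⟨y, hy0, hy.congr (fun _ _ => rfl) ?_, ρ, ⟨hr₁0.trans_lt hρ.1, hρ.2⟩, hall⟩
  filter_upwards [ae_restrict_mem measurableSet_Ioi] with t ht
  rw [meanRhs, meanRhs, hGeq (hball (hall t (le_of_lt ht)))]

end Funnel

end

section

/-! ### Moments of the solution -/

section Moments

variable {n : ℕ} {c : ℝ} {Γ : Matrix (Fin n) (Fin n) ℝ}
  {v : OrthonormalBasis (Fin n) ℝ (Euc n)} {l : Fin n → ℝ} {g : Euc n → Euc n}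
  {d p : ℝ → HSp c Γ} {u : ℝ → Euc n}

theorem hasTemperateGrowth_inner (a : Euc n) :
    (fun x : Euc n => (inner ℝ a x : ℝ)).HasTemperateGrowth :=
  (innerSL ℝ a).hasTemperateGrowth

theorem hermFun_single (j : Fin n) (x : Euc n) :
    hermFun v l (Pi.single j 1) x = √(l j) * inner ℝ (v j) x := by
  have := hermFun_add_single (v := v) (l := l) 0 j x
  simpa [hermFun_zero] using this

theorem hermFun_single_add_single (i j : Fin n) (x : Euc n) :
    hermFun v l (Pi.single i 1 + Pi.single j 1) x =
      √(l j) * inner ℝ (v j) x * (√(l i) * inner ℝ (v i) x) - if i = j then 1 else 0 := by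
  rw [hermFun_add_single, hermFun_single]
  split_ifs with hij
  · subst hij
    simp [hermFun_zero]
  · simp [Pi.single_eq_of_ne (Ne.symm hij)]

namespace IsEigBasis

/-- The Hermite moments of an element of `𝔥`. -/
def moment (_ : IsEigBasis c Γ v l) (f : HSp c Γ) (k : Fin n → ℕ) : ℝ :=
  ∫ x, f x * hermFun v l k x

theorem moment_eq (h : IsEigBasis c Γ v l) (f : HSp c Γ) (k : Fin n → ℕ) :
    h.moment f k = hermNorm c Γ k * inner ℝ (h.basisH k) f := by
  rw [moment, ← h.inner_hermH, h.hermH_eq, real_inner_smul_right, real_inner_comm]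

theorem mass_eq (h : IsEigBasis c Γ v l) (f : HSp c Γ) : mass c Γ f = h.moment f 0 := by
  simp only [mass, moment, hermFun_zero, mul_one]

theorem integrable_coe (h : IsEigBasis c Γ v l) (f : HSp c Γ) : Integrable fun x => f x := by
  simpa using h.integrable_mul_temperate f (f := fun _ => 1) (by fun_prop)

theorem inner_meanVal (h : IsEigBasis c Γ v l) (f : HSp c Γ) (a : Euc n) :
    inner ℝ a (meanVal c Γ f) = ∫ x, f x * inner ℝ a x := by
  have hi : Integrable fun x : Euc n => f x • x := by
    have h1 : ∀ j, Integrable fun x : Euc n => (f x * inner ℝ (v j) x) • v j := fun j =>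
      (h.integrable_mul_temperate f (hasTemperateGrowth_inner (v j))).smul_const _
    refine (integrable_finsetSum Finset.univ fun j _ => h1 j).congr
        (Eventually.of_forall fun x => ?_)
    simp only [mul_smul, ← Finset.smul_sum]
    rw [v.sum_repr']
  rw [meanVal, ← integral_inner hi]
  simp only [real_inner_smul_right]

theorem inner_meanVal_basis (h : IsEigBasis c Γ v l) (f : HSp c Γ) (j : Fin n) :
    √(l j) * inner ℝ (v j) (meanVal c Γ f) = h.moment f (Pi.single j 1) := by
  rw [h.inner_meanVal, moment, ← integral_const_mul]
  simp only [hermFun_single]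
  congr 1 with x
  ring

/-- The moments satisfy a triangular system of ordinary differential equations. -/
theorem isPrim_moment (h : IsEigBasis c Γ v l)
    (hs : IsTriSol c l (drift v g u) (h.coef d) (h.coef p)) (k : Fin n → ℕ) :
    IsPrim (fun t => h.moment (p t) k) fun t => -(c * eigVal l k * h.moment (p t) k) +
      (∑ j, drift v g u j t * (√(l j) * k j * h.moment (p t) (k - Pi.single j 1)) +
        h.moment (d t) k) := by
  refine ((hs k).const_mul (hermNorm c Γ k)).congr (fun t _ => h.moment_eq _ _)
    (Eventually.of_forall fun t => ?_)
  simp only [h.moment_eq, triForce, coef, mul_add, Finset.mul_sum]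
  congr 1
  · ring
  congr 1
  refine Finset.sum_congr rfl fun j _ => ?_
  by_cases hj : k j = 0
  · simp [hj]
  · have h1 := h.hermNorm_add_single (k - Pi.single j 1) j
    rw [sub_add_single hj] at h1
    have h2 : (((k - Pi.single j 1 : Fin n → ℕ) j : ℕ) : ℝ) + 1 = k j := by
      simp only [Pi.sub_apply, Pi.single_eq_same]
      rw [Nat.cast_sub (Nat.one_le_iff_ne_zero.2 hj)]
      simp
    rw [h2] at h1
    rw [h1, Real.sqrt_mul (h.pos j).le]
    have h5 : √(k j : ℝ) * √(k j) = (k j : ℝ) := Real.mul_self_sqrt (Nat.cast_nonneg _)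
    linear_combination -(drift v g u j t * √(l j) * hermNorm c Γ (k - Pi.single j 1) *
      inner ℝ (h.basisH (k - Pi.single j 1)) (p t)) * h5

theorem mass_eq_of_isTriSol (h : IsEigBasis c Γ v l)
    (hs : IsTriSol c l (drift v g u) (h.coef d) (h.coef p))
    (hd0 : ∀ᵐ t ∂volume.restrict (Ioi 0), mass c Γ (d t) = 0) {t : ℝ} (ht : 0 ≤ t) :
    mass c Γ (p t) = mass c Γ (p 0) := by
  have h1 : IsPrim (fun t => mass c Γ (p t)) (fun _ => 0) := by
    refine (h.isPrim_moment hs 0).congr (fun t _ => h.mass_eq _) ?_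
    filter_upwards [hd0] with s hs
    rw [h.mass_eq] at hs
    simp [eigVal, hs]
  simpa using h1.eq_integral t ht

theorem ae_coef_zero (h : IsEigBasis c Γ v l)
    (hd0 : ∀ᵐ t ∂volume.restrict (Ioi 0), mass c Γ (d t) = 0) :
    ∀ᵐ t ∂volume.restrict (Ioi 0), h.coef d 0 t = 0 := by
  filter_upwards [hd0] with t ht
  rw [h.mass_eq, h.moment_eq] at ht
  exact (mul_eq_zero.1 ht).resolve_left (h.hermNorm_pos 0).ne'

/-- The mean as a continuous linear map. -/
def meanCLM (h : IsEigBasis c Γ v l) : HSp c Γ →L[ℝ] Euc n :=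
  ∑ j, (hermNorm c Γ (Pi.single j 1) / √(l j)) •
    (innerSL ℝ (h.basisH (Pi.single j 1))).smulRight (v j)

theorem _root_.OrthonormalBasis.ext_inner {x y : Euc n} (v : OrthonormalBasis (Fin n) ℝ (Euc n))
    (hxy : ∀ j, inner ℝ (v j) x = inner ℝ (v j) y) : x = y := by
  rw [← v.sum_repr' x, ← v.sum_repr' y]
  exact Finset.sum_congr rfl fun j _ => by rw [hxy]

theorem meanCLM_apply (h : IsEigBasis c Γ v l) (f : HSp c Γ) : h.meanCLM f = meanVal c Γ f := by
  refine v.ext_inner fun i => ?_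
  have hl : √(l i) ≠ 0 := (Real.sqrt_pos.2 (h.pos i)).ne'
  refine mul_left_cancel₀ hl ?_
  rw [h.inner_meanVal_basis, h.moment_eq, meanCLM, _root_.sum_apply, inner_sum,
    Finset.sum_eq_single i]
  · rw [_root_.smul_apply, ContinuousLinearMap.smulRight_apply, innerSL_apply_apply,
      real_inner_smul_right, real_inner_smul_right, real_inner_self_eq_norm_sq, v.orthonormal.1]
    field_simp
  · intro j _ hj
    rw [_root_.smul_apply, ContinuousLinearMap.smulRight_apply, real_inner_smul_right,
      real_inner_smul_right, orthonormal_iff_ite.1 v.orthonormal, if_neg (Ne.symm hj)]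
    simp
  · simp

/-- The linear map which is diagonal with entries `m` in the basis `v`. -/
def _root_.diagCLM (v : OrthonormalBasis (Fin n) ℝ (Euc n)) (m : Fin n → ℝ) :
    Euc n →L[ℝ] Euc n := ∑ j, m j • (innerSL ℝ (v j)).smulRight (v j)

theorem _root_.inner_diagCLM (v : OrthonormalBasis (Fin n) ℝ (Euc n)) (m : Fin n → ℝ) (i : Fin n)
    (x : Euc n) : inner ℝ (v i) (diagCLM v m x) = m i * inner ℝ (v i) x := by
  rw [diagCLM, _root_.sum_apply, inner_sum, Finset.sum_eq_single i]
  · rw [_root_.smul_apply, ContinuousLinearMap.smulRight_apply, innerSL_apply_apply,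
      real_inner_smul_right, real_inner_smul_right, real_inner_self_eq_norm_sq, v.orthonormal.1]
    ring
  · intro j _ hj
    rw [_root_.smul_apply, ContinuousLinearMap.smulRight_apply, real_inner_smul_right,
      real_inner_smul_right, orthonormal_iff_ite.1 v.orthonormal, if_neg (Ne.symm hj)]
    simp
  · simp

theorem _root_.IsPrim.of_inner {F f : ℝ → Euc n} (v : OrthonormalBasis (Fin n) ℝ (Euc n))
    (h : ∀ j, IsPrim (fun t => inner ℝ (v j) (F t)) fun t => inner ℝ (v j) (f t)) :
    IsPrim F f := by
  have h1 := IsPrim.sum Finset.univ fun j _ =>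
    (h j).clm_comp (ContinuousLinearMap.toSpanSingleton ℝ (v j))
  refine h1.congr (fun t _ => ?_) (Eventually.of_forall fun t => ?_)
  · simp only [ContinuousLinearMap.toSpanSingleton_apply]
    rw [v.sum_repr']
  · simp only [ContinuousLinearMap.toSpanSingleton_apply]
    rw [v.sum_repr']

/-- Modes of degree one couple only to mode zero, which is the conserved mass. The mean therefore
obeys a closed finite-dimensional equation in which the density no longer appears. -/
theorem isPrim_meanVal (h : IsEigBasis c Γ v l)
    (hs : IsTriSol c l (drift v g u) (h.coef d) (h.coef p))
    (hd0 : ∀ᵐ t ∂volume.restrict (Ioi 0), mass c Γ (d t) = 0) :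
    IsPrim (fun t => meanVal c Γ (p t)) fun t => -diagCLM v (fun j => c * l j) (meanVal c Γ (p t)) +
      mass c Γ (p 0) • g (u t) + h.meanCLM (d t) := by
  refine IsPrim.of_inner v fun j => ?_
  have hl : √(l j) ≠ 0 := (Real.sqrt_pos.2 (h.pos j)).ne'
  refine ((h.isPrim_moment hs (Pi.single j 1)).const_mul (√(l j))⁻¹).congr (fun t _ => ?_) ?_
  · simp only
    rw [← h.inner_meanVal_basis, inv_mul_cancel_left₀ hl]
  · filter_upwards [ae_restrict_mem measurableSet_Ioi] with t ht
    have e1 : ∑ i, drift v g u i t * (√(l i) * ((Pi.single j 1 : Fin n → ℕ) i : ℝ) *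
        h.moment (p t) (Pi.single j 1 - Pi.single i 1)) =
        inner ℝ (v j) (g (u t)) * (√(l j) * mass c Γ (p 0)) := by
      rw [Finset.sum_eq_single j]
      · rw [Pi.single_eq_same, tsub_self, ← h.mass_eq, h.mass_eq_of_isTriSol hs hd0 (le_of_lt ht)]
        simp [drift]
      · intro i _ hi
        simp [Pi.single_eq_of_ne hi]
      · simp
    have e2 : eigVal l (Pi.single j 1) = l j := by
      rw [eigVal, Finset.sum_eq_single j (fun i _ hi => by simp [hi]) (by simp)]
      simp
    rw [e1, e2, ← h.inner_meanVal_basis, ← h.inner_meanVal_basis, h.meanCLM_apply, inner_add_right,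
      inner_add_right, inner_neg_right, inner_diagCLM, real_inner_smul_right]
    field_simp
    ring

/-! ### The covariance -/

theorem eigVal_single_add_single (i j : Fin n) :
    eigVal l (Pi.single i 1 + Pi.single j 1) = l i + l j := by
  rw [eigVal_add_single, ← zero_add (Pi.single i 1 : Fin n → ℕ), eigVal_add_single]
  simp [eigVal]

/-- The second Hermite cumulants. -/
def cumulant (h : IsEigBasis c Γ v l) (f : HSp c Γ) (i j : Fin n) : ℝ :=
  h.moment f (Pi.single i 1 + Pi.single j 1) -
    h.moment f (Pi.single i 1) * h.moment f (Pi.single j 1)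

/-- With mass one, the input terms driving the second moment are exactly those produced by the
product rule for the two first moments. They cancel in the cumulant, leaving pure decay at rate `c
(l_i + l_j)`. -/
theorem cumulant_eq (h : IsEigBasis c Γ v l)
    (hs : IsTriSol c l (drift v g u) (h.coef d) (h.coef p))
    (hd : ∀ᵐ t ∂volume.restrict (Ioi 0), d t = 0) (h1 : mass c Γ (p 0) = 1) (i j : Fin n) {t : ℝ}
    (ht : 0 ≤ t) : h.cumulant (p t) i j =
      Real.exp (-(c * l i * t)) * h.cumulant (p 0) i j * Real.exp (-(c * l j * t)) := by
  have hdm : ∀ᵐ t ∂volume.restrict (Ioi 0), ∀ k, h.moment (d t) k = 0 := by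
    filter_upwards [hd] with t ht k
    rw [ht, h.moment_eq, inner_zero_right, mul_zero]
  have hd0 : ∀ᵐ t ∂volume.restrict (Ioi 0), mass c Γ (d t) = 0 := by
    filter_upwards [hdm] with t ht
    rw [h.mass_eq, ht]
  have hp := (h.isPrim_moment hs (Pi.single i 1 + Pi.single j 1)).sub
    ((h.isPrim_moment hs (Pi.single i 1)).mul (h.isPrim_moment hs (Pi.single j 1)))
  have hq : IsPrim (fun t => h.cumulant (p t) i j)
      fun t => -(c * (l i + l j) * h.cumulant (p t) i j) + 0 := by
    refine hp.congr (fun _ _ => rfl) ?_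
    filter_upwards [hdm, ae_restrict_mem measurableSet_Ioi] with t hdt ht
    have e2 : ∀ j, eigVal l (Pi.single j 1) = l j := fun j => by
      rw [eigVal, Finset.sum_eq_single j (fun i _ hi => by simp [hi]) (by simp)]
      simp
    have e1 : ∀ j, ∑ i, drift v g u i t * (√(l i) * ((Pi.single j 1 : Fin n → ℕ) i : ℝ) *
        h.moment (p t) (Pi.single j 1 - Pi.single i 1)) = drift v g u j t * √(l j) := fun j => by
      rw [Finset.sum_eq_single j]
      · rw [Pi.single_eq_same, tsub_self, ← h.mass_eq, h.mass_eq_of_isTriSol hs hd0 (le_of_lt ht),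
          h1]
        simp
      · intro i _ hi
        simp [Pi.single_eq_of_ne hi]
      · simp
    have e3 : ∑ m, drift v g u m t * (√(l m) *
        ((Pi.single i 1 + Pi.single j 1 : Fin n → ℕ) m : ℝ) *
        h.moment (p t) (Pi.single i 1 + Pi.single j 1 - Pi.single m 1)) =
        drift v g u i t * √(l i) * h.moment (p t) (Pi.single j 1) +
        drift v g u j t * √(l j) * h.moment (p t) (Pi.single i 1) := by
      have e4 : ∀ m, drift v g u m t * (√(l m) *
          ((Pi.single i 1 + Pi.single j 1 : Fin n → ℕ) m : ℝ) *
          h.moment (p t) (Pi.single i 1 + Pi.single j 1 - Pi.single m 1)) =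
          (if m = i then drift v g u i t * √(l i) * h.moment (p t) (Pi.single j 1) else 0) +
          (if m = j then drift v g u j t * √(l j) * h.moment (p t) (Pi.single i 1) else 0) := by
        intro m
        by_cases hmi : m = i
        · subst hmi
          by_cases hmj : m = j
          · subst hmj
            simp only [if_true, Pi.add_apply, Pi.single_eq_same, add_tsub_cancel_right]
            push_cast
            ring
          · simp only [if_true, if_neg hmj, Pi.add_apply, Pi.single_eq_same,
              Pi.single_eq_of_ne hmj, add_tsub_cancel_left]
            push_cast
            ring
        · by_cases hmj : m = j
          · subst hmj
            simp only [if_true, if_neg hmi, Pi.add_apply, Pi.single_eq_same,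
              Pi.single_eq_of_ne hmi, add_tsub_cancel_right]
            push_cast
            ring
          · simp [hmi, hmj]
      simp only [e4, Finset.sum_add_distrib]
      simp
    simp only [hdt, e1, e2, e3, eigVal_single_add_single, add_zero, cumulant]
    ring
  have h2 := hq.eq_exp_mul ht
  simp only [mul_zero, intervalIntegral.integral_zero, add_zero] at h2
  rw [h2, show -(c * (l i + l j) * t) = -(c * l i * t) + -(c * l j * t) by ring, Real.exp_add]
  ring

theorem integral_centered (h : IsEigBasis c Γ v l) {f : HSp c Γ} (hf : mass c Γ f = 1)
    (i j : Fin n) : ∫ x, inner ℝ (v i) (x - meanVal c Γ f) * inner ℝ (v j) (x - meanVal c Γ f) *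
      f x = (h.cumulant f i j + if i = j then 1 else 0) / (√(l i) * √(l j)) := by
  set m := meanVal c Γ f
  have hli : √(l i) ≠ 0 := (Real.sqrt_pos.2 (h.pos i)).ne'
  have hlj : √(l j) ≠ 0 := (Real.sqrt_pos.2 (h.pos j)).ne'
  have hti := hasTemperateGrowth_inner (v i)
  have htj := hasTemperateGrowth_inner (v j)
  have i1 := h.integrable_mul_temperate f hti
  have i2 := h.integrable_mul_temperate f htj
  have i3 := h.integrable_mul_temperate f (hermFun_hasTemperateGrowth (v := v) (l := l)
    (Pi.single i 1 + Pi.single j 1))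
  have i0 := h.integrable_coe f
  set δ : ℝ := if i = j then 1 else 0
  have e : ∀ x : Euc n, inner ℝ (v i) (x - m) * inner ℝ (v j) (x - m) * f x =
      (√(l i) * √(l j))⁻¹ * (f x * hermFun v l (Pi.single i 1 + Pi.single j 1) x) +
      ((√(l i) * √(l j))⁻¹ * δ + inner ℝ (v i) m * inner ℝ (v j) m) * f x -
      (inner ℝ (v j) m * (f x * inner ℝ (v i) x) + inner ℝ (v i) m * (f x * inner ℝ (v j) x)) := by
    intro x
    rw [hermFun_single_add_single, inner_sub_right, inner_sub_right]
    field_simp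
    ring
  simp only [e]
  have j1 : Integrable fun x : Euc n =>
      (√(l i) * √(l j))⁻¹ * (f x * hermFun v l (Pi.single i 1 + Pi.single j 1) x) +
      ((√(l i) * √(l j))⁻¹ * δ + inner ℝ (v i) m * inner ℝ (v j) m) * f x :=
    (i3.const_mul _).add (i0.const_mul _)
  have j2 : Integrable fun x : Euc n => inner ℝ (v j) m * (f x * inner ℝ (v i) x) +
      inner ℝ (v i) m * (f x * inner ℝ (v j) x) := (i1.const_mul _).add (i2.const_mul _)
  rw [integral_sub j1 j2, integral_add (i3.const_mul _) (i0.const_mul _),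
    integral_add (i1.const_mul _) (i2.const_mul _),
    integral_const_mul, integral_const_mul, integral_const_mul, integral_const_mul,
    ← h.inner_meanVal, ← h.inner_meanVal]
  have hm : ∫ x, f x = 1 := hf
  have hmm : ∫ x, f x * hermFun v l (Pi.single i 1 + Pi.single j 1) x =
      h.moment f (Pi.single i 1 + Pi.single j 1) := rfl
  rw [hm, hmm, cumulant, ← h.inner_meanVal_basis, ← h.inner_meanVal_basis]
  field_simp
  ring

theorem covMat_eq (h : IsEigBasis c Γ v l) {f : HSp c Γ} (hf : mass c Γ f = 1) :
    covMat c Γ f = (Matrix.of fun i k => v k i) *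
      (Matrix.of fun a b => (h.cumulant f a b + if a = b then 1 else 0) / (√(l a) * √(l b))) *
      (Matrix.of fun i k => v k i)ᵀ := by
  ext i j
  set m := meanVal c Γ f
  have hx : ∀ (x : Euc n) (i : Fin n), x i - m i = ∑ a, v a i * inner ℝ (v a) (x - m) := by
    intro x i
    have := congrArg (fun y : Euc n => y i) (v.sum_repr' (x - m))
    simp only [PiLp.sub_apply, WithLp.ofLp_sum, WithLp.ofLp_smul, Finset.sum_apply, Pi.smul_apply,
      smul_eq_mul] at this
    rw [← this]
    exact Finset.sum_congr rfl fun a _ => mul_comm _ _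
  have hint : ∀ a b, Integrable fun x : Euc n =>
      inner ℝ (v a) (x - m) * inner ℝ (v b) (x - m) * f x := fun a b => by
    have ht : ∀ a : Fin n, (fun x : Euc n => (inner ℝ (v a) (x - m) : ℝ)).HasTemperateGrowth :=
      fun a => by
        have := hasTemperateGrowth_inner (v a)
        simp only [inner_sub_right]
        fun_prop
    refine (h.integrable_mul_temperate f ((ht a).mul (ht b))).congr
      (Eventually.of_forall fun x => ?_)
    simp only [Pi.mul_apply]
    ring
  have e : ∀ x : Euc n, (x i - m i) * (x j - m j) * f x = ∑ b, ∑ a, v a i * v b j *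
      (inner ℝ (v a) (x - m) * inner ℝ (v b) (x - m) * f x) := by
    intro x
    rw [hx, hx, Finset.sum_mul_sum, Finset.sum_comm, Finset.sum_mul]
    refine Finset.sum_congr rfl fun b _ => ?_
    rw [Finset.sum_mul]
    exact Finset.sum_congr rfl fun a _ => by ring
  rw [covMat, Matrix.of_apply]
  simp only [m] at e
  simp only [e]
  rw [integral_finsetSum _ fun b _ => integrable_finsetSum _ fun a _ => (hint a b).const_mul _,
    Matrix.mul_apply]
  refine Finset.sum_congr rfl fun b _ => ?_
  rw [integral_finsetSum _ fun a _ => (hint a b).const_mul _, Matrix.mul_apply, Finset.sum_mul]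
  refine Finset.sum_congr rfl fun a _ => ?_
  rw [integral_const_mul, h.integral_centered hf]
  simp only [Matrix.of_apply, Matrix.transpose_apply]
  ring

/-- The covariance of the solution. -/
theorem covMat_eq_of_isTriSol (h : IsEigBasis c Γ v l)
    (hs : IsTriSol c l (drift v g u) (h.coef d) (h.coef p))
    (hd : ∀ᵐ t ∂volume.restrict (Ioi 0), d t = 0) (h1 : mass c Γ (p 0) = 1) :
    ∃ K : Matrix (Fin n) (Fin n) ℝ, ∀ t ≥ 0,
      let V : Matrix (Fin n) (Fin n) ℝ := Matrix.of fun i k => v k i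
      let R : Matrix (Fin n) (Fin n) ℝ := Matrix.diagonal fun k => √(l k / 2)
      let D : Matrix (Fin n) (Fin n) ℝ := Matrix.diagonal fun k => Real.exp (-(c * l k * t))
      covMat c Γ (p t) =
        (1 / 4 : ℝ) • (V * R⁻¹ * (D * K * D + (2 : ℝ) • 1) * R⁻¹ * Vᵀ) := by
  -- The factor `2` makes `K` commensurate with the term `2 I`: since `R⁻¹` has entries `√2 / √l_k`,
  -- the prefactor `1/4` turns `2 (C + I)` into `C + I` divided by `√l_a √l_b`.
  refine ⟨Matrix.of fun a b => 2 * h.cumulant (p 0) a b, fun t ht => ?_⟩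
  intro V R D
  have hd0 : ∀ᵐ t ∂volume.restrict (Ioi 0), mass c Γ (d t) = 0 := by
    filter_upwards [hd] with t ht
    rw [ht, h.mass_eq, h.moment_eq, inner_zero_right, mul_zero]
  have hl : ∀ k, √(l k / 2) ≠ 0 := fun k => (Real.sqrt_pos.2 (by linarith [h.pos k])).ne'
  have hR : R⁻¹ = Matrix.diagonal fun k => (√(l k / 2))⁻¹ := by
    refine Matrix.inv_eq_right_inv ?_
    rw [Matrix.diagonal_mul_diagonal, ← Matrix.diagonal_one]
    congr 1 with k
    exact mul_inv_cancel₀ (hl k)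
  rw [h.covMat_eq ((h.mass_eq_of_isTriSol hs hd0 ht).trans h1)]
  suffices hmid : (Matrix.of fun a b =>
      (h.cumulant (p t) a b + if a = b then 1 else 0) / (√(l a) * √(l b))) =
      (1 / 4 : ℝ) • (R⁻¹ * (D * (Matrix.of fun a b => 2 * h.cumulant (p 0) a b) * D +
        (2 : ℝ) • 1) * R⁻¹) by
    rw [hmid]
    simp only [Matrix.mul_smul, Matrix.smul_mul, Matrix.mul_assoc, V]
  rw [hR]
  ext a b
  rw [Matrix.smul_apply, Matrix.mul_diagonal, Matrix.diagonal_mul, Matrix.add_apply,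
    Matrix.mul_diagonal, Matrix.diagonal_mul, Matrix.smul_apply, Matrix.of_apply, Matrix.of_apply,
    h.cumulant_eq hs hd h1 a b ht, Matrix.one_apply]
  have h2 : √(2 : ℝ) * √2 = 2 := Real.mul_self_sqrt (by norm_num)
  have h3 : √(2 : ℝ) ≠ 0 := by positivity
  have h4 : √(l a) ≠ 0 := (Real.sqrt_pos.2 (h.pos a)).ne'
  have h5 : √(l b) ≠ 0 := (Real.sqrt_pos.2 (h.pos b)).ne'
  rw [Real.sqrt_div' _ (by norm_num), Real.sqrt_div' _ (by norm_num), smul_eq_mul, smul_eq_mul,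
    inv_div, inv_div]
  field_simp
  rw [show √(2 : ℝ) ^ 2 = 2 from Real.sq_sqrt (by norm_num)]
  ring

theorem tendsto_covMat (h : IsEigBasis c Γ v l)
    (hs : IsTriSol c l (drift v g u) (h.coef d) (h.coef p))
    (hd : ∀ᵐ t ∂volume.restrict (Ioi 0), d t = 0) (h1 : mass c Γ (p 0) = 1) :
    Tendsto (fun t => covMat c Γ (p t)) atTop (𝓝 (c • Γ⁻¹)) := by
  have hd0 : ∀ᵐ t ∂volume.restrict (Ioi 0), mass c Γ (d t) = 0 := by
    filter_upwards [hd] with t ht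
    rw [ht, h.mass_eq, h.moment_eq, inner_zero_right, mul_zero]
  set V : Matrix (Fin n) (Fin n) ℝ := Matrix.of fun i k => v k i
  have hVV : V * Vᵀ = 1 := by
    have h2 : Vᵀ * V = 1 := by
      ext a b
      rw [Matrix.mul_apply, Matrix.one_apply, ← orthonormal_iff_ite.1 v.orthonormal a b,
        PiLp.inner_apply]
      refine Finset.sum_congr rfl fun i _ => ?_
      simp [V, mul_comm]
    exact mul_eq_one_comm.1 h2
  have hVV' : Vᵀ * V = 1 := mul_eq_one_comm.1 hVV
  have hΓV : Γ * V = V * Matrix.diagonal fun k => c * l k := by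
    ext i k
    rw [Matrix.mul_diagonal]
    have := congrFun (h.eig k) i
    simp only [Matrix.mulVec, dotProduct, Pi.smul_apply, smul_eq_mul] at this
    rw [Matrix.mul_apply]
    refine this.trans ?_
    simp only [V, Matrix.of_apply]
    ring
  have hlim : c • Γ⁻¹ = V * (Matrix.diagonal fun k => (l k)⁻¹) * Vᵀ := by
    have h3 : Γ⁻¹ = V * (Matrix.diagonal fun k => (c * l k)⁻¹) * Vᵀ := by
      refine Matrix.inv_eq_right_inv ?_
      rw [← Matrix.mul_assoc, ← Matrix.mul_assoc, hΓV, Matrix.mul_assoc V,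
        Matrix.diagonal_mul_diagonal]
      have : (fun k => c * l k * (c * l k)⁻¹) = fun _ => (1 : ℝ) := funext fun k =>
        mul_inv_cancel₀ (mul_pos h.cpos (h.pos k)).ne'
      rw [this, Matrix.diagonal_one, Matrix.mul_one, hVV]
    rw [h3, ← Matrix.smul_mul, ← Matrix.mul_smul, ← Matrix.diagonal_smul]
    congr 3
    ext k
    have := h.cpos.ne'
    simp only [Pi.smul_apply, smul_eq_mul, mul_inv]
    field_simp
  have hdec : ∀ a b, Tendsto (fun t => h.cumulant (p t) a b) atTop (𝓝 0) := by
    intro a b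
    have he : ∀ k : Fin n, Tendsto (fun t => Real.exp (-(c * l k * t))) atTop (𝓝 0) := fun k =>
      Real.tendsto_exp_neg_atTop_nhds_zero.comp
        (tendsto_id.const_mul_atTop (mul_pos h.cpos (h.pos k)))
    have h4 := ((he a).mul_const (h.cumulant (p 0) a b)).mul (he b)
    rw [zero_mul, zero_mul] at h4
    refine h4.congr' ?_
    filter_upwards [eventually_ge_atTop 0] with t ht
    exact (h.cumulant_eq hs hd h1 a b ht).symm
  have hC : Tendsto (fun t => Matrix.of fun a b =>
      (h.cumulant (p t) a b + if a = b then 1 else 0) / (√(l a) * √(l b))) atTop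
      (𝓝 (Matrix.diagonal fun k => (l k)⁻¹)) := by
    refine tendsto_pi_nhds.2 fun a => tendsto_pi_nhds.2 fun b => ?_
    have h5 := ((hdec a b).add_const (if a = b then 1 else 0)).div_const (√(l a) * √(l b))
    have h6 : ((0 : ℝ) + if a = b then 1 else 0) / (√(l a) * √(l b)) =
        Matrix.diagonal (fun k => (l k)⁻¹) a b := by
      rw [Matrix.diagonal_apply]
      split_ifs with hab
      · subst hab
        rw [Real.mul_self_sqrt (h.pos a).le]
        simp
      · simp
    rw [← h6]
    exact h5
  rw [hlim]
  have hM : Continuous fun M : Matrix (Fin n) (Fin n) ℝ => V * M * Vᵀ := by fun_prop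
  refine ((hM.tendsto _).comp hC).congr' ?_
  filter_upwards [eventually_ge_atTop 0] with t ht
  exact (h.covMat_eq ((h.mass_eq_of_isTriSol hs hd0 ht).trans h1)).symm

end IsEigBasis

end Moments

end

section

/-! ### The Fourier transform in the Hermite basis -/

theorem Real.hasTemperateGrowth_cos : Real.cos.HasTemperateGrowth :=
  ⟨Real.contDiff_cos, fun m => ⟨0, 1, fun x => by
    rw [norm_iteratedFDeriv_eq_norm_iteratedDeriv]
    simpa using Real.abs_iteratedDeriv_cos_le_one m x⟩⟩

theorem Real.hasTemperateGrowth_sin : Real.sin.HasTemperateGrowth :=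
  ⟨Real.contDiff_sin, fun m => ⟨0, 1, fun x => by
    rw [norm_iteratedFDeriv_eq_norm_iteratedDeriv]
    simpa using Real.abs_iteratedDeriv_sin_le_one m x⟩⟩

variable {n : ℕ} {c : ℝ} {Γ : Matrix (Fin n) (Fin n) ℝ}
  {v : OrthonormalBasis (Fin n) ℝ (Euc n)} {l : Fin n → ℝ}

theorem hasTemperateGrowth_cos_inner (ξ : Euc n) :
    (fun x : Euc n => Real.cos (inner ℝ x ξ)).HasTemperateGrowth :=
  Real.hasTemperateGrowth_cos.comp (Function.hasTemperateGrowth_inner_left ξ)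

theorem hasTemperateGrowth_sin_inner (ξ : Euc n) :
    (fun x : Euc n => Real.sin (inner ℝ x ξ)).HasTemperateGrowth :=
  Real.hasTemperateGrowth_sin.comp (Function.hasTemperateGrowth_inner_left ξ)

/-- The Fourier transform `∫ z(x) e^{i⟨x, ξ⟩} dx` of `z ∈ 𝔥`. -/
def fourierH {c : ℝ} {Γ : Matrix (Fin n) (Fin n) ℝ} (ξ : Euc n) (z : HSp c Γ) : ℂ :=
  ∫ x, (z x : ℂ) * Complex.exp (inner ℝ x ξ * Complex.I)

namespace IsEigBasis

/-- Writing the Fourier transform by means of inner products with `e^{-φ} cos` and `e^{-φ} sin`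
makes Parseval's identity available. -/
theorem fourierH_eq (h : IsEigBasis c Γ v l) (ξ : Euc n) (z : HSp c Γ) :
    fourierH ξ z = (inner ℝ z (gaussEmb c Γ fun x => Real.cos (inner ℝ x ξ)) : ℝ) +
      (inner ℝ z (gaussEmb c Γ fun x => Real.sin (inner ℝ x ξ)) : ℝ) * Complex.I := by
  have ic := h.integrable_mul_temperate z (hasTemperateGrowth_cos_inner ξ)
  have is := h.integrable_mul_temperate z (hasTemperateGrowth_sin_inner ξ)
  have e : ∀ x, (z x : ℂ) * Complex.exp (inner ℝ x ξ * Complex.I) =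
      ((z x * Real.cos (inner ℝ x ξ) : ℝ) : ℂ) +
        ((z x * Real.sin (inner ℝ x ξ) : ℝ) : ℂ) * Complex.I := fun x => by
    rw [Complex.exp_mul_I]
    push_cast
    ring
  have ic' : Integrable fun x => ((z x * Real.cos (inner ℝ x ξ) : ℝ) : ℂ) := ic.ofReal
  have is' : Integrable fun x => ((z x * Real.sin (inner ℝ x ξ) : ℝ) : ℂ) * Complex.I :=
    is.ofReal.mul_const _
  rw [h.inner_gaussEmb z (hasTemperateGrowth_cos_inner ξ),
    h.inner_gaussEmb z (hasTemperateGrowth_sin_inner ξ), fourierH]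
  simp only [e]
  rw [integral_add ic' is', integral_mul_const, integral_complex_ofReal, integral_complex_ofReal]

theorem hasSum_fourierH (h : IsEigBasis c Γ v l) (ξ : Euc n) (z : HSp c Γ) :
    HasSum (fun k => (inner ℝ (h.basisH k) z : ℂ) * fourierH ξ (h.basisH k)) (fourierH ξ z) := by
  have h1 := h.basisH.hasSum_inner_mul_inner z (gaussEmb c Γ fun x => Real.cos (inner ℝ x ξ))
  have h2 := h.basisH.hasSum_inner_mul_inner z (gaussEmb c Γ fun x => Real.sin (inner ℝ x ξ))
  have h3 := (Complex.hasSum_ofReal.2 h1).add ((Complex.hasSum_ofReal.2 h2).mul_right Complex.I)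
  rw [← h.fourierH_eq] at h3
  refine h3.congr_fun fun k => ?_
  rw [h.fourierH_eq, real_inner_comm z]
  push_cast
  ring

theorem summable_fourierH_sq (h : IsEigBasis c Γ v l) (ξ : Euc n) :
    Summable fun k => ‖fourierH ξ (h.basisH k)‖ ^ 2 := by
  have h1 := h.basisH.hasSum_inner_sq (gaussEmb c Γ fun x => Real.cos (inner ℝ x ξ))
  have h2 := h.basisH.hasSum_inner_sq (gaussEmb c Γ fun x => Real.sin (inner ℝ x ξ))
  refine (h1.add h2).summable.congr fun k => ?_
  rw [h.fourierH_eq, ← Complex.normSq_eq_norm_sq, Complex.normSq_add_mul_I]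

theorem gradAlong_of_grad_eq {w : VSp c Γ} {z : HSp c Γ} {ξ : Euc n} {σ : ℝ}
    (hw : ∀ i, VSp.grad c Γ w i = (σ * ξ i) • z) (a : Euc n) :
    gradAlong c Γ a w = (σ * inner ℝ a ξ) • z := by
  rw [gradAlong]
  simp only [hw, smul_smul, ← Finset.sum_smul]
  congr 1
  rw [PiLp.inner_apply, Finset.mul_sum]
  exact Finset.sum_congr rfl fun i _ => by simp; ring

/-- Differentiating sine and cosine multiplies by `ξ`, while the adjoint of the gradient raises
indices. By iteration the transform of `e_k` is a monomial in `ξ` times that of the Gaussian `e_0`.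
-/
theorem fourierH_basisH_add_single (h : IsEigBasis c Γ v l) (ξ : Euc n) (k : Fin n → ℕ)
    (j : Fin n) : (√(l j * (k j + 1)) : ℂ) * fourierH ξ (h.basisH (k + Pi.single j 1)) =
      Complex.I * (inner ℝ (v j) ξ : ℝ) * fourierH ξ (h.basisH k) := by
  have hc := hasTemperateGrowth_cos_inner ξ
  have hs := hasTemperateGrowth_sin_inner ξ
  have hd : ∀ (x : Euc n), HasFDerivAt (fun x : Euc n => (inner ℝ x ξ : ℝ)) (innerSL ℝ ξ) x :=
    fun x => by
      have := (innerSL ℝ ξ).hasFDerivAt (x := x)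
      simpa [real_inner_comm] using! this
  obtain ⟨wc, hwc, gwc⟩ := h.exists_gaussV hc
  obtain ⟨ws, hws, gws⟩ := h.exists_gaussV hs
  have gc : ∀ i, VSp.grad c Γ wc i =
      (-1 * ξ i) • gaussEmb c Γ fun x => Real.sin (inner ℝ x ξ) := fun i => by
    rw [gwc, ← h.gaussEmb_const_mul hs]
    congr 1 with x
    rw [(hd x).cos.fderiv]
    simp [EuclideanSpace.inner_single_right]
    ring
  have gs : ∀ i, VSp.grad c Γ ws i =
      (1 * ξ i) • gaussEmb c Γ fun x => Real.cos (inner ℝ x ξ) := fun i => by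
    rw [gws, ← h.gaussEmb_const_mul hc]
    congr 1 with x
    rw [(hd x).sin.fderiv]
    simp [EuclideanSpace.inner_single_right]
    ring
  have ec := h.inner_gradAlong_basisH wc j k
  have es := h.inner_gradAlong_basisH ws j k
  rw [gradAlong_of_grad_eq gc, hwc, real_inner_smul_left, real_inner_comm (h.basisH k),
    real_inner_comm (h.basisH (k + Pi.single j 1))] at ec
  rw [gradAlong_of_grad_eq gs, hws, real_inner_smul_left, real_inner_comm (h.basisH k),
    real_inner_comm (h.basisH (k + Pi.single j 1))] at es
  have ec' := congrArg (fun r : ℝ => (r : ℂ)) ec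
  have es' := congrArg (fun r : ℝ => (r : ℂ)) es
  simp only [Complex.ofReal_mul, Complex.ofReal_neg, Complex.ofReal_one] at ec' es'
  rw [h.fourierH_eq, h.fourierH_eq]
  linear_combination (-1 : ℂ) * ec' - Complex.I * es' -
    ((inner ℝ (v j) ξ : ℝ) : ℂ) * ((inner ℝ (h.basisH k)
      (gaussEmb c Γ fun x => Real.sin (inner ℝ x ξ)) : ℝ) : ℂ) * Complex.I_sq

theorem exists_fourierH_zero (h : IsEigBasis c Γ v l) : ∃ κ : ℂ, κ ≠ 0 ∧ ∀ ξ : Euc n,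
    fourierH ξ (h.basisH 0) =
      κ * Complex.exp ((-(1 / 2) * ∑ j, inner ℝ (v j) ξ ^ 2 / l j : ℝ)) := by
  have hN := (h.hermNorm_pos 0).ne'
  refine ⟨(hermNorm c Γ 0 : ℂ)⁻¹ * ∏ j, (Real.pi / (l j / 2 : ℂ)) ^ (1 / 2 : ℂ),
    mul_ne_zero (inv_ne_zero (Complex.ofReal_ne_zero.2 hN)) (Finset.prod_ne_zero_iff.2
      fun j _ => ?_), fun ξ => ?_⟩
  · have hl : (l j : ℂ) ≠ 0 := Complex.ofReal_ne_zero.2 (h.pos j).ne'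
    have hπ : (Real.pi : ℂ) ≠ 0 := Complex.ofReal_ne_zero.2 Real.pi_ne_zero
    rw [Complex.cpow_ne_zero_iff_of_exponent_ne_zero (by norm_num)]
    exact div_ne_zero hπ (div_ne_zero hl two_ne_zero)
  · have e1 : fourierH ξ (h.basisH 0) = ∫ x : Euc n, (hermNorm c Γ 0 : ℂ)⁻¹ *
        Complex.exp (-∑ j, (l j / 2 : ℂ) * ((v.repr x j : ℝ) : ℂ) ^ 2 +
          ∑ j, (Complex.I * (inner ℝ (v j) ξ : ℝ)) * ((v.repr x j : ℝ) : ℂ)) := by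
      refine integral_congr_ae ?_
      filter_upwards [h.coe_gaussEmb (hermFun_hasTemperateGrowth (v := v) (l := l) 0),
        ae_wMeasure_iff.1 (Lp.coeFn_smul (hermNorm c Γ 0)⁻¹ (hermH c Γ v l 0))] with x h1 h2
      have h3 : (h.basisH 0 : Euc n → ℝ) x =
          (hermNorm c Γ 0)⁻¹ * Real.exp (-pot c Γ x) := by
        rw [h.basisH_apply, h2, Pi.smul_apply, smul_eq_mul, hermH, h1, hermFun_zero, mul_one]
      rw [h3, h.pot_eq, Complex.ofReal_mul, Complex.ofReal_exp, mul_assoc, ← Complex.exp_add]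
      congr 2
      · push_cast
        rfl
      · have h4 : (inner ℝ x ξ : ℝ) = ∑ j, inner ℝ (v j) x * inner ℝ (v j) ξ := by
          rw [← v.sum_inner_mul_inner x ξ]
          exact Finset.sum_congr rfl fun j _ => by rw [real_inner_comm x]
        simp only [v.repr_apply_apply, h4]
        push_cast
        rw [Finset.mul_sum, Finset.sum_mul]
        congr 1
        · congr 1
          exact Finset.sum_congr rfl fun j _ => by ring
        · exact Finset.sum_congr rfl fun j _ => by ring
    rw [e1, integral_const_mul, mul_assoc]
    congr 1
    rw [v.measurePreserving_repr.integral_comp v.measurableEquiv.measurableEmbedding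
      (fun y : Euc n => Complex.exp (-∑ j, (l j / 2 : ℂ) * ((y j : ℝ) : ℂ) ^ 2 +
          ∑ j, (Complex.I * (inner ℝ (v j) ξ : ℝ)) * ((y j : ℝ) : ℂ))),
      ← (PiLp.volume_preserving_toLp (Fin n)).integral_comp
      (MeasurableEquiv.toLp 2 _).measurableEmbedding]
    have := GaussianFourier.integral_cexp_neg_sum_mul_add (b := fun j => (l j / 2 : ℂ))
      (fun j => by
        have := h.pos j
        rw [show (l j / 2 : ℂ) = ((l j / 2 : ℝ) : ℂ) by push_cast; rfl, Complex.ofReal_re]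
        linarith)
      (fun j => Complex.I * (inner ℝ (v j) ξ : ℝ))
    refine this.trans ?_
    rw [Finset.prod_mul_distrib, ← Complex.exp_sum]
    congr 2
    push_cast
    rw [Finset.mul_sum]
    refine Finset.sum_congr rfl fun j _ => ?_
    have hl : (l j : ℂ) ≠ 0 := Complex.ofReal_ne_zero.2 (h.pos j).ne'
    rw [mul_pow, Complex.I_sq]
    field_simp
    ring

end IsEigBasis

end

section

/-! ### Positivity -/

theorem IsPrim.of_tendsto {E : Type*} [NormedAddCommGroup E] [NormedSpace ℝ E]
    {F f : ℕ → ℝ → E} {G g : ℝ → E} (h : ∀ N, IsPrim (F N) (f N))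
    (hF : ∀ t ≥ 0, Tendsto (fun N => F N t) atTop (𝓝 (G t)))
    (hf : ∀ t ≥ 0, Tendsto (fun N => f N t) atTop (𝓝 (g t)))
    (hb : ∀ T ≥ 0, ∃ B : ℝ, ∀ N, ∀ t ∈ Icc 0 T, ‖f N t‖ ≤ B) : IsPrim G g := by
  have hlim : ∀ T ≥ 0, ∀ t ∈ uIoc 0 T, Tendsto (fun N => f N t) atTop (𝓝 (g t)) :=
    fun T hT t ht => by
      rw [uIoc_of_le hT] at ht
      exact hf t ht.1.le
  have hm : ∀ T ≥ 0, ∀ N, AEStronglyMeasurable (f N) (volume.restrict (uIoc 0 T)) :=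
    fun T hT N => by
      rw [uIoc_of_le hT]
      exact ((h N).intervalIntegrable T hT).1.aestronglyMeasurable
  refine ⟨fun T hT => ?_, fun t ht => ?_⟩
  · obtain ⟨B, hB⟩ := hb T hT
    have hmg := aestronglyMeasurable_of_tendsto_ae atTop (hm T hT)
      (ae_restrict_of_forall_mem measurableSet_uIoc (hlim T hT))
    refine (intervalIntegrable_const (c := B)).mono_fun hmg ?_
    refine ae_restrict_of_forall_mem measurableSet_uIoc fun t ht => ?_
    have h1 := le_of_tendsto (hlim T hT t ht).norm (Eventually.of_forall fun N => hB N t ?_)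
    · exact h1.trans (le_abs_self B)
    · rw [uIoc_of_le hT] at ht
      exact ⟨ht.1.le, ht.2⟩
  · obtain ⟨B, hB⟩ := hb t ht
    have h1 := intervalIntegral.tendsto_integral_filter_of_dominated_convergence (μ := volume)
      (l := atTop) (F := f) (f := g) (a := 0) (b := t) (fun _ => B)
      (Eventually.of_forall (hm t ht))
      (Eventually.of_forall fun N => Eventually.of_forall fun s hs => by
        rw [uIoc_of_le ht] at hs
        exact hB N s ⟨hs.1.le, hs.2⟩)
      intervalIntegrable_const (Eventually.of_forall (hlim t ht))
    refine tendsto_nhds_unique (hF t ht) (((hF 0 le_rfl).add h1).congr fun N => ?_)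
    exact ((h N).eq_integral t ht).symm

theorem IsPrim.eq_cexp_mul {R : ℝ → ℂ} {θ : ℝ → ℝ} (hθ : ContinuousOn θ (Ici 0))
    (h : IsPrim R fun s => (θ s : ℂ) * Complex.I * R s) {t : ℝ} (ht : 0 ≤ t) :
    R t = Complex.exp ((∫ s in (0 : ℝ)..t, θ s : ℝ) * Complex.I) * R 0 := by
  set σ : ℝ → ℝ := fun s => θ (max s 0)
  have hσ : Continuous σ := hθ.comp_continuous (by fun_prop) fun s =>
    mem_Ici.2 (le_max_right s 0)
  have hσθ : ∀ s ≥ 0, σ s = θ s := fun s hs => by simp only [σ, max_eq_left hs]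
  set Y : ℝ → ℂ := fun s => Complex.exp ((∫ r in (0 : ℝ)..s, σ r : ℝ) * Complex.I) * R 0
  have hd : ∀ s, HasDerivAt Y ((σ s : ℂ) * Complex.I * Y s) s := fun s => by
    have h1 : HasDerivAt (fun s => ∫ r in (0 : ℝ)..s, σ r) (σ s) s :=
      (hσ.integral_hasStrictDerivAt 0 s).hasDerivAt
    have h2 := ((h1.ofReal_comp.mul_const Complex.I).cexp).mul_const (R 0)
    convert! h2 using 1
    simp only [Y]
    ring
  have hY : IsPrim Y fun s => (θ s : ℂ) * Complex.I * Y s := by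
    have hYc : Continuous Y := continuous_iff_continuousAt.2 fun s => (hd s).continuousAt
    refine IsPrim.of_hasDerivWithinAt ?_ fun s hs => ?_
    · exact ((Complex.continuous_ofReal.comp_continuousOn hθ).mul continuousOn_const).mul
        hYc.continuousOn
    · have := hd s
      rw [hσθ s hs] at this
      exact this.hasDerivWithinAt
  obtain ⟨K, hK⟩ := isCompact_Icc.exists_bound_of_continuousOn
    (hθ.mono (fun s hs => hs.1 : Icc 0 t ⊆ Ici (0 : ℝ)))
  have hK0 : 0 ≤ K := (norm_nonneg _).trans (hK t ⟨ht, le_rfl⟩)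
  have h3 := h.eqOn_of_norm_sub_le (T := t) hK0 hY (by simp [Y]) (fun s hs => by
    rw [← mul_sub, norm_mul, norm_mul, Complex.norm_I, mul_one, Complex.norm_real]
    exact mul_le_mul_of_nonneg_right (hK s hs) (norm_nonneg _)) (right_mem_Icc.2 ht)
  rw [h3]
  simp only [Y]
  congr 4
  refine intervalIntegral.integral_congr fun s hs => ?_
  rw [uIcc_of_le ht] at hs
  exact hσθ s hs.1

variable {n : ℕ} {c : ℝ} {Γ : Matrix (Fin n) (Fin n) ℝ}
  {v : OrthonormalBasis (Fin n) ℝ (Euc n)} {l : Fin n → ℝ}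

theorem monotone_degBox : Monotone (degBox n) := fun _ _ hNM _ hk =>
  mem_degBox.2 ((mem_degBox.1 hk).trans hNM)

theorem tendsto_degBox : Tendsto (degBox n) atTop atTop :=
  Filter.tendsto_atTop_finset_of_monotone monotone_degBox fun k =>
    ⟨∑ j, k j, mem_degBox.2 le_rfl⟩

theorem sum_degBox_succ {E : Type*} [AddCommMonoid E] (N : ℕ) (j : Fin n) {f : (Fin n → ℕ) → E}
    (hf : ∀ k, k j = 0 → f k = 0) :
    ∑ k ∈ degBox n (N + 1), f k = ∑ k ∈ degBox n N, f (k + Pi.single j 1) := by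
  classical
  have hinj : Function.Injective fun k : Fin n → ℕ => k + Pi.single j 1 :=
    fun k m hkm => add_right_cancel hkm
  rw [← Finset.sum_image (f := f) (g := fun k => k + Pi.single j 1) hinj.injOn]
  symm
  refine Finset.sum_subset (fun k hk => ?_) fun k hk hk' => hf k ?_
  · obtain ⟨m, hm, rfl⟩ := Finset.mem_image.1 hk
    rw [mem_degBox] at hm ⊢
    rw [sum_add_single]
    omega
  · by_contra hj
    refine hk' (Finset.mem_image.2 ⟨k - Pi.single j 1, ?_, sub_add_single hj⟩)
    have h1 := sum_add_single (k - Pi.single j 1) j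
    rw [sub_add_single hj] at h1
    rw [mem_degBox] at hk ⊢
    omega

/-- The factor `e^{c μ_k s}` removes the damping, and the recursion for `C` turns the shift of
indices into multiplication by `ζ_j`. The sum of degree at most `N + 1` is thus driven by that of
degree at most `N`, which closes up as `N → ∞`. -/
theorem IsTriSol.isPrim_sum_smul {b : Fin n → ℝ → ℝ} {d a : (Fin n → ℕ) → ℝ → ℝ}
    (hs : IsTriSol c l b d a) (hd : ∀ᵐ t ∂volume.restrict (Ioi 0), ∀ k, d k t = 0)
    {C : (Fin n → ℕ) → ℂ} {ζ : Fin n → ℂ}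
    (hC : ∀ k j, (√(l j * (k j + 1)) : ℂ) * C (k + Pi.single j 1) = ζ j * C k) (N : ℕ) :
    IsPrim (fun s => ∑ k ∈ degBox n (N + 1),
        ((Real.exp (c * eigVal l k * s) * a k s : ℝ) : ℂ) * C k)
      fun s => (∑ j, ((b j s * Real.exp (c * l j * s) : ℝ) : ℂ) * ζ j) *
        ∑ k ∈ degBox n N, ((Real.exp (c * eigVal l k * s) * a k s : ℝ) : ℂ) * C k := by
  have h1 := IsPrim.sum (degBox n (N + 1)) fun k _ =>
    ((IsPrim.exp (c * eigVal l k)).mul (hs k)).clm_comp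
      ((ContinuousLinearMap.id ℝ ℝ).smulRight (C k))
  refine h1.congr (fun s _ => ?_) ?_
  · refine Finset.sum_congr rfl fun k _ => ?_
    simp
  filter_upwards [hd] with s hds
  have e1 : ∀ k, ((ContinuousLinearMap.id ℝ ℝ).smulRight (C k))
      (c * eigVal l k * Real.exp (c * eigVal l k * s) * a k s + Real.exp (c * eigVal l k * s) *
        (-(c * eigVal l k * a k s) + triForce l b d a k s)) =
      ∑ j, ((b j s * (√(l j * k j) * (Real.exp (c * eigVal l k * s) *
        a (k - Pi.single j 1) s)) : ℝ) : ℂ) * C k := fun k => by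
    rw [← Finset.sum_mul, ← Complex.ofReal_sum, ContinuousLinearMap.smulRight_apply,
      ContinuousLinearMap.id_apply, Complex.real_smul, triForce, hds, add_zero]
    congr 2
    have e2 : ∑ j, b j s * (√(l j * k j) * (Real.exp (c * eigVal l k * s) *
        a (k - Pi.single j 1) s)) = Real.exp (c * eigVal l k * s) *
        ∑ j, b j s * (√(l j * k j) * a (k - Pi.single j 1) s) := by
      rw [Finset.mul_sum]
      exact Finset.sum_congr rfl fun j _ => by ring
    rw [e2]
    ring
  rw [Finset.sum_congr rfl fun k _ => e1 k, Finset.sum_comm, Finset.sum_mul]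
  refine Finset.sum_congr rfl fun j _ => ?_
  rw [sum_degBox_succ N j fun k hk => by simp [hk], Finset.mul_sum]
  refine Finset.sum_congr rfl fun k _ => ?_
  rw [add_tsub_cancel_right, eigVal_add_single]
  have e3 := hC k j
  have e4 : ((k + Pi.single j 1 : Fin n → ℕ) j : ℝ) = k j + 1 := by simp
  rw [e4, show c * (eigVal l k + l j) * s = c * eigVal l k * s + c * l j * s by ring, Real.exp_add]
  push_cast at e3 ⊢
  linear_combination -((b j s : ℂ) * Complex.exp (c * eigVal l k * s) *
    Complex.exp (c * l j * s) * a k s) * e3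

/-! ### Evolution of the normalised Fourier transform -/

namespace IsEigBasis

theorem fourierH_zero_ne_zero (h : IsEigBasis c Γ v l) (ξ : Euc n) :
    fourierH ξ (h.basisH 0) ≠ 0 := by
  obtain ⟨κ, hκ, hA⟩ := h.exists_fourierH_zero
  rw [hA]
  exact mul_ne_zero hκ (Complex.exp_ne_zero _)

/-- The normalised Fourier transform of `z ∈ 𝔥`. -/
def fourierRatio (h : IsEigBasis c Γ v l) (ξ : Euc n) (z : HSp c Γ) : ℂ :=
  fourierH ξ z / fourierH ξ (h.basisH 0)

theorem fourierRatio_basisH_add_single (h : IsEigBasis c Γ v l) (ξ : Euc n) (k : Fin n → ℕ)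
    (j : Fin n) : (√(l j * (k j + 1)) : ℂ) * h.fourierRatio ξ (h.basisH (k + Pi.single j 1)) =
      Complex.I * (inner ℝ (v j) ξ : ℝ) * h.fourierRatio ξ (h.basisH k) := by
  rw [fourierRatio, fourierRatio, ← mul_div_assoc, h.fourierH_basisH_add_single, mul_div_assoc]

theorem hasSum_fourierRatio (h : IsEigBasis c Γ v l) (ξ : Euc n) (z : HSp c Γ) :
    HasSum (fun k => (inner ℝ (h.basisH k) z : ℂ) * h.fourierRatio ξ (h.basisH k))
      (h.fourierRatio ξ z) := by
  refine ((h.hasSum_fourierH ξ z).div_const _).congr_fun fun k => ?_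
  rw [fourierRatio, mul_div_assoc]

/-- The ratio of `e_k` is a monomial of multidegree `k`, so dilating coordinate `j` by `e^{c l_j s}`
multiplies it by `e^{c μ_k s}`. -/
theorem fourierRatio_diagCLM (h : IsEigBasis c Γ v l) (ξ : Euc n) (s : ℝ) (k : Fin n → ℕ) :
    h.fourierRatio (diagCLM v (fun j => Real.exp (c * l j * s)) ξ) (h.basisH k) =
      Real.exp (c * eigVal l k * s) * h.fourierRatio ξ (h.basisH k) := by
  refine multiIndex_induction (P := fun k =>
    h.fourierRatio (diagCLM v (fun j => Real.exp (c * l j * s)) ξ) (h.basisH k) =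
      Real.exp (c * eigVal l k * s) * h.fourierRatio ξ (h.basisH k)) ?_ (fun k j ih => ?_) k
  · rw [fourierRatio, fourierRatio, div_self (h.fourierH_zero_ne_zero _),
      div_self (h.fourierH_zero_ne_zero _)]
    simp [eigVal]
  · have h0 : (√(l j * (k j + 1)) : ℂ) ≠ 0 := by
      have := h.pos j
      exact Complex.ofReal_ne_zero.2 (Real.sqrt_pos.2 (by positivity)).ne'
    refine mul_left_cancel₀ h0 ?_
    rw [h.fourierRatio_basisH_add_single, ih, inner_diagCLM, mul_left_comm (√(l j * (k j + 1)) : ℂ),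
      h.fourierRatio_basisH_add_single, eigVal_add_single,
      show c * (eigVal l k + l j) * s = c * eigVal l k * s + c * l j * s by ring, Real.exp_add]
    push_cast
    ring

variable {g : Euc n → Euc n} {d p : ℝ → HSp c Γ} {u : ℝ → Euc n}

/-- The method of characteristics on the Fourier side: dilating the frequency compensates the
damping, and only the drift remains, as a phase. -/
theorem fourierRatio_eq_of_isTriSol (h : IsEigBasis c Γ v l) (hg : Continuous g)
    (hu : ContinuousOn u (Ici 0)) (hp : ContinuousOn p (Ici 0))
    (hs : IsTriSol c l (drift v g u) (h.coef d) (h.coef p))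
    (hd : ∀ᵐ t ∂volume.restrict (Ioi 0), d t = 0) (ξ : Euc n) {t : ℝ} (ht : 0 ≤ t) :
    h.fourierRatio (diagCLM v (fun j => Real.exp (c * l j * t)) ξ) (p t) =
      Complex.exp ((∫ s in (0 : ℝ)..t, ∑ j, drift v g u j s * Real.exp (c * l j * s) *
        inner ℝ (v j) ξ : ℝ) * Complex.I) * h.fourierRatio ξ (p 0) := by
  have hdc : ∀ᵐ t ∂volume.restrict (Ioi 0), ∀ k, h.coef d k t = 0 := by
    filter_upwards [hd] with t ht k
    rw [coef, ht, inner_zero_right]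
  set θ : ℝ → ℝ := fun s => ∑ j, drift v g u j s * Real.exp (c * l j * s) * inner ℝ (v j) ξ
  have hθ : ContinuousOn θ (Ici 0) := continuousOn_finsetSum _ fun j _ =>
    ((continuousOn_drift v hg hu j).mul (by fun_prop)).mul continuousOn_const
  set R : ℝ → ℂ := fun s =>
    h.fourierRatio (diagCLM v (fun j => Real.exp (c * l j * s)) ξ) (p s)
  set P : ℕ → ℝ → ℂ := fun N s => ∑ k ∈ degBox n N,
    ((Real.exp (c * eigVal l k * s) * h.coef p k s : ℝ) : ℂ) * h.fourierRatio ξ (h.basisH k)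
  have hP : ∀ N s, P N s = ∑ k ∈ degBox n N, (inner ℝ (h.basisH k) (p s) : ℂ) *
      h.fourierRatio (diagCLM v (fun j => Real.exp (c * l j * s)) ξ) (h.basisH k) :=
    fun N s => Finset.sum_congr rfl fun k _ => by
      rw [h.fourierRatio_diagCLM, coef]
      push_cast
      ring
  have hPR : ∀ s, Tendsto (fun N => P N s) atTop (𝓝 (R s)) := fun s => by
    simp only [hP]
    exact (h.hasSum_fourierRatio _ _).comp tendsto_degBox
  have hb : ∀ T ≥ 0, ∃ B : ℝ, ∀ N, ∀ s ∈ Icc 0 T, ‖P N s‖ ≤ B := by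
    intro T hT
    obtain ⟨M, hM⟩ := isCompact_Icc.exists_bound_of_continuousOn
      (hp.mono (fun s hs => hs.1 : Icc 0 T ⊆ Ici (0 : ℝ)))
    set η := diagCLM v (fun j => Real.exp (c * l j * T)) ξ
    have hsum : Summable fun k => ‖h.fourierRatio η (h.basisH k)‖ ^ 2 := by
      refine ((h.summable_fourierH_sq η).mul_left (‖fourierH η (h.basisH 0)‖ ^ 2)⁻¹).congr
        fun k => ?_
      rw [fourierRatio, norm_div, div_pow, div_eq_inv_mul]
    -- For `s ≤ T` the factor `e^{c μ_k s}` is at most `e^{c μ_k T}`, which is absorbed by the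
    -- dilated frequency `η`. The products are then bounded by sums of squares, uniformly in `N`.
    refine ⟨(∑' k, ‖h.fourierRatio η (h.basisH k)‖ ^ 2) + M ^ 2, fun N s hs => ?_⟩
    have e1 : ∀ k, ‖((Real.exp (c * eigVal l k * s) * h.coef p k s : ℝ) : ℂ) *
        h.fourierRatio ξ (h.basisH k)‖ ≤ ‖h.fourierRatio η (h.basisH k)‖ ^ 2 +
          h.coef p k s ^ 2 := fun k => by
      have h1 : ‖h.fourierRatio η (h.basisH k)‖ =
          Real.exp (c * eigVal l k * T) * ‖h.fourierRatio ξ (h.basisH k)‖ := by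
        rw [h.fourierRatio_diagCLM, norm_mul, Complex.norm_real,
          Real.norm_of_nonneg (Real.exp_pos _).le]
      have h2 : Real.exp (c * eigVal l k * s) ≤ Real.exp (c * eigVal l k * T) :=
        Real.exp_le_exp.2 (mul_le_mul_of_nonneg_left hs.2
          (mul_nonneg h.cpos.le (h.eigVal_nonneg k)))
      rw [norm_mul, Complex.norm_real, norm_mul, Real.norm_of_nonneg (Real.exp_pos _).le,
        Real.norm_eq_abs]
      have h3 : Real.exp (c * eigVal l k * s) * |h.coef p k s| *
          ‖h.fourierRatio ξ (h.basisH k)‖ ≤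
          ‖h.fourierRatio η (h.basisH k)‖ * |h.coef p k s| := by
        rw [h1, mul_right_comm]
        gcongr
      nlinarith [sq_abs (h.coef p k s), sq_nonneg (‖h.fourierRatio η (h.basisH k)‖ -
        |h.coef p k s|), sq_nonneg (‖h.fourierRatio η (h.basisH k)‖), sq_nonneg (h.coef p k s)]
    refine (norm_sum_le _ _).trans ((Finset.sum_le_sum fun k _ => e1 k).trans ?_)
    rw [Finset.sum_add_distrib]
    refine add_le_add (hsum.sum_le_tsum _ fun _ _ => sq_nonneg _)
      ((h.sum_coef_sq_le p s _).trans ?_)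
    exact pow_le_pow_left₀ (norm_nonneg _) (hM s hs) 2
  have hR : IsPrim R fun s => (θ s : ℂ) * Complex.I * R s := by
    have e2 : ∀ s, (∑ j, ((drift v g u j s * Real.exp (c * l j * s) : ℝ) : ℂ) *
        (Complex.I * (inner ℝ (v j) ξ : ℝ))) = (θ s : ℂ) * Complex.I := fun s => by
      simp only [θ]
      push_cast
      rw [Finset.sum_mul]
      exact Finset.sum_congr rfl fun j _ => by ring
    have h1 := fun N => hs.isPrim_sum_smul hdc (C := fun k => h.fourierRatio ξ (h.basisH k))
      (ζ := fun j => Complex.I * (inner ℝ (v j) ξ : ℝ)) (h.fourierRatio_basisH_add_single ξ) N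
    simp only [e2] at h1
    refine IsPrim.of_tendsto h1 (fun s _ => (tendsto_add_atTop_iff_nat 1).2 (hPR s))
      (fun s _ => (hPR s).const_mul _) fun T hT => ?_
    obtain ⟨B, hB⟩ := hb T hT
    obtain ⟨K, hK⟩ := isCompact_Icc.exists_bound_of_continuousOn
      (hθ.mono (fun s hs => hs.1 : Icc 0 T ⊆ Ici (0 : ℝ)))
    refine ⟨K * B, fun N s hs => ?_⟩
    rw [norm_mul, norm_mul, Complex.norm_I, mul_one, Complex.norm_real]
    exact mul_le_mul (hK s hs) (hB N s hs) (norm_nonneg _)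
      ((norm_nonneg _).trans (hK s hs))
  have h5 := hR.eq_cexp_mul hθ ht
  have h6 : R 0 = h.fourierRatio ξ (p 0) := by
    have : diagCLM v (fun j => Real.exp (c * l j * 0)) ξ = ξ :=
      v.ext_inner fun j => by rw [inner_diagCLM]; simp
    simp only [R, this]
  rw [h6] at h5
  exact h5

theorem _root_.inner_diagCLM_left (v : OrthonormalBasis (Fin n) ℝ (Euc n)) (m : Fin n → ℝ)
    (x y : Euc n) : inner ℝ (diagCLM v m x) y = inner ℝ x (diagCLM v m y) := by
  rw [← v.sum_inner_mul_inner (diagCLM v m x) y, ← v.sum_inner_mul_inner x]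
  refine Finset.sum_congr rfl fun j _ => ?_
  rw [real_inner_comm, inner_diagCLM, inner_diagCLM, real_inner_comm x]
  ring

theorem _root_.charFun_map_diagCLM (μ : Measure (Euc n)) (v : OrthonormalBasis (Fin n) ℝ (Euc n))
    (m : Fin n → ℝ) (ξ : Euc n) :
    charFun (μ.map (diagCLM v m)) ξ = charFun μ (diagCLM v m ξ) := by
  rw [charFun_apply, charFun_apply, integral_map (by fun_prop) (by fun_prop)]
  simp only [inner_diagCLM_left]

theorem _root_.norm_sq_diagCLM (v : OrthonormalBasis (Fin n) ℝ (Euc n)) (m : Fin n → ℝ)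
    (x : Euc n) : ‖diagCLM v m x‖ ^ 2 = ∑ j, m j ^ 2 * inner ℝ (v j) x ^ 2 := by
  rw [← v.sum_sq_norm_inner_right]
  refine Finset.sum_congr rfl fun j _ => ?_
  rw [inner_diagCLM, Real.norm_eq_abs, sq_abs, mul_pow]

/-- Without disturbances, the dynamics preserve nonnegativity. -/
theorem ae_nonneg_of_isTriSol (h : IsEigBasis c Γ v l) (hg : Continuous g)
    (hu : ContinuousOn u (Ici 0)) (hp : ContinuousOn p (Ici 0))
    (hs : IsTriSol c l (drift v g u) (h.coef d) (h.coef p))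
    (hd : ∀ᵐ t ∂volume.restrict (Ioi 0), d t = 0) (h0 : ∀ᵐ x : Euc n, 0 ≤ p 0 x) {t : ℝ}
    (ht : 0 ≤ t) : ∀ᵐ x : Euc n, 0 ≤ p t x := by
  set μ₀ : Measure (Euc n) := volume.withDensity fun x => ENNReal.ofReal (p 0 x)
  have f0 : IsFiniteMeasure μ₀ := isFiniteMeasure_withDensity_ofReal (h.integrable_coe _).2
  have hμ₀ : ∀ ξ, charFun μ₀ ξ = fourierH ξ (p 0) := fun ξ => by
    rw [charFun_apply, integral_withDensity_eq_integral_toReal_smul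
      (Lp.stronglyMeasurable (p 0)).measurable.ennreal_ofReal
      (Eventually.of_forall fun _ => ENNReal.ofReal_lt_top), fourierH]
    refine integral_congr_ae ?_
    filter_upwards [h0] with x hx
    rw [ENNReal.toReal_ofReal hx, Complex.real_smul]
  set ε : Fin n → ℝ := fun j => Real.exp (-(c * l j * t))
  set σ : Fin n → ℝ := fun j => √((1 - ε j ^ 2) / l j)
  set m : Euc n := ∑ j, (∫ s in (0 : ℝ)..t, drift v g u j s * Real.exp (c * l j * s) * ε j) • v j
  have hσ : ∀ j, σ j ^ 2 = (1 - ε j ^ 2) / l j := fun j => by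
    refine Real.sq_sqrt (div_nonneg ?_ (h.pos j).le)
    have h1 : ε j ≤ 1 := Real.exp_le_one_iff.2 (neg_nonpos.2
      (mul_nonneg (mul_nonneg h.cpos.le (h.pos j).le) ht))
    have h2 : 0 < ε j := Real.exp_pos _
    nlinarith
  -- Mehler's formula: the initial measure is contracted by `ε_j = e^{-c l_j t}`, translated by the
  -- accumulated drift, and convolved with a Gaussian of variances `(1 - ε_j²) / l_j`.
  set μ : Measure (Euc n) := ((μ₀.map (diagCLM v ε)).map (· + m)) ∗
    ((ProbabilityTheory.stdGaussian (Euc n)).map (diagCLM v σ))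
  have f1 : IsFiniteMeasure ((μ₀.map (diagCLM v ε)).map (· + m)) := inferInstance
  have f2 : IsFiniteMeasure ((ProbabilityTheory.stdGaussian (Euc n)).map (diagCLM v σ)) :=
    inferInstance
  have f3 : IsFiniteMeasure μ := inferInstance
  refine ae_nonneg_of_charFun (Lp.stronglyMeasurable (p t)) (h.integrable_coe _) μ fun ξ => ?_
  have e1 : charFun μ ξ = charFun μ₀ (diagCLM v ε ξ) * Complex.exp (inner ℝ m ξ * Complex.I) *
      Complex.exp ((-(∑ j, σ j ^ 2 * inner ℝ (v j) ξ ^ 2) / 2 : ℝ)) := by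
    rw [charFun_conv, charFun_map_add_const, charFun_map_diagCLM, charFun_map_diagCLM,
      ProbabilityTheory.charFun_stdGaussian, ← norm_sq_diagCLM]
    push_cast
    rfl
  have e2 := h.fourierRatio_eq_of_isTriSol hg hu hp hs hd (diagCLM v ε ξ) ht
  have e3 : diagCLM v (fun j => Real.exp (c * l j * t)) (diagCLM v ε ξ) = ξ :=
    v.ext_inner fun j => by
      rw [inner_diagCLM, inner_diagCLM, ← mul_assoc, ← Real.exp_add]
      simp
  have e4 : (∫ s in (0 : ℝ)..t, ∑ j, drift v g u j s * Real.exp (c * l j * s) *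
      inner ℝ (v j) (diagCLM v ε ξ)) = inner ℝ m ξ := by
    rw [intervalIntegral.integral_finsetSum, sum_inner]
    · refine Finset.sum_congr rfl fun j _ => ?_
      rw [real_inner_smul_left, ← intervalIntegral.integral_mul_const]
      simp only [inner_diagCLM, mul_assoc]
    · intro j _
      refine ContinuousOn.intervalIntegrable ?_
      rw [uIcc_of_le ht]
      exact (((continuousOn_drift v hg hu j).mul (by fun_prop)).mul continuousOn_const).mono
        fun s hs => hs.1
  rw [e3, e4] at e2
  obtain ⟨κ, hκ, hA⟩ := h.exists_fourierH_zero
  rw [fourierRatio, fourierRatio, div_eq_iff (h.fourierH_zero_ne_zero _)] at e2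
  change fourierH ξ (p t) = charFun μ ξ
  rw [e1, hμ₀, e2, hA, hA]
  -- The stationary variance splits as `1 / l_j = ε_j² / l_j + σ_j²`.
  have e5 : Complex.exp ((-(1 / 2) * ∑ j, inner ℝ (v j) ξ ^ 2 / l j : ℝ)) =
      Complex.exp ((-(1 / 2) * ∑ j, inner ℝ (v j) (diagCLM v ε ξ) ^ 2 / l j : ℝ)) *
      Complex.exp ((-(∑ j, σ j ^ 2 * inner ℝ (v j) ξ ^ 2) / 2 : ℝ)) := by
    rw [← Complex.exp_add, ← Complex.ofReal_add]
    congr 2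
    rw [neg_div, ← sub_eq_add_neg, Finset.mul_sum, Finset.mul_sum, Finset.sum_div,
      ← Finset.sum_sub_distrib]
    refine Finset.sum_congr rfl fun j _ => ?_
    rw [hσ, inner_diagCLM]
    ring
  rw [e5]
  have e6 := Complex.exp_ne_zero ((-(1 / 2) * ∑ j, inner ℝ (v j) (diagCLM v ε ξ) ^ 2 / l j : ℝ))
  field_simp

end IsEigBasis

end

/-! ### The closed loop -/

theorem continuousOn_Ici_of_forall_Icc {E : Type*} [TopologicalSpace E] {f : ℝ → E}
    (h : ∀ t₁ > 0, ContinuousOn f (Icc 0 t₁)) : ContinuousOn f (Ici 0) := by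
  intro t ht
  have ht : 0 ≤ t := ht
  refine (h (t + 1) (by linarith) t ⟨ht, by linarith⟩).mono_of_mem_nhdsWithin ?_
  rw [← Ici_inter_Iic]
  exact inter_mem self_mem_nhdsWithin (mem_nhdsWithin_of_mem_nhds (Iic_mem_nhds (by linarith)))

theorem intervalIntegrable_of_memLp_top {E : Type*} [NormedAddCommGroup E] {f : ℝ → E}
    (hf : MemLp f (⊤ : ℝ≥0∞) (volume.restrict (Ioi 0))) (T : ℝ) (hT : 0 ≤ T) :
    IntervalIntegrable f volume 0 T := by
  rw [intervalIntegrable_iff_integrableOn_Ioc_of_le hT]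
  exact (hf.mono_measure (Measure.restrict_mono Ioc_subset_Ioi_self le_rfl)).integrable le_top

theorem IsPrim.memW1_top {E ι : Type*} [NormedAddCommGroup E] [NormedSpace ℝ E] [CompleteSpace E]
    {F f : ℝ → E} (h : IsPrim F f) (L : ι → E →L[ℝ] ℝ)
    (hL : ∀ x y, (∀ i, L i x = L i y) → x = y) {M M' : ℝ}
    (hF : ∀ᵐ t ∂volume.restrict (Ioi 0), ‖F t‖ ≤ M)
    (hf : ∀ᵐ t ∂volume.restrict (Ioi 0), ‖f t‖ ≤ M') : MemW1 (⊤ : ℝ≥0∞) (Ioi 0) F := by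
  have h1 : LocallyIntegrableOn F (Ioi 0) :=
    (h.continuousOn.mono Ioi_subset_Ici_self).locallyIntegrableOn measurableSet_Ioi
  have h2 : LocallyIntegrableOn f (Ioi 0) := locallyIntegrableOn_Ioi fun T hT =>
    ((intervalIntegrable_iff_integrableOn_Ioc_of_le hT.le).1
      (h.intervalIntegrable T hT.le)).mono_set
      Ioo_subset_Ioc_self
  exact ⟨f, memLp_top_of_bound h1.aestronglyMeasurable M hF,
    memLp_top_of_bound h2.aestronglyMeasurable M' hf,
    hasWeakDerivOn_of_isPrim Subset.rfl h1 h2 L hL fun i => h.clm_comp (L i)⟩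

variable {n : ℕ} {c : ℝ} {Γ : Matrix (Fin n) (Fin n) ℝ}
  {v : OrthonormalBasis (Fin n) ℝ (Euc n)} {l : Fin n → ℝ} {g : Euc n → Euc n} {p₀ : HSp c Γ}
  {d : ℝ → HSp c Γ} {φ α N : ℝ → ℝ} {yref : ℝ → Euc n} {p : ℝ → HSp c Γ} {u y : ℝ → Euc n}

namespace IsClosedLoop

theorem continuousOn_input (hcl : IsClosedLoop c Γ g p₀ d φ α N yref p u y) :
    ContinuousOn u (Ici 0) := continuousOn_Ici_of_forall_Icc fun t₁ h1 => (hcl t₁ h1).cont_u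

theorem continuousOn_output (hcl : IsClosedLoop c Γ g p₀ d φ α N yref p u y) :
    ContinuousOn y (Ici 0) := continuousOn_Ici_of_forall_Icc fun t₁ h1 => (hcl t₁ h1).cont_y

theorem output_eq (hcl : IsClosedLoop c Γ g p₀ d φ α N yref p u y) {t : ℝ} (ht : 0 ≤ t) :
    y t = meanVal c Γ (p t) := (hcl (t + 1) (by linarith)).output t ⟨ht, by linarith⟩

theorem feedback_eq (hcl : IsClosedLoop c Γ g p₀ d φ α N yref p u y) {t : ℝ} (ht : 0 ≤ t) :
    u t = (N ∘ α) (‖scaledErr φ yref y t‖ ^ 2) • scaledErr φ yref y t :=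
  (hcl (t + 1) (by linarith)).feedback t ⟨ht, by linarith⟩

theorem scaledErr_sq_lt (hcl : IsClosedLoop c Γ g p₀ d φ α N yref p u y) {t : ℝ} (ht : 0 ≤ t) :
    ‖scaledErr φ yref y t‖ ^ 2 < 1 :=
  ((hcl (t + 1) (by linarith)).dom t ⟨ht, by linarith⟩).2

/-- The output of a closed-loop solution solves an autonomous equation. -/
theorem isPrim_output (h : IsEigBasis c Γ v l)
    (hcl : IsClosedLoop c Γ g p₀ d φ α N yref p u y)
    (hs : IsTriSol c l (drift v g u) (h.coef d) (h.coef p)) (hp0 : p 0 = p₀)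
    (hd0 : ∀ᵐ t ∂volume.restrict (Ioi 0), mass c Γ (d t) = 0) :
    IsPrim y (meanRhs (diagCLM v fun j => c * l j) (mass c Γ p₀) (gainMap g (N ∘ α))
      (fun t => h.meanCLM (d t)) φ yref y) := by
  refine (h.isPrim_meanVal hs hd0).congr (fun t ht => hcl.output_eq ht) ?_
  refine ae_restrict_of_forall_mem measurableSet_Ioi fun t ht => ?_
  have ht : 0 ≤ t := le_of_lt ht
  rw [meanRhs, gainMap, ← hcl.feedback_eq ht, hcl.output_eq ht, hp0]

/-- The output of a closed-loop solution is determined by the data. -/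
theorem eqOn_output (hg : ContDiff ℝ 1 g) (hdes : IsFunnelDesign φ α N)
    (hyc : ContinuousOn yref (Ici 0)) {L : Euc n →L[ℝ] Euc n} {P₀ : ℝ} {D : ℝ → Euc n}
    {y y' : ℝ → Euc n} (hy : IsPrim y (meanRhs L P₀ (gainMap g (N ∘ α)) D φ yref y))
    (hy' : IsPrim y' (meanRhs L P₀ (gainMap g (N ∘ α)) D φ yref y')) (h0 : y 0 = y' 0)
    (hw : ∀ t ≥ 0, ‖scaledErr φ yref y t‖ ^ 2 < 1)
    (hw' : ∀ t ≥ 0, ‖scaledErr φ yref y' t‖ ^ 2 < 1) : EqOn y y' (Ici 0) := by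
  intro T hT
  have hT : 0 ≤ T := hT
  have hφ : ContinuousOn φ (Ici 0) := hdes.funnel.smooth.continuousOn
  have hmax : ∀ {y : ℝ → Euc n}, ContinuousOn y (Ici 0) →
      (∀ t ≥ 0, ‖scaledErr φ yref y t‖ ^ 2 < 1) → ∃ r < 1, ∀ t ∈ Icc 0 T,
        ‖scaledErr φ yref y t‖ ^ 2 ≤ r := fun {y} hyc' hwy => by
    have hc : ContinuousOn (fun t => ‖scaledErr φ yref y t‖ ^ 2) (Icc 0 T) :=
      ((continuousOn_scaledErr hφ hyc hyc').mono fun s hs => hs.1).norm.pow 2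
    obtain ⟨s, hs, hmax⟩ := isCompact_Icc.exists_isMaxOn (nonempty_Icc.2 hT) hc
    exact ⟨_, hwy s hs.1, fun t ht => hmax ht⟩
  obtain ⟨r, hr, hyr⟩ := hmax hy.continuousOn hw
  obtain ⟨r', hr', hyr'⟩ := hmax hy'.continuousOn hw'
  obtain ⟨K, hK⟩ := exists_lipschitzOnWith_gainMap hg hdes.contDiffOn (max_lt hr hr')
  have hball : ∀ {x : Euc n}, ‖x‖ ^ 2 ≤ max r r' → x ∈ Metric.closedBall 0 √(max r r') :=
    fun hx => by
      rw [mem_closedBall_zero_iff]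
      exact Real.le_sqrt_of_sq_le hx
  exact eqOn_of_isPrim_meanRhs hK hφ (fun _ _ => rfl) hy hy' h0
    (fun t ht => hball ((hyr t ht).trans (le_max_left _ _)))
    (fun t ht => hball ((hyr' t ht).trans (le_max_right _ _))) (right_mem_Icc.2 hT)

end IsClosedLoop

/-- Existence of a closed-loop solution which stays uniformly away from the funnel boundary. -/
theorem exists_isClosedLoop (h : IsEigBasis c Γ v l) (hn : 0 < n) (hg : ContDiff ℝ 1 g)
    (hg' : IsHighGain g) (hd : MemLp d (⊤ : ℝ≥0∞) (volume.restrict (Ioi 0)))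
    (hd0 : ∀ᵐ t ∂volume.restrict (Ioi 0), mass c Γ (d t) = 0)
    (hyc : ContinuousOn yref (Ici 0)) (hy : MemW1 (⊤ : ℝ≥0∞) (Ioi 0) yref)
    (hdes : IsFunnelDesign φ α N) (hP₀ : mass c Γ p₀ ≠ 0)
    (hE₀ : φ 0 * ‖meanVal c Γ p₀ - yref 0‖ < 1) :
    ∃ (p : ℝ → HSp c Γ) (u y : ℝ → Euc n), IsClosedLoop c Γ g p₀ d φ α N yref p u y ∧
      ContinuousOn p (Ici 0) ∧ IsTriSol c l (drift v g u) (h.coef d) (h.coef p) ∧ p 0 = p₀ ∧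
      ∃ ρ ∈ Ioo (0 : ℝ) 1, ∀ t ≥ 0, ‖scaledErr φ yref y t‖ ^ 2 ≤ ρ := by
  obtain ⟨r, hyL, hrL, hweak⟩ := hy
  obtain ⟨My, -, hMy⟩ := ae_norm_le_of_memLp_top hyL
  obtain ⟨Mr, -, hMr⟩ := ae_norm_le_of_memLp_top hrL
  have hD : MemLp (fun t => h.meanCLM (d t)) (⊤ : ℝ≥0∞) (volume.restrict (Ioi 0)) :=
    h.meanCLM.comp_memLp' hd
  obtain ⟨MD, -, hMD⟩ := ae_norm_le_of_memLp_top hD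
  have hr : IsPrim yref r :=
    isPrim_of_hasWeakDerivOn hyc (intervalIntegrable_of_memLp_top hrL) hweak
  have hφ : ContinuousOn φ (Ici 0) := hdes.funnel.smooth.continuousOn
  have h0 : ‖φ 0 • (meanVal c Γ p₀ - yref 0)‖ < 1 := by
    rwa [norm_smul, Real.norm_of_nonneg (hdes.funnel.nonneg le_rfl)]
  obtain ⟨y, hy0, hyP, ρ, hρ, hw⟩ := exists_funnel_solution (L := diagCLM v fun j => c * l j)
    hn hg hg' hdes hP₀ (intervalIntegrable_of_memLp_top hD) hMD hr hMr hMy h0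
  set u : ℝ → Euc n := fun t =>
    (N ∘ α) (‖scaledErr φ yref y t‖ ^ 2) • scaledErr φ yref y t
  have hwc : ContinuousOn (scaledErr φ yref y) (Ici 0) :=
    continuousOn_scaledErr hφ hyc hyP.continuousOn
  have hdom : ∀ t ≥ 0, ‖scaledErr φ yref y t‖ ^ 2 ∈ Ico (0 : ℝ) 1 := fun t ht =>
    ⟨sq_nonneg _, (hw t ht).trans_lt hρ.2⟩
  have hu : ContinuousOn u (Ici 0) :=
    (hdes.contDiffOn.continuousOn.comp (hwc.norm.pow 2) hdom).smul hwc
  obtain ⟨p, hp, hs, hp0⟩ := h.exists_isTriSol_coef hg.continuous hd hu p₀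
  -- The input `u` was built from `y`, not from `p`. With `u` fixed, `y` and the mean of `p` solve
  -- the same linear equation, so the loop closes.
  have hmean : ∀ t ≥ 0, y t = meanVal c Γ (p t) := fun t ht => by
    refine IsPrim.eqOn_of_norm_sub_le (norm_nonneg (diagCLM v fun j => c * l j)) hyP
      (h.isPrim_meanVal hs hd0) (by rw [hy0, hp0]) (fun s hs => ?_) (right_mem_Icc.2 ht)
    rw [meanRhs, hp0, add_sub_add_right_eq_sub, gainMap, add_sub_add_right_eq_sub, neg_sub_neg,
      ← map_sub, norm_sub_rev]
    exact ContinuousLinearMap.le_opNorm _ _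
  refine ⟨p, u, y, fun t₁ ht₁ => ?_, hp, hs, hp0, ρ, hρ, hw⟩
  have hsub : Icc 0 t₁ ⊆ Ici (0 : ℝ) := fun s hs => hs.1
  exact ⟨hu.mono hsub, hyP.continuousOn.mono hsub, fun t ht => hmean t ht.1,
    fun t ht => hdom t ht.1, fun t _ => rfl,
    hp0 ▸ h.isMildSolutionOn_of_isTriSol hg.continuous hd hu hp hs t₁⟩

theorem exists_bound_input (hdes : IsFunnelDesign φ α N) {ρ : ℝ} (hρ : ρ ∈ Ioo (0 : ℝ) 1)
    (hw : ∀ t ≥ 0, ‖scaledErr φ yref y t‖ ^ 2 ≤ ρ)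
    (hu : ∀ t ≥ 0, u t = (N ∘ α) (‖scaledErr φ yref y t‖ ^ 2) • scaledErr φ yref y t) :
    ∃ M : ℝ, ∀ t ≥ 0, ‖u t‖ ≤ M := by
  obtain ⟨K, hK⟩ := (isCompact_Icc (a := (0 : ℝ)) (b := ρ)).exists_bound_of_continuousOn
    (hdes.contDiffOn.continuousOn.mono fun s hs => ⟨hs.1, hs.2.trans_lt hρ.2⟩)
  refine ⟨K * 1, fun t ht => ?_⟩
  have h1 := hK _ ⟨sq_nonneg _, hw t ht⟩
  rw [hu t ht, norm_smul]
  refine mul_le_mul h1 ?_ (norm_nonneg _) ((norm_nonneg _).trans h1)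
  rw [← sq_le_one_iff₀ (norm_nonneg _)]
  exact (hw t ht).trans hρ.2.le

/-- Near time zero the funnel may give no information, so compactness of `[0, 1]` is used there;
afterwards the error is at most `1 / m`. -/
theorem exists_ae_bound_output (hφ : IsFunnelFun φ)
    (hyref : MemLp yref (⊤ : ℝ≥0∞) (volume.restrict (Ioi 0))) (hy : ContinuousOn y (Ici 0))
    (hw : ∀ t ≥ 0, ‖scaledErr φ yref y t‖ ≤ 1) :
    ∃ M : ℝ, ∀ᵐ t ∂volume.restrict (Ioi 0), ‖y t‖ ≤ M := by
  obtain ⟨My, hMy0, hMy⟩ := ae_norm_le_of_memLp_top hyref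
  obtain ⟨m, hm, hmφ⟩ := hφ.exists_le one_pos
  obtain ⟨B, hB⟩ := (isCompact_Icc (a := (0 : ℝ)) (b := 1)).exists_bound_of_continuousOn
    (hy.mono fun s hs => hs.1)
  refine ⟨max B (1 / m + My), ?_⟩
  filter_upwards [hMy, ae_restrict_mem measurableSet_Ioi] with t ht ht0
  have ht0 : 0 < t := ht0
  rcases le_total t 1 with h1 | h1
  · exact (hB t ⟨ht0.le, h1⟩).trans (le_max_left _ _)
  · refine le_trans ?_ (le_max_right _ _)
    have h2 := hw t ht0.le
    rw [scaledErr, norm_smul, Real.norm_of_nonneg (hφ.nonneg ht0.le)] at h2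
    have h3 : ‖y t - yref t‖ ≤ 1 / m := by
      rw [le_div_iff₀ hm, mul_comm]
      exact (mul_le_mul_of_nonneg_right (hmφ t h1) (norm_nonneg _)).trans h2
    calc ‖y t‖ = ‖(y t - yref t) + yref t‖ := by rw [sub_add_cancel]
      _ ≤ 1 / m + My := (norm_add_le _ _).trans (add_le_add h3 ht)

theorem exists_bound_comp_input (hg : Continuous g) {M : ℝ} (hM : ∀ t ≥ 0, ‖u t‖ ≤ M) :
    ∃ β : ℝ, ∀ t ≥ 0, ‖g (u t)‖ ≤ β := by
  obtain ⟨β, hβ⟩ := (isCompact_closedBall (0 : Euc n) M).exists_bound_of_continuousOn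
    hg.continuousOn
  exact ⟨β, fun t ht => hβ _ (mem_closedBall_zero_iff.2 (hM t ht))⟩

theorem theorem5p1 (n : ℕ) (hn : 0 < n) (c : ℝ) (hc : 0 < c)
    (Γ : Matrix (Fin n) (Fin n) ℝ) (hΓ : Γ.PosDef)
    (g : Euc n → Euc n) (hg : ContDiff ℝ 1 g) (hg' : IsHighGain g)
    (p₀ : HSp c Γ) (d : ℝ → HSp c Γ)
    (hd : MemLp d ∞ (volume.restrict (Ioi 0)))
    (hd0 : ∀ᵐ t ∂volume.restrict (Ioi 0), mass c Γ (d t) = 0)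
    (yref : ℝ → Euc n) (hyc : ContinuousOn yref (Ici 0)) (hy : MemW1 ∞ (Ioi 0) yref)
    (φ α N : ℝ → ℝ) (hdes : IsFunnelDesign φ α N)
    (hP₀ : mass c Γ p₀ ≠ 0)
    (hE₀ : φ 0 * ‖meanVal c Γ p₀ - yref 0‖ < 1) :
    ∃ (p : ℝ → HSp c Γ) (u y : ℝ → Euc n),
      -- existence and uniqueness of the global mild solution
      IsClosedLoop c Γ g p₀ d φ α N yref p u y ∧
      (∀ (p' : ℝ → HSp c Γ) (u' y' : ℝ → Euc n),
        IsClosedLoop c Γ g p₀ d φ α N yref p' u' y' →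
          EqOn p' p (Ici 0) ∧ EqOn u' u (Ici 0) ∧ EqOn y' y (Ici 0)) ∧
      -- regularity and boundedness
      (∀ q : ℝ≥0∞, 1 ≤ q → q < 2 → ∀ t₁ > 0, IsRegularOn c Γ q t₁ p) ∧
      MemLp p ∞ (volume.restrict (Ioi 0)) ∧
      (ContinuousOn u (Ici 0) ∧ ∃ M : ℝ, ∀ t ≥ 0, ‖u t‖ ≤ M) ∧
      (ContinuousOn y (Ici 0) ∧ MemW1 ∞ (Ioi 0) y) ∧
      -- the error evolves uniformly within the funnel
      (∃ ε ∈ Ioo (0 : ℝ) 1, ∀ t ≥ 0, φ t * ‖y t - yref t‖ ≤ ε) ∧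
      -- weak formulation, and higher regularity for smoother initial data
      IsWeakSolution c Γ g d p u ∧
      ((∃ v : VSp c Γ, VSp.val c Γ v = p₀) →
        ∀ q : ℝ≥0∞, 1 ≤ q → q ≠ ⊤ → ∀ t₁ > 0, IsRegularOn c Γ q t₁ p) ∧
      -- the undisturbed case
      ((∀ᵐ t ∂volume.restrict (Ioi 0), d t = 0) →
        (∀ t ≥ 0, mass c Γ (p t) = mass c Γ p₀) ∧
        ((∀ᵐ x : Euc n, 0 ≤ p₀ x) → ∀ t ≥ 0, ∀ᵐ x : Euc n, 0 ≤ p t x) ∧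
        (mass c Γ p₀ = 1 →
          (∀ (v : OrthonormalBasis (Fin n) ℝ (Euc n)) (l : Fin n → ℝ),
            (∀ k, Γ *ᵥ (v k).ofLp = (c * l k) • (v k).ofLp) →
            ∃ K : Matrix (Fin n) (Fin n) ℝ, ∀ t ≥ 0,
              let V : Matrix (Fin n) (Fin n) ℝ := Matrix.of fun i k => v k i
              let R : Matrix (Fin n) (Fin n) ℝ := Matrix.diagonal fun k => √(l k / 2)
              let D : Matrix (Fin n) (Fin n) ℝ :=
                Matrix.diagonal fun k => Real.exp (-(c * l k * t))
              covMat c Γ (p t) =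
                (1 / 4 : ℝ) • (V * R⁻¹ * (D * K * D + (2 : ℝ) • 1) * R⁻¹ * Vᵀ)) ∧
          Tendsto (fun t => covMat c Γ (p t)) atTop (𝓝 (c • Γ⁻¹)))) := by
  obtain ⟨v, l, h⟩ := exists_isEigBasis hc hΓ
  have hgc := hg.continuous
  obtain ⟨p, u, y, hcl, hp, hs, hp0, ρ, hρ, hw⟩ :=
    exists_isClosedLoop h hn hg hg' hd hd0 hyc hy hdes hP₀ hE₀
  have hu := hcl.continuousOn_input
  have hyP := hcl.isPrim_output h hs hp0 hd0
  have hφ0 : ∀ t ≥ 0, 0 ≤ φ t := fun t ht => hdes.funnel.nonneg ht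
  obtain ⟨M, hM⟩ := exists_bound_input hdes hρ hw fun t ht => hcl.feedback_eq ht
  obtain ⟨β, hβ⟩ := exists_bound_comp_input hgc hM
  have hw1 : ∀ t ≥ 0, ‖scaledErr φ yref y t‖ ≤ 1 := fun t ht =>
    (sq_le_one_iff₀ (norm_nonneg _)).1 (hcl.scaledErr_sq_lt ht).le
  refine ⟨p, u, y, hcl, fun p' u' y' hcl' => ?_,
    fun q _ hq t₁ ht₁ => h.isRegularOn hgc hp hu hd hs hq.le ht₁,
    h.memLp_top_path hp hd (h.ae_coef_zero hd0) hs (β := β) fun j t ht => ?_,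
    ⟨hu, M, hM⟩, ⟨hcl.continuousOn_output, ?_⟩, ⟨√ρ, ⟨Real.sqrt_pos.2 hρ.1, ?_⟩, fun t ht => ?_⟩,
    h.isWeakSolution hgc hp hu hd hs, fun ⟨w₀, hw₀⟩ q _ _ t₁ ht₁ =>
      h.isRegularOn_of_mem_VSp hgc hp hu hd hs (hw₀.trans hp0.symm) q ht₁,
    fun hdz => ⟨fun t ht => (h.mass_eq_of_isTriSol hs hd0 ht).trans (by rw [hp0]),
      fun hpos t ht => h.ae_nonneg_of_isTriSol hgc hu hp hs hdz (by rwa [hp0]) ht,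
      fun hP1 => ⟨fun v' l' hv' => ?_, h.tendsto_covMat hs hdz (by rwa [hp0])⟩⟩⟩
  -- Uniqueness follows the order of construction: the output solves the autonomous mean equation,
  -- the output determines the input, and the input determines the density.
  · have hu' := hcl'.continuousOn_input
    obtain ⟨hp', hs', hp0'⟩ := h.isTriSol_of_isMildSolutionOn hgc hd hu'
      fun t₁ ht₁ => (hcl' t₁ ht₁).mild
    have hyy : EqOn y' y (Ici 0) := IsClosedLoop.eqOn_output hg hdes hyc
      (hcl'.isPrim_output h hs' hp0' hd0) hyP
      (by rw [hcl'.output_eq le_rfl, hcl.output_eq le_rfl, hp0', hp0])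
      (fun t ht => hcl'.scaledErr_sq_lt ht) fun t ht => hcl.scaledErr_sq_lt ht
    have huu : EqOn u' u (Ici 0) := fun t ht => by
      rw [hcl'.feedback_eq ht, hcl.feedback_eq ht, scaledErr, scaledErr, hyy ht]
    exact ⟨fun t ht => h.eqOn_of_isTriSol_coef (huu.mono fun s hs => hs.1) hs hs'
      (hp0'.trans hp0.symm) (right_mem_Icc.2 ht), huu, hyy⟩
  · refine (abs_real_inner_le_norm _ _).trans ?_
    rw [v.orthonormal.1, one_mul]
    exact hβ t ht
  · have hD : MemLp (fun t => h.meanCLM (d t)) (⊤ : ℝ≥0∞) (volume.restrict (Ioi 0)) :=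
      h.meanCLM.comp_memLp' hd
    obtain ⟨MD, -, hMD⟩ := ae_norm_le_of_memLp_top hD
    obtain ⟨r, hyL, -, -⟩ := hy
    obtain ⟨B, hB⟩ := exists_ae_bound_output hdes.funnel hyL hcl.continuousOn_output hw1
    refine hyP.memW1_top (fun j => innerSL ℝ (v j)) (fun x y hxy => v.ext_inner hxy) hB
      (M' := ‖diagCLM v fun j => c * l j‖ * B + |mass c Γ p₀| * β + MD) ?_
    filter_upwards [hB, hMD, ae_restrict_mem measurableSet_Ioi] with t hBt hMDt ht
    have ht : 0 ≤ t := le_of_lt ht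
    rw [meanRhs, gainMap, ← hcl.feedback_eq ht]
    refine (norm_add_le _ _).trans (add_le_add ((norm_add_le _ _).trans (add_le_add ?_ ?_)) hMDt)
    · rw [norm_neg]
      exact ContinuousLinearMap.le_opNorm_of_le _ hBt
    · rw [norm_smul, Real.norm_eq_abs]
      exact mul_le_mul_of_nonneg_left (hβ t ht) (abs_nonneg _)
  · exact (Real.sqrt_lt' one_pos).2 (by rw [one_pow]; exact hρ.2)
  · have := Real.le_sqrt_of_sq_le (hw t ht)
    rwa [scaledErr, norm_smul, Real.norm_of_nonneg (hφ0 t ht)] at this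
  -- The solution was built in one eigenbasis. The mild formulation is independent of that choice,
  -- so its coefficients in the given basis solve the corresponding triangular system.
  · have h' := isEigBasis_of_posDef hc hΓ hv'
    obtain ⟨-, hs', -⟩ := h'.isTriSol_of_isMildSolutionOn hgc hd hu
      fun t₁ ht₁ => (hcl t₁ ht₁).mild
    exact h'.covMat_eq_of_isTriSol hs' hdz (by rwa [hp0])

end
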